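/- Let $k$ be an algebraically closed field, $\mathsf c$ a small category, $A$ a (covariant) presheaf of associative $k$-algebras on $\mathsf c$, and $\mathcal F=\{F_1,\dots,F_p\}$ ($p\ge 1$) a finite family of (covariant) presheaves of left $A$-modules on $\mathsf c$. **Pointed algebras.** A $p$-pointed algebra is a $k$-algebra $R$ with $k$-algebra maps $k^p\to R\to k^p$ whose composition is the identity; morphisms commute with both maps. Write $I(R)=\ker(R\to k^p)$, $e_i\in R$ for the idempotents, $R_{ij}=e_iRe_j$. The category $\mathsf a_p$ consists of those $R$ that are Artinian and $I(R)$-adically complete (and separated), $\mathsf a_p(2)$ of those with moreover $I(R)^2=0$; the pro-category $\hat{\mathsf a}_p$ consists of the $R$ that are $I(R)$-adically complete with all $R/I(R)^n$ Artinian. A functor $D$ on $\mathsf a_p$ is extended by $D(H)=\varprojlim D(H/I(H)^n)$, and $\xi\in D(H)$ defines a map of functors $\mathrm{Mor}(H,-)\to D$ on $\mathsf a_p$. The pair $(H,\xi)$ is a *pro-representing hull* of $D$ if this map is smooth (for every surjection $R\to S$ in $\mathsf a_p$, $\mathrm{Mor}(H,R)\to \mathrm{Mor}(H,S)\times_{D(S)}D(R)$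 is surjective) and bijective on $\mathsf a_p(2)$. **Deformations.** A lifting of $\mathcal F$ to $R$ is a presheaf $X$ of left $A$-modules with a commuting right $R$-action, such that $X(c)\cong\bigoplus_{i,j}F_i(c)\otimes_kR_{ij}$ as right $R$-modules for every $c$, together with isomorphisms $X\otimes_Rk_i\cong F_i$, where $k_i$ is the $i$-th factor of $k^p$. $\mathrm{Def}_{\mathcal F}(R)$ is the set of liftings up to $R$-linear isomorphisms compatible with the isomorphisms to the $F_i$; it is a functor of $R$ through $X\mapsto X\otimes_RS$. **Cohomology.** For presheaves $F,G$ of left $A$-modules, $HH^n(\mathsf c,A,\mathcal Hom_k(F,G))$ is the cohomology of the total complex of the double complex $$D^{rs}=\prod_{c_0\to\dots\to c_r}\mathrm{Hom}_k\bigl(A(c_0)^{\otimes s},\mathrm{Hom}_k(F(c_0),G(c_r))\bigr),$$ with horizontal differential the alternating sum over omitting one object of a string $c_0\to\dots\to c_{r+1}$, and vertical differential $(-1)^r$ times the Hochschild differential. Put $H^n_{ij}=HH^n(\mathsf c,A,\mathcal Hom_k(F_j,F_i))$, and let $T^n$ be the free formal matrix ring generated by the dual spaces $(H^n_{ij})^*$,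 that is, the completion of the tensor algebra over $k^p$ of the bimodule $\bigoplus_{i,j}(H^n_{ij})^*$. **First order classes and obstructions.** Let $u:R\to S$ be a surjection of pointed algebras with kernel $K$, and $X$ a lifting of $\mathcal F$ to $S$. Choose a surjection $\bigoplus_iF_i(c)\otimes_ke_iR\to X(c)$ of right $R$-modules compatible with the reductions to the $F_i$, for every $c$, and $R$-linear lifts $L(a)$ (linear in $a\in A(c)$) and $L(\phi)$ of the action of $a$ on $X(c)$ and of the restriction map $X(\phi)$ to these free modules. If $I(R)K=KI(R)=0$, the class of the 2-cocycle $$L(ab)-L(a)L(b),\quad L(\phi)L(a)-L(A(\phi)(a))L(\phi),\quad L(\phi')L(\phi)-L(\phi'\phi)$$ is the obstruction in $(H^2_{ij}\otimes_kK_{ij})$ for lifting $X$ to $R$. If $u=\mathrm{id}$ and $I(R)^2=0$, the class in $(H^1_{ij}\otimes_kI(R)_{ij})$ of the 1-cocycle with components $L(a)$ and $-L(\phi)$, modulo the part with values in $k^p\subseteq R$, is the first order class of $X$. Both are considered as families of linear maps $(H^2_{ij})^*\to K_{ij}$, respectively $(H^1_{ij})^*\to I(R)_{ij}$. **Generalized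 Massey products.** For a morphism $o:T^2\to T^1$ of pointed algebras let $H_o=T^1\widehat\otimes_{T^2}k^p$ be the quotient of $T^1$ by the closure of the two-sided ideal generated by $o(I(T^2))$. For $\xi\in\mathrm{Def}_{\mathcal F}(H_o)$, say that $(o,\xi)$ is *given by generalized Massey products* (the linear dual of $o$ on generators being the generalized Massey products with defining system $\xi$) if: 1. $o(I(T^2))\subseteq I(T^1)^2$; 2. the first order class of the image of $\xi$ in $\mathrm{Def}_{\mathcal F}(H_o/I(H_o)^2)$ is the family of maps that sends each $\lambda\in(H^1_{ij})^*$ to the image of the corresponding generator of $T^1$; 3. for all $n\ge2$, with $I=I(T^1)$, $a_n=\ker(T^1\to H_o/I(H_o)^n)$ and $b_n=Ia_n+a_nI$, the obstruction for lifting the image of $\xi$ in $\mathrm{Def}_{\mathcal F}(H_o/I(H_o)^n)$ along $T^1/b_n\to T^1/a_n=H_o/I(H_o)^n$ sends each $\lambda\in(H^2_{ij})^*$ to the class of $o(\lambda)$ in $T^1/b_n$. **Theorem.** Assume that $\dim_kHH^n(\mathsf c,A,\mathcal Hom_k(F_j,F_i))<\infty$ for $n=1,2$ and all $i,j$. Then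 $\mathrm{Def}_{\mathcal F}$ is a functor of noncommutative Artin rings, i.e. $\mathrm{Def}_{\mathcal F}(k^p)$ has exactly one element, and $\mathrm{Def}_{\mathcal F}:\mathsf a_p\to\mathsf{Sets}$ has a pro-representing hull. It is determined by the spaces $H^1_{ij}$, $H^2_{ij}$ together with generalized Massey products on them: $T^1$, $T^2$ and all $H_o$ lie in $\hat{\mathsf a}_p$, there exist $o:T^2\to T^1$ and $\xi\in\mathrm{Def}_{\mathcal F}(H_o)$ such that $(o,\xi)$ is given by generalized Massey products, and for every such pair $(o,\xi)$, $(H_o,\xi)$ is a pro-representing hull of $\mathrm{Def}_{\mathcal F}$. -/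

import Mathlib

open CategoryTheory TensorProduct

universe w u

noncomputable section

/-! ## Pointed algebras -/

/-- A `p`-pointed `k`-algebra: a `k`-algebra `R` with homomorphisms `k^p → R → k^p` whose
composition is the identity. -/
structure PointedAlg (k : Type u) [Field k] (p : ℕ) where
  carrier : Type u
  [ring : Ring carrier]
  [algebra : Algebra k carrier]
  incl : (Fin p → k) →ₐ[k] carrier
  aug : carrier →ₐ[k] (Fin p → k)
  aug_incl : ∀ a, aug (incl a) = a

namespace PointedAlg

variable {k : Type u} [Field k] {p : ℕ}

instance : CoeSort (PointedAlg k p) (Type u) := ⟨carrier⟩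

attribute [instance] ring algebra

/-- Morphisms of pointed algebras: algebra homomorphisms compatible with both structure maps. -/
structure Hom (R S : PointedAlg k p) where
  toAlgHom : R →ₐ[k] S
  map_incl : ∀ a, toAlgHom (R.incl a) = S.incl a
  aug_map : ∀ r, S.aug (toAlgHom r) = R.aug r

instance (R S : PointedAlg k p) : CoeFun (Hom R S) (fun _ => R → S) := ⟨fun f => f.toAlgHom⟩

@[ext] theorem Hom.ext {R S : PointedAlg k p} {f g : Hom R S} (h : ∀ r, f r = g r) : f = g := by
  cases f; cases g; congr; exact AlgHom.ext h

instance : Category (PointedAlg k p) where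
  Hom := Hom
  id R := ⟨AlgHom.id k R, fun _ => rfl, fun _ => rfl⟩
  comp f g := ⟨g.toAlgHom.comp f.toAlgHom,
    fun a => by simp [f.map_incl, g.map_incl], fun r => by simp [f.aug_map, g.aug_map]⟩

/-- The underlying algebra homomorphism of a morphism. -/
abbrev hom {R S : PointedAlg k p} (f : R ⟶ S) : R →ₐ[k] S := Hom.toAlgHom f

@[ext] theorem hom_ext {R S : PointedAlg k p} {f g : R ⟶ S} (h : ∀ r, hom f r = hom g r) :
    f = g := Hom.ext h

theorem hom_incl {R S : PointedAlg k p} (f : R ⟶ S) (a) : hom f (R.incl a) = S.incl a :=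
  Hom.map_incl f a

theorem aug_hom {R S : PointedAlg k p} (f : R ⟶ S) (r) : S.aug (hom f r) = R.aug r :=
  Hom.aug_map f r

@[simp] theorem hom_id (R : PointedAlg k p) (r : R) : hom (𝟙 R) r = r := rfl

@[simp] theorem hom_comp {R S T : PointedAlg k p} (f : R ⟶ S) (g : S ⟶ T) (r : R) :
    hom (f ≫ g) r = hom g (hom f r) := rfl

variable (R : PointedAlg k p)

/-- The radical ideal `I(R)`, the kernel of `R → k^p`. -/
def rad : Ideal R := RingHom.ker R.aug.toRingHom

instance : R.rad.IsTwoSided := inferInstanceAs (RingHom.ker R.aug.toRingHom).IsTwoSided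

theorem mem_rad {r : R} : r ∈ R.rad ↔ R.aug r = 0 := RingHom.mem_ker

/-- The idempotent `e_i`. -/
def e (i : Fin p) : R := R.incl (Pi.single i 1)

theorem e_mul_e (i : Fin p) : R.e i * R.e i = R.e i := by
  simp [e, ← map_mul, ← Pi.single_mul]

theorem hom_e {R S : PointedAlg k p} (f : R ⟶ S) (i : Fin p) : hom f (R.e i) = S.e i :=
  hom_incl f _

theorem hom_pow_rad {R S : PointedAlg k p} (f : R ⟶ S) (n : ℕ) {r : R} (hr : r ∈ R.rad ^ n) :
    hom f r ∈ S.rad ^ n := by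
  suffices h : R.rad ^ n ≤ Ideal.comap (hom f) (S.rad ^ n) from h hr
  clear hr r
  induction n with
  | zero => intro x _; simp [Submodule.pow_zero]
  | succ n ih =>
    rw [Ideal.IsTwoSided.pow_succ, Ideal.IsTwoSided.pow_succ, Ideal.mul_le]
    intro a ha b hb
    rw [Ideal.mem_comap, map_mul]
    refine Ideal.mul_mem_mul ?_ (ih hb)
    rw [mem_rad] at ha ⊢
    rw [aug_hom, ha]

theorem exists_of_mem_pow_rad {R S : PointedAlg k p} (f : R ⟶ S)
    (hf : Function.Surjective (hom f)) (n : ℕ) {s : S} (hs : s ∈ S.rad ^ n) :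
    ∃ r ∈ R.rad ^ n, hom f r = s := by
  suffices h : S.rad ^ n ≤ Ideal.map (hom f) (R.rad ^ n) from
    (Ideal.mem_map_iff_of_surjective _ hf).1 (h hs)
  clear hs s
  induction n with
  | zero =>
    rw [Submodule.pow_zero, Submodule.pow_zero, Ideal.one_eq_top, Ideal.one_eq_top, Ideal.map_top]
  | succ n ih =>
    rw [Ideal.IsTwoSided.pow_succ, Ideal.IsTwoSided.pow_succ, Ideal.mul_le]
    intro a ha b hb
    obtain ⟨a', rfl⟩ := hf a
    obtain ⟨b', hb', rfl⟩ := (Ideal.mem_map_iff_of_surjective _ hf).1 (ih hb)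
    rw [← map_mul]
    refine Ideal.mem_map_of_mem _ (Ideal.mul_mem_mul ?_ hb')
    rw [mem_rad] at ha ⊢
    rwa [aug_hom] at ha

/-- The quotient of `R` by a two-sided ideal contained in the radical. -/
def quot (J : Ideal R) [J.IsTwoSided] (hJ : J ≤ R.rad) : PointedAlg k p where
  carrier := R ⧸ J
  incl := (Ideal.Quotient.mkₐ k J).comp R.incl
  aug := Ideal.Quotient.liftₐ J R.aug fun _ ha => (R.mem_rad).1 (hJ ha)
  aug_incl a := R.aug_incl a

section quot

variable {R} {S : PointedAlg k p} (J : Ideal R) [J.IsTwoSided] (hJ : J ≤ R.rad)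

/-- The projection `R → R/J`. -/
def proj : R ⟶ R.quot J hJ where
  toAlgHom := Ideal.Quotient.mkₐ k J
  map_incl _ := rfl
  aug_map _ := rfl

/-- The morphism `R/J → S` induced by a morphism that kills `J`. -/
def desc (f : R ⟶ S) (hf : ∀ a ∈ J, hom f a = 0) : R.quot J hJ ⟶ S where
  toAlgHom := Ideal.Quotient.liftₐ J (hom f) hf
  map_incl a := hom_incl f a
  aug_map r := by
    obtain ⟨r, rfl⟩ := Ideal.Quotient.mk_surjective r
    exact aug_hom f r

theorem proj_surjective : Function.Surjective (hom (proj J hJ)) := Ideal.Quotient.mk_surjective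

end quot

theorem pow_succ_rad_le (n : ℕ) : R.rad ^ (n + 1) ≤ R.rad := Ideal.pow_le_self n.succ_ne_zero

/-- `R.level n` is the quotient `R_{n+1} = R / I(R)^{n+1}`. -/
def level (n : ℕ) : PointedAlg k p := R.quot (R.rad ^ (n + 1)) (R.pow_succ_rad_le n)

/-- The projection `R → R / I(R)^{n+1}`. -/
def toLevel (n : ℕ) : R ⟶ R.level n := proj _ _

/-- The projection `R / I(R)^{n+2} → R / I(R)^{n+1}`. -/
def levelTrans (n : ℕ) : R.level (n + 1) ⟶ R.level n :=
  desc _ _ (R.toLevel n) fun _ ha =>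
    Ideal.Quotient.eq_zero_iff_mem.2 (Ideal.pow_le_pow_right (Nat.le_succ _) ha)

/-- `R` is separated and complete in the `I(R)`-adic topology. -/
def IsComplete : Prop :=
  (∀ x : R, (∀ n, x ∈ R.rad ^ n) → x = 0) ∧
  ∀ x : ℕ → R, (∀ n, x (n + 1) - x n ∈ R.rad ^ n) → ∃ y : R, ∀ n, y - x n ∈ R.rad ^ n

/-- The objects of the category `a_p`: Artinian and complete. -/
def IsArt : ObjectProperty (PointedAlg k p) := fun R => IsArtinianRing R ∧ R.IsComplete

/-- The objects of the pro-category of `a_p`: complete, with `R / I(R)^n` Artinian for `n ≥ 1`. -/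
def IsPro : ObjectProperty (PointedAlg k p) := fun R =>
  (∀ n, IsArtinianRing (R.level n)) ∧ R.IsComplete

theorem level_rad_pow (n : ℕ) : (R.level n).rad ^ (n + 1) = ⊥ := by
  rw [eq_bot_iff]
  intro s hs
  obtain ⟨r, hr, rfl⟩ := exists_of_mem_pow_rad (R.toLevel n) (proj_surjective _ _) _ hs
  exact Ideal.Quotient.eq_zero_iff_mem.2 hr

theorem isComplete_of_pow_eq_bot {n : ℕ} (h : R.rad ^ n = ⊥) : R.IsComplete := by
  have h0 : ∀ m, n ≤ m → R.rad ^ m ≤ ⊥ := fun m hm => h ▸ Ideal.pow_le_pow_right hm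
  refine ⟨fun x hx => (Submodule.mem_bot R).1 (h ▸ hx n), fun x hx => ⟨x n, fun m => ?_⟩⟩
  have key : ∀ a d, x (a + d) - x a ∈ R.rad ^ a := by
    intro a d
    induction d with
    | zero => simp
    | succ d ih =>
      have := (R.rad ^ a).add_mem (Ideal.pow_le_pow_right (Nat.le_add_right a d) (hx (a + d))) ih
      rwa [sub_add_sub_cancel] at this
  rcases le_total m n with hm | hm
  · obtain ⟨d, rfl⟩ := Nat.exists_eq_add_of_le hm
    exact key m d
  · obtain ⟨d, rfl⟩ := Nat.exists_eq_add_of_le hm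
    have : x (n + d) - x n = 0 := (Submodule.mem_bot R).1 (h0 n le_rfl (key n d))
    rw [← neg_sub, this, neg_zero]
    exact Submodule.zero_mem _

variable {R} in
theorem IsPro.isArt_level (h : R.IsPro) (n : ℕ) : (R.level n).IsArt :=
  ⟨h.1 n, isComplete_of_pow_eq_bot _ (R.level_rad_pow n)⟩

variable {R} in
theorem IsArt.exists_pow_eq_bot (h : R.IsArt) : ∃ n, R.rad ^ (n + 1) = ⊥ := by
  have := h.1
  obtain ⟨n, hn⟩ := IsArtinian.monotone_stabilizes (R := R) (M := R)
    ⟨fun n => OrderDual.toDual (R.rad ^ n), fun a b hab => Ideal.pow_le_pow_right hab⟩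
  have hn' : ∀ m, n ≤ m → R.rad ^ n = R.rad ^ m := hn
  refine ⟨n, ?_⟩
  rw [← hn' (n + 1) n.le_succ, eq_bot_iff]
  intro x hx
  refine h.2.1 x fun m => ?_
  rcases le_total n m with hm | hm
  · rwa [← hn' m hm]
  · exact Ideal.pow_le_pow_right hm hx

/-- The pointed algebra `k^p`. -/
def base (k : Type u) [Field k] (p : ℕ) : PointedAlg k p where
  carrier := Fin p → k
  incl := AlgHom.id k _
  aug := AlgHom.id k _
  aug_incl _ := rfl

theorem base_rad : (base k p).rad ^ 1 = ⊥ := by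
  rw [Submodule.pow_one, eq_bot_iff]
  intro x hx
  exact hx

theorem isArt_base : (base k p).IsArt :=
  ⟨isArtinian_of_tower k (inferInstanceAs (IsArtinian k (Fin p → k))),
    isComplete_of_pow_eq_bot _ base_rad⟩

/-- The structure morphism `k^p → R`. -/
def ofBase : base k p ⟶ R where
  toAlgHom := R.incl
  map_incl _ := rfl
  aug_map := R.aug_incl

/-- The completion of `R` in the `I(R)`-adic topology, as the limit of the `R / I(R)^{n+1}`. -/
def complAlg : Subalgebra k (∀ n, R.level n) where
  carrier := {x | ∀ n, hom (R.levelTrans n) (x (n + 1)) = x n}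
  mul_mem' hx hy n := by simp [hx n, hy n]
  add_mem' hx hy n := by simp [hx n, hy n]
  algebraMap_mem' r n := by simp

/-- The canonical map from `R` to its completion. -/
def toComplAlg : R →ₐ[k] R.complAlg :=
  (AlgHom.pi fun n => hom (R.toLevel n)).codRestrict _ fun _ _ => rfl

/-- The completion of a pointed algebra, as a pointed algebra. -/
def completion : PointedAlg k p where
  carrier := R.complAlg
  incl := R.toComplAlg.comp R.incl
  aug := ((R.level 0).aug.comp (Pi.evalAlgHom k (fun n => R.level n) 0)).comp R.complAlg.val
  aug_incl a := R.aug_incl a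

/-- The canonical morphism from `R` to its completion. -/
def toCompletion : R ⟶ R.completion where
  toAlgHom := R.toComplAlg
  map_incl _ := rfl
  aug_map _ := rfl

end PointedAlg

/-- The category `a_p` of `p`-pointed noncommutative Artin rings. -/
abbrev ArtAlg (k : Type u) [Field k] (p : ℕ) :=
  (PointedAlg.IsArt : ObjectProperty (PointedAlg k p)).FullSubcategory

/-- The pro-category of `a_p`. -/
abbrev ProAlg (k : Type u) [Field k] (p : ℕ) :=
  (PointedAlg.IsPro : ObjectProperty (PointedAlg k p)).FullSubcategory

/-! ## Pro-representing hulls -/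

section Hull

open PointedAlg

variable {k : Type u} [Field k] {p : ℕ}

/-- `H / I(H)^{n+1}` as an object of `a_p`. -/
def ProAlg.level (H : ProAlg k p) (n : ℕ) : ArtAlg k p := ⟨H.obj.level n, H.property.isArt_level n⟩

/-- The transition morphisms in `a_p`. -/
def ProAlg.levelTrans (H : ProAlg k p) (n : ℕ) : H.level (n + 1) ⟶ H.level n :=
  ObjectProperty.homMk (H.obj.levelTrans n)

variable (D : ArtAlg k p ⥤ Type w)

/-- The value `D(H) = lim D(H / I(H)^n)` on an object `H` of the pro-category. -/
def ProElt (H : ProAlg k p) : Type w :=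
  {ξ : ∀ n, D.obj (H.level n) // ∀ n, D.map (H.levelTrans n) (ξ (n + 1)) = ξ n}

variable {D}

/-- The map `Mor(H, R) → D(R)` that corresponds to `ξ ∈ D(H)`: a morphism `f : H → R` factors
through some `f' : H / I(H)^{n+1} → R`, and is mapped to `D(f')(ξ_n)`. -/
def yonedaMap (H : ProAlg k p) (ξ : ProElt D H) (R : ArtAlg k p) (f : H.obj ⟶ R.obj) : D.obj R :=
  let n := R.property.exists_pow_eq_bot.choose
  D.map (X := H.level n) (Y := R) (ObjectProperty.homMk (desc _ (H.obj.pow_succ_rad_le n) f fun _ ha =>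
    (Submodule.mem_bot _).1
      (R.property.exists_pow_eq_bot.choose_spec ▸ hom_pow_rad f (n + 1) ha))) (ξ.1 n)

/-- `(H, ξ)` is a pro-representing hull of `D`: the map `Mor(H, -) → D` is smooth on `a_p`, and an
isomorphism on `a_p(2)`. -/
structure IsHull (D : ArtAlg k p ⥤ Type w) (H : ProAlg k p) (ξ : ProElt D H) : Prop where
  smooth : ∀ (R S : ArtAlg k p) (u : R ⟶ S), Function.Surjective (hom u.hom) →
    ∀ (v : H.obj ⟶ S.obj) (x : D.obj R), D.map u x = yonedaMap H ξ S v →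
    ∃ w : H.obj ⟶ R.obj, w ≫ u.hom = v ∧ yonedaMap H ξ R w = x
  bijective : ∀ R : ArtAlg k p, R.obj.rad ^ 2 = ⊥ → Function.Bijective (yonedaMap H ξ R)

end Hull

/-! ## Free formal matrix rings -/

section FreeFormal

open PointedAlg

variable {k : Type u} [Field k] {p : ℕ} (V : Fin p → Fin p → Type u)
  [∀ i j, AddCommGroup (V i j)] [∀ i j, Module k (V i j)]

/-- The space `k^p ⊕ ⨁ V_ij` of generators. -/
abbrev FreeGen := (Fin p → k) × (∀ i j, V i j)

/-- The vector `v ∈ V_ij`, as a generator. -/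
def vec (i j : Fin p) : V i j →ₗ[k] FreeGen (k := k) V :=
  LinearMap.inr k _ _ ∘ₗ LinearMap.single k (fun i => ∀ j, V i j) i ∘ₗ LinearMap.single k (V i) j

/-- The relations of the free matrix ring: `k^p` is a subring, and `e_i v = v = v e_j` for all
`v ∈ V_ij`. -/
inductive FreeRel : TensorAlgebra k (FreeGen (k := k) V) → TensorAlgebra k (FreeGen (k := k) V) → Prop
  | one : FreeRel (TensorAlgebra.ι k (1, 0)) 1
  | mul (a b : Fin p → k) : FreeRel
      (TensorAlgebra.ι k (a, 0) * TensorAlgebra.ι k (b, 0)) (TensorAlgebra.ι k (a * b, 0))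
  | left (i j : Fin p) (v : V i j) : FreeRel
      (TensorAlgebra.ι k (Pi.single i 1, 0) * TensorAlgebra.ι k (vec V i j v))
      (TensorAlgebra.ι k (vec V i j v))
  | right (i j : Fin p) (v : V i j) : FreeRel
      (TensorAlgebra.ι k (vec V i j v) * TensorAlgebra.ι k (Pi.single j 1, 0))
      (TensorAlgebra.ι k (vec V i j v))

/-- The free matrix ring generated by the `V_ij`, that is, the tensor algebra over `k^p` of the
bimodule `⨁ V_ij`. -/
def freeMatrix : PointedAlg k p where
  carrier := RingQuot (FreeRel (k := k) V)
  incl := AlgHom.ofLinearMap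
    ((RingQuot.mkAlgHom k (FreeRel V)).toLinearMap ∘ₗ TensorAlgebra.ι k ∘ₗ LinearMap.inl k _ _)
    (by simpa using RingQuot.mkAlgHom_rel k (FreeRel.one (k := k) (V := V)))
    (fun a b => by simpa using (RingQuot.mkAlgHom_rel k (FreeRel.mul (V := V) a b)).symm)
  aug := RingQuot.liftAlgHom k ⟨TensorAlgebra.lift k (LinearMap.fst k _ _), by
    rintro _ _ (_ | ⟨a, b⟩ | ⟨i, j, v⟩ | ⟨i, j, v⟩) <;> simp [vec]⟩
  aug_incl a := by simp [RingQuot.liftAlgHom_mkAlgHom_apply]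

/-- The free formal matrix ring generated by the `V_ij`. -/
def freeFormal : PointedAlg k p := (freeMatrix (k := k) V).completion

/-- The inclusion of the space `V_ij` of generators. -/
def freeFormalGen (i j : Fin p) : V i j →ₗ[k] freeFormal (k := k) V :=
  (hom (freeMatrix (k := k) V).toCompletion).toLinearMap ∘ₗ
    (RingQuot.mkAlgHom k (FreeRel V)).toLinearMap ∘ₗ TensorAlgebra.ι k ∘ₗ vec V i j

end FreeFormal

/-! ## Tensor products over a noncommutative algebra -/

section NCTensor

variable {k : Type u} [Field k] {R : Type u} [Ring R] [Algebra k R]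
  {M N P Q : Type u} [AddCommGroup M] [Module k M] [AddCommGroup N] [Module k N]
  [AddCommGroup P] [Module k P] [AddCommGroup Q] [Module k Q]

/-- The relations `m r ⊗ n = m ⊗ r n`, for a right `R`-module `M` (an algebra homomorphism
`ρ : Rᵐᵒᵖ → End_k(M)`) and a left `R`-module `N` (an algebra homomorphism `R → End_k(N)`). -/
def ncRel (ρ : Rᵐᵒᵖ →ₐ[k] Module.End k M) (l : R →ₐ[k] Module.End k N) : Submodule k (M ⊗[k] N) :=
  Submodule.span k {x | ∃ m r n, x = ρ (MulOpposite.op r) m ⊗ₜ[k] n - m ⊗ₜ[k] l r n}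

/-- The tensor product `M ⊗_R N` of a right and a left `R`-module. -/
abbrev NCTensor (ρ : Rᵐᵒᵖ →ₐ[k] Module.End k M) (l : R →ₐ[k] Module.End k N) : Type u :=
  (M ⊗[k] N) ⧸ ncRel ρ l

namespace NCTensor

variable (ρ : Rᵐᵒᵖ →ₐ[k] Module.End k M) (l : R →ₐ[k] Module.End k N)

/-- The class of `m ⊗ n` in `M ⊗_R N`. -/
def mk : M →ₗ[k] N →ₗ[k] NCTensor ρ l := (TensorProduct.mk k M N).compr₂ (ncRel ρ l).mkQ

theorem mk_smul (m : M) (r : R) (n : N) :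
    mk ρ l (ρ (MulOpposite.op r) m) n = mk ρ l m (l r n) :=
  (Submodule.Quotient.eq _).2 (Submodule.subset_span ⟨m, r, n, rfl⟩)

variable {ρ l}

/-- The linear map `M ⊗_R N → P` induced by a balanced bilinear map. -/
def lift (f : M →ₗ[k] N →ₗ[k] P)
    (hf : ∀ m r n, f (ρ (MulOpposite.op r) m) n = f m (l r n)) : NCTensor ρ l →ₗ[k] P :=
  (ncRel ρ l).liftQ (TensorProduct.lift f) <| Submodule.span_le.2 <| by
    rintro _ ⟨m, r, n, rfl⟩
    simp [hf]

@[simp] theorem lift_mk (f : M →ₗ[k] N →ₗ[k] P)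
    (hf : ∀ m r n, f (ρ (MulOpposite.op r) m) n = f m (l r n)) (m : M) (n : N) :
    lift f hf (mk ρ l m n) = f m n := rfl

theorem ext {f g : NCTensor ρ l →ₗ[k] P} (h : ∀ m n, f (mk ρ l m n) = g (mk ρ l m n)) : f = g :=
  Submodule.linearMap_qext _ (TensorProduct.ext' h)

theorem ind {motive : NCTensor ρ l → Prop} (x : NCTensor ρ l)
    (h : ∀ m n, motive (mk ρ l m n)) (add : ∀ a b, motive a → motive b → motive (a + b)) :
    motive x := by
  obtain ⟨x, rfl⟩ := Submodule.Quotient.mk_surjective _ x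
  induction x using TensorProduct.induction_on with
  | zero => simpa using h 0 0
  | tmul m n => exact h m n
  | add a b ha hb => exact add _ _ ha hb

/-- Functoriality of `M ⊗_R N` in both arguments. -/
def map {ρ' : Rᵐᵒᵖ →ₐ[k] Module.End k P} {l' : R →ₐ[k] Module.End k Q} (f : M →ₗ[k] P)
    (g : N →ₗ[k] Q) (hf : ∀ r m, f (ρ r m) = ρ' r (f m)) (hg : ∀ r n, g (l r n) = l' r (g n)) :
    NCTensor ρ l →ₗ[k] NCTensor ρ' l' :=
  lift ((mk ρ' l').compl₁₂ f g) fun m r n => by simp [hf, hg, mk_smul]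

@[simp] theorem map_mk {ρ' : Rᵐᵒᵖ →ₐ[k] Module.End k P} {l' : R →ₐ[k] Module.End k Q}
    (f : M →ₗ[k] P) (g : N →ₗ[k] Q) (hf : ∀ r m, f (ρ r m) = ρ' r (f m))
    (hg : ∀ r n, g (l r n) = l' r (g n)) (m : M) (n : N) :
    map f g hf hg (mk ρ l m n) = mk ρ' l' (f m) (g n) := rfl

end NCTensor

end NCTensor

/-! ## Presheaves of modules -/

section Presheaf

variable {k : Type u} [Field k] {C : Type u} [SmallCategory C]

/-- A (covariant) presheaf of left `A`-modules on `C`, for a (covariant) presheaf `A` of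
`k`-algebras: a functor `F` from `C` to vector spaces with an `A(c)`-module structure on each
`F(c)`, such that the restriction maps are linear over the restriction maps of `A`. -/
structure ModPresheaf (A : C ⥤ AlgCat.{u} k) where
  obj : C → Type u
  [addCommGroup : ∀ c, AddCommGroup (obj c)]
  [module : ∀ c, Module k (obj c)]
  act : ∀ c, A.obj c →ₐ[k] Module.End k (obj c)
  map : ∀ {c d : C}, (c ⟶ d) → (obj c →ₗ[k] obj d)
  map_id : ∀ c x, map (𝟙 c) x = x
  map_comp : ∀ {c d e : C} (f : c ⟶ d) (g : d ⟶ e) x, map (f ≫ g) x = map g (map f x)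
  map_act : ∀ {c d : C} (f : c ⟶ d) a x, map f (act c a x) = act d ((A.map f).hom a) (map f x)

attribute [instance] ModPresheaf.addCommGroup ModPresheaf.module

variable {A : C ⥤ AlgCat.{u} k}

namespace ModPresheaf

/-- Morphisms of presheaves of left `A`-modules. -/
structure Hom (F G : ModPresheaf A) where
  app : ∀ c, F.obj c →ₗ[k] G.obj c
  app_act : ∀ c a x, app c (F.act c a x) = G.act c a (app c x)
  naturality : ∀ {c d : C} (f : c ⟶ d) x, app d (F.map f x) = G.map f (app c x)

theorem Hom.ext {F G : ModPresheaf A} {f g : Hom F G} (h : ∀ c x, f.app c x = g.app c x) :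
    f = g := by
  cases f; cases g; congr; funext c; exact LinearMap.ext (h c)

instance : Category (ModPresheaf A) where
  Hom := Hom
  id F := ⟨fun _ => LinearMap.id, fun _ _ _ => rfl, fun _ _ => rfl⟩
  comp f g := ⟨fun c => g.app c ∘ₗ f.app c, fun c a x => by simp [f.app_act, g.app_act],
    fun φ x => by simp [f.naturality, g.naturality]⟩

/-- The component at `c` of a morphism. -/
abbrev app {F G : ModPresheaf A} (f : F ⟶ G) (c : C) : F.obj c →ₗ[k] G.obj c := Hom.app f c

theorem hom_ext {F G : ModPresheaf A} {f g : F ⟶ G} (h : ∀ c x, app f c x = app g c x) : f = g :=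
  Hom.ext h

@[simp] theorem app_comp {F G H : ModPresheaf A} (f : F ⟶ G) (g : G ⟶ H) (c : C) (x) :
    app (f ≫ g) c x = app g c (app f c x) := rfl

@[simp] theorem app_id (F : ModPresheaf A) (c : C) (x) : app (𝟙 F) c x = x := rfl

theorem app_act {F G : ModPresheaf A} (f : F ⟶ G) (c a x) :
    app f c (F.act c a x) = G.act c a (app f c x) := Hom.app_act f c a x

theorem app_map {F G : ModPresheaf A} (f : F ⟶ G) {c d : C} (φ : c ⟶ d) (x) :
    app f d (F.map φ x) = G.map φ (app f c x) := Hom.naturality f φ x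

/-- A morphism with linear inverses at all objects is an isomorphism. -/
def isoOfInv {F G : ModPresheaf A} (f : F ⟶ G) (g : ∀ c, G.obj c →ₗ[k] F.obj c)
    (hgf : ∀ c x, g c (app f c x) = x) (hfg : ∀ c y, app f c (g c y) = y) : F ≅ G where
  hom := f
  inv :=
    { app := g
      app_act := fun c a x => by rw [← hgf c (F.act c a (g c x)), app_act, hfg]
      naturality := fun {c d} φ x => by rw [← hgf d (F.map φ (g c x)), app_map, hfg] }
  hom_inv_id := hom_ext hgf
  inv_hom_id := hom_ext hfg

end ModPresheaf

variable {p : ℕ}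

/-- An `R`-object in the category of presheaves of left `A`-modules: a presheaf `X` with a right
`R`-module structure on each `X(c)` that commutes with the action of `A(c)` and with restriction. -/
structure RObj (A : C ⥤ AlgCat.{u} k) (R : PointedAlg k p) extends ModPresheaf A where
  ract : ∀ c, (R : Type u)ᵐᵒᵖ →ₐ[k] Module.End k (obj c)
  ract_act : ∀ c r a x, ract c r (act c a x) = act c a (ract c r x)
  ract_map : ∀ {c d : C} (f : c ⟶ d) r x, map f (ract c r x) = ract d r (map f x)

open ModPresheaf MulOpposite

namespace RObj

/-- Morphisms of `R`-objects. -/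
structure Hom {R : PointedAlg k p} (X Y : RObj A R) where
  hom : X.toModPresheaf ⟶ Y.toModPresheaf
  app_ract : ∀ c r x, app hom c (X.ract c r x) = Y.ract c r (app hom c x)

instance (R : PointedAlg k p) : Category (RObj A R) where
  Hom := Hom
  id X := ⟨𝟙 _, fun _ _ _ => rfl⟩
  comp f g := ⟨f.hom ≫ g.hom, fun c r x => by simp [f.app_ract, g.app_ract]⟩

variable {R S T : PointedAlg k p}

/-- The underlying morphism of presheaves. -/
abbrev hom {X Y : RObj A R} (f : X ⟶ Y) : X.toModPresheaf ⟶ Y.toModPresheaf := Hom.hom f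

theorem Hom.ext {X Y : RObj A R} {f g : Hom X Y} (h : f.hom = g.hom) : f = g := by
  cases f; cases g; congr

theorem hom_ext {X Y : RObj A R} {f g : X ⟶ Y} (h : ∀ c x, app (hom f) c x = app (hom g) c x) :
    f = g := Hom.ext (ModPresheaf.hom_ext h)

theorem app_ract {X Y : RObj A R} (f : X ⟶ Y) (c r x) :
    app (hom f) c (X.ract c r x) = Y.ract c r (app (hom f) c x) := Hom.app_ract f c r x

/-- A morphism with linear inverses at all objects is an isomorphism. -/
def isoOfInv {X Y : RObj A R} (f : X ⟶ Y) (g : ∀ c, Y.obj c →ₗ[k] X.obj c)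
    (hgf : ∀ c x, g c (app (hom f) c x) = x) (hfg : ∀ c y, app (hom f) c (g c y) = y) : X ≅ Y where
  hom := f
  inv :=
    { hom := (ModPresheaf.isoOfInv (hom f) g hgf hfg).inv
      app_ract := fun c r x => by
        change g c (Y.ract c r x) = X.ract c r (g c x)
        rw [← hgf c (X.ract c r (g c x)), app_ract, hfg] }
  hom_inv_id := RObj.hom_ext hgf
  inv_hom_id := RObj.hom_ext hfg

@[simp] theorem hom_comp {X Y Z : RObj A R} (f : X ⟶ Y) (g : Y ⟶ Z) :
    hom (f ≫ g) = hom f ≫ hom g := rfl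

@[simp] theorem hom_id (X : RObj A R) : hom (𝟙 X) = 𝟙 _ := rfl

section Tensor

variable {N N' : Type u} [AddCommGroup N] [Module k N] [AddCommGroup N'] [Module k N']

/-- The action of `a ∈ A(c)` on `X(c) ⊗_R N`. -/
def tensorAct (X : RObj A R) (l : R →ₐ[k] Module.End k N) (c : C) (a : A.obj c) :
    Module.End k (NCTensor (X.ract c) l) :=
  NCTensor.map (X.act c a) LinearMap.id (fun r x => (X.ract_act c r a x).symm) (fun _ _ => rfl)

/-- The presheaf `X ⊗_R N`, for an `R`-object `X` and a left `R`-module `N`. -/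
def tensor (X : RObj A R) (l : R →ₐ[k] Module.End k N) : ModPresheaf A where
  obj c := NCTensor (X.ract c) l
  act c := AlgHom.ofLinearMap
    { toFun := X.tensorAct l c
      map_add' := fun a b => NCTensor.ext fun x n => by simp [tensorAct]
      map_smul' := fun t a => NCTensor.ext fun x n => by simp [tensorAct] }
    (NCTensor.ext fun x n => by simp [tensorAct])
    (fun a b => NCTensor.ext fun x n => by simp [tensorAct])
  map f := NCTensor.map (X.map f) LinearMap.id (fun r x => X.ract_map f r x) (fun _ _ => rfl)
  map_id c x := by
    induction x using NCTensor.ind with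
    | h x n => simp [X.map_id]
    | add a b ha hb => simp only [map_add, ha, hb]
  map_comp f g x := by
    induction x using NCTensor.ind with
    | h x n => simp [X.map_comp]
    | add a b ha hb => simp only [map_add, ha, hb]
  map_act f a x := by
    induction x using NCTensor.ind with
    | h x n => simp [tensorAct, X.map_act]
    | add a b ha hb => simp only [map_add, ha, hb]

/-- The class of `x ⊗ n` in `(X ⊗_R N)(c)`. -/
def tmk (X : RObj A R) (l : R →ₐ[k] Module.End k N) (c : C) :
    X.obj c →ₗ[k] N →ₗ[k] (X.tensor l).obj c := NCTensor.mk (X.ract c) l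

theorem tmk_smul (X : RObj A R) (l : R →ₐ[k] Module.End k N) (c : C) (x r n) :
    X.tmk l c (X.ract c (op r) x) n = X.tmk l c x (l r n) := NCTensor.mk_smul _ _ _ _ _

theorem tensor_ext {X : RObj A R} {l : R →ₐ[k] Module.End k N} {c : C} {P : Type u}
    [AddCommGroup P] [Module k P] {f g : (X.tensor l).obj c →ₗ[k] P}
    (h : ∀ x n, f (X.tmk l c x n) = g (X.tmk l c x n)) : f = g := NCTensor.ext h

@[simp] theorem tensor_act_tmk (X : RObj A R) (l : R →ₐ[k] Module.End k N) (c : C) (a x n) :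
    (X.tensor l).act c a (X.tmk l c x n) = X.tmk l c (X.act c a x) n := rfl

@[simp] theorem tensor_map_tmk (X : RObj A R) (l : R →ₐ[k] Module.End k N) {c d : C} (f : c ⟶ d)
    (x n) : (X.tensor l).map f (X.tmk l c x n) = X.tmk l d (X.map f x) n := rfl

/-- The linear map `(X ⊗_R N)(c) → P` induced by a balanced bilinear map. -/
def tlift {X : RObj A R} {l : R →ₐ[k] Module.End k N} {c : C} {P : Type u} [AddCommGroup P]
    [Module k P] (f : X.obj c →ₗ[k] N →ₗ[k] P)
    (hf : ∀ x r n, f (X.ract c (op r) x) n = f x (l r n)) : (X.tensor l).obj c →ₗ[k] P :=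
  NCTensor.lift f hf

@[simp] theorem tlift_tmk {X : RObj A R} {l : R →ₐ[k] Module.End k N} {c : C} {P : Type u}
    [AddCommGroup P] [Module k P] (f : X.obj c →ₗ[k] N →ₗ[k] P)
    (hf : ∀ x r n, f (X.ract c (op r) x) n = f x (l r n)) (x n) :
    tlift f hf (X.tmk l c x n) = f x n := rfl

theorem tensor_ind {X : RObj A R} {l : R →ₐ[k] Module.End k N} {c : C}
    {motive : (X.tensor l).obj c → Prop} (x : (X.tensor l).obj c)
    (h : ∀ x n, motive (X.tmk l c x n)) (add : ∀ a b, motive a → motive b → motive (a + b)) :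
    motive x := NCTensor.ind x h add

/-- Functoriality of `X ⊗_R N` in `X`. -/
def tensorMap {X Y : RObj A R} (f : X ⟶ Y) (l : R →ₐ[k] Module.End k N) :
    X.tensor l ⟶ Y.tensor l where
  app c := tlift ((Y.tmk l c).compl₁₂ (app (hom f) c) LinearMap.id) fun x r n => by
    simp [app_ract, tmk_smul]
  app_act c a x := by
    induction x using tensor_ind with
    | h x n => exact congrArg (fun y => Y.tmk l c y n) ((hom f).app_act c a x)
    | add a b ha hb => simp only [map_add, ha, hb]
  naturality {c d} φ x := by
    induction x using tensor_ind with
    | h x n => exact congrArg (fun y => Y.tmk l d y n) ((hom f).naturality φ x)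
    | add a b ha hb => simp only [map_add, ha, hb]

@[simp] theorem tensorMap_tmk {X Y : RObj A R} (f : X ⟶ Y) (l : R →ₐ[k] Module.End k N) (c x n) :
    app (tensorMap f l) c (X.tmk l c x n) = Y.tmk l c (app (hom f) c x) n := rfl

theorem tensor_hom_ext {X : RObj A R} {l : R →ₐ[k] Module.End k N} {G : ModPresheaf A}
    {f g : X.tensor l ⟶ G} (h : ∀ c x n, app f c (X.tmk l c x n) = app g c (X.tmk l c x n)) :
    f = g :=
  ModPresheaf.hom_ext fun c x => LinearMap.congr_fun (tensor_ext (h c)) x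

/-- `S` as a left `R`-module, along `u : R → S`. -/
def leftAlong (u : R ⟶ S) : R →ₐ[k] Module.End k S :=
  (Algebra.lmul k S).comp (PointedAlg.hom u)

@[simp] theorem leftAlong_apply (u : R ⟶ S) (r : R) (s : S) :
    leftAlong u r s = PointedAlg.hom u r * s := rfl

/-- The simple left `R`-module `k_i`: the `i`-th factor of `k^p`. -/
def simpleMod (R : PointedAlg k p) (i : Fin p) : R →ₐ[k] Module.End k k :=
  (Algebra.lmul k k).comp ((Pi.evalAlgHom k (fun _ => k) i).comp R.aug)

@[simp] theorem simpleMod_apply (R : PointedAlg k p) (i : Fin p) (r : R) (t : k) :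
    simpleMod R i r t = R.aug r i * t := rfl

/-- Right multiplication by `s` on `X(c) ⊗_R S`. -/
def tensorMul (u : R ⟶ S) (X : RObj A R) (c : C) (s : (S : Type u)ᵐᵒᵖ) :
    Module.End k (NCTensor (X.ract c) (leftAlong u)) :=
  NCTensor.map LinearMap.id (LinearMap.mulRight k s.unop)
    (fun _ _ => rfl) (fun r t => by simp [mul_assoc])

@[simp] theorem tensorMul_mk (u : R ⟶ S) (X : RObj A R) (c s x t) :
    X.tensorMul u c s (NCTensor.mk (X.ract c) (leftAlong u) x t) =
      NCTensor.mk (X.ract c) (leftAlong u) x (t * s.unop) := rfl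

/-- The right `S`-module structure of `X(c) ⊗_R S`. -/
def tensorMulHom (u : R ⟶ S) (X : RObj A R) (c : C) :
    (S : Type u)ᵐᵒᵖ →ₐ[k] Module.End k (NCTensor (X.ract c) (leftAlong u)) :=
  AlgHom.ofLinearMap
    { toFun := X.tensorMul u c
      map_add' := fun s t => NCTensor.ext fun x n => by simp [mul_add]
      map_smul' := fun s t => NCTensor.ext fun x n => by simp }
    (NCTensor.ext fun x n => by simp)
    (fun a b => NCTensor.ext fun x n => by simp [mul_assoc])

/-- The base change `X ⊗_R S` along `u : R → S`, with its right `S`-module structure. -/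
def baseChange (u : R ⟶ S) (X : RObj A R) : RObj A S where
  toModPresheaf := X.tensor (leftAlong u)
  ract := X.tensorMulHom u
  ract_act c s a x := by
    induction x using tensor_ind with
    | h x n => rfl
    | add a b ha hb => simp only [map_add, ha, hb]
  ract_map f s x := by
    induction x using tensor_ind with
    | h x n => rfl
    | add a b ha hb => simp only [map_add, ha, hb]

/-- The class of `x ⊗ s` in `(X ⊗_R S)(c)`. -/
def bmk (u : R ⟶ S) (X : RObj A R) (c : C) :
    X.obj c →ₗ[k] S →ₗ[k] (X.baseChange u).obj c := X.tmk (leftAlong u) c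

@[simp] theorem baseChange_ract_bmk (u : R ⟶ S) (X : RObj A R) (c s x t) :
    (X.baseChange u).ract c s (X.bmk u c x t) = X.bmk u c x (t * s.unop) := rfl

theorem baseChange_ind {u : R ⟶ S} {X : RObj A R} {c : C}
    {motive : (X.baseChange u).obj c → Prop} (x : (X.baseChange u).obj c)
    (h : ∀ x s, motive (X.bmk u c x s)) (add : ∀ a b, motive a → motive b → motive (a + b)) :
    motive x := NCTensor.ind x h add

/-- Functoriality of base change, on underlying presheaves. -/
def baseChangeHom (u : R ⟶ S) {X Y : RObj A R} (f : X ⟶ Y) :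
    (X.baseChange u).toModPresheaf ⟶ (Y.baseChange u).toModPresheaf := tensorMap f (leftAlong u)

/-- Functoriality of base change. -/
def baseChangeMap (u : R ⟶ S) {X Y : RObj A R} (f : X ⟶ Y) :
    X.baseChange u ⟶ Y.baseChange u where
  hom := baseChangeHom u f
  app_ract c s x := by
    induction x using baseChange_ind with
    | h x n => rfl
    | add a b ha hb => simp only [map_add, ha, hb]

@[simp] theorem baseChangeMap_bmk (u : R ⟶ S) {X Y : RObj A R} (f : X ⟶ Y) (c x s) :
    app (hom (baseChangeMap u f)) c (X.bmk u c x s) = Y.bmk u c (app (hom f) c x) s := rfl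

/-- Functoriality of base change, for isomorphisms. -/
def baseChangeIso (u : R ⟶ S) {X Y : RObj A R} (τ : X ≅ Y) : X.baseChange u ≅ Y.baseChange u where
  hom := baseChangeMap u τ.hom
  inv := baseChangeMap u τ.inv
  hom_inv_id := RObj.hom_ext fun c x => by
    induction x using baseChange_ind with
    | h x s =>
      change X.bmk u c (app (hom (τ.hom ≫ τ.inv)) c x) s = _
      rw [τ.hom_inv_id]
      rfl
    | add a b ha hb => rw [map_add, map_add, ha, hb]
  inv_hom_id := RObj.hom_ext fun c x => by
    induction x using baseChange_ind with
    | h x s =>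
      change Y.bmk u c (app (hom (τ.inv ≫ τ.hom)) c x) s = _
      rw [τ.inv_hom_id]
      rfl
    | add a b ha hb => rw [map_add, map_add, ha, hb]

/-- The linear map `(X ⊗_R S)(c) → P` induced by a balanced bilinear map. -/
def blift {u : R ⟶ S} {X : RObj A R} {c : C} {P : Type u} [AddCommGroup P] [Module k P]
    (f : X.obj c →ₗ[k] S →ₗ[k] P)
    (hf : ∀ x r s, f (X.ract c (op r) x) s = f x (PointedAlg.hom u r * s)) :
    (X.baseChange u).obj c →ₗ[k] P := tlift (l := leftAlong u) f hf

@[simp] theorem blift_bmk {u : R ⟶ S} {X : RObj A R} {c : C} {P : Type u} [AddCommGroup P]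
    [Module k P] (f : X.obj c →ₗ[k] S →ₗ[k] P)
    (hf : ∀ x r s, f (X.ract c (op r) x) s = f x (PointedAlg.hom u r * s)) (x s) :
    blift f hf (X.bmk u c x s) = f x s := rfl

@[simp] theorem baseChange_act_bmk (u : R ⟶ S) (X : RObj A R) (c : C) (a x s) :
    (X.baseChange u).act c a (X.bmk u c x s) = X.bmk u c (X.act c a x) s := rfl

@[simp] theorem baseChange_map_bmk (u : R ⟶ S) (X : RObj A R) {c d : C} (f : c ⟶ d) (x s) :
    (X.baseChange u).map f (X.bmk u c x s) = X.bmk u d (X.map f x) s := rfl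

theorem bmk_smul (u : R ⟶ S) (X : RObj A R) (c : C) (x r s) :
    X.bmk u c (X.ract c (op r) x) s = X.bmk u c x (PointedAlg.hom u r * s) :=
  X.tmk_smul (leftAlong u) c x r s

/-- The map `X ⊗_R R → X` at `c`. -/
def unitApp (X : RObj A R) (c : C) : (X.baseChange (𝟙 R)).obj c →ₗ[k] X.obj c :=
  blift ((X.ract c).toLinearMap ∘ₗ (opLinearEquiv k).toLinearMap).flip fun x r s => by simp

@[simp] theorem unitApp_bmk (X : RObj A R) (c x s) :
    X.unitApp c (X.bmk (𝟙 R) c x s) = X.ract c (op s) x := rfl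

/-- The canonical morphism `X ⊗_R R → X`. -/
def unitHom (X : RObj A R) : X.baseChange (𝟙 R) ⟶ X where
  hom :=
    { app := X.unitApp
      app_act := fun c a x => by
        induction x using baseChange_ind with
        | h x s => simp [X.ract_act]
        | add a b ha hb => simp only [map_add, ha, hb]
      naturality := fun f x => by
        induction x using baseChange_ind with
        | h x s => simp [X.ract_map]
        | add a b ha hb => simp only [map_add, ha, hb] }
  app_ract c r x := by
    change X.unitApp c _ = X.ract c r (X.unitApp c x)
    induction x using baseChange_ind with
    | h x s => simp
    | add a b ha hb => simp only [map_add, ha, hb]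

@[simp] theorem unitHom_app (X : RObj A R) (c) : app (hom X.unitHom) c = X.unitApp c := rfl

/-- The canonical isomorphism `X ⊗_R R ≅ X`. -/
def unitIso (X : RObj A R) : X.baseChange (𝟙 R) ≅ X :=
  isoOfInv X.unitHom (fun c => (X.bmk (𝟙 R) c).flip 1)
    (fun c x => by
      induction x using baseChange_ind with
      | h x s => simpa using X.bmk_smul (𝟙 R) c x s 1
      | add a b ha hb => simp only [map_add, ha, hb])
    (fun c x => by simp)

section Assoc

variable (X : RObj A R) (u : R ⟶ S) (l : S →ₐ[k] Module.End k N) (l' : R →ₐ[k] Module.End k N)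
  (h : ∀ r, l' r = l (PointedAlg.hom u r))

/-- The map `(X ⊗_R S) ⊗_S N → X ⊗_R N` at `c`. -/
def assocApp (c : C) : ((X.baseChange u).tensor l).obj c →ₗ[k] (X.tensor l').obj c :=
  tlift (blift (LinearMap.mk₂ k (fun x s => X.tmk l' c x ∘ₗ l s)
      (fun x y s => by ext; simp) (fun t x s => by ext; simp)
      (fun x s t => by ext; simp) (fun t x s => by ext; simp))
      (fun x r s => by ext n; simp [tmk_smul, h])) fun x s n => by
    induction x using baseChange_ind with
    | h x s => simp
    | add a b ha hb => simp only [map_add, LinearMap.add_apply, ha, hb]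

@[simp] theorem assocApp_tmk (c x s n) :
    assocApp X u l l' h c ((X.baseChange u).tmk l c (X.bmk u c x s) n) = X.tmk l' c x (l s n) := rfl

theorem assoc_ind {c : C} {motive : ((X.baseChange u).tensor l).obj c → Prop}
    (x : ((X.baseChange u).tensor l).obj c)
    (h : ∀ x s n, motive ((X.baseChange u).tmk l c (X.bmk u c x s) n))
    (add : ∀ a b, motive a → motive b → motive (a + b)) : motive x := by
  induction x using tensor_ind with
  | h x n =>
    induction x using baseChange_ind with
    | h x s => exact h x s n
    | add a b ha hb => rw [map_add]; exact add _ _ ha hb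
  | add a b ha hb => exact add _ _ ha hb

/-- The canonical morphism `(X ⊗_R S) ⊗_S N → X ⊗_R N`. -/
def assocHom : (X.baseChange u).tensor l ⟶ X.tensor l' where
  app := assocApp X u l l' h
  app_act c a x := by
    induction x using assoc_ind with
    | h x s n => simp
    | add a b ha hb => simp only [map_add, ha, hb]
  naturality f x := by
    induction x using assoc_ind with
    | h x s n => simp
    | add a b ha hb => simp only [map_add, ha, hb]

@[simp] theorem assocHom_app (c) : app (assocHom X u l l' h) c = assocApp X u l l' h c := rfl

/-- The inverse of `assocHom` at `c`. -/
def assocInv (c : C) : (X.tensor l').obj c →ₗ[k] ((X.baseChange u).tensor l).obj c :=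
  tlift ((X.baseChange u).tmk l c ∘ₗ (X.bmk u c).flip 1) fun x r n => by
    have := (X.baseChange u).tmk_smul l c (X.bmk u c x 1) (PointedAlg.hom u r) n
    simpa [bmk_smul, h] using this

@[simp] theorem assocInv_tmk (c x n) :
    assocInv X u l l' h c (X.tmk l' c x n) = (X.baseChange u).tmk l c (X.bmk u c x 1) n := rfl

theorem assocInv_assocApp (c x) : assocInv X u l l' h c (assocApp X u l l' h c x) = x := by
  induction x using assoc_ind with
  | h x s n =>
    have := (X.baseChange u).tmk_smul l c (X.bmk u c x 1) s n
    simpa using this.symm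
  | add a b ha hb => rw [map_add, map_add, ha, hb]

theorem assocApp_assocInv (c x) : assocApp X u l l' h c (assocInv X u l l' h c x) = x := by
  induction x using tensor_ind with
  | h x n => simp
  | add a b ha hb => rw [map_add, map_add, ha, hb]

/-- The canonical isomorphism `(X ⊗_R S) ⊗_S N ≅ X ⊗_R N`. -/
def assocIso : (X.baseChange u).tensor l ≅ X.tensor l' :=
  ModPresheaf.isoOfInv (assocHom X u l l' h) (assocInv X u l l' h)
    (assocInv_assocApp X u l l' h) (assocApp_assocInv X u l l' h)

@[simp] theorem assocIso_hom_tmk (c x s n) :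
    app (assocIso X u l l' h).hom c ((X.baseChange u).tmk l c (X.bmk u c x s) n) =
      X.tmk l' c x (l s n) := rfl

end Assoc

/-- The map `(X ⊗_R S) ⊗_S T → X ⊗_R T` at `c`. -/
def compApp (X : RObj A R) (u : R ⟶ S) (v : S ⟶ T) (c : C) :
    ((X.baseChange u).baseChange v).obj c →ₗ[k] (X.baseChange (u ≫ v)).obj c :=
  assocApp X u (leftAlong v) (leftAlong (u ≫ v)) (fun _ => rfl) c

@[simp] theorem compApp_bmk (X : RObj A R) (u : R ⟶ S) (v : S ⟶ T) (c x s t) :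
    compApp X u v c ((X.baseChange u).bmk v c (X.bmk u c x s) t) =
      X.bmk (u ≫ v) c x (PointedAlg.hom v s * t) := rfl

theorem comp_ind {X : RObj A R} {u : R ⟶ S} {v : S ⟶ T} {c : C}
    {motive : ((X.baseChange u).baseChange v).obj c → Prop}
    (x : ((X.baseChange u).baseChange v).obj c)
    (h : ∀ x s t, motive ((X.baseChange u).bmk v c (X.bmk u c x s) t))
    (add : ∀ a b, motive a → motive b → motive (a + b)) : motive x :=
  assoc_ind X u (leftAlong v) x h add

/-- The canonical morphism `(X ⊗_R S) ⊗_S T → X ⊗_R T`. -/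
def compHom (X : RObj A R) (u : R ⟶ S) (v : S ⟶ T) :
    (X.baseChange u).baseChange v ⟶ X.baseChange (u ≫ v) where
  hom := assocHom X u (leftAlong v) (leftAlong (u ≫ v)) fun _ => rfl
  app_ract c r x := by
    change compApp X u v c _ = (X.baseChange (u ≫ v)).ract c r (compApp X u v c x)
    induction x using comp_ind with
    | h x s t => simp [mul_assoc]
    | add a b ha hb => simp only [map_add, ha, hb]

/-- The canonical isomorphism `(X ⊗_R S) ⊗_S T ≅ X ⊗_R T`. -/
def compIso (X : RObj A R) (u : R ⟶ S) (v : S ⟶ T) :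
    (X.baseChange u).baseChange v ≅ X.baseChange (u ≫ v) :=
  isoOfInv (compHom X u v) (assocInv X u (leftAlong v) (leftAlong (u ≫ v)) fun _ => rfl)
    (assocInv_assocApp _ _ _ _ _) (assocApp_assocInv _ _ _ _ _)

@[simp] theorem compIso_hom_bmk (X : RObj A R) (u : R ⟶ S) (v : S ⟶ T) (c x s t) :
    app (hom (compIso X u v).hom) c ((X.baseChange u).bmk v c (X.bmk u c x s) t) =
      X.bmk (u ≫ v) c x (PointedAlg.hom v s * t) := rfl

@[simp] theorem unitIso_hom_bmk (X : RObj A R) (c x s) :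
    app (hom X.unitIso.hom) c (X.bmk (𝟙 R) c x s) = X.ract c (op s) x := rfl

end Tensor

end RObj

/-! ## Global Hochschild cohomology -/

section Hochschild

variable {B M P : Type u} [Ring B] [Algebra k B] [AddCommGroup M] [Module k M]
  [AddCommGroup P] [Module k P]

/-- The cochain `(a_1, …, a_{q+1}) ↦ f(a_1, …, a_i a_{i+1}, …, a_{q+1})`. -/
def contract {N : Type u} [AddCommGroup N] [Module k N] {q : ℕ} (i : Fin q)
    (f : MultilinearMap k (fun _ : Fin q => B) N) :
    MultilinearMap k (fun _ : Fin (q + 1) => B) N :=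
  have key : ∀ [DecidableEq (Fin (q + 1))] (a : Fin (q + 1) → B) (j : Fin (q + 1)),
      ∃ (j' : Fin q) (φ : B →ₗ[k] B), ∀ v, Fin.contractNth i.castSucc (· * ·)
        (Function.update a j v) = Function.update (Fin.contractNth i.castSucc (· * ·) a) j' (φ v) := by
    intro _ a j
    have hi := i.2
    have hj := j.2
    rcases lt_trichotomy (j : ℕ) i with h | h | h
    · refine ⟨⟨j, by omega⟩, LinearMap.id, fun v => funext fun t => ?_⟩
      simp only [Fin.contractNth, Function.update_apply, Fin.ext_iff, Fin.val_castSucc,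
        Fin.val_succ, LinearMap.id_apply]
      split_ifs <;> first | rfl | omega
    · refine ⟨i, LinearMap.mulRight k (a i.succ), fun v => funext fun t => ?_⟩
      simp only [Fin.contractNth, Function.update_apply, Fin.ext_iff, Fin.val_castSucc,
        Fin.val_succ, LinearMap.mulRight_apply]
      split_ifs <;> first | rfl | omega | skip
      congr 2; ext; simp; omega
    · rcases eq_or_ne (j : ℕ) (i + 1) with h' | h'
      · refine ⟨i, LinearMap.mulLeft k (a i.castSucc), fun v => funext fun t => ?_⟩
        simp only [Fin.contractNth, Function.update_apply, Fin.ext_iff, Fin.val_castSucc,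
          Fin.val_succ, LinearMap.mulLeft_apply]
        split_ifs <;> first | rfl | omega | skip
        congr 2; ext; simp; omega
      · refine ⟨⟨j - 1, by omega⟩, LinearMap.id, fun v => funext fun t => ?_⟩
        simp only [Fin.contractNth, Function.update_apply, Fin.ext_iff, Fin.val_castSucc,
          Fin.val_succ, LinearMap.id_apply]
        split_ifs <;> first | rfl | omega
  { toFun := fun a => f (Fin.contractNth i.castSucc (· * ·) a)
    map_update_add' := fun a j x y => by
      obtain ⟨j', φ, h⟩ := key a j
      rw [h, h, h, map_add, f.map_update_add]
    map_update_smul' := fun a j t x => by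
      obtain ⟨j', φ, h⟩ := key a j
      rw [h, h, map_smul, f.map_update_smul] }

/-- The Hochschild differential on cochains of `B` with values in the bimodule `Hom_k(M, P)`, for
left `B`-modules `M` and `P`. -/
def hochschildD (r : B →ₐ[k] Module.End k M) (l : B →ₐ[k] Module.End k P) (q : ℕ)
    (f : MultilinearMap k (fun _ : Fin q => B) (M →ₗ[k] P)) :
    MultilinearMap k (fun _ : Fin (q + 1) => B) (M →ₗ[k] P) :=
  LinearMap.uncurryLeft (M := fun _ : Fin (q + 1) => B)
    { toFun := fun b => (LinearMap.llcomp k M P P (l b)).compMultilinearMap f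
      map_add' := fun b b' => by ext; simp
      map_smul' := fun t b => by ext; simp } +
  ∑ i : Fin q, (-1 : k) ^ ((i : ℕ) + 1) • contract i f +
  (-1 : k) ^ (q + 1) • MultilinearMap.uncurryRight (M := fun _ : Fin (q + 1) => B)
    ((LinearMap.mk₂ k (fun (T : M →ₗ[k] P) (b : B) => T ∘ₗ r b)
      (fun _ _ _ => by ext; simp) (fun _ _ _ => by ext; simp)
      (fun _ _ _ => by ext; simp) (fun _ _ _ => by ext; simp)).compMultilinearMap f)

theorem hochschildD_apply (r : B →ₐ[k] Module.End k M) (l : B →ₐ[k] Module.End k P) (q : ℕ)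
    (f : MultilinearMap k (fun _ : Fin q => B) (M →ₗ[k] P)) (a : Fin (q + 1) → B) :
    hochschildD r l q f a = l (a 0) ∘ₗ f (Fin.tail a) +
      ∑ i : Fin q, (-1 : k) ^ ((i : ℕ) + 1) • f (Fin.contractNth i.castSucc (· * ·) a) +
      (-1 : k) ^ (q + 1) • (f (Fin.init a) ∘ₗ r (a (Fin.last q))) := by
  simp only [hochschildD, add_apply, sum_apply,
    smul_apply]
  rfl

theorem hochschildD_add (r : B →ₐ[k] Module.End k M) (l : B →ₐ[k] Module.End k P) (q : ℕ)
    (f g : MultilinearMap k (fun _ : Fin q => B) (M →ₗ[k] P)) :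
    hochschildD r l q (f + g) = hochschildD r l q f + hochschildD r l q g := by
  ext a : 1
  simp only [hochschildD_apply, add_apply, LinearMap.comp_add, LinearMap.add_comp,
    smul_add, Finset.sum_add_distrib]
  abel

theorem hochschildD_smul (r : B →ₐ[k] Module.End k M) (l : B →ₐ[k] Module.End k P) (q : ℕ)
    (t : k) (f : MultilinearMap k (fun _ : Fin q => B) (M →ₗ[k] P)) :
    hochschildD r l q (t • f) = t • hochschildD r l q f := by
  ext a : 1
  simp only [hochschildD_apply, smul_apply, LinearMap.comp_smul,
    LinearMap.smul_comp, smul_add, Finset.smul_sum, smul_comm t]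

end Hochschild

section GlobalHochschild

/-- The space `D^p(C, HC^q(A, Hom_k(F, G)))`: for every string `c_0 → ⋯ → c_p` in `C`, a `q`-linear
map on `A(c_0)` with values in `Hom_k(F(c_0), G(c_p))`. -/
abbrev DCochain (F G : ModPresheaf A) (p q : ℕ) : Type u :=
  ∀ x : ComposableArrows C p, MultilinearMap k (fun _ : Fin q => A.obj (x.obj 0))
    (F.obj (x.obj 0) →ₗ[k] G.obj (x.obj (Fin.last p)))

variable {F G : ModPresheaf A}

/-- The map `HC^q(A, Hom_k(F, G))(φ) → HC^q(A, Hom_k(F, G))(β φ α)`. -/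
def pullHC {c c' d d' : C} (α : d ⟶ c) (β : c' ⟶ d') {q : ℕ} :
    MultilinearMap k (fun _ : Fin q => A.obj c) (F.obj c →ₗ[k] G.obj c') →ₗ[k]
      MultilinearMap k (fun _ : Fin q => A.obj d) (F.obj d →ₗ[k] G.obj d') where
  toFun f := ((LinearMap.lcomp k _ (F.map α)).comp
      (LinearMap.llcomp k (F.obj c) _ _ (G.map β))).compMultilinearMap
    (f.compLinearMap fun _ => (A.map α).hom.toLinearMap)
  map_add' f g := by ext; simp
  map_smul' t f := by ext; simp

theorem pullHC_apply {c c' d d' : C} (α : d ⟶ c) (β : c' ⟶ d') {q : ℕ}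
    (f : MultilinearMap k (fun _ : Fin q => A.obj c) (F.obj c →ₗ[k] G.obj c'))
    (a : Fin q → A.obj d) :
    pullHC α β f a = G.map β ∘ₗ f (fun j => (A.map α).hom (a j)) ∘ₗ F.map α := rfl

/-- The string obtained from `c_0 → ⋯ → c_{p+1}` by leaving out `c_i`. -/
def face {p : ℕ} (x : ComposableArrows C (p + 1)) (i : Fin (p + 2)) : ComposableArrows C p :=
  (Fin.succAboveOrderEmb i).monotone.functor ⋙ x

/-- The differential of the resolving complex: the alternating sum over all ways to leave out an
object of a string. For `i = 0` and `i = p + 1` the coefficients change along the arrow that is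
left out, and for `0 < i < p + 1` the map on the coefficients is the identity. -/
def dHor (p q : ℕ) : DCochain F G p q →ₗ[k] DCochain F G (p + 1) q where
  toFun g x := ∑ i : Fin (p + 2), (-1 : k) ^ (i : ℕ) •
    pullHC (x.map (homOfLE (Fin.zero_le (i.succAbove 0))))
      (x.map (homOfLE (Fin.le_last (i.succAbove (Fin.last p))))) (g (face x i))
  map_add' g h := by
    funext x
    simp only [Pi.add_apply, ← Finset.sum_add_distrib, ← smul_add]
    exact Finset.sum_congr rfl fun i _ => congrArg _ (map_add _ _ _)
  map_smul' t g := by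
    funext x
    simp only [Pi.smul_apply, Finset.smul_sum, RingHom.id_apply]
    refine Finset.sum_congr rfl fun i _ => ?_
    rw [smul_comm t]
    exact congrArg _ (map_smul _ _ _)

/-- The Hochschild differential, for every string. -/
def dVer (p q : ℕ) : DCochain F G p q →ₗ[k] DCochain F G p (q + 1) where
  toFun g x := hochschildD (F.act (x.obj 0)) ((G.act (x.obj (Fin.last p))).comp
    (A.map (x.map (homOfLE (Fin.zero_le (Fin.last p))))).hom) q (g x)
  map_add' g h := by funext x; exact hochschildD_add _ _ _ _ _
  map_smul' t g := by funext x; exact hochschildD_smul _ _ _ _ _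

/-- The cochains of degree `n` of the global Hochschild complex `HC^*(C, A, Hom_k(F, G))`, the total
complex of the double complex `D^{pq}`. -/
def GHC (F G : ModPresheaf A) (n : ℕ) : Type u :=
  ∀ s : {s : ℕ × ℕ // s.1 + s.2 = n}, DCochain F G s.1.1 s.1.2

instance (F G : ModPresheaf A) (n : ℕ) : AddCommGroup (GHC F G n) :=
  inferInstanceAs (AddCommGroup (∀ s : {s : ℕ × ℕ // s.1 + s.2 = n}, DCochain F G s.1.1 s.1.2))

instance (F G : ModPresheaf A) (n : ℕ) : Module k (GHC F G n) :=
  inferInstanceAs (Module k (∀ s : {s : ℕ × ℕ // s.1 + s.2 = n}, DCochain F G s.1.1 s.1.2))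

/-- The component of a cochain in `D^{pq}`. -/
def ghcComp {n : ℕ} (p q : ℕ) (h : p + q = n) : GHC F G n →ₗ[k] DCochain F G p q where
  toFun z := z ⟨(p, q), h⟩
  map_add' _ _ := rfl
  map_smul' _ _ := rfl

/-- The horizontal part of the total differential. -/
def totHor (F G : ModPresheaf A) (n : ℕ) :
    ∀ p q : ℕ, p + q = n + 1 → (GHC F G n →ₗ[k] DCochain F G p q)
  | 0, _, _ => 0
  | p + 1, q, h => dHor p q ∘ₗ ghcComp p q (by omega)

/-- The vertical part of the total differential, with sign `(-1)^p`. -/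
def totVer (F G : ModPresheaf A) (n : ℕ) :
    ∀ p q : ℕ, p + q = n + 1 → (GHC F G n →ₗ[k] DCochain F G p q)
  | _, 0, _ => 0
  | p, q + 1, h => (-1 : k) ^ p • (dVer p q ∘ₗ ghcComp p q (by omega))

/-- The differential of the global Hochschild complex. -/
def ghcD (F G : ModPresheaf A) (n : ℕ) : GHC F G n →ₗ[k] GHC F G (n + 1) where
  toFun z s := totHor F G n s.1.1 s.1.2 s.2 z + totVer F G n s.1.1 s.1.2 s.2 z
  map_add' z z' := by
    funext s
    rw [map_add, map_add, add_add_add_comm]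
    rfl
  map_smul' t z := by
    funext s
    rw [map_smul, map_smul, ← smul_add]
    rfl

/-- The coboundaries of the global Hochschild complex. -/
def ghcB (F G : ModPresheaf A) : ∀ n : ℕ, Submodule k (GHC F G n)
  | 0 => ⊥
  | n + 1 => LinearMap.range (ghcD F G n)

/-- The cocycles of the global Hochschild complex. -/
abbrev ghcZ (F G : ModPresheaf A) (n : ℕ) : Submodule k (GHC F G n) := LinearMap.ker (ghcD F G n)

/-- The global Hochschild cohomology `HH^n(C, A, Hom_k(F, G))`. -/
abbrev HH (F G : ModPresheaf A) (n : ℕ) : Type u := ghcZ F G n ⧸ (ghcB F G n).comap (ghcZ F G n).subtype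

end GlobalHochschild
/-! ## Matric freeness, liftings and the deformation functor -/

open RObj

/-- The right ideal `e_i R = ⨁_j R_ij` of `R`. -/
def PointedAlg.row (R : PointedAlg k p) (i : Fin p) : Submodule k R where
  carrier := {r | R.e i * r = r}
  zero_mem' := mul_zero _
  add_mem' {a b} ha hb := by
    change R.e i * (a + b) = a + b
    rw [mul_add, ha, hb]
  smul_mem' t a ha := by
    change R.e i * (t • a) = t • a
    rw [mul_smul_comm, ha]

/-- Right multiplication by `r` on `e_i R`. -/
def PointedAlg.rowMul (R : PointedAlg k p) (i : Fin p) (r : R) : R.row i →ₗ[k] R.row i :=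
  (LinearMap.mulRight k r).restrict fun a (ha : R.e i * a = a) => by
    change R.e i * (a * r) = a * r
    rw [← mul_assoc, ha]

/-- The element `e_i` of `e_i R`. -/
def PointedAlg.rowOne (R : PointedAlg k p) (i : Fin p) : R.row i := ⟨R.e i, R.e_mul_e i⟩

/-- The map `e_i R → e_i S` induced by `u : R → S`. -/
def PointedAlg.rowMap {R S : PointedAlg k p} (u : R ⟶ S) (i : Fin p) : R.row i →ₗ[k] S.row i :=
  (PointedAlg.hom u).toLinearMap.restrict fun a (ha : R.e i * a = a) => by
    change S.e i * PointedAlg.hom u a = PointedAlg.hom u a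
    rw [← R.hom_e u, ← map_mul, ha]

@[simp] theorem PointedAlg.coe_rowMul (R : PointedAlg k p) (i : Fin p) (r : R) (a : R.row i) :
    (R.rowMul i r a : R) = a * r := rfl

@[simp] theorem PointedAlg.coe_rowOne (R : PointedAlg k p) (i : Fin p) :
    (R.rowOne i : R) = R.e i := rfl

@[simp] theorem PointedAlg.coe_rowMap {R S : PointedAlg k p} (u : R ⟶ S) (i : Fin p)
    (a : R.row i) : (PointedAlg.rowMap u i a : S) = PointedAlg.hom u a := rfl

theorem PointedAlg.e_mul_row (R : PointedAlg k p) (i : Fin p) (a : R.row i) :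
    R.e i * (a : R) = a := a.2

variable (F : Fin p → ModPresheaf A)

/-- The right `R`-module `(F_i(c) ⊗_k R_ij) = ⨁_i F_i(c) ⊗_k e_i R`. -/
abbrev FreeMod (R : PointedAlg k p) (c : C) : Type u := ∀ i, (F i).obj c ⊗[k] R.row i

/-- The right action of `r ∈ R` on `⨁_i F_i(c) ⊗_k e_i R`. -/
def freeMul (R : PointedAlg k p) (c : C) (r : R) : FreeMod F R c →ₗ[k] FreeMod F R c :=
  LinearMap.pi fun i => (R.rowMul i r).lTensor _ ∘ₗ LinearMap.proj i

/-- The embedding `f ↦ f ⊗ e_i` of `F_i(c)`. -/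
def freeIncl (R : PointedAlg k p) (c : C) (i : Fin p) : (F i).obj c →ₗ[k] FreeMod F R c :=
  LinearMap.single k (fun i => (F i).obj c ⊗[k] R.row i) i ∘ₗ
    (TensorProduct.mk k _ _).flip (R.rowOne i)

/-- The map `⨁_i F_i(c) ⊗_k e_i R → F_i(c)` that applies a linear form on `R` to the `i`-th
component. -/
def freeEval (R : PointedAlg k p) (c : C) (i : Fin p) (μ : R →ₗ[k] k) :
    FreeMod F R c →ₗ[k] (F i).obj c :=
  (TensorProduct.rid k _).toLinearMap ∘ₗ (μ ∘ₗ (R.row i).subtype).lTensor _ ∘ₗ LinearMap.proj i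

variable {F}

/-- `X` is `R`-free: `X(c) ≅ (F_i(c) ⊗_k R_ij)` as a right `R`-module, for every `c`. -/
def RObj.IsFree {R : PointedAlg k p} (X : RObj A R) (F : Fin p → ModPresheaf A) : Prop :=
  ∀ c, ∃ θ : X.obj c ≃ₗ[k] FreeMod F R c, ∀ r x, θ (X.ract c (op r) x) = freeMul F R c r (θ x)

theorem RObj.IsFree.baseChange {R S : PointedAlg k p} {X : RObj A R} (h : X.IsFree F)
    (u : R ⟶ S) : (X.baseChange u).IsFree F := by
  intro c
  obtain ⟨θ, hθ⟩ := h c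
  have hθ' : ∀ r y, θ.symm (freeMul F R c r y) = X.ract c (op r) (θ.symm y) := fun r y => by
    rw [LinearEquiv.symm_apply_eq, hθ, LinearEquiv.apply_symm_apply]
  -- forward map
  let φ (i : Fin p) (s : S) : R.row i →ₗ[k] S.row i := S.rowMul i s ∘ₗ PointedAlg.rowMap u i
  let f : X.obj c →ₗ[k] S →ₗ[k] FreeMod F S c := LinearMap.mk₂ k
    (fun x s i => (φ i s).lTensor _ (θ x i))
    (fun x y s => by ext i; simp) (fun t x s => by ext i; simp)
    (fun x s t => by
      ext i
      have : φ i (s + t) = φ i s + φ i t := by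
        ext a; simp [φ, mul_add]
      simp [this, LinearMap.lTensor_add])
    (fun t x s => by
      ext i
      have : φ i (t • s) = t • φ i s := by
        ext a; simp [φ]
      simp [this, LinearMap.lTensor_smul])
  have hf : ∀ x r s, f (X.ract c (op r) x) s = f x (PointedAlg.hom u r * s) := by
    intro x r s
    ext i
    simp only [f, LinearMap.mk₂_apply, hθ, freeMul, LinearMap.pi_apply, LinearMap.comp_apply,
      LinearMap.proj_apply, ← LinearMap.lTensor_comp_apply]
    congr 2
    ext a
    simp [φ, mul_assoc]
  let g : FreeMod F S c →ₗ[k] (X.baseChange u).obj c := ∑ i,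
    TensorProduct.lift ((X.bmk u c).compl₁₂ (θ.symm.toLinearMap ∘ₗ freeIncl F R c i)
      (S.row i).subtype) ∘ₗ LinearMap.proj i
  have key : ∀ i (v : (F i).obj c) (a : R.row i),
      (Pi.single i (v ⊗ₜ a) : FreeMod F R c) = freeMul F R c a (freeIncl F R c i v) := by
    intro i v a
    funext j
    rcases eq_or_ne j i with rfl | hj
    · simp [freeMul, freeIncl]
      congr 1
      ext
      simp [PointedAlg.e_mul_row]
    · simp [freeMul, freeIncl, hj]
  have hg : ∀ i (v : (F i).obj c) (a : S.row i),
      g (Pi.single i (v ⊗ₜ a)) = X.bmk u c (θ.symm (freeIncl F R c i v)) a := by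
    intro i v a
    simp only [g, LinearMap.sum_apply, LinearMap.comp_apply, LinearMap.proj_apply]
    rw [Finset.sum_eq_single i]
    · simp
    · intro j _ hj
      simp [hj]
    · simp
  have hφ : ∀ i (v : (F i).obj c) (a : R.row i) s,
      f (θ.symm (Pi.single i (v ⊗ₜ a))) s = Pi.single i (v ⊗ₜ φ i s a) := by
    intro i v a s
    funext j
    rcases eq_or_ne j i with rfl | hj
    · simp [f]
    · simp [f, hj]
  have hgf : ∀ x, g (blift f hf x) = x := by
    intro x
    induction x using baseChange_ind with
    | add a b ha hb => simp only [map_add, ha, hb]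
    | h x s =>
      obtain ⟨y, rfl⟩ := θ.symm.surjective x
      suffices h : g ∘ₗ (f.flip s) ∘ₗ θ.symm.toLinearMap = ((X.bmk u c).flip s) ∘ₗ θ.symm.toLinearMap from
        LinearMap.congr_fun h y
      apply LinearMap.pi_ext'
      intro i
      apply TensorProduct.ext'
      intro v a
      change g (f (θ.symm (Pi.single i (v ⊗ₜ a))) s) = X.bmk u c (θ.symm (Pi.single i (v ⊗ₜ a))) s
      rw [hφ, hg, key, hθ', bmk_smul]
      rfl
  have hfg : ∀ y, blift f hf (g y) = y := by
    intro y
    suffices h : blift f hf ∘ₗ g = LinearMap.id from LinearMap.congr_fun h y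
    apply LinearMap.pi_ext'
    intro i
    apply TensorProduct.ext'
    intro v a
    change blift f hf (g (Pi.single i (v ⊗ₜ a))) = Pi.single i (v ⊗ₜ a)
    rw [hg, blift_bmk]
    refine (hφ i v (R.rowOne i) a).trans ?_
    congr 2
    ext
    simp [φ, PointedAlg.hom_e, PointedAlg.e_mul_row]
  refine ⟨LinearEquiv.ofLinearMap (blift f hf) g (LinearMap.ext hfg) (LinearMap.ext hgf), ?_⟩
  intro s x
  change blift f hf _ = freeMul F S c s (blift f hf x)
  induction x using baseChange_ind with
  | add a b ha hb => simp only [map_add, ha, hb]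
  | h x t =>
    rw [baseChange_ract_bmk, blift_bmk, blift_bmk]
    ext i
    simp only [f, LinearMap.mk₂_apply, freeMul, LinearMap.pi_apply, LinearMap.comp_apply,
      LinearMap.proj_apply, ← LinearMap.lTensor_comp_apply]
    congr 2
    ext a
    simp [φ, mul_assoc]

/-- A lifting of the family `F` to `R`: an `R`-free `R`-object `X` together with isomorphisms
`X ⊗_R k_i ≅ F_i`. -/
structure Lifting (F : Fin p → ModPresheaf A) (R : PointedAlg k p) where
  obj : RObj A R
  free : obj.IsFree F
  iso : ∀ i, obj.tensor (simpleMod R i) ≅ F i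

namespace Lifting

variable {R S T : PointedAlg k p}

/-- Two liftings are equivalent if there is an isomorphism of `R`-objects that is compatible with
the isomorphisms to the `F_i`. -/
def Equivalent (X Y : Lifting F R) : Prop :=
  ∃ τ : X.obj ≅ Y.obj, ∀ i, tensorMap τ.hom (simpleMod R i) ≫ (Y.iso i).hom = (X.iso i).hom

variable (F R) in
instance setoid : Setoid (Lifting F R) where
  r := Equivalent
  iseqv :=
    { refl := fun X => ⟨Iso.refl _, fun i => tensor_hom_ext fun c x n => rfl⟩
      symm := by
        rintro X Y ⟨τ, h⟩
        refine ⟨τ.symm, fun i => tensor_hom_ext fun c y n => ?_⟩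
        rw [← h i]
        change app (Y.iso i).hom c (Y.obj.tmk _ c (app (hom (τ.inv ≫ τ.hom)) c y) n) = _
        rw [τ.inv_hom_id]
        rfl
      trans := by
        rintro X Y Z ⟨τ, h⟩ ⟨σ, h'⟩
        refine ⟨τ ≪≫ σ, fun i => ?_⟩
        rw [← h i, ← h' i]
        exact tensor_hom_ext fun c x n => rfl }

/-- The lifting `X ⊗_R S`, with the isomorphisms `(X ⊗_R S) ⊗_S k_i ≅ X ⊗_R k_i ≅ F_i`. -/
abbrev baseChange (u : R ⟶ S) (X : Lifting F R) : Lifting F S where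
  obj := X.obj.baseChange u
  free := X.free.baseChange u
  iso i := assocIso X.obj u (simpleMod S i) (simpleMod R i)
    (fun r => by ext; simp [PointedAlg.aug_hom]) ≪≫ X.iso i

theorem baseChange_iso_tmk (u : R ⟶ S) (X : Lifting F R) (i c x s n) :
    app ((X.baseChange u).iso i).hom c ((X.baseChange u).obj.tmk (simpleMod S i) c
      (X.obj.bmk u c x s) n) = app (X.iso i).hom c (X.obj.tmk _ c x (S.aug s i * n)) := rfl

theorem baseChange_equivalent (u : R ⟶ S) {X Y : Lifting F R} (h : Equivalent X Y) :
    Equivalent (X.baseChange u) (Y.baseChange u) := by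
  obtain ⟨τ, h⟩ := h
  refine ⟨baseChangeIso u τ, fun i => ?_⟩
  refine ModPresheaf.hom_ext fun c x => ?_
  induction x using assoc_ind with
  | h x s n =>
    change app (Y.iso i).hom c (Y.obj.tmk _ c (app (hom τ.hom) c x) (S.aug s i * n)) =
      app (X.iso i).hom c (X.obj.tmk _ c x (S.aug s i * n))
    rw [← h i]
    rfl
  | add a b ha hb => rw [map_add, map_add, ha, hb]

theorem baseChange_id (X : Lifting F R) : Equivalent (X.baseChange (𝟙 R)) X := by
  refine ⟨X.obj.unitIso, fun i => ModPresheaf.hom_ext fun c x => ?_⟩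
  induction x using assoc_ind with
  | h x s n =>
    change app (X.iso i).hom c (X.obj.tmk _ c (X.obj.ract c (op s) x) n) = 
      app (X.iso i).hom c (X.obj.tmk _ c x (R.aug s i * n))
    rw [tmk_smul]
    rfl
  | add a b ha hb => rw [map_add, map_add, ha, hb]

theorem baseChange_comp (u : R ⟶ S) (v : S ⟶ T) (X : Lifting F R) :
    Equivalent ((X.baseChange u).baseChange v) (X.baseChange (u ≫ v)) := by
  refine ⟨compIso X.obj u v, fun i => ModPresheaf.hom_ext fun c x => ?_⟩
  induction x using tensor_ind with
  | h x n =>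
    induction x using comp_ind with
    | h x s t =>
      change app (X.iso i).hom c (X.obj.tmk _ c x (T.aug (PointedAlg.hom v s * t) i * n)) =
        app (X.iso i).hom c (X.obj.tmk _ c x (S.aug s i * (T.aug t i * n)))
      simp [PointedAlg.aug_hom, mul_assoc]
    | add a b ha hb =>
      have e : ((X.obj.baseChange u).baseChange v).tmk (simpleMod T i) c (a + b) n =
        ((X.obj.baseChange u).baseChange v).tmk (simpleMod T i) c a n +
        ((X.obj.baseChange u).baseChange v).tmk (simpleMod T i) c b n := by
        rw [map_add, LinearMap.add_apply]
      exact (congrArg _ e).trans (((LinearMap.map_add _ _ _).trans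
        ((congrArg₂ _ ha hb).trans (LinearMap.map_add _ _ _).symm)).trans (congrArg _ e).symm)
  | add a b ha hb => rw [map_add, map_add, ha, hb]

end Lifting

/-- Equivalence classes of liftings, as a functor on all pointed algebras. -/
def defFunctorAll (F : Fin p → ModPresheaf A) : PointedAlg k p ⥤ Type (u + 1) where
  obj R := Quotient (Lifting.setoid F R)
  map u := TypeCat.ofHom
    (Quotient.map (Lifting.baseChange u) fun _ _ h => Lifting.baseChange_equivalent u h)
  map_id R := by
    ext x
    induction x using Quotient.inductionOn with
    | h X => exact Quotient.sound X.baseChange_id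
  map_comp u v := by
    ext x
    induction x using Quotient.inductionOn with
    | h X => exact Quotient.sound (Setoid.symm (X.baseChange_comp u v))

/-- The noncommutative deformation functor `Def_F : a_p → Sets`. -/
def defFunctor (F : Fin p → ModPresheaf A) : ArtAlg k p ⥤ Type (u + 1) := ObjectProperty.ι _ ⋙ defFunctorAll F


/-! ## Obstructions of liftings -/

section Obstruction

variable {R S : PointedAlg k p}

/-- For a lifting `X` of the family `F` to `S` and a morphism `u : R → S`, a choice of
* surjections `q c : ⨁_i F_i(c) ⊗_k e_i R → X(c)` of right `R`-modules that are compatible with the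
  identifications of the reduction with the `F_i`, and
* `R`-linear maps `act c a` and `map φ` on the free modules `⨁_i F_i(c) ⊗_k e_i R` that lift the
  action of `a ∈ A(c)` on `X(c)` and the restriction maps `X(φ)`. -/
structure LiftedAction (u : R ⟶ S) (X : Lifting F S) where
  q : ∀ c, FreeMod F R c →ₗ[k] X.obj.obj c
  q_mul : ∀ c r n, q c (freeMul F R c r n) = X.obj.ract c (op (PointedAlg.hom u r)) (q c n)
  q_surjective : ∀ c, Function.Surjective (q c)
  q_reduction : ∀ i c n, app (X.iso i).hom c (X.obj.tmk (simpleMod S i) c (q c n) 1) =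
    freeEval F R c i (LinearMap.proj i ∘ₗ R.aug.toLinearMap) n
  act : ∀ c, A.obj c →ₗ[k] Module.End k (FreeMod F R c)
  act_mul : ∀ c a r n, act c a (freeMul F R c r n) = freeMul F R c r (act c a n)
  q_act : ∀ c a n, q c (act c a n) = X.obj.act c a (q c n)
  map : ∀ {c d : C}, (c ⟶ d) → (FreeMod F R c →ₗ[k] FreeMod F R d)
  map_mul : ∀ {c d : C} (φ : c ⟶ d) r n, map φ (freeMul F R c r n) = freeMul F R d r (map φ n)
  q_map : ∀ {c d : C} (φ : c ⟶ d) n, q d (map φ n) = X.obj.map φ (q c n)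

/-- The linear map `F_j(c) → F_i(d)` obtained from a map of free modules by applying a linear form
`μ` on `R` to its component in `Hom_k(F_j(c), F_i(d) ⊗_k R_ij)`. -/
def freeComp {c d : C} (i j : Fin p) (μ : R →ₗ[k] k) (T : FreeMod F R c →ₗ[k] FreeMod F R d) :
    (F j).obj c →ₗ[k] (F i).obj d :=
  freeEval F R d i μ ∘ₗ T ∘ₗ freeIncl F R c j

/-- `w` is the obstruction for lifting `X` along the small surjection `u : R → S` with kernel `K`:
the obstruction in `HH^2(C, A, Hom_k(F_j, F_i)) ⊗_k K_ij` is the class of the 2-cocycle with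
components
* `o(0,2)(a, b) = L(ab) - L(a) L(b)`,
* `o(1,1)(φ, a) = L(φ) L(a) - L(A(φ)(a)) L(φ)`,
* `o(2,0)(φ, φ') = L(φ') L(φ) - L(φ' φ)`,
where `L` lifts the structure maps of `X` to the free `R`-modules, and it is considered as a family
of linear maps `w_ij : HH^2(C, A, Hom_k(F_j, F_i))^* → K_ij ⊆ R`. -/
def IsObstruction (u : R ⟶ S) (X : Lifting F S)
    (w : ∀ i j, Module.Dual k (HH (F j) (F i) 2) →ₗ[k] R) : Prop :=
  (∀ i j v, PointedAlg.hom u (w i j v) = 0) ∧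
  ∃ L : LiftedAction u X, ∀ (i j : Fin p) (μ : R →ₗ[k] k), ∃ z : ghcZ (F j) (F i) 2,
    (∀ (x : ComposableArrows C 0) a, ghcComp 0 2 rfl z.1 x a =
      freeComp i j μ (L.act _ (a 0 * a 1) - L.act _ (a 0) ∘ₗ L.act _ (a 1))) ∧
    (∀ (x : ComposableArrows C 1) a, ghcComp 1 1 rfl z.1 x a =
      freeComp i j μ (L.map (x.map' 0 1) ∘ₗ L.act _ (a 0) -
        L.act _ ((A.map (x.map' 0 1)).hom (a 0)) ∘ₗ L.map (x.map' 0 1))) ∧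
    (∀ (x : ComposableArrows C 2) a, ghcComp 2 0 rfl z.1 x a =
      freeComp i j μ (L.map (x.map' 1 2) ∘ₗ L.map (x.map' 0 1) - L.map (x.map' 0 2))) ∧
    ∀ v : Module.Dual k (HH (F j) (F i) 2), v (Submodule.Quotient.mk z) = μ (w i j v)

/-- For a lifting `X` to an algebra `R` with `I(R)^2 = 0`, `w` is the class of `X` in
`HH^1(C, A, Hom_k(F_j, F_i)) ⊗_k I(R)_ij`, considered as a family of linear maps
`w_ij : HH^1(C, A, Hom_k(F_j, F_i))^* → I(R)_ij ⊆ R`: it is the class of the 1-cocycle with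
components `a ↦ L(a)` and `φ ↦ -L(φ)` modulo the trivial lifting. -/
def IsFirstOrderClass (X : Lifting F R)
    (w : ∀ i j, Module.Dual k (HH (F j) (F i) 1) →ₗ[k] R) : Prop :=
  (∀ i j v, w i j v ∈ R.rad) ∧
  ∃ L : LiftedAction (𝟙 R) X, ∀ (i j : Fin p) (μ : R →ₗ[k] k), (∀ a, μ (R.incl a) = 0) →
    ∃ z : ghcZ (F j) (F i) 1,
    (∀ (x : ComposableArrows C 0) a, ghcComp 0 1 rfl z.1 x a = freeComp i j μ (L.act _ (a 0))) ∧
    (∀ (x : ComposableArrows C 1) a, ghcComp 1 0 rfl z.1 x a =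
      -freeComp i j μ (L.map (x.map' 0 1))) ∧
    ∀ v : Module.Dual k (HH (F j) (F i) 1), v (Submodule.Quotient.mk z) = μ (w i j v)

end Obstruction

/-! ## Obstruction morphisms and generalized Massey products -/

section Massey

namespace PointedAlg

variable {R S : PointedAlg k p}

theorem closure_le_rad (J : Ideal R) (hJ : J ≤ R.rad) : ⨅ n : ℕ, J ⊔ R.rad ^ n ≤ R.rad :=
  (iInf_le _ 1).trans (sup_le hJ (Submodule.pow_one R.rad).le)

instance closure_isTwoSided (J : Ideal R) [J.IsTwoSided] :
    (⨅ n : ℕ, J ⊔ R.rad ^ n).IsTwoSided where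
  mul_mem_of_left b ha := by
    rw [Submodule.mem_iInf] at ha ⊢
    intro n
    obtain ⟨x, hx, y, hy, rfl⟩ := Submodule.mem_sup.1 (ha n)
    rw [add_mul]
    exact Submodule.add_mem_sup (J.mul_mem_right b hx) (Ideal.mul_mem_right b _ hy)

/-- The two-sided ideal of `S` generated by the image of `I(R)` under `f : R → S`. -/
def imageIdeal (f : R ⟶ S) : Ideal S := (TwoSidedIdeal.span (hom f '' R.rad)).asIdeal

instance (f : R ⟶ S) : (imageIdeal f).IsTwoSided := by
  unfold imageIdeal
  infer_instance

theorem imageIdeal_le_rad (f : R ⟶ S) : imageIdeal f ≤ S.rad := by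
  intro x hx
  have h : TwoSidedIdeal.span (hom f '' R.rad) ≤ TwoSidedIdeal.ker S.aug := by
    rw [TwoSidedIdeal.span_le]
    rintro _ ⟨r, hr, rfl⟩
    change hom f r ∈ TwoSidedIdeal.ker S.aug
    rw [TwoSidedIdeal.mem_ker, aug_hom]
    exact hr
  exact (TwoSidedIdeal.mem_ker _).1 (h (TwoSidedIdeal.mem_asIdeal.1 hx))

/-- The completed tensor product `S ⊗̂_R k^p` along `f : R → S`: the quotient of `S` by the closure
of the two-sided ideal generated by `f(I(R))`. -/
def cofiber (f : R ⟶ S) : PointedAlg k p :=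
  S.quot (⨅ n : ℕ, imageIdeal f ⊔ S.rad ^ n) (closure_le_rad _ (imageIdeal_le_rad f))

/-- The projection `S → S ⊗̂_R k^p`. -/
def toCofiber (f : R ⟶ S) : S ⟶ cofiber f := proj _ _

/-- The kernel of a morphism. -/
def ker (f : R ⟶ S) : Ideal R := RingHom.ker (hom f)

instance (f : R ⟶ S) : (ker f).IsTwoSided := inferInstanceAs (RingHom.ker (hom f)).IsTwoSided

theorem ker_le_rad (f : R ⟶ S) : ker f ≤ R.rad := fun r hr => by
  have hr : hom f r = 0 := hr
  rw [mem_rad, ← aug_hom f, hr, map_zero]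

/-- For a morphism `f : R → S` with kernel `a`, the ideal `b = I(R) a + a I(R)`. -/
def smallIdeal (f : R ⟶ S) : Ideal R := R.rad * ker f ⊔ ker f * R.rad

instance (f : R ⟶ S) : (smallIdeal f).IsTwoSided where
  mul_mem_of_left b ha := by
    obtain ⟨x, hx, y, hy, rfl⟩ := Submodule.mem_sup.1 ha
    rw [add_mul]
    exact Submodule.add_mem_sup (Ideal.mul_mem_right b _ hx) (Ideal.mul_mem_right b _ hy)

theorem smallIdeal_le_ker (f : R ⟶ S) : smallIdeal f ≤ ker f :=
  sup_le (Ideal.mul_le.2 fun a _ _ hb => (ker f).mul_mem_left a hb)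
    (Ideal.mul_le.2 fun _ ha b _ => (ker f).mul_mem_right b ha)

/-- The quotient `R / b`, the universal small extension of `R / a` that is a quotient of `R`. -/
def smallExt (f : R ⟶ S) : PointedAlg k p :=
  R.quot (smallIdeal f) ((smallIdeal_le_ker f).trans (ker_le_rad f))

/-- The projection `R → R / b`. -/
def toSmallExt (f : R ⟶ S) : R ⟶ smallExt f := proj _ _

/-- The morphism `R / b → S` induced by `f`. It is small: its kernel `K` satisfies `I K = K I = 0`. -/
def smallExtMap (f : R ⟶ S) : smallExt f ⟶ S := desc _ _ f fun _ ha => smallIdeal_le_ker f ha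

end PointedAlg

open PointedAlg

/-- The free formal matrix ring `T^n` generated by the dual spaces of the
`HH^n(C, A, Hom_k(F_j, F_i))`. -/
def formalT (F : Fin p → ModPresheaf A) (n : ℕ) : PointedAlg k p :=
  freeFormal fun i j => Module.Dual k (HH (F j) (F i) n)

/-- The generators of `T^n`. -/
def formalGen (F : Fin p → ModPresheaf A) (n : ℕ) (i j : Fin p) :
    Module.Dual k (HH (F j) (F i) n) →ₗ[k] formalT F n :=
  freeFormalGen (fun i j => Module.Dual k (HH (F j) (F i) n)) i j

/-- Let `o : T^2 → T^1` be a morphism and let `H = T^1 ⊗̂_{T^2} k^p`, with `ξ ∈ Def_F(H)`. Then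
`o` is the obstruction morphism for `ξ`, that is, the linear dual of the generalized Massey products
with defining system `ξ`, if
* it maps `I(T^2)` to `I(T^1)^2`,
* `ξ` is tautological to first order: the class of its image in `Def_F(H / I(H)^2)` maps a vector in
  the dual space of `HH^1(C, A, Hom_k(F_j, F_i))` to the corresponding generator of `T^1`,
* for `n ≥ 2`, with `a_n` the kernel of `T^1 → H / I(H)^n` and `b_n = I a_n + a_n I`, the obstruction
  for lifting the image of `ξ` in `Def_F(H / I(H)^n)` along `T^1 / b_n → T^1 / a_n = H / I(H)^n` is
  the composition of `o` with `T^1 → T^1 / b_n`. -/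
structure IsMassey (o : formalT F 2 ⟶ formalT F 1) (hH : (cofiber o).IsPro)
    (ξ : ProElt (defFunctor F) ⟨cofiber o, hH⟩) : Prop where
  map_rad : ∀ x ∈ (formalT F 2).rad, hom o x ∈ (formalT F 1).rad ^ 2
  firstOrder : ∃ X : Lifting F ((cofiber o).level 1),
    ξ.1 1 = Quotient.mk (Lifting.setoid F _) X ∧
    IsFirstOrderClass X fun i j =>
      (hom (toCofiber o ≫ (cofiber o).toLevel 1)).toLinearMap ∘ₗ formalGen F 1 i j
  obstruction : ∀ n : ℕ, 1 ≤ n → ∃ X : Lifting F ((cofiber o).level n),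
    ξ.1 n = Quotient.mk (Lifting.setoid F _) X ∧
    IsObstruction (smallExtMap (toCofiber o ≫ (cofiber o).toLevel n)) X fun i j =>
      (hom (o ≫ toSmallExt (toCofiber o ≫ (cofiber o).toLevel n))).toLinearMap ∘ₗ formalGen F 2 i j

end Massey

end Presheaf

end

noncomputable section

namespace Deformation

open ModPresheaf MulOpposite RObj

section FreeModules

variable {k : Type u} [Field k] {C : Type u} [SmallCategory C] {A : C ⥤ AlgCat.{u} k} {p : ℕ}
  (F : Fin p → ModPresheaf A) {R S T : PointedAlg k p} {c d e : C}

/-! ### The free modules `⨁ F_i(c) ⊗ e_i R` -/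

/-! Over a nilpotent R a lifting can be put into coordinates: it becomes a family of R-linear
operators on the fixed free modules ⨁ F_i(c) ⊗ e_i R that reduce to the structure maps of the F_i.
Such families are the `PreModel`s; `PreModel.IsExact` says that they satisfy the identities of a
presheaf of modules, and equivalence of liftings becomes conjugation by linear automorphisms that
reduce to the identity (`PreModel.Gauge`). Coordinates exist by `frame_bijective` and
`Frame.exists_frame`, and `HasModel` records the dictionary.

Let u : R → S be small with kernel K. The operators always lift along u; only the identities can
fail, and the failure has values in K. Since IK = KI = 0, composing a K-valued map with a lifted
operator is the same as composing it with the action on some F_i (`freeComp_comp_left`,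
`freeComp_comp_right`). Applying linear forms to R therefore turns everything into cochains with
values in Hom_k(F_j, F_i): the defects form a 2-cocycle (`PreModel.obs_mem`), another lift changes
it by a coboundary (`PreModel.obs_sub`), its class is natural (`PreModel.Obs.push`), and it vanishes
only if an exact lift exists (`PreModel.Obs.exists_isExact`). Two exact lifts differ by a 1-cocycle,
and they are gauge equivalent if it is a coboundary (`PreModel.exists_gauge`).

Massey products give a hull (`smoothAt_of_isMassey`, `isHull_of_isMassey`). By `smoothAt_of_small`
only small u matter. Given v : H_o → S and a deformation x over R above the one induced by v, lift v
to w : T^1 → R, which is possible because T^1 is free. By naturality w(o(λ)) is the obstruction for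
lifting the induced deformation to R; it is zero because x is such a lift, so w factors through H_o.
The deformation induced by w differs from x by a class in H^1 ⊗ K, and since ξ is tautological to
first order, changing w on the generators by this class removes the difference
(`exists_cls_diff_push`). The same formula gives injectivity when I(R)^2 = 0. Surjectivity is
smoothness along R → k^p, over which there is exactly one deformation.

Existence (`exists_models`, `exists_isMassey`) is by successive approximation: start with o = 0 and
the tautological first order deformation, lift one level in the cofiber of the current o, and change
o in high degree so that it gives the new obstruction. The changes converge because T^1 is complete.

Finiteness enters through `RadFG`: it makes the completed free matrix rings complete with the
expected I-adic topology (`complProj_eq_zero`) and makes the objects of a_p finite-dimensional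
(`finite_of_isArt`), so that K-valued operators are recovered from finitely many components. -/

theorem freeMul_single (r : R) (i : Fin p) (f : (F i).obj c) (a : R.row i) :
    freeMul F R c r (Pi.single i (f ⊗ₜ a)) = Pi.single i (f ⊗ₜ R.rowMul i r a) := by
  funext j
  rcases eq_or_ne j i with rfl | hj
  · simp [freeMul]
  · simp [freeMul, hj]

theorem freeIncl_apply (i : Fin p) (f : (F i).obj c) :
    freeIncl F R c i f = Pi.single i (f ⊗ₜ R.rowOne i) := rfl

/-- Because a = e_i a, an elementary tensor is a translate of f ⊗ e_i. So the F_i(c) generate the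
free module, which is what induction and extensionality rest on. -/
theorem single_eq (i : Fin p) (f : (F i).obj c) (a : R.row i) :
    (Pi.single i (f ⊗ₜ a) : FreeMod F R c) = freeMul F R c a (freeIncl F R c i f) := by
  rw [freeIncl_apply, freeMul_single]
  congr 2
  ext
  simp [PointedAlg.e_mul_row]

theorem freeMul_mul (r s : R) (n : FreeMod F R c) :
    freeMul F R c (r * s) n = freeMul F R c s (freeMul F R c r n) := by
  funext i
  simp only [freeMul, LinearMap.pi_apply, LinearMap.comp_apply, LinearMap.proj_apply,
    ← LinearMap.lTensor_comp_apply]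
  congr 2
  ext a
  simp [mul_assoc]

theorem freeMul_one (n : FreeMod F R c) : freeMul F R c 1 n = n := by
  funext i
  have : R.rowMul i 1 = LinearMap.id := by ext a; simp
  simp [freeMul, this]

theorem freeMul_add (r s : R) (n : FreeMod F R c) :
    freeMul F R c (r + s) n = freeMul F R c r n + freeMul F R c s n := by
  funext i
  have : R.rowMul i (r + s) = R.rowMul i r + R.rowMul i s := by ext a; simp [mul_add]
  simp [freeMul, this, LinearMap.lTensor_add]

theorem freeMul_smul (t : k) (r : R) (n : FreeMod F R c) :
    freeMul F R c (t • r) n = t • freeMul F R c r n := by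
  funext i
  have : R.rowMul i (t • r) = t • R.rowMul i r := by ext a; simp
  simp [freeMul, this, LinearMap.lTensor_smul]

theorem freeMul_zero (n : FreeMod F R c) : freeMul F R c 0 n = 0 := by
  simpa using freeMul_smul F (0 : k) (0 : R) n

variable (R c) in
/-- The right `R`-module structure of `⨁ F_i(c) ⊗ e_i R`. -/
def freeAct : (R : Type u)ᵐᵒᵖ →ₐ[k] Module.End k (FreeMod F R c) :=
  AlgHom.ofLinearMap
    { toFun := fun r => freeMul F R c r.unop
      map_add' := fun a b => LinearMap.ext fun n => freeMul_add F a.unop b.unop n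
      map_smul' := fun t a => LinearMap.ext fun n => freeMul_smul F t a.unop n }
    (LinearMap.ext fun n => freeMul_one F n)
    (fun a b => LinearMap.ext fun n => freeMul_mul F b.unop a.unop n)

@[simp] theorem freeAct_apply (r) (n) : freeAct F R c r n = freeMul F R c r.unop n := rfl

theorem freeMul_e_freeIncl (i : Fin p) (f : (F i).obj c) :
    freeMul F R c (R.e i) (freeIncl F R c i f) = freeIncl F R c i f :=
  (single_eq F i f (R.rowOne i)).symm

variable {F} in
@[elab_as_elim]
theorem free_ind {motive : FreeMod F R c → Prop} (n : FreeMod F R c) (zero : motive 0)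
    (h : ∀ i f (a : R.row i), motive (freeMul F R c a (freeIncl F R c i f)))
    (add : ∀ a b, motive a → motive b → motive (a + b)) : motive n := by
  classical
  rw [← Finset.univ_sum_single n]
  refine Finset.sum_induction _ _ add zero fun i _ => ?_
  generalize n i = x
  induction x using TensorProduct.induction_on with
  | zero => simpa using zero
  | tmul f a => rw [single_eq]; exact h i f a
  | add x y hx hy => rw [Pi.single_add]; exact add _ _ hx hy

variable {F}

theorem free_ext {P : Type*} [AddCommGroup P] [Module k P] {g h : FreeMod F R c →ₗ[k] P}
    (H : ∀ i f (a : R.row i), g (freeMul F R c a (freeIncl F R c i f)) =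
      h (freeMul F R c a (freeIncl F R c i f))) : g = h := by
  refine LinearMap.ext fun n => ?_
  induction n using free_ind with
  | zero => simp
  | h i f a => exact H i f a
  | add a b ha hb => simp [ha, hb]

/-- `R`-linearity of maps between free modules. -/
def IsRLin (f : FreeMod F R c →ₗ[k] FreeMod F R d) : Prop :=
  ∀ r n, f (freeMul F R c r n) = freeMul F R d r (f n)

namespace IsRLin

theorem id : IsRLin (LinearMap.id : FreeMod F R c →ₗ[k] FreeMod F R c) := fun _ _ => rfl

theorem comp {g : FreeMod F R d →ₗ[k] FreeMod F R e} {f : FreeMod F R c →ₗ[k] FreeMod F R d}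
    (hg : IsRLin g) (hf : IsRLin f) : IsRLin (g ∘ₗ f) := fun r n => by
  rw [LinearMap.comp_apply, hf, hg]; rfl

theorem add {f g : FreeMod F R c →ₗ[k] FreeMod F R d} (hf : IsRLin f) (hg : IsRLin g) :
    IsRLin (f + g) := fun r n => by
  rw [LinearMap.add_apply, hf, hg, ← map_add]; rfl

theorem sub {f g : FreeMod F R c →ₗ[k] FreeMod F R d} (hf : IsRLin f) (hg : IsRLin g) :
    IsRLin (f - g) := fun r n => by
  rw [LinearMap.sub_apply, hf, hg, ← map_sub]; rfl

theorem sum {ι : Type*} {s : Finset ι} {f : ι → (FreeMod F R c →ₗ[k] FreeMod F R d)}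
    (hf : ∀ i, IsRLin (f i)) : IsRLin (∑ i ∈ s, f i) := fun r n => by
  simp only [LinearMap.sum_apply, map_sum]
  exact Finset.sum_congr rfl fun i _ => hf i r n

theorem ext {f g : FreeMod F R c →ₗ[k] FreeMod F R d} (hf : IsRLin f) (hg : IsRLin g)
    (h : ∀ i x, f (freeIncl F R c i x) = g (freeIncl F R c i x)) : f = g :=
  free_ext fun i x a => by rw [hf, hg, h]

end IsRLin

/-- The `R`-linear map on `⨁ F_i(c) ⊗ e_i R` with prescribed values on the `F_i(c)`. -/
def freeLift {P : Type*} [AddCommGroup P] [Module k P] (ρ : (R : Type u)ᵐᵒᵖ →ₐ[k] Module.End k P)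
    (t : ∀ i, (F i).obj c →ₗ[k] P) : FreeMod F R c →ₗ[k] P :=
  ∑ i, TensorProduct.lift (((LinearMap.lcomp k P (t i)) ∘ₗ ρ.toLinearMap ∘ₗ
    (opLinearEquiv k).toLinearMap ∘ₗ (R.row i).subtype).flip) ∘ₗ LinearMap.proj i

theorem freeLift_single {P : Type*} [AddCommGroup P] [Module k P]
    (ρ : (R : Type u)ᵐᵒᵖ →ₐ[k] Module.End k P) (t : ∀ i, (F i).obj c →ₗ[k] P) (i : Fin p)
    (f : (F i).obj c) (a : R.row i) :
    freeLift ρ t (Pi.single i (f ⊗ₜ a)) = ρ (op (a : R)) (t i f) := by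
  simp only [freeLift, LinearMap.sum_apply, LinearMap.comp_apply, LinearMap.proj_apply]
  rw [Finset.sum_eq_single i]
  · simp
  · intro j _ hj
    simp [hj]
  · simp

/-- The factor e_i is forced: f ⊗ e_i is fixed by e_i, so an R-linear map can only send it to a
vector fixed by e_i. -/
theorem freeLift_freeIncl {P : Type*} [AddCommGroup P] [Module k P]
    (ρ : (R : Type u)ᵐᵒᵖ →ₐ[k] Module.End k P) (t : ∀ i, (F i).obj c →ₗ[k] P) (i : Fin p)
    (f : (F i).obj c) : freeLift ρ t (freeIncl F R c i f) = ρ (op (R.e i)) (t i f) :=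
  freeLift_single ρ t i f _

theorem freeLift_freeMul {P : Type*} [AddCommGroup P] [Module k P]
    (ρ : (R : Type u)ᵐᵒᵖ →ₐ[k] Module.End k P) (t : ∀ i, (F i).obj c →ₗ[k] P) (r : R)
    (n : FreeMod F R c) : freeLift ρ t (freeMul F R c r n) = ρ (op r) (freeLift ρ t n) := by
  induction n using free_ind with
  | zero => simp
  | h i f a =>
    rw [← single_eq, freeMul_single, freeLift_single, freeLift_single]
    simp [op_mul]
  | add a b ha hb => simp only [map_add, ha, hb]

theorem isRLin_freeLift (t : ∀ i, (F i).obj c →ₗ[k] FreeMod F R d) :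
    IsRLin (freeLift (freeAct F R d) t) := fun r n => freeLift_freeMul _ t r n

/-! ### Functoriality in the algebra -/

variable (F) in
/-- The map `⨁ F_i(c) ⊗ e_i R → ⨁ F_i(c) ⊗ e_i S`. -/
def freeMap (u : R ⟶ S) (c : C) : FreeMod F R c →ₗ[k] FreeMod F S c :=
  LinearMap.pi fun i => (PointedAlg.rowMap u i).lTensor _ ∘ₗ LinearMap.proj i

theorem freeMap_freeMul (u : R ⟶ S) (r : R) (n : FreeMod F R c) :
    freeMap F u c (freeMul F R c r n) = freeMul F S c (PointedAlg.hom u r) (freeMap F u c n) := by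
  funext i
  simp only [freeMul, freeMap, LinearMap.pi_apply, LinearMap.comp_apply, LinearMap.proj_apply,
    ← LinearMap.lTensor_comp_apply]
  congr 2
  ext a
  simp

theorem freeMap_freeIncl (u : R ⟶ S) (i : Fin p) (f : (F i).obj c) :
    freeMap F u c (freeIncl F R c i f) = freeIncl F S c i f := by
  have : PointedAlg.rowMap u i (R.rowOne i) = S.rowOne i := Subtype.ext (R.hom_e u i)
  funext j
  rcases eq_or_ne j i with rfl | hj
  · simp [freeMap, freeIncl_apply, this]
  · simp [freeMap, freeIncl_apply, hj]

theorem freeMap_comp (u : R ⟶ S) (v : S ⟶ T) (n : FreeMod F R c) :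
    freeMap F (u ≫ v) c n = freeMap F v c (freeMap F u c n) := by
  funext i
  simp only [freeMap, LinearMap.pi_apply, LinearMap.comp_apply, LinearMap.proj_apply,
    ← LinearMap.lTensor_comp_apply]
  rfl

theorem freeMap_id (n : FreeMod F R c) : freeMap F (𝟙 R) c n = n := by
  funext i
  have : PointedAlg.rowMap (𝟙 R) i = LinearMap.id := rfl
  simp [freeMap, this]

theorem freeMap_surjective (u : R ⟶ S) (hu : Function.Surjective (PointedAlg.hom u)) :
    Function.Surjective (freeMap F u c) := by
  intro n
  induction n using free_ind with
  | zero => exact ⟨0, map_zero _⟩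
  | h i f a =>
    obtain ⟨r, hr⟩ := hu a
    exact ⟨freeMul F R c r (freeIncl F R c i f), by rw [freeMap_freeMul, freeMap_freeIncl, hr]⟩
  | add a b ha hb =>
    obtain ⟨x, rfl⟩ := ha
    obtain ⟨y, rfl⟩ := hb
    exact ⟨x + y, map_add _ _ _⟩

/-- Tensoring over a field is exact, so on each summand the kernel is F_i(c) ⊗ ker(e_i R → e_i S).
-/
theorem freeMap_ker (u : R ⟶ S) (n : FreeMod F R c) (hn : freeMap F u c n = 0) :
    n ∈ Submodule.span k {x | ∃ r i f, PointedAlg.hom u r = 0 ∧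
      x = freeMul F R c r (freeIncl F R c i f)} := by
  classical
  rw [← Finset.univ_sum_single n]
  refine Submodule.sum_mem _ fun i _ => ?_
  have h : n i ∈ LinearMap.ker ((PointedAlg.rowMap u i).lTensor ((F i).obj c)) := congrFun hn i
  obtain ⟨y, hy⟩ := (Module.Flat.lTensor_exact (R := k) (M := (F i).obj c)
    (N := LinearMap.ker (PointedAlg.rowMap u i)) (N' := R.row i) (N'' := S.row i)
    (LinearMap.exact_subtype_ker_map (PointedAlg.rowMap u i)) _).1 h
  rw [← hy]
  clear hy
  induction y using TensorProduct.induction_on with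
  | zero => simp
  | tmul f a =>
    refine Submodule.subset_span ⟨(a : R.row i), i, f, ?_, ?_⟩
    · exact congrArg Subtype.val a.2
    · rw [LinearMap.lTensor_tmul, Submodule.subtype_apply, single_eq]
  | add x y hx hy => rw [map_add, Pi.single_add]; exact Submodule.add_mem _ hx hy

theorem freeMap_ker_ind (u : R ⟶ S) {motive : FreeMod F R c → Prop} (n : FreeMod F R c)
    (hn : freeMap F u c n = 0) (zero : motive 0)
    (h : ∀ r i f, PointedAlg.hom u r = 0 → motive (freeMul F R c r (freeIncl F R c i f)))
    (add : ∀ a b, motive a → motive b → motive (a + b)) : motive n := by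
  have := freeMap_ker u n hn
  induction this using Submodule.span_induction with
  | mem x hx =>
    obtain ⟨r, i, f, hr, rfl⟩ := hx
    exact h r i f hr
  | zero => exact zero
  | add x y hx hy h1 h2 =>
    -- The induction hypotheses carry the premise that the vector is in the kernel, so it has to be
    -- restored for each summand.
    have key : ∀ z, z ∈ Submodule.span k {x | ∃ r i f, PointedAlg.hom u r = 0 ∧
      x = freeMul F R c r (freeIncl F R c i f)} → freeMap F u c z = 0 := by
      intro z hz
      induction hz using Submodule.span_induction with
      | mem x hx =>
        obtain ⟨r, i, f, hr, rfl⟩ := hx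
        rw [freeMap_freeMul, hr, freeMul_zero]
      | zero => simp
      | add x y _ _ h1 h2 => rw [map_add, h1, h2, add_zero]
      | smul t x _ h => rw [map_smul, h, smul_zero]
    exact add _ _ (h1 (key _ hx)) (h2 (key _ hy))
  | smul t x hx h1 =>
    clear h1 hn
    -- The motive is not assumed stable under scalars; the scalar is absorbed into the kernel
    -- element r.
    induction hx using Submodule.span_induction generalizing t with
    | mem x hx =>
      obtain ⟨r, i, f, hr, rfl⟩ := hx
      rw [← freeMul_smul]
      exact h _ i f (by rw [map_smul, hr, smul_zero])
    | zero => simpa using zero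
    | add x y _ _ h1 h2 => rw [smul_add]; exact add _ _ (h1 t) (h2 t)
    | smul s x _ h1 => rw [smul_smul]; exact h1 _

/-! ### Reduction to the `F_i` -/

theorem freeEval_freeMul_freeIncl (i j : Fin p) (μ : R →ₗ[k] k) (r : R) (f : (F j).obj c) :
    freeEval F R c i μ (freeMul F R c r (freeIncl F R c j f)) =
      if h : j = i then μ (R.e i * r) • (h ▸ f) else 0 := by
  split_ifs with h
  · subst h
    simp [freeEval, freeMul, freeIncl_apply]
  · simp [freeEval, freeMul, freeIncl_apply, Ne.symm h]

theorem freeEval_freeMul_freeIncl_self (i : Fin p) (μ : R →ₗ[k] k) (r : R) (f : (F i).obj c) :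
    freeEval F R c i μ (freeMul F R c r (freeIncl F R c i f)) = μ (R.e i * r) • f := by
  rw [freeEval_freeMul_freeIncl, dif_pos rfl]

theorem freeEval_freeMul_freeIncl_ne {i j : Fin p} (h : j ≠ i) (μ : R →ₗ[k] k) (r : R)
    (f : (F j).obj c) : freeEval F R c i μ (freeMul F R c r (freeIncl F R c j f)) = 0 := by
  rw [freeEval_freeMul_freeIncl, dif_neg h]

theorem freeEval_add (i : Fin p) (μ ν : R →ₗ[k] k) (n : FreeMod F R c) :
    freeEval F R c i (μ + ν) n = freeEval F R c i μ n + freeEval F R c i ν n := by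
  simp [freeEval, LinearMap.add_comp, LinearMap.lTensor_add]

theorem freeEval_smul (i : Fin p) (t : k) (μ : R →ₗ[k] k) (n : FreeMod F R c) :
    freeEval F R c i (t • μ) n = t • freeEval F R c i μ n := by
  simp [freeEval, LinearMap.smul_comp, LinearMap.lTensor_smul]

theorem freeEval_freeMap (u : R ⟶ S) (i : Fin p) (μ : S →ₗ[k] k) (n : FreeMod F R c) :
    freeEval F S c i μ (freeMap F u c n) =
      freeEval F R c i (μ ∘ₗ (PointedAlg.hom u).toLinearMap) n := by
  induction n using free_ind with
  | zero => simp
  | h j f a =>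
    rw [freeMap_freeMul, freeMap_freeIncl]
    rcases eq_or_ne j i with rfl | hj
    · rw [freeEval_freeMul_freeIncl_self, freeEval_freeMul_freeIncl_self]
      simp [R.hom_e]
    · rw [freeEval_freeMul_freeIncl_ne hj, freeEval_freeMul_freeIncl_ne hj]
  | add a b ha hb => simp only [map_add, ha, hb]

variable (F R c) in
/-- The reduction `⨁ F_i(c) ⊗ e_i R → F_i(c)`. -/
def red (i : Fin p) : FreeMod F R c →ₗ[k] (F i).obj c :=
  freeEval F R c i (LinearMap.proj i ∘ₗ R.aug.toLinearMap)

theorem aug_e (i j : Fin p) : R.aug (R.e i) j = if j = i then 1 else 0 := by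
  rw [PointedAlg.e, R.aug_incl, Pi.single_apply]

theorem red_freeIncl_self (i : Fin p) (f : (F i).obj c) :
    red F R c i (freeIncl F R c i f) = f := by
  rw [red, ← freeMul_e_freeIncl, freeEval_freeMul_freeIncl_self]
  simp [PointedAlg.e_mul_e, aug_e]

theorem red_freeIncl_ne {i j : Fin p} (h : j ≠ i) (f : (F j).obj c) :
    red F R c i (freeIncl F R c j f) = 0 := by
  rw [red, ← freeMul_e_freeIncl, freeEval_freeMul_freeIncl_ne h]

theorem red_freeMul (i : Fin p) (r : R) (n : FreeMod F R c) :
    red F R c i (freeMul F R c r n) = R.aug r i • red F R c i n := by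
  induction n using free_ind with
  | zero => simp
  | h j f a =>
    rw [← freeMul_mul, red]
    rcases eq_or_ne j i with rfl | hj
    · rw [freeEval_freeMul_freeIncl_self, freeEval_freeMul_freeIncl_self, smul_smul]
      simp
      ring_nf
    · rw [freeEval_freeMul_freeIncl_ne hj, freeEval_freeMul_freeIncl_ne hj, smul_zero]
  | add a b ha hb => simp only [map_add, smul_add, ha, hb]

theorem red_freeMap (u : R ⟶ S) (i : Fin p) (n : FreeMod F R c) :
    red F S c i (freeMap F u c n) = red F R c i n := by
  rw [red, freeEval_freeMap, red]
  congr 1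
  congr 1
  ext r
  simp [PointedAlg.aug_hom]

/-- Elements congruent modulo the radical part. -/
theorem sub_sum_red_mem (n : FreeMod F R c) :
    n - ∑ i, freeIncl F R c i (red F R c i n) ∈ Submodule.span k
      {x | ∃ r ∈ R.rad, ∃ m, x = freeMul F R c r m} := by
  induction n using free_ind with
  | zero => simp
  | h i f a =>
    rw [Finset.sum_eq_single i, red_freeMul, red_freeIncl_self, map_smul,
      ← freeMul_e_freeIncl F i f, ← freeMul_smul, ← freeMul_mul]
    · refine Submodule.subset_span ⟨a - R.aug a i • R.e i, ?_, freeIncl F R c i f, ?_⟩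
      · rw [PointedAlg.mem_rad, map_sub, map_smul]
        conv_lhs => rw [← R.e_mul_row i a, map_mul]
        funext j
        by_cases hj : j = i <;> simp [aug_e, hj]
      · rw [PointedAlg.e_mul_row, sub_eq_add_neg, sub_eq_add_neg, freeMul_add,
          ← neg_one_smul k (R.aug a i • R.e i), freeMul_smul F (-1), neg_one_smul]
    · intro j _ hj
      rw [red_freeMul, red_freeIncl_ne hj.symm, smul_zero, map_zero]
    · simp
  | add a b ha hb =>
    convert Submodule.add_mem _ ha hb using 1
    simp only [map_add, Finset.sum_add_distrib]
    abel

theorem mem_of_red_eq_zero (n : FreeMod F R c) (hn : ∀ i, red F R c i n = 0) :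
    n ∈ Submodule.span k {x | ∃ r ∈ R.rad, ∃ m, x = freeMul F R c r m} := by
  simpa [hn] using sub_sum_red_mem n

end FreeModules

/-- Small surjections of pointed algebras. -/
structure IsSmall {k : Type u} [Field k] {p : ℕ} {R S : PointedAlg k p} (u : R ⟶ S) : Prop where
  surjective : Function.Surjective (PointedAlg.hom u)
  rad_mul : ∀ r ∈ R.rad, ∀ x, PointedAlg.hom u x = 0 → r * x = 0
  mul_rad : ∀ r ∈ R.rad, ∀ x, PointedAlg.hom u x = 0 → x * r = 0

section Components

variable {k : Type u} [Field k] {C : Type u} [SmallCategory C] {A : C ⥤ AlgCat.{u} k} {p : ℕ}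
  {F : Fin p → ModPresheaf A} {R S T : PointedAlg k p} {c d e : C}

/-! ### Components of maps between free modules -/

-- Coordinates in a basis of e_i R separate the points of F_i(c) ⊗ e_i R, and every coordinate form
-- on the subspace e_i R extends to R.
open scoped Classical in
theorem freeEval_ext {n m : FreeMod F R c} (h : ∀ i μ, freeEval F R c i μ n = freeEval F R c i μ m) :
    n = m := by
  funext i
  let b := Module.Basis.ofVectorSpace k (R.row i)
  apply (TensorProduct.equivFinsuppOfBasisRight (M := (F i).obj c) b).injective
  refine Finsupp.ext fun α => ?_
  obtain ⟨μ, hμ⟩ := (b.coord α).exists_extend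
  have := h i μ
  simp only [freeEval, LinearMap.comp_apply, hμ, LinearMap.proj_apply] at this
  have key : ∀ x : (F i).obj c ⊗[k] R.row i,
      TensorProduct.equivFinsuppOfBasisRight (M := (F i).obj c) b x α =
        TensorProduct.rid k _ ((b.coord α).lTensor _ x) := by
    intro x
    induction x using TensorProduct.induction_on with
    | zero => simp
    | tmul f a => simp
    | add x y hx hy => simp only [map_add, Finsupp.add_apply, hx, hy]
  rw [key, key]
  exact this

/-- An identity between operators can thus be checked on k-linear maps F_j(c) → F_i(d), one for each
linear form on R. Elements of Hom_k(F_j, F_i) ⊗ K_ij are handled in this way throughout. -/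
theorem freeComp_ext {f g : FreeMod F R c →ₗ[k] FreeMod F R d} (hf : IsRLin f) (hg : IsRLin g)
    (h : ∀ i j μ, freeComp i j μ f = freeComp i j μ g) : f = g :=
  hf.ext hg fun j x => freeEval_ext fun i μ => LinearMap.congr_fun (h i j μ) x

theorem freeComp_add (i j : Fin p) (μ : R →ₗ[k] k) (f g : FreeMod F R c →ₗ[k] FreeMod F R d) :
    freeComp i j μ (f + g) = freeComp i j μ f + freeComp i j μ g := by
  ext; simp [freeComp]

theorem freeComp_sub (i j : Fin p) (μ : R →ₗ[k] k) (f g : FreeMod F R c →ₗ[k] FreeMod F R d) :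
    freeComp i j μ (f - g) = freeComp i j μ f - freeComp i j μ g := by
  ext; simp [freeComp]

theorem freeComp_smul (i j : Fin p) (μ : R →ₗ[k] k) (t : k)
    (f : FreeMod F R c →ₗ[k] FreeMod F R d) :
    freeComp i j μ (t • f) = t • freeComp i j μ f := by
  ext; simp [freeComp]

theorem freeComp_form_add (i j : Fin p) (μ ν : R →ₗ[k] k)
    (f : FreeMod F R c →ₗ[k] FreeMod F R d) :
    freeComp i j (μ + ν) f = freeComp i j μ f + freeComp i j ν f :=
  LinearMap.ext fun _ => freeEval_add _ _ _ _

theorem freeComp_form_smul (i j : Fin p) (t : k) (μ : R →ₗ[k] k)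
    (f : FreeMod F R c →ₗ[k] FreeMod F R d) :
    freeComp i j (t • μ) f = t • freeComp i j μ f :=
  LinearMap.ext fun _ => freeEval_smul _ _ _ _

/-- `freeComp` as a linear map in the linear form. -/
def freeCompL (i j : Fin p) (f : FreeMod F R c →ₗ[k] FreeMod F R d) :
    (R →ₗ[k] k) →ₗ[k] ((F j).obj c →ₗ[k] (F i).obj d) where
  toFun μ := freeComp i j μ f
  map_add' μ ν := freeComp_form_add i j μ ν f
  map_smul' t μ := freeComp_form_smul i j t μ f

/-- Vectors killed by u have coefficients in K, and KI = 0. -/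
theorem freeMul_eq_zero_of_mem_rad {u : R ⟶ S} (hu : IsSmall u) {r : R} (hr : r ∈ R.rad)
    {n : FreeMod F R c} (hn : freeMap F u c n = 0) : freeMul F R c r n = 0 := by
  refine freeMap_ker_ind (motive := fun n => freeMul F R c r n = 0) u n hn (map_zero _)
    (fun s i f hs => ?_) fun a b ha hb => ?_
  · rw [← freeMul_mul, hu.mul_rad r hr s hs, freeMul_zero]
  · rw [map_add, ha, hb, add_zero]

/-- Vectors with zero reduction have coefficients in I, and IK = 0. -/
theorem freeMul_eq_zero_of_mem_ker {u : R ⟶ S} (hu : IsSmall u) {x : R}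
    (hx : PointedAlg.hom u x = 0) {n : FreeMod F R c} (hn : ∀ i, red F R c i n = 0) :
    freeMul F R c x n = 0 := by
  have := mem_of_red_eq_zero n hn
  clear hn
  induction this using Submodule.span_induction with
  | mem m hm =>
    obtain ⟨r, hr, m, rfl⟩ := hm
    rw [← freeMul_mul, hu.rad_mul r hr x hx, freeMul_zero]
  | zero => simp
  | add a b _ _ ha hb => rw [map_add, ha, hb, add_zero]
  | smul t a _ ha => rw [map_smul, ha, smul_zero]

/-- By linearity a K-valued map sends multiples by the radical to multiples with coefficients in KI
= 0. It therefore factors through the reduction. -/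
theorem eq_zero_of_red_eq_zero {u : R ⟶ S} (hu : IsSmall u)
    {o : FreeMod F R c →ₗ[k] FreeMod F R d} (ho : IsRLin o) (ho' : ∀ n, freeMap F u d (o n) = 0)
    {n : FreeMod F R c} (hn : ∀ i, red F R c i n = 0) : o n = 0 := by
  have := mem_of_red_eq_zero n hn
  clear hn
  induction this using Submodule.span_induction with
  | mem m hm =>
    obtain ⟨r, hr, m, rfl⟩ := hm
    rw [ho, freeMul_eq_zero_of_mem_rad hu hr (ho' m)]
  | zero => simp
  | add a b _ _ ha hb => rw [map_add, ha, hb, add_zero]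
  | smul t a _ ha => rw [map_smul, ha, smul_zero]

/-- `f` reduces to the family `t` modulo the radical. -/
def ReducesTo (f : FreeMod F R c →ₗ[k] FreeMod F R d)
    (t : ∀ i, (F i).obj c →ₗ[k] (F i).obj d) : Prop :=
  ∀ i n, red F R d i (f n) = t i (red F R c i n)

theorem ReducesTo.red_sub {f : FreeMod F R c →ₗ[k] FreeMod F R d}
    {t : ∀ i, (F i).obj c →ₗ[k] (F i).obj d} (h : ReducesTo f t) (i j : Fin p) (x : (F j).obj c) :
    red F R d i (f (freeIncl F R c j x) - freeIncl F R d j (t j x)) = 0 := by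
  rw [map_sub, h]
  rcases eq_or_ne j i with rfl | hj
  · rw [red_freeIncl_self, red_freeIncl_self, sub_self]
  · rw [red_freeIncl_ne hj, red_freeIncl_ne hj, map_zero, sub_self]

/-- The vectors f(x ⊗ e_j) and t_j(x) ⊗ e_j have the same reduction, so by IK = 0 they agree after
multiplication by an element of K. On vectors with coefficients in K only the reduction of f is
visible. -/
theorem freeEval_reducesTo {u : R ⟶ S} (hu : IsSmall u) {f : FreeMod F R c →ₗ[k] FreeMod F R d}
    {t : ∀ i, (F i).obj c →ₗ[k] (F i).obj d} (hf : IsRLin f) (h : ReducesTo f t) (i : Fin p)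
    (μ : R →ₗ[k] k) {n : FreeMod F R c} (hn : freeMap F u c n = 0) :
    freeEval F R d i μ (f n) = t i (freeEval F R c i μ n) := by
  refine freeMap_ker_ind (motive := fun n => freeEval F R d i μ (f n) =
    t i (freeEval F R c i μ n)) u n hn (by simp) (fun s j x hs => ?_) fun a b ha hb => ?_
  · have h1 : freeMul F R d s (f (freeIncl F R c j x)) =
        freeMul F R d s (freeIncl F R d j (t j x)) := by
      rw [← sub_eq_zero, ← map_sub]
      exact freeMul_eq_zero_of_mem_ker hu hs fun i => h.red_sub i j x
    rw [hf, h1]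
    rcases eq_or_ne j i with rfl | hj
    · rw [freeEval_freeMul_freeIncl_self, freeEval_freeMul_freeIncl_self, map_smul]
    · rw [freeEval_freeMul_freeIncl_ne hj, freeEval_freeMul_freeIncl_ne hj, map_zero]
  · simp only [map_add, ha, hb]

/-- This and `freeComp_comp_right` turn composition with lifted operators into the actions on the
coefficients Hom_k(F_j, F_i). They are the reason why defects of lifts live in the global Hochschild
complex of the F_i. -/
theorem freeComp_comp_left {u : R ⟶ S} (hu : IsSmall u) {f : FreeMod F R d →ₗ[k] FreeMod F R e}
    {t : ∀ i, (F i).obj d →ₗ[k] (F i).obj e} (hf : IsRLin f) (h : ReducesTo f t)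
    {o : FreeMod F R c →ₗ[k] FreeMod F R d} (ho' : ∀ n, freeMap F u d (o n) = 0) (i j : Fin p)
    (μ : R →ₗ[k] k) : freeComp i j μ (f ∘ₗ o) = t i ∘ₗ freeComp i j μ o :=
  LinearMap.ext fun _ => freeEval_reducesTo hu hf h i μ (ho' _)

theorem freeComp_comp_right {u : R ⟶ S} (hu : IsSmall u) {f : FreeMod F R c →ₗ[k] FreeMod F R d}
    {t : ∀ i, (F i).obj c →ₗ[k] (F i).obj d} (h : ReducesTo f t)
    {o : FreeMod F R d →ₗ[k] FreeMod F R e} (ho : IsRLin o) (ho' : ∀ n, freeMap F u e (o n) = 0)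
    (i j : Fin p) (μ : R →ₗ[k] k) : freeComp i j μ (o ∘ₗ f) = freeComp i j μ o ∘ₗ t j := by
  ext x
  have := eq_zero_of_red_eq_zero hu ho ho' fun i => h.red_sub i j x
  rw [map_sub, sub_eq_zero] at this
  exact congrArg (freeEval F R e i μ) this

theorem freeComp_freeMap (u : R ⟶ S) {f : FreeMod F R c →ₗ[k] FreeMod F R d}
    {g : FreeMod F S c →ₗ[k] FreeMod F S d} (h : ∀ n, freeMap F u d (f n) = g (freeMap F u c n))
    (i j : Fin p) (μ : S →ₗ[k] k) :
    freeComp i j μ g = freeComp i j (μ ∘ₗ (PointedAlg.hom u).toLinearMap) f := by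
  ext x
  change freeEval F S d i μ (g (freeIncl F S c j x)) = freeEval F R d i _ (f (freeIncl F R c j x))
  rw [← freeEval_freeMap, h, freeMap_freeIncl]

/-- The subspace `e_i K e_j` of the kernel `K` of `u`. -/
def kerSpace (u : R ⟶ S) (i j : Fin p) : Submodule k R where
  carrier := {x | PointedAlg.hom u x = 0 ∧ R.e i * x = x ∧ x * R.e j = x}
  zero_mem' := by simp
  add_mem' {a b} ha hb := by
    refine ⟨?_, ?_, ?_⟩
    · rw [map_add, ha.1, hb.1, add_zero]
    · rw [mul_add, ha.2.1, hb.2.1]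
    · rw [add_mul, ha.2.2, hb.2.2]
  smul_mem' t a ha := by
    refine ⟨?_, ?_, ?_⟩
    · rw [map_smul, ha.1, smul_zero]
    · rw [mul_smul_comm, ha.2.1]
    · rw [smul_mul_assoc, ha.2.2]

/-- The (i, j) component of a K-valued linear map has coefficients in e_i K e_j: the factor e_i
comes from the row, and e_j from linearity, because x ⊗ e_j is fixed by e_j. Hence only the
restriction of μ to `kerSpace` matters. -/
theorem freeComp_eq_zero (u : R ⟶ S) {o : FreeMod F R c →ₗ[k] FreeMod F R d} (ho : IsRLin o)
    (ho' : ∀ n, freeMap F u d (o n) = 0) (i j : Fin p) (μ : R →ₗ[k] k)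
    (hμ : ∀ x ∈ kerSpace u i j, μ x = 0) : freeComp i j μ o = 0 := by
  ext x
  change freeEval F R d i μ (o (freeIncl F R c j x)) = 0
  rw [← freeMul_e_freeIncl, ho]
  generalize h : o (freeIncl F R c j x) = n
  have hn : freeMap F u d n = 0 := h ▸ ho' _
  clear h
  refine freeMap_ker_ind (motive := fun n => freeEval F R d i μ (freeMul F R d (R.e j) n) = 0)
    u n hn (by simp) (fun s l y hs => ?_) fun a b ha hb => ?_
  · rw [← freeMul_mul]
    rcases eq_or_ne l i with rfl | hl
    · rw [freeEval_freeMul_freeIncl_self, hμ, zero_smul]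
      refine ⟨?_, ?_, ?_⟩
      · rw [map_mul, map_mul, hs, zero_mul, mul_zero]
      · rw [← mul_assoc, PointedAlg.e_mul_e]
      · rw [mul_assoc, mul_assoc, PointedAlg.e_mul_e]
    · rw [freeEval_freeMul_freeIncl_ne hl]
  · simp only [map_add, ha, hb, add_zero]

/-! ### Maps with prescribed components -/

/-- The map `F_j(c) ⊗ e_j R → F_i(d) ⊗ e_i R` given by `y` and left multiplication by `x`. -/
def elemMap (i j : Fin p) (x : R) (y : (F j).obj c →ₗ[k] (F i).obj d) :
    FreeMod F R c →ₗ[k] FreeMod F R d :=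
  freeLift (freeAct F R d) (Pi.single j (freeMul F R d x ∘ₗ freeIncl F R d i ∘ₗ y))

theorem freeComp_elemMap {i j : Fin p} {x : R} (h1 : R.e i * x = x) (h2 : x * R.e j = x)
    (y : (F j).obj c →ₗ[k] (F i).obj d) (μ : R →ₗ[k] k) :
    freeComp i j μ (elemMap i j x y) = μ x • y := by
  ext f
  change freeEval F R d i μ (freeLift _ _ (freeIncl F R c j f)) = _
  rw [freeLift_freeIncl, Pi.single_eq_same, freeAct_apply, LinearMap.comp_apply, ← freeMul_mul,
    unop_op, h2, LinearMap.comp_apply, freeEval_freeMul_freeIncl_self, h1]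
  rfl

theorem freeComp_elemMap_of_ne {i j i' j' : Fin p} (h : i ≠ i' ∨ j ≠ j') (x : R)
    (y : (F j).obj c →ₗ[k] (F i).obj d) (μ : R →ₗ[k] k) :
    freeComp i' j' μ (elemMap i j x y) = 0 := by
  ext f
  change freeEval F R d i' μ (freeLift _ _ (freeIncl F R c j' f)) = _
  rw [freeLift_freeIncl]
  rcases eq_or_ne j' j with rfl | hj
  · rw [Pi.single_eq_same, freeAct_apply, LinearMap.comp_apply, ← freeMul_mul, LinearMap.comp_apply,
      freeEval_freeMul_freeIncl_ne (by simpa using h)]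
    rfl
  · rw [Pi.single_eq_of_ne hj]
    simp

theorem freeMap_elemMap (u : R ⟶ S) {i j : Fin p} {x : R} (hx : PointedAlg.hom u x = 0)
    (y : (F j).obj c →ₗ[k] (F i).obj d) (n : FreeMod F R c) :
    freeMap F u d (elemMap i j x y n) = 0 := by
  induction n using free_ind with
  | zero => simp
  | h l f a =>
    rw [elemMap, freeLift_freeMul, freeLift_freeIncl]
    rcases eq_or_ne l j with rfl | hl
    · rw [Pi.single_eq_same]
      simp [freeMap_freeMul, hx, freeMul_zero]
    · rw [Pi.single_eq_of_ne hl]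
      simp
  | add a b ha hb => rw [map_add, map_add, ha, hb, add_zero]

variable {ι : Fin p → Fin p → Type*} [∀ i j, Fintype (ι i j)]

/-- The map with components `Y` along the elements `x` of `R`. -/
def matMap (x : ∀ i j, ι i j → R) (Y : ∀ i j, ι i j → ((F j).obj c →ₗ[k] (F i).obj d)) :
    FreeMod F R c →ₗ[k] FreeMod F R d :=
  ∑ i, ∑ j, ∑ α, elemMap i j (x i j α) (Y i j α)

theorem isRLin_matMap (x : ∀ i j, ι i j → R)
    (Y : ∀ i j, ι i j → ((F j).obj c →ₗ[k] (F i).obj d)) : IsRLin (matMap x Y) :=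
  .sum fun _ => .sum fun _ => .sum fun _ => isRLin_freeLift _

theorem freeMap_matMap (u : R ⟶ S) {x : ∀ i j, ι i j → R}
    (hx : ∀ i j α, PointedAlg.hom u (x i j α) = 0)
    (Y : ∀ i j, ι i j → ((F j).obj c →ₗ[k] (F i).obj d)) (n : FreeMod F R c) :
    freeMap F u d (matMap x Y n) = 0 := by
  simp only [matMap, LinearMap.sum_apply, map_sum, freeMap_elemMap u (hx _ _ _),
    Finset.sum_const_zero]

theorem freeComp_sum {κ : Type*} (s : Finset κ) (i j : Fin p) (μ : R →ₗ[k] k)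
    (f : κ → (FreeMod F R c →ₗ[k] FreeMod F R d)) :
    freeComp i j μ (∑ a ∈ s, f a) = ∑ a ∈ s, freeComp i j μ (f a) := by
  ext; simp [freeComp]

theorem freeComp_matMap {x : ∀ i j, ι i j → R} (h1 : ∀ i j α, R.e i * x i j α = x i j α)
    (h2 : ∀ i j α, x i j α * R.e j = x i j α)
    (Y : ∀ i j, ι i j → ((F j).obj c →ₗ[k] (F i).obj d)) (i j : Fin p) (μ : R →ₗ[k] k) :
    freeComp i j μ (matMap x Y) = ∑ α, μ (x i j α) • Y i j α := by
  simp only [matMap, freeComp_sum]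
  rw [Finset.sum_eq_single i, Finset.sum_eq_single j]
  · simp only [freeComp_elemMap (h1 _ _ _) (h2 _ _ _)]
  · intro j' _ hj'
    simp only [freeComp_elemMap_of_ne (Or.inr hj'), Finset.sum_const_zero]
  · simp
  · intro i' _ hi'
    simp only [freeComp_elemMap_of_ne (Or.inl hi'), Finset.sum_const_zero]
  · simp

/-- A basis of `e_i K e_j`. -/
def kerBasis [Module.Finite k R] (u : R ⟶ S) (i j : Fin p) :
    Module.Basis (Fin (Module.finrank k (kerSpace u i j))) k (kerSpace u i j) :=
  Module.finBasis k _

/-- Linear forms on `R` that extend the dual basis. -/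
def kerDual [Module.Finite k R] (u : R ⟶ S) (i j : Fin p)
    (α : Fin (Module.finrank k (kerSpace u i j))) : R →ₗ[k] k :=
  ((kerBasis u i j).coord α).exists_extend.choose

theorem kerDual_apply [Module.Finite k R] (u : R ⟶ S) (i j : Fin p)
    (α : Fin (Module.finrank k (kerSpace u i j))) (x : kerSpace u i j) :
    kerDual u i j α x = (kerBasis u i j).repr x α :=
  LinearMap.congr_fun ((kerBasis u i j).coord α).exists_extend.choose_spec x

theorem form_sub_mem [Module.Finite k R] (u : R ⟶ S) (i j : Fin p) (μ : R →ₗ[k] k)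
    (x : R) (hx : x ∈ kerSpace u i j) :
    (μ - ∑ α, μ (kerBasis u i j α : R) • kerDual u i j α) x = 0 := by
  have h := congrArg (fun y : kerSpace u i j => μ y) ((kerBasis u i j).sum_repr ⟨x, hx⟩)
  simp only [Submodule.coe_sum, Submodule.coe_smul, map_sum, map_smul] at h
  simp only [LinearMap.sub_apply, LinearMap.sum_apply, LinearMap.smul_apply]
  rw [sub_eq_zero, ← h]
  refine Finset.sum_congr rfl fun α _ => ?_
  rw [kerDual_apply u i j α ⟨x, hx⟩, smul_eq_mul, smul_eq_mul, mul_comm]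

/-- This is the expansion of an element of Hom_k(F_j, F_i) ⊗ e_i K e_j in a basis of e_i K e_j:
finitely many forms recover all components. -/
theorem freeComp_eq_sum [Module.Finite k R] (u : R ⟶ S) {o : FreeMod F R c →ₗ[k] FreeMod F R d}
    (ho : IsRLin o) (ho' : ∀ n, freeMap F u d (o n) = 0) (i j : Fin p) (μ : R →ₗ[k] k) :
    freeComp i j μ o =
      ∑ α, μ (kerBasis u i j α : R) • freeComp i j (kerDual u i j α) o := by
  have := freeComp_eq_zero u ho ho' i j _ (form_sub_mem u i j μ)
  change freeCompL i j o _ = 0 at this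
  rw [map_sub, sub_eq_zero, map_sum] at this
  simp only [map_smul] at this
  exact this

end Components

/-! ### Global Hochschild cochains of low degree -/

section Cochains

variable {k : Type u} [Field k] {C : Type u} [SmallCategory C] {A : C ⥤ AlgCat.{u} k}
  {F G : ModPresheaf A}

theorem GHC.ext {n : ℕ} {z z' : GHC F G n}
    (h : ∀ p q (h : p + q = n) x a, ghcComp p q h z x a = ghcComp p q h z' x a) : z = z' := by
  funext ⟨⟨p, q⟩, hs⟩ x
  exact MultilinearMap.ext fun a => h p q hs x a

/-- A bilinear map as a multilinear map. -/
def bilinMulti {B N : Type*} [AddCommGroup B] [Module k B] [AddCommGroup N] [Module k N]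
    (f : B →ₗ[k] B →ₗ[k] N) : MultilinearMap k (fun _ : Fin 2 => B) N where
  toFun a := f (a 0) (a 1)
  map_update_add' a i x y := by fin_cases i <;> simp
  map_update_smul' a i t x := by fin_cases i <;> simp

/-- The cochain of degree `0` with given values. -/
def mkGHC0 (h : ∀ c, F.obj c →ₗ[k] G.obj c) : GHC F G 0
  | ⟨(0, 0), _⟩ => fun x => MultilinearMap.constOfIsEmpty k _ (h (x.obj 0))
  | ⟨(_ + 1, _), h⟩ => absurd h (by simp)
  | ⟨(0, _ + 1), h⟩ => absurd h (by simp)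

/-- The cochain of degree `1` with given values. -/
def mkGHC1 (y : ∀ c, A.obj c →ₗ[k] F.obj c →ₗ[k] G.obj c)
    (w : ∀ {c d : C}, (c ⟶ d) → (F.obj c →ₗ[k] G.obj d)) : GHC F G 1
  | ⟨(0, 1), _⟩ => fun x => MultilinearMap.ofSubsingleton k _ _ 0 (y (x.obj 0))
  | ⟨(1, 0), _⟩ => fun x => MultilinearMap.constOfIsEmpty k _ (w (x.map' 0 1))
  | ⟨(0, 0), h⟩ => absurd h (by simp)
  | ⟨(0, _ + 2), h⟩ => absurd h (by simp)
  | ⟨(1, _ + 1), h⟩ => absurd h (by simp)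
  | ⟨(_ + 2, _), h⟩ => absurd h (by simp; omega)

/-- The cochain of degree `2` with given values. -/
def mkGHC2 (r : ∀ c, A.obj c →ₗ[k] A.obj c →ₗ[k] F.obj c →ₗ[k] G.obj c)
    (s : ∀ {c d : C}, (c ⟶ d) → (A.obj c →ₗ[k] F.obj c →ₗ[k] G.obj d))
    (t : ∀ {c d e : C}, (c ⟶ d) → (d ⟶ e) → (F.obj c →ₗ[k] G.obj e)) : GHC F G 2
  | ⟨(0, 2), _⟩ => fun x => bilinMulti (r (x.obj 0))
  | ⟨(1, 1), _⟩ => fun x => MultilinearMap.ofSubsingleton k _ _ 0 (s (x.map' 0 1))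
  | ⟨(2, 0), _⟩ => fun x => MultilinearMap.constOfIsEmpty k _
      (t (x.map (homOfLE (Fin.zero_le (1 : Fin 3)))) (x.map (homOfLE (by decide : (1 : Fin 3) ≤ 2))))
  | ⟨(0, 0), h⟩ => absurd h (by simp)
  | ⟨(0, 1), h⟩ => absurd h (by simp)
  | ⟨(0, _ + 3), h⟩ => absurd h (by simp)
  | ⟨(1, 0), h⟩ => absurd h (by simp)
  | ⟨(1, _ + 2), h⟩ => absurd h (by simp; omega)
  | ⟨(2, _ + 1), h⟩ => absurd h (by simp)
  | ⟨(_ + 3, _), h⟩ => absurd h (by simp; omega)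

theorem GHC.ext0 {z z' : GHC F G 0}
    (h : ∀ x a, ghcComp 0 0 rfl z x a = ghcComp 0 0 rfl z' x a) : z = z' :=
  GHC.ext fun p q hpq => by
    obtain ⟨rfl, rfl⟩ : p = 0 ∧ q = 0 := by omega
    exact h

theorem GHC.ext1 {z z' : GHC F G 1}
    (h1 : ∀ x a, ghcComp 0 1 rfl z x a = ghcComp 0 1 rfl z' x a)
    (h2 : ∀ x a, ghcComp 1 0 rfl z x a = ghcComp 1 0 rfl z' x a) : z = z' :=
  GHC.ext fun p q hpq => by
    obtain ⟨rfl, rfl⟩ | ⟨rfl, rfl⟩ : (p = 0 ∧ q = 1) ∨ (p = 1 ∧ q = 0) := by omega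
    exacts [h1, h2]

theorem GHC.ext2 {z z' : GHC F G 2}
    (h1 : ∀ x a, ghcComp 0 2 rfl z x a = ghcComp 0 2 rfl z' x a)
    (h2 : ∀ x a, ghcComp 1 1 rfl z x a = ghcComp 1 1 rfl z' x a)
    (h3 : ∀ x a, ghcComp 2 0 rfl z x a = ghcComp 2 0 rfl z' x a) : z = z' :=
  GHC.ext fun p q hpq => by
    obtain ⟨rfl, rfl⟩ | ⟨rfl, rfl⟩ | ⟨rfl, rfl⟩ :
      (p = 0 ∧ q = 2) ∨ (p = 1 ∧ q = 1) ∨ (p = 2 ∧ q = 0) := by omega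
    exacts [h1, h2, h3]

theorem GHC.ext3 {z z' : GHC F G 3}
    (h1 : ∀ x a, ghcComp 0 3 rfl z x a = ghcComp 0 3 rfl z' x a)
    (h2 : ∀ x a, ghcComp 1 2 rfl z x a = ghcComp 1 2 rfl z' x a)
    (h3 : ∀ x a, ghcComp 2 1 rfl z x a = ghcComp 2 1 rfl z' x a)
    (h4 : ∀ x a, ghcComp 3 0 rfl z x a = ghcComp 3 0 rfl z' x a) : z = z' :=
  GHC.ext fun p q hpq => by
    obtain ⟨rfl, rfl⟩ | ⟨rfl, rfl⟩ | ⟨rfl, rfl⟩ | ⟨rfl, rfl⟩ :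
      (p = 0 ∧ q = 3) ∨ (p = 1 ∧ q = 2) ∨ (p = 2 ∧ q = 1) ∨ (p = 3 ∧ q = 0) := by omega
    exacts [h1, h2, h3, h4]

theorem exists_mkGHC0 (z : GHC F G 0) : ∃ h, z = mkGHC0 h := by
  refine ⟨fun c => ghcComp 0 0 rfl z (ComposableArrows.mk₀ c) Fin.elim0, GHC.ext0 fun x a => ?_⟩
  obtain ⟨c, rfl⟩ := ComposableArrows.mk₀_surjective x
  rw [Subsingleton.elim a Fin.elim0]
  rfl

/-- Strings of length 0 and 1 are objects and arrows, so an abstract 1-cochain, such as a primitive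
of an obstruction, unpacks into two families that can be added to operators. -/
theorem exists_mkGHC1 (z : GHC F G 1) :
    ∃ (y : ∀ c, A.obj c →ₗ[k] F.obj c →ₗ[k] G.obj c)
      (w : ∀ {c d : C}, (c ⟶ d) → (F.obj c →ₗ[k] G.obj d)), z = mkGHC1 y w := by
  refine ⟨fun c => (MultilinearMap.ofSubsingleton k _ _ 0).symm
    (ghcComp 0 1 rfl z (ComposableArrows.mk₀ c)),
    fun φ => ghcComp 1 0 rfl z (ComposableArrows.mk₁ φ) Fin.elim0,
    GHC.ext1 (fun x a => ?_) fun x a => ?_⟩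
  · obtain ⟨c, rfl⟩ := ComposableArrows.mk₀_surjective x
    change _ = ghcComp 0 1 rfl z _ fun _ => a 0
    congr 1
    funext j
    rw [Subsingleton.elim j 0]
  · obtain ⟨c, d, φ, rfl⟩ := ComposableArrows.mk₁_surjective x
    rw [Subsingleton.elim a Fin.elim0]
    rfl

theorem hochschildD_zero {B M P : Type u} [Ring B] [Algebra k B] [AddCommGroup M] [Module k M]
    [AddCommGroup P] [Module k P] (r : B →ₐ[k] Module.End k M) (l : B →ₐ[k] Module.End k P)
    (f : MultilinearMap k (fun _ : Fin 0 => B) (M →ₗ[k] P)) (a : Fin 1 → B) :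
    hochschildD r l 0 f a = l (a 0) ∘ₗ f Fin.elim0 - f Fin.elim0 ∘ₗ r (a 0) := by
  rw [hochschildD_apply, Subsingleton.elim (Fin.tail a) Fin.elim0,
    Subsingleton.elim (Fin.init a) Fin.elim0]
  simp [sub_eq_add_neg]

theorem hochschildD_one {B M P : Type u} [Ring B] [Algebra k B] [AddCommGroup M] [Module k M]
    [AddCommGroup P] [Module k P] (r : B →ₐ[k] Module.End k M) (l : B →ₐ[k] Module.End k P)
    (f : B →ₗ[k] M →ₗ[k] P) (a : Fin 2 → B) :
    hochschildD r l 1 (MultilinearMap.ofSubsingleton k _ _ 0 f) a =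
      l (a 0) ∘ₗ f (a 1) - f (a 0 * a 1) + f (a 0) ∘ₗ r (a 1) := by
  rw [hochschildD_apply]
  simp [sub_eq_add_neg, Fin.tail, Fin.init, Fin.contractNth]

theorem hochschildD_two {B M P : Type u} [Ring B] [Algebra k B] [AddCommGroup M] [Module k M]
    [AddCommGroup P] [Module k P] (r : B →ₐ[k] Module.End k M) (l : B →ₐ[k] Module.End k P)
    (f : B →ₗ[k] B →ₗ[k] M →ₗ[k] P) (a : Fin 3 → B) :
    hochschildD r l 2 (bilinMulti f) a =
      l (a 0) ∘ₗ f (a 1) (a 2) - f (a 0 * a 1) (a 2) + f (a 0) (a 1 * a 2) -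
        f (a 0) (a 1) ∘ₗ r (a 2) := by
  rw [hochschildD_apply]
  have h1 : (1 : Fin 3).castSucc = 1 := rfl
  change l (a 0) ∘ₗ f (a 1) (a 2) + ∑ i : Fin 2, (-1 : k) ^ ((i : ℕ) + 1) • bilinMulti f _ +
    (-1 : k) ^ 3 • (f (a 0) (a 1) ∘ₗ r (a 2)) = _
  rw [Fin.sum_univ_two]
  change l (a 0) ∘ₗ f (a 1) (a 2) + ((-1 : k) ^ 1 • f (a 0 * a 1) (a 2) +
    (-1 : k) ^ 2 • f (a 0) (a 1 * a 2)) + (-1 : k) ^ 3 • (f (a 0) (a 1) ∘ₗ r (a 2)) = _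
  simp only [pow_succ, pow_zero]
  simp
  abel

theorem ghcComp_ghcD_ver {n q : ℕ} (h : 0 + (q + 1) = n + 1) (z : GHC F G n) :
    ghcComp 0 (q + 1) h (ghcD F G n z) = dVer 0 q (ghcComp 0 q (by omega) z) := by
  change 0 + (-1 : k) ^ 0 • dVer 0 q _ = _
  rw [zero_add, pow_zero, one_smul]

theorem ghcComp_ghcD_hor {n p : ℕ} (h : (p + 1) + 0 = n + 1) (z : GHC F G n) :
    ghcComp (p + 1) 0 h (ghcD F G n z) = dHor p 0 (ghcComp p 0 (by omega) z) := by
  change dHor p 0 _ + 0 = _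
  rw [add_zero]

theorem ghcComp_ghcD {n p q : ℕ} (h : (p + 1) + (q + 1) = n + 1) (z : GHC F G n) :
    ghcComp (p + 1) (q + 1) h (ghcD F G n z) = dHor p (q + 1) (ghcComp p (q + 1) (by omega) z) +
      (-1 : k) ^ (p + 1) • dVer (p + 1) q (ghcComp (p + 1) q (by omega) z) := rfl

theorem map_eq_id {n : ℕ} (x : ComposableArrows C n) {i : Fin (n + 1)} (f : i ⟶ i) :
    x.map f = 𝟙 _ := by
  rw [Subsingleton.elim f (𝟙 i), x.map_id]

theorem dHor_apply {p q : ℕ} (g : DCochain F G p q) (x : ComposableArrows C (p + 1))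
    (a : Fin q → A.obj (x.obj 0)) (m : F.obj (x.obj 0)) : dHor p q g x a m =
      ∑ i : Fin (p + 2), (-1 : k) ^ (i : ℕ) •
        G.map (x.map (homOfLE (Fin.le_last (i.succAbove (Fin.last p)))))
        (g (face x i) (fun j => (A.map (x.map (homOfLE (Fin.zero_le (i.succAbove 0))))).hom (a j))
          (F.map (x.map (homOfLE (Fin.zero_le (i.succAbove 0)))) m)) := by
  simp only [dHor, LinearMap.coe_mk, AddHom.coe_mk, sum_apply, smul_apply,
    LinearMap.sum_apply, LinearMap.smul_apply]
  rfl

theorem A_map_id_apply {c : C} (f : c ⟶ c) (hf : f = 𝟙 c) (a : A.obj c) : (A.map f).hom a = a := by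
  rw [hf, A.map_id]
  rfl

theorem A_map_comp_apply {c d e : C} (f : c ⟶ d) (g : d ⟶ e) (a : A.obj c) :
    (A.map (f ≫ g)).hom a = (A.map g).hom ((A.map f).hom a) := by
  rw [A.map_comp]
  rfl

theorem ghcD_mkGHC0 (h : ∀ c, F.obj c →ₗ[k] G.obj c) :
    ghcD F G 0 (mkGHC0 h) = mkGHC1
      (fun c => LinearMap.mk₂ k (fun a x => G.act c a (h c x) - h c (F.act c a x))
        (fun a b x => by simp; abel) (fun t a x => by simp [smul_sub])
        (fun a x y => by simp; abel) (fun t a x => by simp [smul_sub]))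
      (fun {c d} φ => h d ∘ₗ F.map φ - G.map φ ∘ₗ h c) := by
  refine GHC.ext1 (fun x a => ?_) fun x a => ?_
  · rw [ghcComp_ghcD_ver]
    refine (hochschildD_zero _ _ _ _).trans (LinearMap.ext fun m => ?_)
    change G.act _ ((A.map (x.map _)).hom (a 0)) _ - _ = _
    rw [A_map_id_apply _ (map_eq_id x _)]
    rfl
  · rw [ghcComp_ghcD_hor]
    refine LinearMap.ext fun m => ?_
    rw [dHor_apply, Fin.sum_univ_two]
    -- Omitting c_0 leaves the end of the string unchanged and omitting c_1 leaves its beginning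
    -- unchanged, so in each term one of the two transition arrows is an identity.
    change (-1 : k) ^ 0 • (G.map (x.map (𝟙 (1 : Fin 2))) (h (x.obj 1) (F.map (x.map (homOfLE (Fin.zero_le (1 : Fin 2)))) m))) +
      (-1 : k) ^ 1 • (G.map (x.map (homOfLE (Fin.zero_le (1 : Fin 2)))) (h (x.obj 0) (F.map (x.map (𝟙 (0 : Fin 2))) m))) = _
    rw [x.map_id, x.map_id, F.map_id, G.map_id]
    simp only [pow_zero, pow_one, one_smul, neg_smul, ← sub_eq_add_neg]
    rfl

/-- The first component of the differential of a cochain of degree `1`. -/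
def d02 (y : ∀ c, A.obj c →ₗ[k] F.obj c →ₗ[k] G.obj c) (c : C) :
    A.obj c →ₗ[k] A.obj c →ₗ[k] F.obj c →ₗ[k] G.obj c :=
  LinearMap.mk₂ k (fun a b => G.act c a ∘ₗ y c b - y c (a * b) + y c a ∘ₗ F.act c b)
    (fun a b e => by ext; simp [add_mul]; abel) (fun t a b => by ext; simp [smul_sub])
    (fun a b e => by ext; simp [mul_add]; abel) (fun t a b => by ext; simp [smul_sub])

/-- The second component of the differential of a cochain of degree `1`. -/
def d11 (y : ∀ c, A.obj c →ₗ[k] F.obj c →ₗ[k] G.obj c)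
    (w : ∀ {c d : C}, (c ⟶ d) → (F.obj c →ₗ[k] G.obj d)) {c d : C} (φ : c ⟶ d) :
    A.obj c →ₗ[k] F.obj c →ₗ[k] G.obj d where
  toFun a := y d ((A.map φ).hom a) ∘ₗ F.map φ - G.map φ ∘ₗ y c a -
    (G.act d ((A.map φ).hom a) ∘ₗ w φ - w φ ∘ₗ F.act c a)
  map_add' a b := by ext; simp; abel
  map_smul' t a := by ext; simp [smul_sub]

/-- The third component of the differential of a cochain of degree `1`. -/
def d20 (w : ∀ {c d : C}, (c ⟶ d) → (F.obj c →ₗ[k] G.obj d)) {c d e : C} (φ : c ⟶ d)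
    (ψ : d ⟶ e) : F.obj c →ₗ[k] G.obj e :=
  w ψ ∘ₗ F.map φ - w (φ ≫ ψ) + G.map ψ ∘ₗ w φ

theorem ghcD_mkGHC1 (y : ∀ c, A.obj c →ₗ[k] F.obj c →ₗ[k] G.obj c)
    (w : ∀ {c d : C}, (c ⟶ d) → (F.obj c →ₗ[k] G.obj d)) :
    ghcD F G 1 (mkGHC1 y w) = mkGHC2 (d02 y) (d11 y w) (d20 w) := by
  refine GHC.ext2 (fun x a => ?_) (fun x a => ?_) fun x a => ?_
  · rw [ghcComp_ghcD_ver]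
    refine (hochschildD_one _ _ _ _).trans (LinearMap.ext fun m => ?_)
    change G.act _ ((A.map (x.map _)).hom (a 0)) _ - _ + _ = _
    rw [A_map_id_apply _ (map_eq_id x _)]
    rfl
  · rw [ghcComp_ghcD]
    refine LinearMap.ext fun m => ?_
    change dHor 0 1 (ghcComp 0 1 rfl (mkGHC1 y w)) x a m + ((-1 : k) ^ 1 •
      hochschildD (F.act (x.obj 0)) ((G.act (x.obj (Fin.last 1))).comp
        (A.map (x.map (homOfLE (Fin.zero_le (Fin.last 1))))).hom) 0
        (ghcComp 1 0 rfl (mkGHC1 y w) x) a) m = _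
    rw [dHor_apply, Fin.sum_univ_two, hochschildD_zero]
    change (-1 : k) ^ 0 • (G.map (x.map (𝟙 (1 : Fin 2))) (y (x.obj 1)
        ((A.map (x.map (homOfLE (Fin.zero_le (1 : Fin 2))))).hom (a 0)) (F.map (x.map (homOfLE (Fin.zero_le (1 : Fin 2)))) m))) +
      (-1 : k) ^ 1 • (G.map (x.map (homOfLE (Fin.zero_le (1 : Fin 2)))) (y (x.obj 0) ((A.map (x.map (𝟙 (0 : Fin 2)))).hom (a 0))
        (F.map (x.map (𝟙 (0 : Fin 2))) m))) + (-1 : k) ^ 1 • (G.act (x.obj 1)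
          ((A.map (x.map (homOfLE (Fin.zero_le (1 : Fin 2))))).hom (a 0)) (w (x.map (homOfLE (Fin.zero_le (1 : Fin 2)))) m) -
          w (x.map (homOfLE (Fin.zero_le (1 : Fin 2)))) (F.act (x.obj 0) (a 0) m)) = _
    rw [A_map_id_apply _ (x.map_id _), x.map_id, x.map_id, F.map_id, G.map_id]
    simp only [pow_zero, pow_one, one_smul, neg_smul, ← sub_eq_add_neg]
    rfl
  · rw [ghcComp_ghcD_hor]
    refine LinearMap.ext fun m => ?_
    rw [dHor_apply, Fin.sum_univ_three]
    change (-1 : k) ^ 0 • (G.map (x.map (𝟙 (2 : Fin 3))) (w (x.map (homOfLE (by decide : (1 : Fin 3) ≤ 2))) (F.map (x.map (homOfLE (Fin.zero_le (1 : Fin 3)))) m))) +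
      (-1 : k) ^ 1 • (G.map (x.map (𝟙 (2 : Fin 3))) (w (x.map (homOfLE (Fin.zero_le (2 : Fin 3))))
        (F.map (x.map (𝟙 (0 : Fin 3))) m))) +
      (-1 : k) ^ 2 • (G.map (x.map (homOfLE (by decide : (1 : Fin 3) ≤ 2))) (w (x.map (homOfLE (Fin.zero_le (1 : Fin 3)))) (F.map (x.map (𝟙 (0 : Fin 3))) m))) = _
    -- Omitting the middle object of a string leaves the composite of its two arrows.
    rw [x.map_id, x.map_id, F.map_id, G.map_id, G.map_id,
      show x.map (homOfLE (Fin.zero_le (2 : Fin 3))) = x.map (homOfLE (Fin.zero_le (1 : Fin 3))) ≫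
        x.map (homOfLE (by decide : (1 : Fin 3) ≤ 2)) from x.map_comp _ _]
    simp only [pow_zero, pow_one, one_smul, neg_smul, ← sub_eq_add_neg, even_two, Even.neg_pow,
      one_pow]
    rfl

/-- The four hypotheses are the cocycle condition in bidegrees (0,3), (1,2), (2,1) and (3,0). The
Hochschild part enters with sign -1 on strings of length 1 and +1 on strings of length 2. -/
theorem ghcD_mkGHC2 (r : ∀ c, A.obj c →ₗ[k] A.obj c →ₗ[k] F.obj c →ₗ[k] G.obj c)
    (s : ∀ {c d : C}, (c ⟶ d) → (A.obj c →ₗ[k] F.obj c →ₗ[k] G.obj d))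
    (t : ∀ {c d e : C}, (c ⟶ d) → (d ⟶ e) → (F.obj c →ₗ[k] G.obj e))
    (h1 : ∀ c a b b' m, G.act c a (r c b b' m) - r c (a * b) b' m + r c a (b * b') m -
      r c a b (F.act c b' m) = 0)
    (h2 : ∀ {c d : C} (φ : c ⟶ d) a b m, r d ((A.map φ).hom a) ((A.map φ).hom b) (F.map φ m) -
      G.map φ (r c a b m) - (G.act d ((A.map φ).hom a) (s φ b m) - s φ (a * b) m +
        s φ a (F.act c b m)) = 0)
    (h3 : ∀ {c d e : C} (φ : c ⟶ d) (ψ : d ⟶ e) a m, s ψ ((A.map φ).hom a) (F.map φ m) -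
      s (φ ≫ ψ) a m + G.map ψ (s φ a m) +
      (G.act e ((A.map ψ).hom ((A.map φ).hom a)) (t φ ψ m) - t φ ψ (F.act c a m)) = 0)
    (h4 : ∀ {c d e e' : C} (φ : c ⟶ d) (ψ : d ⟶ e) (χ : e ⟶ e') m, t ψ χ (F.map φ m) -
      t (φ ≫ ψ) χ m + t φ (ψ ≫ χ) m - G.map χ (t φ ψ m) = 0) :
    ghcD F G 2 (mkGHC2 r s t) = 0 := by
  refine GHC.ext3 (fun x a => ?_) (fun x a => ?_) (fun x a => ?_) fun x a => ?_
  · rw [ghcComp_ghcD_ver]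
    refine (hochschildD_two _ _ _ _).trans (LinearMap.ext fun m => ?_)
    change G.act _ ((A.map (x.map _)).hom (a 0)) _ - _ + _ - _ = _
    rw [A_map_id_apply _ (map_eq_id x _)]
    exact h1 _ _ _ _ _
  · rw [ghcComp_ghcD]
    refine LinearMap.ext fun m => ?_
    change dHor 0 2 (ghcComp 0 2 rfl (mkGHC2 r s t)) x a m + ((-1 : k) ^ 1 •
      hochschildD (F.act (x.obj 0)) ((G.act (x.obj (Fin.last 1))).comp
        (A.map (x.map (homOfLE (Fin.zero_le (Fin.last 1))))).hom) 1
        (MultilinearMap.ofSubsingleton k _ _ 0 (s (x.map (homOfLE (Fin.zero_le (1 : Fin 2)))))) a) m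
          = _
    rw [dHor_apply, Fin.sum_univ_two, hochschildD_one]
    change (-1 : k) ^ 0 • (G.map (x.map (𝟙 (1 : Fin 2))) (r (x.obj 1)
        ((A.map (x.map (homOfLE (Fin.zero_le (1 : Fin 2))))).hom (a 0))
        ((A.map (x.map (homOfLE (Fin.zero_le (1 : Fin 2))))).hom (a 1))
        (F.map (x.map (homOfLE (Fin.zero_le (1 : Fin 2)))) m))) +
      (-1 : k) ^ 1 • (G.map (x.map (homOfLE (Fin.zero_le (1 : Fin 2)))) (r (x.obj 0)
        ((A.map (x.map (𝟙 (0 : Fin 2)))).hom (a 0)) ((A.map (x.map (𝟙 (0 : Fin 2)))).hom (a 1))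
        (F.map (x.map (𝟙 (0 : Fin 2))) m))) +
      (-1 : k) ^ 1 • (G.act (x.obj 1)
          ((A.map (x.map (homOfLE (Fin.zero_le (1 : Fin 2))))).hom (a 0))
          (s (x.map (homOfLE (Fin.zero_le (1 : Fin 2)))) (a 1) m) -
          s (x.map (homOfLE (Fin.zero_le (1 : Fin 2)))) (a 0 * a 1) m +
          s (x.map (homOfLE (Fin.zero_le (1 : Fin 2)))) (a 0) (F.act (x.obj 0) (a 1) m)) = _
    rw [A_map_id_apply _ (x.map_id _), A_map_id_apply _ (x.map_id _), x.map_id, x.map_id,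
      F.map_id, G.map_id]
    simp only [pow_zero, pow_one, one_smul, neg_smul, ← sub_eq_add_neg]
    exact h2 _ _ _ _
  · rw [ghcComp_ghcD]
    refine LinearMap.ext fun m => ?_
    change dHor 1 1 (ghcComp 1 1 rfl (mkGHC2 r s t)) x a m + ((-1 : k) ^ 2 •
      hochschildD (F.act (x.obj 0)) ((G.act (x.obj (Fin.last 2))).comp
        (A.map (x.map (homOfLE (Fin.zero_le (Fin.last 2))))).hom) 0
        (ghcComp 2 0 rfl (mkGHC2 r s t) x) a) m = _
    rw [dHor_apply, Fin.sum_univ_three, hochschildD_zero]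
    change (-1 : k) ^ 0 • (G.map (x.map (𝟙 (2 : Fin 3)))
        (s (x.map (homOfLE (by decide : (1 : Fin 3) ≤ 2)))
        ((A.map (x.map (homOfLE (Fin.zero_le (1 : Fin 3))))).hom (a 0))
        (F.map (x.map (homOfLE (Fin.zero_le (1 : Fin 3)))) m))) +
      (-1 : k) ^ 1 • (G.map (x.map (𝟙 (2 : Fin 3)))
        (s (x.map (homOfLE (Fin.zero_le (2 : Fin 3)))) ((A.map (x.map (𝟙 (0 : Fin 3)))).hom (a 0))
        (F.map (x.map (𝟙 (0 : Fin 3))) m))) +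
      (-1 : k) ^ 2 • (G.map (x.map (homOfLE (by decide : (1 : Fin 3) ≤ 2)))
        (s (x.map (homOfLE (Fin.zero_le (1 : Fin 3)))) ((A.map (x.map (𝟙 (0 : Fin 3)))).hom (a 0))
        (F.map (x.map (𝟙 (0 : Fin 3))) m))) +
      (-1 : k) ^ 2 • (G.act (x.obj 2)
          ((A.map (x.map (homOfLE (Fin.zero_le (2 : Fin 3))))).hom (a 0))
          (t (x.map (homOfLE (Fin.zero_le (1 : Fin 3))))
            (x.map (homOfLE (by decide : (1 : Fin 3) ≤ 2))) m) -
          t (x.map (homOfLE (Fin.zero_le (1 : Fin 3))))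
            (x.map (homOfLE (by decide : (1 : Fin 3) ≤ 2))) (F.act (x.obj 0) (a 0) m)) = _
    rw [A_map_id_apply _ (x.map_id _), x.map_id, x.map_id, F.map_id, G.map_id, G.map_id,
      show x.map (homOfLE (Fin.zero_le (2 : Fin 3))) = x.map (homOfLE (Fin.zero_le (1 : Fin 3))) ≫
        x.map (homOfLE (by decide : (1 : Fin 3) ≤ 2)) from x.map_comp _ _, A_map_comp_apply]
    simp only [pow_zero, pow_one, one_smul, neg_smul, ← sub_eq_add_neg, even_two, Even.neg_pow,
      one_pow]
    exact h3 _ _ _ _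
  · rw [ghcComp_ghcD_hor]
    refine LinearMap.ext fun m => ?_
    rw [dHor_apply, Fin.sum_univ_four]
    change (-1 : k) ^ 0 • (G.map (x.map (𝟙 (3 : Fin 4)))
        (t (x.map (homOfLE (by decide : (1 : Fin 4) ≤ 2)))
          (x.map (homOfLE (by decide : (2 : Fin 4) ≤ 3)))
        (F.map (x.map (homOfLE (Fin.zero_le (1 : Fin 4)))) m))) +
      (-1 : k) ^ 1 • (G.map (x.map (𝟙 (3 : Fin 4)))
        (t (x.map (homOfLE (Fin.zero_le (2 : Fin 4))))
          (x.map (homOfLE (by decide : (2 : Fin 4) ≤ 3))) (F.map (x.map (𝟙 (0 : Fin 4))) m))) +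
      (-1 : k) ^ 2 • (G.map (x.map (𝟙 (3 : Fin 4)))
        (t (x.map (homOfLE (Fin.zero_le (1 : Fin 4))))
          (x.map (homOfLE (by decide : (1 : Fin 4) ≤ 3))) (F.map (x.map (𝟙 (0 : Fin 4))) m))) +
      (-1 : k) ^ 3 • (G.map (x.map (homOfLE (by decide : (2 : Fin 4) ≤ 3)))
        (t (x.map (homOfLE (Fin.zero_le (1 : Fin 4))))
          (x.map (homOfLE (by decide : (1 : Fin 4) ≤ 2))) (F.map (x.map (𝟙 (0 : Fin 4))) m))) = _
    rw [x.map_id, x.map_id, F.map_id, G.map_id, G.map_id, G.map_id,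
      show x.map (homOfLE (Fin.zero_le (2 : Fin 4))) = x.map (homOfLE (Fin.zero_le (1 : Fin 4))) ≫
        x.map (homOfLE (by decide : (1 : Fin 4) ≤ 2)) from x.map_comp _ _,
      show x.map (homOfLE (by decide : (1 : Fin 4) ≤ 3)) =
        x.map (homOfLE (by decide : (1 : Fin 4) ≤ 2)) ≫
        x.map (homOfLE (by decide : (2 : Fin 4) ≤ 3)) from x.map_comp _ _]
    have h3 : (-1 : k) ^ 3 = -1 := by simp [pow_succ]
    rw [h3]
    simp only [pow_zero, pow_one, one_smul, neg_smul, ← sub_eq_add_neg, even_two, Even.neg_pow,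
      one_pow]
    exact h4 _ _ _ _

end Cochains

section Models

variable {k : Type u} [Field k] {C : Type u} [SmallCategory C] {A : C ⥤ AlgCat.{u} k} {p : ℕ}
  {F : Fin p → ModPresheaf A} {R S R' S' T : PointedAlg k p} {c d e : C}

/-! ### Linear extension -/

/-- The `R`-linear map with given restrictions to the `F_i(c)`, as a linear map in these data. -/
def freeExt : (∀ i, (F i).obj c →ₗ[k] FreeMod F R d) →ₗ[k]
    (FreeMod F R c →ₗ[k] FreeMod F R d) where
  toFun t := freeLift (freeAct F R d) t
  map_add' s t := (isRLin_freeLift _).ext ((isRLin_freeLift _).add (isRLin_freeLift _))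
    fun i x => by simp [freeLift_freeIncl]
  map_smul' s t := free_ext fun i x a => by simp [freeLift_freeIncl, freeLift_freeMul]

theorem isRLin_freeExt (t : ∀ i, (F i).obj c →ₗ[k] FreeMod F R d) : IsRLin (freeExt t) :=
  isRLin_freeLift t

theorem freeExt_freeIncl (t : ∀ i, (F i).obj c →ₗ[k] FreeMod F R d) (i) (x) :
    freeExt t (freeIncl F R c i x) = freeMul F R d (R.e i) (t i x) := freeLift_freeIncl _ t i x

/-- The extension of scalars of a map between free modules. -/
def pushMap (u : R ⟶ S) : (FreeMod F R c →ₗ[k] FreeMod F R d) →ₗ[k]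
    (FreeMod F S c →ₗ[k] FreeMod F S d) :=
  freeExt ∘ₗ LinearMap.pi fun i => LinearMap.compRight k (freeMap F u d) ∘ₗ
    LinearMap.lcomp k _ (freeIncl F R c i)

theorem isRLin_pushMap (u : R ⟶ S) (f : FreeMod F R c →ₗ[k] FreeMod F R d) :
    IsRLin (pushMap u f) := isRLin_freeExt _

theorem pushMap_freeMap (u : R ⟶ S) {f : FreeMod F R c →ₗ[k] FreeMod F R d} (hf : IsRLin f)
    (n : FreeMod F R c) : pushMap u f (freeMap F u c n) = freeMap F u d (f n) := by
  induction n using free_ind with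
  | zero => simp
  | h i x a =>
    rw [freeMap_freeMul, isRLin_pushMap, freeMap_freeIncl, hf, freeMap_freeMul]
    congr 1
    refine (freeExt_freeIncl _ _ _).trans ?_
    change freeMul F S d _ (freeMap F u d (f _)) = _
    rw [← R.hom_e u, ← freeMap_freeMul, ← hf, freeMul_e_freeIncl]
  | add a b ha hb => simp only [map_add, ha, hb]

/-- A linear section of `freeMap`. -/
theorem exists_section (u : R ⟶ S) (hu : Function.Surjective (PointedAlg.hom u)) (d : C) :
    ∃ s : FreeMod F S d →ₗ[k] FreeMod F R d, ∀ n, freeMap F u d (s n) = n := by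
  obtain ⟨s, hs⟩ := (freeMap F u d).exists_rightInverse_of_surjective
    (LinearMap.range_eq_top.2 (freeMap_surjective (F := F) u hu))
  exact ⟨s, LinearMap.congr_fun hs⟩

/-- A lift of a map between free modules along a surjection of algebras. -/
def pullMap (u : R ⟶ S) (hu : Function.Surjective (PointedAlg.hom u)) :
    (FreeMod F S c →ₗ[k] FreeMod F S d) →ₗ[k] (FreeMod F R c →ₗ[k] FreeMod F R d) :=
  freeExt ∘ₗ LinearMap.pi fun i => LinearMap.compRight k (exists_section (F := F) u hu d).choose ∘ₗ
    LinearMap.lcomp k _ (freeIncl F S c i)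

theorem isRLin_pullMap (u : R ⟶ S) (hu : Function.Surjective (PointedAlg.hom u))
    (f : FreeMod F S c →ₗ[k] FreeMod F S d) : IsRLin (pullMap u hu f) := isRLin_freeExt _

theorem freeMap_pullMap (u : R ⟶ S) (hu : Function.Surjective (PointedAlg.hom u))
    {f : FreeMod F S c →ₗ[k] FreeMod F S d} (hf : IsRLin f) (n : FreeMod F R c) :
    freeMap F u d (pullMap u hu f n) = f (freeMap F u c n) := by
  induction n using free_ind with
  | zero => simp
  | h i x a =>
    rw [isRLin_pullMap, freeMap_freeMul, freeMap_freeMul, hf, freeMap_freeIncl]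
    congr 1
    refine (congrArg (freeMap F u d) (freeExt_freeIncl _ _ _)).trans ?_
    rw [freeMap_freeMul, R.hom_e u]
    change freeMul F S d _ (freeMap F u d ((exists_section (F := F) u hu d).choose _)) = _
    rw [(exists_section (F := F) u hu d).choose_spec]
    change freeMul F S d _ (f _) = _
    rw [← hf, freeMul_e_freeIncl]
  | add a b ha hb => simp only [map_add, ha, hb]

/-! ### Models -/

variable (F R) in
/-- Families of `R`-linear maps on the free modules that lift the structure maps of the `F_i`. -/
structure PreModel where
  act : ∀ c, A.obj c →ₗ[k] Module.End k (FreeMod F R c)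
  act_lin : ∀ c a, IsRLin (act c a)
  act_red : ∀ c a, ReducesTo (act c a) fun i => (F i).act c a
  map : ∀ {c d : C}, (c ⟶ d) → (FreeMod F R c →ₗ[k] FreeMod F R d)
  map_lin : ∀ {c d : C} (φ : c ⟶ d), IsRLin (map φ)
  map_red : ∀ {c d : C} (φ : c ⟶ d), ReducesTo (map φ) fun i => (F i).map φ

namespace PreModel

theorem ext {L M : PreModel F R} (h1 : ∀ c a n, L.act c a n = M.act c a n)
    (h2 : ∀ {c d : C} (φ : c ⟶ d) n, L.map φ n = M.map φ n) : L = M := by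
  obtain ⟨a, _, _, m, _, _⟩ := L
  obtain ⟨a', _, _, m', _, _⟩ := M
  obtain rfl : a = a' := funext fun c => LinearMap.ext fun x => LinearMap.ext fun n => h1 c x n
  obtain rfl : @m = @m' := by
    funext c d φ
    exact LinearMap.ext fun n => h2 φ n
  rfl

/-- The structure maps define a presheaf of modules. -/
structure IsExact (M : PreModel F R) : Prop where
  act_one : ∀ c n, M.act c 1 n = n
  act_mul : ∀ c a b n, M.act c (a * b) n = M.act c a (M.act c b n)
  map_id : ∀ c n, M.map (𝟙 c) n = n
  map_comp : ∀ {c d e : C} (φ : c ⟶ d) (ψ : d ⟶ e) n, M.map (φ ≫ ψ) n = M.map ψ (M.map φ n)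
  map_act : ∀ {c d : C} (φ : c ⟶ d) a n,
    M.map φ (M.act c a n) = M.act d ((A.map φ).hom a) (M.map φ n)

/-- `L` lifts `M` along `u`. -/
structure Lifts (u : R ⟶ S) (L : PreModel F R) (M : PreModel F S) : Prop where
  act : ∀ c a n, freeMap F u c (L.act c a n) = M.act c a (freeMap F u c n)
  map : ∀ {c d : C} (φ : c ⟶ d) n, freeMap F u d (L.map φ n) = M.map φ (freeMap F u c n)

theorem Lifts.comp {u : R ⟶ S} {v : S ⟶ T} {L : PreModel F R} {M : PreModel F S}
    {N : PreModel F T} (h : Lifts u L M) (h' : Lifts v M N) : Lifts (u ≫ v) L N :=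
  ⟨fun c a n => by rw [freeMap_comp, h.act, h'.act, freeMap_comp],
    fun φ n => by rw [freeMap_comp, h.map, h'.map, freeMap_comp]⟩

/-- No surjectivity of u is required: the image of `freeMap` contains all f ⊗ e_i, and these
generate the free module over S. -/
theorem eq_of_freeMap (u : R ⟶ S) {f g : FreeMod F S c →ₗ[k] FreeMod F S d} (hf : IsRLin f)
    (hg : IsRLin g) (h : ∀ n, f (freeMap F u c n) = g (freeMap F u c n)) : f = g :=
  hf.ext hg fun i x => by rw [← freeMap_freeIncl u i x, h]

theorem Lifts.unique {u : R ⟶ S} {L : PreModel F R} {M M' : PreModel F S} (h : Lifts u L M)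
    (h' : Lifts u L M') : M = M' :=
  ext (fun c a => LinearMap.congr_fun (eq_of_freeMap u (M.act_lin c a) (M'.act_lin c a)
    fun n => by rw [← h.act, ← h'.act]))
    (fun φ => LinearMap.congr_fun (eq_of_freeMap u (M.map_lin φ) (M'.map_lin φ)
    fun n => by rw [← h.map, ← h'.map]))

theorem Lifts.of_comp {u : R ⟶ S} {v : S ⟶ T} {L : PreModel F R} {M : PreModel F S}
    {N : PreModel F T} (h : Lifts u L M) (h' : Lifts (u ≫ v) L N) : Lifts v M N :=
  ⟨fun c a => LinearMap.congr_fun (f := freeMap F v c ∘ₗ M.act c a) (g := N.act c a ∘ₗ freeMap F v c)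
    (free_ext fun i x r => by
      have h1 := h'.act c a (freeIncl F R c i x)
      rw [freeMap_comp, h.act, freeMap_comp, freeMap_freeIncl] at h1
      simp only [LinearMap.comp_apply]
      rw [M.act_lin, freeMap_freeMul, freeMap_freeMul, N.act_lin, h1]),
   fun {c d} φ => LinearMap.congr_fun (f := freeMap F v d ∘ₗ M.map φ) (g := N.map φ ∘ₗ freeMap F v c)
    (free_ext fun i x r => by
      have h1 := h'.map φ (freeIncl F R c i x)
      rw [freeMap_comp, h.map, freeMap_comp, freeMap_freeIncl] at h1
      simp only [LinearMap.comp_apply]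
      rw [M.map_lin, freeMap_freeMul, freeMap_freeMul, N.map_lin, h1])⟩

theorem reducesTo_pushMap (u : R ⟶ S) {f : FreeMod F R c →ₗ[k] FreeMod F R d} (hf : IsRLin f)
    {t : ∀ i, (F i).obj c →ₗ[k] (F i).obj d} (h : ReducesTo f t) : ReducesTo (pushMap u f) t := by
  intro i n
  induction n using free_ind with
  | zero => simp
  | h j x a =>
    rw [isRLin_pushMap, red_freeMul, red_freeMul, map_smul, ← freeMap_freeIncl u j x,
      pushMap_freeMap u hf, red_freeMap, red_freeMap, h]
  | add a b ha hb => simp only [map_add, ha, hb]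

/-- Extension of scalars. -/
def push (u : R ⟶ S) (M : PreModel F R) : PreModel F S where
  act c := pushMap u ∘ₗ M.act c
  act_lin _ _ := isRLin_pushMap _ _
  act_red c a := reducesTo_pushMap u (M.act_lin c a) (M.act_red c a)
  map φ := pushMap u (M.map φ)
  map_lin _ := isRLin_pushMap _ _
  map_red φ := reducesTo_pushMap u (M.map_lin φ) (M.map_red φ)

theorem lifts_push (u : R ⟶ S) (M : PreModel F R) : Lifts u M (M.push u) :=
  ⟨fun c a n => (pushMap_freeMap u (M.act_lin c a) n).symm,
    fun φ n => (pushMap_freeMap u (M.map_lin φ) n).symm⟩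

theorem Lifts.push_eq {u : R ⟶ S} {L : PreModel F R} {M : PreModel F S} (h : Lifts u L M) :
    L.push u = M := (lifts_push u L).unique h

theorem push_comp (u : R ⟶ S) (v : S ⟶ T) (M : PreModel F R) :
    (M.push u).push v = M.push (u ≫ v) :=
  (((lifts_push u M).comp (lifts_push v _)).push_eq).symm

/-- Identities between operators descend along any morphism. The failure of the converse is what
obstructions measure. -/
theorem Lifts.isExact {u : R ⟶ S} {L : PreModel F R} {M : PreModel F S} (h : Lifts u L M)
    (hL : L.IsExact) : M.IsExact where
  act_one c := LinearMap.congr_fun (f := M.act c 1) (g := LinearMap.id)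
    (eq_of_freeMap u (M.act_lin c 1) .id fun n => by rw [← h.act, hL.act_one]; rfl)
  act_mul c a b := LinearMap.congr_fun (f := M.act c (a * b)) (g := M.act c a ∘ₗ M.act c b)
    (eq_of_freeMap u (M.act_lin c _) ((M.act_lin c a).comp (M.act_lin c b)) fun n => by
      rw [← h.act, hL.act_mul, h.act, h.act]; rfl)
  map_id c := LinearMap.congr_fun (f := M.map (𝟙 c)) (g := LinearMap.id)
    (eq_of_freeMap u (M.map_lin _) .id fun n => by rw [← h.map, hL.map_id]; rfl)
  map_comp φ ψ := LinearMap.congr_fun (f := M.map (φ ≫ ψ)) (g := M.map ψ ∘ₗ M.map φ)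
    (eq_of_freeMap u (M.map_lin _) ((M.map_lin ψ).comp (M.map_lin φ)) fun n => by
      rw [← h.map, hL.map_comp, h.map, h.map]; rfl)
  map_act {c d} φ a := LinearMap.congr_fun (f := M.map φ ∘ₗ M.act c a)
    (g := M.act d ((A.map φ).hom a) ∘ₗ M.map φ)
    (eq_of_freeMap u ((M.map_lin φ).comp (M.act_lin c a)) ((M.act_lin d _).comp (M.map_lin φ))
      fun n => by
        simp only [LinearMap.comp_apply]
        rw [← h.act, ← h.map, hL.map_act, h.act, h.map])

theorem IsExact.push {M : PreModel F R} (h : M.IsExact) (u : R ⟶ S) : (M.push u).IsExact :=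
  (lifts_push u M).isExact h

/-- Each operator lifts on its own because the modules are free, and the reductions are unaffected.
Only the identities in `IsExact` can get lost. -/
theorem exists_lifts (u : R ⟶ S) (hu : Function.Surjective (PointedAlg.hom u)) (M : PreModel F S) :
    ∃ L : PreModel F R, Lifts u L M := by
  let L : PreModel F R :=
   { act := fun c => pullMap u hu ∘ₗ M.act c
     act_lin := fun _ _ => isRLin_pullMap u hu _
     act_red := fun c a i n => by
       rw [← red_freeMap u]
       refine (congrArg _ (freeMap_pullMap u hu (M.act_lin c a) n)).trans ?_
       rw [M.act_red, red_freeMap]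
     map := fun φ => pullMap u hu (M.map φ)
     map_lin := fun _ => isRLin_pullMap u hu _
     map_red := fun φ i n => by
       rw [← red_freeMap u, freeMap_pullMap u hu (M.map_lin φ), M.map_red, red_freeMap] }
  exact ⟨L, fun c a n => freeMap_pullMap u hu (M.act_lin c a) n,
   fun φ n => freeMap_pullMap u hu (M.map_lin φ) n⟩

theorem reducesTo_freeExt (t : ∀ i, (F i).obj c →ₗ[k] (F i).obj d) :
    ReducesTo (freeExt (R := R) fun i => freeIncl F R d i ∘ₗ t i) t := by
  intro i n
  induction n using free_ind with
  | zero => simp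
  | h j x a =>
    rw [isRLin_freeExt, red_freeMul, red_freeMul, map_smul, freeExt_freeIncl, LinearMap.comp_apply,
      freeMul_e_freeIncl]
    rcases eq_or_ne j i with rfl | hj
    · rw [red_freeIncl_self, red_freeIncl_self]
    · rw [red_freeIncl_ne hj, red_freeIncl_ne hj, map_zero]
  | add a b ha hb => simp only [map_add, ha, hb]

variable (F R) in
/-- The trivial model. -/
def triv : PreModel F R where
  act c := freeExt ∘ₗ LinearMap.pi fun i =>
    LinearMap.compRight k (freeIncl F R c i) ∘ₗ ((F i).act c).toLinearMap
  act_lin _ _ := isRLin_freeExt _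
  act_red c a := reducesTo_freeExt fun i => (F i).act c a
  map φ := freeExt fun i => freeIncl F R _ i ∘ₗ (F i).map φ
  map_lin _ := isRLin_freeExt _
  map_red φ := reducesTo_freeExt fun i => (F i).map φ

theorem triv_act (c : C) (a : A.obj c) (i : Fin p) (x : (F i).obj c) :
    (triv F R).act c a (freeIncl F R c i x) = freeIncl F R c i ((F i).act c a x) :=
  (freeExt_freeIncl _ i x).trans (freeMul_e_freeIncl F i _)

theorem triv_map (φ : c ⟶ d) (i : Fin p) (x : (F i).obj c) :
    (triv F R).map φ (freeIncl F R c i x) = freeIncl F R d i ((F i).map φ x) :=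
  (freeExt_freeIncl _ i x).trans (freeMul_e_freeIncl F i _)

theorem triv_isExact : (triv F R).IsExact where
  act_one c := LinearMap.congr_fun (f := (triv F R).act c 1) (g := LinearMap.id)
    (((triv F R).act_lin c 1).ext .id fun i x => by simp [triv_act])
  act_mul c a b := LinearMap.congr_fun (f := (triv F R).act c (a * b))
    (g := (triv F R).act c a ∘ₗ (triv F R).act c b)
    (((triv F R).act_lin c _).ext (((triv F R).act_lin c a).comp ((triv F R).act_lin c b))
      fun i x => by simp [triv_act])
  map_id c := LinearMap.congr_fun (f := (triv F R).map (𝟙 c)) (g := LinearMap.id)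
    (((triv F R).map_lin _).ext .id fun i x => by simp [triv_map, ModPresheaf.map_id])
  map_comp φ ψ := LinearMap.congr_fun (f := (triv F R).map (φ ≫ ψ))
    (g := (triv F R).map ψ ∘ₗ (triv F R).map φ)
    (((triv F R).map_lin _).ext (((triv F R).map_lin ψ).comp ((triv F R).map_lin φ))
      fun i x => by simp [triv_map, ModPresheaf.map_comp])
  map_act {c d} φ a := LinearMap.congr_fun (f := (triv F R).map φ ∘ₗ (triv F R).act c a)
    (g := (triv F R).act d ((A.map φ).hom a) ∘ₗ (triv F R).map φ)
    ((((triv F R).map_lin φ).comp ((triv F R).act_lin c a)).ext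
      (((triv F R).act_lin d _).comp ((triv F R).map_lin φ))
      fun i x => by simp [triv_map, triv_act, ModPresheaf.map_act])

/-! ### Obstruction cocycles -/

/-- The defect of multiplicativity. -/
def defAct (L : PreModel F R) (c : C) (a b : A.obj c) : FreeMod F R c →ₗ[k] FreeMod F R c :=
  L.act c (a * b) - L.act c a ∘ₗ L.act c b

/-- The defect of compatibility. -/
def defMix (L : PreModel F R) (φ : c ⟶ d) (a : A.obj c) : FreeMod F R c →ₗ[k] FreeMod F R d :=
  L.map φ ∘ₗ L.act c a - L.act d ((A.map φ).hom a) ∘ₗ L.map φ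

/-- The defect of functoriality. -/
def defMap (L : PreModel F R) (φ : c ⟶ d) (ψ : d ⟶ e) : FreeMod F R c →ₗ[k] FreeMod F R e :=
  L.map ψ ∘ₗ L.map φ - L.map (φ ≫ ψ)

theorem defAct_lin (L : PreModel F R) (c : C) (a b : A.obj c) : IsRLin (L.defAct c a b) :=
  (L.act_lin c _).sub ((L.act_lin c a).comp (L.act_lin c b))

theorem defMix_lin (L : PreModel F R) (φ : c ⟶ d) (a : A.obj c) : IsRLin (L.defMix φ a) :=
  ((L.map_lin φ).comp (L.act_lin c a)).sub ((L.act_lin d _).comp (L.map_lin φ))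

theorem defMap_lin (L : PreModel F R) (φ : c ⟶ d) (ψ : d ⟶ e) : IsRLin (L.defMap φ ψ) :=
  ((L.map_lin ψ).comp (L.map_lin φ)).sub (L.map_lin _)

section

variable {u : R ⟶ S} {L : PreModel F R} {M : PreModel F S} (h : Lifts u L M) (hM : M.IsExact)

include h hM

theorem freeMap_defAct (c : C) (a b : A.obj c) (n) : freeMap F u c (L.defAct c a b n) = 0 := by
  change freeMap F u c (L.act c (a * b) n - L.act c a (L.act c b n)) = 0
  rw [map_sub, h.act, h.act, h.act, hM.act_mul, sub_self]

theorem freeMap_defMix (φ : c ⟶ d) (a : A.obj c) (n) : freeMap F u d (L.defMix φ a n) = 0 := by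
  change freeMap F u d (L.map φ (L.act c a n) - L.act d _ (L.map φ n)) = 0
  rw [map_sub, h.act, h.map, h.map, h.act, hM.map_act, sub_self]

theorem freeMap_defMap (φ : c ⟶ d) (ψ : d ⟶ e) (n) : freeMap F u e (L.defMap φ ψ n) = 0 := by
  change freeMap F u e (L.map ψ (L.map φ n) - L.map (φ ≫ ψ) n) = 0
  rw [map_sub, h.map, h.map, h.map, hM.map_comp, sub_self]

end

/-- The obstruction cochain. -/
def obs (L : PreModel F R) (i j : Fin p) (μ : R →ₗ[k] k) : GHC (F j) (F i) 2 :=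
  mkGHC2
    (fun c => LinearMap.mk₂ k (fun a b => freeComp i j μ (L.defAct c a b))
      (fun a b e => by
        rw [← freeComp_add]; congr 1; refine LinearMap.ext fun n => ?_; simp [defAct, add_mul]; abel)
      (fun t a b => by
        rw [← freeComp_smul]; congr 1; refine LinearMap.ext fun n => ?_; simp [defAct, smul_sub])
      (fun a b e => by
        rw [← freeComp_add]; congr 1; refine LinearMap.ext fun n => ?_; simp [defAct, mul_add]; abel)
      (fun t a b => by
        rw [← freeComp_smul]; congr 1; refine LinearMap.ext fun n => ?_; simp [defAct, smul_sub]))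
    (fun {c d} φ =>
      { toFun := fun a => freeComp i j μ (L.defMix φ a)
        map_add' := fun a b => by
          rw [← freeComp_add]; congr 1; refine LinearMap.ext fun n => ?_; simp [defMix]; abel
        map_smul' := fun t a => by
          rw [RingHom.id_apply, ← freeComp_smul]; congr 1; refine LinearMap.ext fun n => ?_; simp [defMix, smul_sub] })
    (fun φ ψ => freeComp i j μ (L.defMap φ ψ))

/-- Each component of the cocycle condition comes from an identity valid for arbitrary operators:
expand the defects, and everything cancels by associativity and the functoriality of A.
`freeComp_comp_left` and `freeComp_comp_right` then replace the outer operators by the actions on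
F_i and F_j. -/
theorem obs_mem {u : R ⟶ S} (hu : IsSmall u) {L : PreModel F R} {M : PreModel F S}
    (h : Lifts u L M) (hM : M.IsExact) (i j : Fin p) (μ : R →ₗ[k] k) :
    L.obs i j μ ∈ ghcZ (F j) (F i) 2 := by
  refine ghcD_mkGHC2 _ _ _ (fun c a b b' => ?_) (fun {c d} φ a b => ?_) (fun {c d e} φ ψ a => ?_)
    (fun {c d e e'} φ ψ χ => ?_)
  · refine LinearMap.congr_fun (f := (F i).act c a ∘ₗ freeComp i j μ (L.defAct c b b') -
      freeComp i j μ (L.defAct c (a * b) b') + freeComp i j μ (L.defAct c a (b * b')) -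
      freeComp i j μ (L.defAct c a b) ∘ₗ (F j).act c b') (g := 0) ?_
    rw [← freeComp_comp_left hu (L.act_lin c a) (L.act_red c a) (freeMap_defAct h hM c b b'),
      ← freeComp_comp_right hu (L.act_red c b') (L.defAct_lin c a b) (freeMap_defAct h hM c a b),
      ← freeComp_sub, ← freeComp_add, ← freeComp_sub]
    have : L.act c a ∘ₗ L.defAct c b b' - L.defAct c (a * b) b' + L.defAct c a (b * b') -
        L.defAct c a b ∘ₗ L.act c b' = 0 := by
      refine LinearMap.ext fun n => ?_; simp [defAct, mul_assoc]; abel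
    rw [this]; ext; simp [freeComp]
  · refine LinearMap.congr_fun (f := freeComp i j μ (L.defAct d ((A.map φ).hom a)
      ((A.map φ).hom b)) ∘ₗ (F j).map φ - (F i).map φ ∘ₗ freeComp i j μ (L.defAct c a b) -
      ((F i).act d ((A.map φ).hom a) ∘ₗ freeComp i j μ (L.defMix φ b) -
        freeComp i j μ (L.defMix φ (a * b)) + freeComp i j μ (L.defMix φ a) ∘ₗ (F j).act c b))
      (g := 0) ?_
    rw [← freeComp_comp_left hu (L.map_lin φ) (L.map_red φ) (freeMap_defAct h hM c a b),
      ← freeComp_comp_right hu (L.map_red φ) (L.defAct_lin d _ _) (freeMap_defAct h hM d _ _),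
      ← freeComp_comp_left hu (L.act_lin d _) (L.act_red d _) (freeMap_defMix h hM φ b),
      ← freeComp_comp_right hu (L.act_red c b) (L.defMix_lin φ a) (freeMap_defMix h hM φ a),
      ← freeComp_sub, ← freeComp_sub, ← freeComp_add, ← freeComp_sub]
    have : L.defAct d ((A.map φ).hom a) ((A.map φ).hom b) ∘ₗ L.map φ -
        L.map φ ∘ₗ L.defAct c a b - (L.act d ((A.map φ).hom a) ∘ₗ L.defMix φ b -
          L.defMix φ (a * b) + L.defMix φ a ∘ₗ L.act c b) = 0 := by
      refine LinearMap.ext fun n => ?_; simp [defAct, defMix]; abel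
    rw [this]; ext; simp [freeComp]
  · refine LinearMap.congr_fun (f := freeComp i j μ (L.defMix ψ ((A.map φ).hom a)) ∘ₗ (F j).map φ -
      freeComp i j μ (L.defMix (φ ≫ ψ) a) + (F i).map ψ ∘ₗ freeComp i j μ (L.defMix φ a) +
      ((F i).act e ((A.map ψ).hom ((A.map φ).hom a)) ∘ₗ freeComp i j μ (L.defMap φ ψ) -
        freeComp i j μ (L.defMap φ ψ) ∘ₗ (F j).act c a)) (g := 0) ?_
    rw [← freeComp_comp_left hu (L.map_lin ψ) (L.map_red ψ) (freeMap_defMix h hM φ a),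
      ← freeComp_comp_right hu (L.map_red φ) (L.defMix_lin ψ _) (freeMap_defMix h hM ψ _),
      ← freeComp_comp_left hu (L.act_lin e _) (L.act_red e _) (freeMap_defMap h hM φ ψ),
      ← freeComp_comp_right hu (L.act_red c a) (L.defMap_lin φ ψ) (freeMap_defMap h hM φ ψ),
      ← freeComp_sub, ← freeComp_add, ← freeComp_sub, ← freeComp_add]
    have : L.defMix ψ ((A.map φ).hom a) ∘ₗ L.map φ - L.defMix (φ ≫ ψ) a + L.map ψ ∘ₗ L.defMix φ a +
        (L.act e ((A.map ψ).hom ((A.map φ).hom a)) ∘ₗ L.defMap φ ψ - L.defMap φ ψ ∘ₗ L.act c a)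
        = 0 := by
      refine LinearMap.ext fun n => ?_; simp [defMap, defMix]; abel
    rw [this]; ext; simp [freeComp]
  · refine LinearMap.congr_fun (f := freeComp i j μ (L.defMap ψ χ) ∘ₗ (F j).map φ -
      freeComp i j μ (L.defMap (φ ≫ ψ) χ) + freeComp i j μ (L.defMap φ (ψ ≫ χ)) -
      (F i).map χ ∘ₗ freeComp i j μ (L.defMap φ ψ)) (g := 0) ?_
    rw [← freeComp_comp_left hu (L.map_lin χ) (L.map_red χ) (freeMap_defMap h hM φ ψ),
      ← freeComp_comp_right hu (L.map_red φ) (L.defMap_lin ψ χ) (freeMap_defMap h hM ψ χ),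
      ← freeComp_sub, ← freeComp_add, ← freeComp_sub]
    have : L.defMap ψ χ ∘ₗ L.map φ - L.defMap (φ ≫ ψ) χ + L.defMap φ (ψ ≫ χ) -
        L.map χ ∘ₗ L.defMap φ ψ = 0 := by
      refine LinearMap.ext fun n => ?_; simp [defMap]; abel
    rw [this]; ext; simp [freeComp]

end PreModel

end Models

/-! ### Differences of lifts: their effect on obstruction cochains, and changes by prescribed
cochains -/

section Differences

variable {k : Type u} [Field k] {C : Type u} [SmallCategory C] {A : C ⥤ AlgCat.{u} k} {p : ℕ}
  {F : Fin p → ModPresheaf A} {R S R' S' T : PointedAlg k p} {c d e : C}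

theorem freeComp_neg (i j : Fin p) (μ : R →ₗ[k] k) (f : FreeMod F R c →ₗ[k] FreeMod F R d) :
    freeComp i j μ (-f) = -freeComp i j μ f := by
  ext; simp [freeComp]

theorem freeComp_zero (i j : Fin p) (μ : R →ₗ[k] k) :
    freeComp i j μ (0 : FreeMod F R c →ₗ[k] FreeMod F R d) = 0 := by
  ext; simp [freeComp]

theorem isRLin_zero : IsRLin (0 : FreeMod F R c →ₗ[k] FreeMod F R d) := fun r n => by simp

/-- The class of a cocycle. -/
def cls {G H : ModPresheaf A} {n : ℕ} (z : GHC G H n) (hz : z ∈ ghcZ G H n) : HH G H n :=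
  Submodule.Quotient.mk ⟨z, hz⟩

theorem cls_eq {G H : ModPresheaf A} {n : ℕ} {z z' : GHC G H n} {hz : z ∈ ghcZ G H n}
    {hz' : z' ∈ ghcZ G H n} : cls z hz = cls z' hz' ↔ z - z' ∈ ghcB G H n :=
  Submodule.Quotient.eq _

theorem cls_eq_zero {G H : ModPresheaf A} {n : ℕ} {z : GHC G H n} {hz : z ∈ ghcZ G H n} :
    cls z hz = 0 ↔ z ∈ ghcB G H n :=
  Submodule.Quotient.mk_eq_zero _

namespace PreModel

/-- `L` and `L'` agree along `u`. -/
structure Agree (u : R ⟶ S) (L L' : PreModel F R) : Prop where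
  act : ∀ c a n, freeMap F u c (L'.act c a n - L.act c a n) = 0
  map : ∀ {c d : C} (φ : c ⟶ d) n, freeMap F u d (L'.map φ n - L.map φ n) = 0

theorem Lifts.agree {u : R ⟶ S} {L L' : PreModel F R} {M : PreModel F S} (h : Lifts u L M)
    (h' : Lifts u L' M) : Agree u L L' :=
  ⟨fun c a n => by rw [map_sub, h.act, h'.act, sub_self],
    fun φ n => by rw [map_sub, h.map, h'.map, sub_self]⟩

theorem Agree.lifts {u : R ⟶ S} {L L' : PreModel F R} {M : PreModel F S} (h : Lifts u L M)
    (h' : Agree u L L') : Lifts u L' M :=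
  ⟨fun c a n => by rw [← h.act, ← sub_eq_zero, ← map_sub, h'.act],
    fun φ n => by rw [← h.map, ← sub_eq_zero, ← map_sub, h'.map]⟩

/-- The difference of two families of structure maps, as a cochain. -/
def diff (L L' : PreModel F R) (i j : Fin p) (μ : R →ₗ[k] k) : GHC (F j) (F i) 1 :=
  mkGHC1
    (fun c =>
      { toFun := fun a => freeComp i j μ (L'.act c a - L.act c a)
        map_add' := fun a b => by
          rw [← freeComp_add, map_add, map_add]; congr 1; abel
        map_smul' := fun t a => by
          rw [RingHom.id_apply, ← freeComp_smul, map_smul, map_smul, smul_sub] })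
    (fun φ => -freeComp i j μ (L'.map φ - L.map φ))

/-- The change of a defect is linear in the difference when written asymmetrically: L'(a)L'(b) -
L(a)L(b) = L(a)(L'(b) - L(b)) + (L'(a) - L(a))L'(b). Using L on the left and L' on the right is
harmless because both have the same reduction. -/
theorem obs_sub {u : R ⟶ S} (hu : IsSmall u) {L L' : PreModel F R} (h : Agree u L L')
    (i j : Fin p) (μ : R →ₗ[k] k) :
    L'.obs i j μ = L.obs i j μ - ghcD (F j) (F i) 1 (diff L L' i j μ) := by
  rw [diff, ghcD_mkGHC1]
  have hact : ∀ c a n, freeMap F u c ((L'.act c a - L.act c a) n) = 0 := h.act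
  have hmap : ∀ {c d : C} (φ : c ⟶ d) n, freeMap F u d ((L'.map φ - L.map φ) n) = 0 := h.map
  have key1 : ∀ (c : C) (a b : A.obj c), freeComp i j μ (L'.defAct c a b) =
      freeComp i j μ (L.defAct c a b) - ((F i).act c a ∘ₗ freeComp i j μ (L'.act c b - L.act c b) -
        freeComp i j μ (L'.act c (a * b) - L.act c (a * b)) +
        freeComp i j μ (L'.act c a - L.act c a) ∘ₗ (F j).act c b) := by
    intro c a b
    rw [← freeComp_comp_left hu (L.act_lin _ _) (L.act_red _ _) (hact _ _),
      ← freeComp_comp_right hu (L'.act_red _ _) ((L'.act_lin _ _).sub (L.act_lin _ _)) (hact _ _),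
      ← freeComp_sub, ← freeComp_add, ← freeComp_sub]
    congr 1
    refine LinearMap.ext fun n => ?_; simp [defAct]; abel
  have key2 : ∀ (c d : C) (φ : c ⟶ d) (a : A.obj c), freeComp i j μ (L'.defMix φ a) =
      freeComp i j μ (L.defMix φ a) -
      (freeComp i j μ (L'.act d ((A.map φ).hom a) - L.act d ((A.map φ).hom a)) ∘ₗ (F j).map φ -
       (F i).map φ ∘ₗ freeComp i j μ (L'.act c a - L.act c a) -
       ((F i).act d ((A.map φ).hom a) ∘ₗ (-freeComp i j μ (L'.map φ - L.map φ)) -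
        (-freeComp i j μ (L'.map φ - L.map φ)) ∘ₗ (F j).act c a)) := by
    intro c d φ a
    rw [LinearMap.comp_neg, LinearMap.neg_comp,
      ← freeComp_comp_left hu (L.act_lin _ _) (L.act_red _ _) (hmap _),
      ← freeComp_comp_left hu (L.map_lin _) (L.map_red _) (hact _ _),
      ← freeComp_comp_right hu (L'.act_red _ _) ((L'.map_lin _).sub (L.map_lin _)) (hmap _),
      ← freeComp_comp_right hu (L'.map_red _) ((L'.act_lin _ _).sub (L.act_lin _ _)) (hact _ _),
      sub_neg_eq_add, neg_add_eq_sub, ← freeComp_sub, ← freeComp_sub, ← freeComp_sub,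
      ← freeComp_sub]
    congr 1
    refine LinearMap.ext fun n => ?_; simp [defMix]; abel
  have key3 : ∀ (c d e : C) (φ : c ⟶ d) (ψ : d ⟶ e), freeComp i j μ (L'.defMap φ ψ) =
      freeComp i j μ (L.defMap φ ψ) - ((-freeComp i j μ (L'.map ψ - L.map ψ)) ∘ₗ (F j).map φ -
        (-freeComp i j μ (L'.map (φ ≫ ψ) - L.map (φ ≫ ψ))) +
        (F i).map ψ ∘ₗ (-freeComp i j μ (L'.map φ - L.map φ))) := by
    intro c d e φ ψ
    rw [LinearMap.comp_neg, LinearMap.neg_comp,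
      ← freeComp_comp_left hu (L.map_lin _) (L.map_red _) (hmap _),
      ← freeComp_comp_right hu (L'.map_red _) ((L'.map_lin _).sub (L.map_lin _)) (hmap _),
      sub_neg_eq_add, neg_add_eq_sub, ← sub_eq_add_neg, ← freeComp_sub, ← freeComp_sub,
      ← freeComp_sub]
    congr 1
    refine LinearMap.ext fun n => ?_; simp [defMap]; abel
  exact GHC.ext2 (fun x a => key1 _ _ _) (fun x a => key2 _ _ (x.map' 0 1) (a 0))
    fun x a => key3 _ _ _ (x.map' 0 1) (x.map (homOfLE (by decide : (1 : Fin 3) ≤ 2)))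

theorem IsExact.obs_eq_zero {L : PreModel F R} (h : L.IsExact) (i j : Fin p) (μ : R →ₗ[k] k) :
    L.obs i j μ = 0 := by
  refine GHC.ext2 (fun x a => ?_) (fun x a => ?_) fun x a => ?_
  · change freeComp i j μ (L.defAct _ (a 0) (a 1)) = 0
    rw [← freeComp_zero i j μ]; congr 1
    exact LinearMap.ext fun n => sub_eq_zero.2 (h.act_mul _ _ _ _)
  · change freeComp i j μ (L.defMix _ (a 0)) = 0
    rw [← freeComp_zero i j μ]; congr 1
    exact LinearMap.ext fun n => sub_eq_zero.2 (h.map_act _ _ _)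
  · change freeComp i j μ (L.defMap _ _) = 0
    rw [← freeComp_zero i j μ]; congr 1
    exact LinearMap.ext fun n => sub_eq_zero.2 (h.map_comp _ _ _).symm

/-- The cochain sees every defect except those of units and identity arrows, and these follow. Let E
be L(1) or L(𝟙): multiplicativity gives E^2 = E, so E(E - 1) = 0. But E - 1 is K-valued, and on such
maps E acts like its reduction, the identity; hence E - 1 = 0. -/
theorem isExact_of_obs_eq_zero {u : R ⟶ S} (hu : IsSmall u) {L : PreModel F R}
    {M : PreModel F S} (h : Lifts u L M) (hM : M.IsExact)
    (h0 : ∀ i j μ, L.obs i j μ = 0) : L.IsExact := by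
  have hact : ∀ c a b, L.defAct c a b = 0 := fun c a b =>
    freeComp_ext (L.defAct_lin c a b) isRLin_zero fun i j μ => by
      rw [freeComp_zero]
      exact congrArg (fun z => ghcComp 0 2 rfl z (ComposableArrows.mk₀ c) ![a, b]) (h0 i j μ)
  have hmix : ∀ {c d : C} (φ : c ⟶ d) a, L.defMix φ a = 0 := fun {c d} φ a =>
    freeComp_ext (L.defMix_lin φ a) isRLin_zero fun i j μ => by
      rw [freeComp_zero]
      exact congrArg (fun z => ghcComp 1 1 rfl z (ComposableArrows.mk₁ φ) ![a]) (h0 i j μ)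
  have hmap : ∀ {c d e : C} (φ : c ⟶ d) (ψ : d ⟶ e), L.defMap φ ψ = 0 := fun {c d e} φ ψ =>
    freeComp_ext (L.defMap_lin φ ψ) isRLin_zero fun i j μ => by
      rw [freeComp_zero]
      exact congrArg (fun z => ghcComp 2 0 rfl z (ComposableArrows.mk₂ φ ψ) ![]) (h0 i j μ)
  refine ⟨fun c => ?_, fun c a b n => sub_eq_zero.1 (LinearMap.congr_fun (hact c a b) n),
    fun c => ?_, fun φ ψ n => (sub_eq_zero.1 (LinearMap.congr_fun (hmap φ ψ) n)).symm,
    fun φ a n => sub_eq_zero.1 (LinearMap.congr_fun (hmix φ a) n)⟩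
  · have hlin : IsRLin (L.act c 1 - LinearMap.id) := (L.act_lin c 1).sub .id
    have hk : ∀ n, freeMap F u c ((L.act c 1 - LinearMap.id : FreeMod F R c →ₗ[k] _) n) = 0 := fun n => by
      simp [h.act, hM.act_one]
    have : L.act c 1 - LinearMap.id = 0 := freeComp_ext hlin isRLin_zero fun i j μ => by
      have h1 := freeComp_comp_left hu (L.act_lin c 1) (L.act_red c 1) hk i j μ
      rw [map_one ((F i).act c), Module.End.one_eq_id, LinearMap.id_comp] at h1
      rw [← h1]
      congr 1
      refine LinearMap.ext fun n => ?_
      have := LinearMap.congr_fun (hact c 1 1) n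
      have h2 : L.act c 1 n = L.act c 1 (L.act c 1 n) := by
        simpa [defAct, sub_eq_zero] using this
      change L.act c 1 (L.act c 1 n - n) = 0
      rw [map_sub, ← h2, sub_self]
    exact fun n => sub_eq_zero.1 (LinearMap.congr_fun this n)
  · have hlin : IsRLin (L.map (𝟙 c) - LinearMap.id) := (L.map_lin _).sub .id
    have hk : ∀ n, freeMap F u c ((L.map (𝟙 c) - LinearMap.id : FreeMod F R c →ₗ[k] _) n) = 0 := fun n => by
      simp [h.map, hM.map_id]
    have : L.map (𝟙 c) - LinearMap.id = 0 := freeComp_ext hlin isRLin_zero fun i j μ => by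
      have h1 := freeComp_comp_left hu (L.map_lin (𝟙 c)) (L.map_red _) hk i j μ
      rw [show (F i).map (𝟙 c) = LinearMap.id from LinearMap.ext ((F i).map_id c),
        LinearMap.id_comp] at h1
      rw [← h1]
      congr 1
      refine LinearMap.ext fun n => ?_
      have := LinearMap.congr_fun (hmap (𝟙 c) (𝟙 c)) n
      have h2 : L.map (𝟙 c) (L.map (𝟙 c) n) = L.map (𝟙 c) n := by
        simpa [defMap, sub_eq_zero] using this
      change L.map (𝟙 c) (L.map (𝟙 c) n - n) = 0
      rw [map_sub, h2, sub_self]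
    exact fun n => sub_eq_zero.1 (LinearMap.congr_fun this n)

theorem obs_eq_sum [Module.Finite k R] {u : R ⟶ S} {L : PreModel F R} {M : PreModel F S}
    (h : Lifts u L M) (hM : M.IsExact) (i j : Fin p) (μ : R →ₗ[k] k) :
    L.obs i j μ = ∑ α, μ (kerBasis u i j α : R) • L.obs i j (kerDual u i j α) := by
  refine GHC.ext2 (fun x a => ?_) (fun x a => ?_) fun x a => ?_
  · refine (freeComp_eq_sum u (L.defAct_lin _ (a 0) (a 1)) (freeMap_defAct h hM _ _ _) i j μ).trans
      ?_
    simp only [map_sum, map_smul, Finset.sum_apply, sum_apply]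
    rfl
  · refine (freeComp_eq_sum u (L.defMix_lin _ (a 0)) (freeMap_defMix h hM _ _) i j μ).trans ?_
    simp only [map_sum, map_smul, Finset.sum_apply, sum_apply]
    rfl
  · refine (freeComp_eq_sum u (L.defMap_lin _ _) (freeMap_defMap h hM _ _) i j μ).trans ?_
    simp only [map_sum, map_smul, Finset.sum_apply, sum_apply]
    rfl

theorem diff_eq_sum [Module.Finite k R] {u : R ⟶ S} {L L' : PreModel F R} (h : Agree u L L')
    (i j : Fin p) (μ : R →ₗ[k] k) :
    diff L L' i j μ = ∑ α, μ (kerBasis u i j α : R) • diff L L' i j (kerDual u i j α) := by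
  refine GHC.ext1 (fun x a => ?_) fun x a => ?_
  · refine (freeComp_eq_sum u ((L'.act_lin _ _).sub (L.act_lin _ (a 0))) (h.act _ _) i j μ).trans ?_
    simp only [map_sum, map_smul, Finset.sum_apply, sum_apply]
    rfl
  · refine (congrArg Neg.neg (freeComp_eq_sum u ((L'.map_lin _).sub (L.map_lin _)) (h.map _) i j
      μ)).trans ?_
    simp only [map_sum, map_smul, Finset.sum_apply, sum_apply,
      ← Finset.sum_neg_distrib, ← smul_neg]
    rfl

/-- Operators may be changed by any cochain with coefficients in the radical part of e_i R e_j
without losing linearity or the reduction. This serves both to cancel obstruction coboundaries, with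
x a basis of K, and to realise first order classes. -/
theorem exists_diff {ι : Fin p → Fin p → Type*} [∀ i j, Fintype (ι i j)] (L : PreModel F R)
    {x : ∀ i j, ι i j → R} (h1 : ∀ i j α, R.e i * x i j α = x i j α)
    (h2 : ∀ i j α, x i j α * R.e j = x i j α) (hx : ∀ i j α, x i j α ∈ R.rad)
    (z : ∀ i j, ι i j → GHC (F j) (F i) 1) :
    ∃ L' : PreModel F R, (∀ (S : PointedAlg k p) (u : R ⟶ S),
      (∀ i j α, PointedAlg.hom u (x i j α) = 0) → Agree u L L') ∧
      ∀ i j μ, diff L L' i j μ = ∑ α, μ (x i j α) • z i j α := by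
  choose y w hz using fun i j α => exists_mkGHC1 (z i j α)
  have hadd : ∀ {c d : C} (Y Z : ∀ i j, ι i j → ((F j).obj c →ₗ[k] (F i).obj d)),
      matMap x (Y + Z) = matMap x Y + matMap x Z := fun Y Z =>
    freeComp_ext (isRLin_matMap _ _) ((isRLin_matMap _ _).add (isRLin_matMap _ _)) fun i j μ => by
      simp [freeComp_add, freeComp_matMap h1 h2, Finset.sum_add_distrib]
  have hsmul : ∀ {c d : C} (t : k) (Y : ∀ i j, ι i j → ((F j).obj c →ₗ[k] (F i).obj d)),
      matMap x (t • Y) = t • matMap x Y := fun t Y =>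
    freeComp_ext (isRLin_matMap _ _) (fun r n => by simp [isRLin_matMap x Y r n]) fun i j μ => by
      simp [freeComp_smul, freeComp_matMap h1 h2, Finset.smul_sum, smul_comm t]
  have hred : ∀ {c d : C} (Y : ∀ i j, ι i j → ((F j).obj c →ₗ[k] (F i).obj d)) i n,
      red F R d i (matMap x Y n) = 0 := fun {c d} Y i n => by
    -- Coefficients in the radical die in k^p, and the reduction can be computed over k^p.
    have := freeMap_matMap (u := (⟨R.aug, R.aug_incl, fun _ => rfl⟩ : PointedAlg.Hom R
      (PointedAlg.base k p))) (fun i j α => (R.mem_rad).1 (hx i j α)) Y n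
    rw [← red_freeMap (S := PointedAlg.base k p) (⟨R.aug, R.aug_incl, fun _ => rfl⟩ :
      PointedAlg.Hom R (PointedAlg.base k p)), this, map_zero]
  let L' : PreModel F R :=
    { act := fun c =>
        { toFun := fun a => L.act c a + matMap x fun i j α => y i j α c a
          map_add' := fun a b => by
            rw [map_add, show (fun i j α => y i j α c (a + b)) = (fun i j α => y i j α c a) +
              fun i j α => y i j α c b by funext i j α; simp, hadd]
            abel
          map_smul' := fun t a => by
            rw [map_smul, show (fun i j α => y i j α c (t • a)) = t • (fun i j α => y i j α c a) by
              funext i j α; simp, hsmul, RingHom.id_apply, smul_add] }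
      act_lin := fun c a => (L.act_lin c a).add (isRLin_matMap _ _)
      act_red := fun c a i n => by
        refine (map_add _ _ _).trans ?_
        rw [hred, add_zero, L.act_red]
      -- The sign matches the one that `diff` puts on its component at arrows.
      map := fun φ => L.map φ - matMap x fun i j α => w i j α φ
      map_lin := fun φ => (L.map_lin φ).sub (isRLin_matMap _ _)
      map_red := fun φ i n => by
        refine (map_sub _ _ _).trans ?_
        rw [hred, sub_zero, L.map_red] }
  refine ⟨L', fun S u hu => ⟨fun c a n => ?_, fun φ n => ?_⟩, fun i j μ => ?_⟩
  · have : L'.act c a n - L.act c a n = matMap x (fun i j α => y i j α c a) n :=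
      add_sub_cancel_left _ _
    rw [this, freeMap_matMap u hu]
  · have : L'.map φ n - L.map φ n = -matMap x (fun i j α => w i j α φ) n :=
      sub_sub_cancel_left _ _
    rw [this, map_neg, freeMap_matMap u hu, neg_zero]
  · refine GHC.ext1 (fun s a => ?_) fun s a => ?_
    · refine (congrArg (freeComp i j μ) (add_sub_cancel_left _ _)).trans
        ((freeComp_matMap h1 h2 _ i j μ).trans ?_)
      simp only [map_sum, map_smul, Finset.sum_apply, sum_apply, hz]
      rfl
    · have : L'.map (s.map' 0 1) - L.map (s.map' 0 1) = -matMap x fun i j α => w i j α _ :=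
        sub_sub_cancel_left _ _
      change -freeComp i j μ (L'.map (s.map' 0 1) - L.map (s.map' 0 1)) = _
      rw [this, freeComp_neg, neg_neg, freeComp_matMap h1 h2]
      simp only [map_sum, map_smul, Finset.sum_apply, sum_apply, hz]
      rfl

end PreModel

end Differences

section Gauges

variable {k : Type u} [Field k] {C : Type u} [SmallCategory C] {A : C ⥤ AlgCat.{u} k} {p : ℕ}
  {F : Fin p → ModPresheaf A} {R S R' S' T : PointedAlg k p} {c d e : C}

/-! ### Automorphisms that are trivial modulo the radical -/

/-- The map g - 1 is linear and kills reductions, so it sends multiples by I^m to multiples by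
I^(m+1). -/
theorem sub_id_pow_mem {g : FreeMod F R c →ₗ[k] FreeMod F R c} (hg : IsRLin g)
    (hr : ∀ i n, red F R c i (g n) = red F R c i n) (m : ℕ) (n : FreeMod F R c) :
    ((g - LinearMap.id : Module.End k (FreeMod F R c)) ^ m) n ∈ Submodule.span k
      {x | ∃ r ∈ R.rad ^ m, ∃ n, x = freeMul F R c r n} := by
  have hlin : IsRLin (g - LinearMap.id) := hg.sub .id
  induction m with
  | zero =>
    exact Submodule.subset_span ⟨1, by simp [Submodule.pow_zero], n, (freeMul_one F n).symm⟩
  | succ m ih =>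
    rw [pow_succ', Module.End.mul_apply]
    generalize ((g - LinearMap.id : Module.End k (FreeMod F R c)) ^ m) n = y at ih
    induction ih using Submodule.span_induction with
    | mem x hx =>
      obtain ⟨r, hr', n, rfl⟩ := hx
      rw [show (g - LinearMap.id : Module.End k (FreeMod F R c)) (freeMul F R c r n) = _ from
        hlin r n]
      have := mem_of_red_eq_zero (g n - n) fun i => by
        rw [map_sub, hr, sub_self]
      change freeMul F R c r (g n - n) ∈ _
      generalize g n - n = y at this
      induction this using Submodule.span_induction with
      | mem y hy =>
        obtain ⟨s, hs, n, rfl⟩ := hy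
        rw [← freeMul_mul]
        refine Submodule.subset_span ⟨s * r, ?_, n, rfl⟩
        rw [Ideal.IsTwoSided.pow_succ]
        exact Ideal.mul_mem_mul hs hr'
      | zero => simp
      | add a b _ _ ha hb => rw [map_add]; exact Submodule.add_mem _ ha hb
      | smul t a _ ha => rw [map_smul]; exact Submodule.smul_mem _ _ ha
    | zero => simp
    | add a b _ _ ha hb => rw [map_add]; exact Submodule.add_mem _ ha hb
    | smul t a _ ha => rw [map_smul]; exact Submodule.smul_mem _ _ ha

/-- Such a g is 1 plus a nilpotent endomorphism. -/
theorem bijective_of_red {m : ℕ} (hR : R.rad ^ m = ⊥) {g : FreeMod F R c →ₗ[k] FreeMod F R c}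
    (hg : IsRLin g) (hr : ∀ i n, red F R c i (g n) = red F R c i n) : Function.Bijective g := by
  have h0 : (g - LinearMap.id : Module.End k (FreeMod F R c)) ^ m = 0 := by
    refine LinearMap.ext fun n => ?_
    have := sub_id_pow_mem hg hr m n
    rw [hR] at this
    refine (Submodule.mem_bot k).1 (Submodule.span_le.2 ?_ this)
    rintro _ ⟨r, hr, n, rfl⟩
    rw [Submodule.mem_bot] at hr
    rw [hr, freeMul_zero]
    exact Submodule.zero_mem _
  have : IsUnit (g : Module.End k (FreeMod F R c)) := by
    have := IsNilpotent.isUnit_one_add ⟨m, h0⟩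
    rwa [show (1 : Module.End k (FreeMod F R c)) = LinearMap.id from rfl, add_sub_cancel] at this
  exact (Module.End.isUnit_iff _).1 this

namespace PreModel

/-- Isomorphisms of models that reduce to the identity. -/
structure Gauge (M M' : PreModel F R) where
  app : ∀ c, FreeMod F R c →ₗ[k] FreeMod F R c
  lin : ∀ c, IsRLin (app c)
  red : ∀ c i n, red F R c i (app c n) = red F R c i n
  act : ∀ c a n, app c (M.act c a n) = M'.act c a (app c n)
  map : ∀ {c d : C} (φ : c ⟶ d) n, app d (M.map φ n) = M'.map φ (app c n)

/-- The identity. -/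
def Gauge.refl (M : PreModel F R) : Gauge M M where
  app _ := LinearMap.id
  lin _ := .id
  red _ _ _ := rfl
  act _ _ _ := rfl
  map _ _ := rfl

theorem Gauge.bijective {m : ℕ} (hR : R.rad ^ m = ⊥) {M M' : PreModel F R} (g : Gauge M M') (c : C) :
    Function.Bijective (g.app c) := bijective_of_red hR (g.lin c) (g.red c)

/-- The inverse of a gauge transformation. -/
def Gauge.symm {m : ℕ} (hR : R.rad ^ m = ⊥) {M M' : PreModel F R} (g : Gauge M M') : Gauge M' M :=
  let E c := LinearEquiv.ofBijective (g.app c) (g.bijective hR c)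
  have hE : ∀ c n, g.app c ((E c).symm n) = n := fun c n => (E c).apply_symm_apply n
  { app := fun c => (E c).symm.toLinearMap
    lin := fun c r n => (g.bijective hR c).1 (by
      change g.app c ((E c).symm _) = g.app c (freeMul F R c r ((E c).symm n))
      rw [g.lin, hE, hE])
    red := fun c i n => by
      rw [← g.red]
      exact congrArg _ (hE c n)
    act := fun c a n => (g.bijective hR c).1 (by
      change g.app c ((E c).symm _) = g.app c (M.act c a ((E c).symm n))
      rw [g.act, hE, hE])
    map := fun {c d} φ n => (g.bijective hR d).1 (by
      change g.app d ((E d).symm _) = g.app d (M.map φ ((E c).symm n))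
      rw [g.map, hE, hE]) }

/-- Transport of a model along an automorphism of the free modules. -/
theorem exists_conj {m : ℕ} (hR : R.rad ^ m = ⊥) (M : PreModel F R)
    (g : ∀ c, FreeMod F R c →ₗ[k] FreeMod F R c) (hg : ∀ c, IsRLin (g c))
    (hr : ∀ c i n, Deformation.red F R c i (g c n) = Deformation.red F R c i n) :
    ∃ (M' : PreModel F R) (G : Gauge M M'), G.app = g := by
  let E c := LinearEquiv.ofBijective (g c) (bijective_of_red hR (hg c) (hr c))
  have hE : ∀ c n, g c ((E c).symm n) = n := fun c n => (E c).apply_symm_apply n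
  have hE' : ∀ c n, (E c).symm (g c n) = n := fun c n => (E c).symm_apply_apply n
  have hl : ∀ c, IsRLin (E c).symm.toLinearMap := fun c r n =>
    (bijective_of_red hR (hg c) (hr c)).1 (by
      change g c ((E c).symm _) = g c (freeMul F R c r ((E c).symm n))
      rw [hg, hE, hE])
  have hr' : ∀ c i n, Deformation.red F R c i ((E c).symm n) = Deformation.red F R c i n :=
    fun c i n => by rw [← hr, hE]
  let M' : PreModel F R :=
    { act := fun c =>
        { toFun := fun a => g c ∘ₗ M.act c a ∘ₗ (E c).symm.toLinearMap
          map_add' := fun a b => by ext; simp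
          map_smul' := fun t a => by ext; simp }
      act_lin := fun c a => (hg c).comp ((M.act_lin c a).comp (hl c))
      act_red := fun c a i n => by
        change Deformation.red F R c i (g c (M.act c a ((E c).symm n))) = _
        rw [hr, M.act_red, hr']
      map := fun {c d} φ => g d ∘ₗ M.map φ ∘ₗ (E c).symm.toLinearMap
      map_lin := fun {c d} φ => (hg d).comp ((M.map_lin φ).comp (hl c))
      map_red := fun {c d} φ i n => by
        change Deformation.red F R d i (g d (M.map φ ((E c).symm n))) = _
        rw [hr, M.map_red, hr'] }
  refine ⟨M', ⟨g, hg, hr, fun c a n => ?_, fun {c d} φ n => ?_⟩, rfl⟩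
  · change _ = g c (M.act c a ((E c).symm (g c n)))
    rw [hE']
  · change _ = g d (M.map φ ((E c).symm (g c n)))
    rw [hE']

theorem Gauge.isExact {m : ℕ} (hR : R.rad ^ m = ⊥) {M M' : PreModel F R} (g : Gauge M M')
    (h : M.IsExact) : M'.IsExact := by
  have hs : ∀ c, Function.Surjective (g.app c) := fun c => (g.bijective hR c).2
  refine ⟨fun c n => ?_, fun c a b n => ?_, fun c n => ?_, fun {c d e} φ ψ n => ?_,
    fun {c d} φ a n => ?_⟩ <;> obtain ⟨n, rfl⟩ := hs c n
  · rw [← g.act, h.act_one]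
  · rw [← g.act, ← g.act, ← g.act, h.act_mul]
  · rw [← g.map, h.map_id]
  · rw [← g.map, ← g.map, ← g.map, h.map_comp]
  · rw [← g.act, ← g.map, ← g.map, ← g.act, h.map_act]

/-- A gauge transformation lifts along a surjection, with its source. -/
theorem Gauge.exists_lifts {m : ℕ} (hR : R.rad ^ m = ⊥) {u : R ⟶ S}
    (hu : Function.Surjective (PointedAlg.hom u)) {M : PreModel F R} {N N' : PreModel F S}
    (h : Lifts u M N) (g : Gauge N N') : ∃ M', Lifts u M' N' ∧ ∃ g' : Gauge M M',
      ∀ c n, freeMap F u c (g'.app c n) = g.app c (freeMap F u c n) := by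
  obtain ⟨M', g', hg'⟩ := exists_conj hR M (fun c => pullMap u hu (g.app c))
    (fun c => isRLin_pullMap _ _ _) fun c i n => by
      rw [← red_freeMap u, freeMap_pullMap u hu (g.lin c), g.red, red_freeMap]
  have key : ∀ c n, freeMap F u c (g'.app c n) = g.app c (freeMap F u c n) := fun c n => by
    rw [hg', freeMap_pullMap u hu (g.lin c)]
  refine ⟨M', ⟨fun c a n => ?_, fun {c d} φ n => ?_⟩, g', key⟩ <;>
    obtain ⟨n, rfl⟩ := (g'.bijective hR c).2 n
  · rw [← g'.act, key, h.act, g.act, key]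
  · rw [← g'.map, key, h.map, g.map, key]

/-! ### Gauge transformations and difference cocycles -/

/-- Write g = 1 + o with o valued in K. The relation M'g = gM becomes M' - M = oM - M'o, and the
components of the right side are the differential of the 0-cochain given by -o. -/
theorem Gauge.diff_eq {u : R ⟶ S} (hu : IsSmall u) {M M' : PreModel F R} (g : Gauge M M')
    (hg : ∀ c n, freeMap F u c (g.app c n) = freeMap F u c n) (i j : Fin p) (μ : R →ₗ[k] k) :
    diff M M' i j μ = ghcD (F j) (F i) 0 (mkGHC0 fun c =>
      -freeComp i j μ (g.app c - LinearMap.id)) := by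
  rw [ghcD_mkGHC0, diff]
  have hl : ∀ c, IsRLin (g.app c - LinearMap.id) := fun c => (g.lin c).sub .id
  have hk : ∀ c n, freeMap F u c ((g.app c - LinearMap.id : FreeMod F R c →ₗ[k] _) n) = 0 :=
    fun c n => by
      change freeMap F u c (g.app c n - n) = 0
      rw [map_sub, hg, sub_self]
  have key1 : ∀ c a, freeComp i j μ (M'.act c a - M.act c a) =
      (F i).act c a ∘ₗ (-freeComp i j μ (g.app c - LinearMap.id)) -
        (-freeComp i j μ (g.app c - LinearMap.id)) ∘ₗ (F j).act c a := fun c a => by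
    rw [LinearMap.comp_neg, LinearMap.neg_comp,
      ← freeComp_comp_left hu (M'.act_lin c a) (M'.act_red c a) (hk c),
      ← freeComp_comp_right hu (M.act_red c a) (hl c) (hk c), sub_neg_eq_add, neg_add_eq_sub,
      ← freeComp_sub]
    congr 1
    refine LinearMap.ext fun n => ?_
    simp [g.act]
  have key2 : ∀ {c d : C} (φ : c ⟶ d), -freeComp i j μ (M'.map φ - M.map φ) =
      (-freeComp i j μ (g.app d - LinearMap.id)) ∘ₗ (F j).map φ -
        (F i).map φ ∘ₗ (-freeComp i j μ (g.app c - LinearMap.id)) := fun {c d} φ => by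
    rw [LinearMap.comp_neg, LinearMap.neg_comp,
      ← freeComp_comp_left hu (M'.map_lin φ) (M'.map_red φ) (hk c),
      ← freeComp_comp_right hu (M.map_red φ) (hl d) (hk d), sub_neg_eq_add, neg_add_eq_sub,
      ← freeComp_sub, ← freeComp_neg]
    congr 1
    refine LinearMap.ext fun n => ?_
    simp [g.map]
  exact GHC.ext1 (fun x a => key1 _ _) fun x a => key2 _

/-- The converse of `Gauge.diff_eq`: primitives of the components along a basis of K, with the
opposite sign, assemble to a K-valued o with M' - M = oM - M'o, and then 1 + o intertwines M and M'.
-/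
theorem exists_gauge [Module.Finite k R] {u : R ⟶ S} (hu : IsSmall u) {M M' : PreModel F R}
    (h : Agree u M M') (h0 : ∀ i j μ, diff M M' i j μ ∈ ghcB (F j) (F i) 1) :
    Nonempty (Gauge M M') := by
  choose z hz using h0
  choose f hf using fun i j α => exists_mkGHC0 (z i j (kerDual u i j α))
  let x : ∀ i j, Fin (Module.finrank k (kerSpace u i j)) → R := fun i j α => kerBasis u i j α
  have h1 : ∀ i j α, R.e i * x i j α = x i j α := fun i j α => (kerBasis u i j α).2.2.1
  have h2 : ∀ i j α, x i j α * R.e j = x i j α := fun i j α => (kerBasis u i j α).2.2.2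
  have h3 : ∀ i j α, PointedAlg.hom u (x i j α) = 0 := fun i j α => (kerBasis u i j α).2.1
  let o c : FreeMod F R c →ₗ[k] FreeMod F R c := matMap x fun i j α => -f i j α c
  have ho : ∀ c, IsRLin (o c) := fun c => isRLin_matMap _ _
  have ho' : ∀ c n, freeMap F u c (o c n) = 0 := fun c => freeMap_matMap u h3 _
  have hoc : ∀ c i j μ, freeComp i j μ (o c) = ∑ α, μ (x i j α) • -f i j α c := fun c i j μ =>
    freeComp_matMap h1 h2 _ i j μ
  have hd : ∀ i j α, diff M M' i j (kerDual u i j α) = ghcD (F j) (F i) 0 (mkGHC0 (f i j α)) :=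
    fun i j α => by rw [← hf, hz]
  have hact : ∀ c a, M'.act c a - M.act c a = o c ∘ₗ M.act c a - M'.act c a ∘ₗ o c := fun c a => by
    refine freeComp_ext ((M'.act_lin c a).sub (M.act_lin c a))
      (((ho c).comp (M.act_lin c a)).sub ((M'.act_lin c a).comp (ho c))) fun i j μ => ?_
    rw [freeComp_sub i j μ (o c ∘ₗ _), freeComp_comp_right hu (M.act_red c a) (ho c) (ho' c),
      freeComp_comp_left hu (M'.act_lin c a) (M'.act_red c a) (ho' c), hoc,
      freeComp_eq_sum u ((M'.act_lin c a).sub (M.act_lin c a)) (h.act c a)]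
    have : ∀ α, freeComp i j (kerDual u i j α) (M'.act c a - M.act c a) =
        (F i).act c a ∘ₗ f i j α c - f i j α c ∘ₗ (F j).act c a := fun α => by
      have := congrArg (fun z => ghcComp 0 1 rfl z (ComposableArrows.mk₀ c) ![a]) (hd i j α)
      rw [ghcD_mkGHC0] at this
      exact this
    refine LinearMap.ext fun n => ?_
    simp only [this, LinearMap.sum_apply, LinearMap.sub_apply, LinearMap.comp_apply,
      LinearMap.smul_apply, map_sum, map_smul, LinearMap.neg_apply, map_neg, smul_sub, smul_neg,
      Finset.sum_sub_distrib, Finset.sum_neg_distrib]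
    abel
  have hmap : ∀ {c d : C} (φ : c ⟶ d), M'.map φ - M.map φ = o d ∘ₗ M.map φ - M'.map φ ∘ₗ o c :=
      fun {c d} φ => by
    refine freeComp_ext ((M'.map_lin φ).sub (M.map_lin φ))
      (((ho d).comp (M.map_lin φ)).sub ((M'.map_lin φ).comp (ho c))) fun i j μ => ?_
    rw [freeComp_sub i j μ (o d ∘ₗ _), freeComp_comp_right hu (M.map_red φ) (ho d) (ho' d),
      freeComp_comp_left hu (M'.map_lin φ) (M'.map_red φ) (ho' c), hoc, hoc,
      freeComp_eq_sum u ((M'.map_lin φ).sub (M.map_lin φ)) (h.map φ)]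
    have : ∀ α, freeComp i j (kerDual u i j α) (M'.map φ - M.map φ) =
        (F i).map φ ∘ₗ f i j α c - f i j α d ∘ₗ (F j).map φ := fun α => by
      have := congrArg (fun z => ghcComp 1 0 rfl z (ComposableArrows.mk₁ φ) ![]) (hd i j α)
      rw [ghcD_mkGHC0] at this
      have h' : -freeComp i j (kerDual u i j α) (M'.map φ - M.map φ) =
        f i j α d ∘ₗ (F j).map φ - (F i).map φ ∘ₗ f i j α c := this
      rw [← neg_neg (freeComp _ _ _ _), h', neg_sub]
    refine LinearMap.ext fun n => ?_
    simp only [this, LinearMap.sum_apply, LinearMap.sub_apply, LinearMap.comp_apply,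
      LinearMap.smul_apply, map_sum, map_smul, LinearMap.neg_apply, map_neg, smul_sub, smul_neg,
      Finset.sum_sub_distrib, Finset.sum_neg_distrib]
    abel
  refine ⟨⟨fun c => LinearMap.id + o c, fun c => .add .id (ho c), fun c i n => ?_, fun c a n => ?_,
    fun {c d} φ n => ?_⟩⟩
  · rw [LinearMap.add_apply, map_add, ← red_freeMap u i (o c n), ho', map_zero, add_zero]
    rfl
  · have := LinearMap.congr_fun (hact c a) n
    simp only [LinearMap.sub_apply, LinearMap.comp_apply] at this
    simp only [LinearMap.add_apply, LinearMap.id_apply, map_add]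
    rw [sub_eq_sub_iff_add_eq_add] at this
    rw [this, add_comm]
  · have := LinearMap.congr_fun (hmap φ) n
    simp only [LinearMap.sub_apply, LinearMap.comp_apply] at this
    simp only [LinearMap.add_apply, LinearMap.id_apply, map_add]
    rw [sub_eq_sub_iff_add_eq_add] at this
    rw [this, add_comm]

/-! ### Obstructions of models -/

/-- `w` is the obstruction for lifting the model `M` along `u`. -/
def Obs (u : R ⟶ S) (M : PreModel F S) (w : ∀ i j, Module.Dual k (HH (F j) (F i) 2) →ₗ[k] R) :
    Prop :=
  (∀ i j v, PointedAlg.hom u (w i j v) = 0) ∧ ∃ L : PreModel F R, Lifts u L M ∧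
    ∀ i j μ, ∃ hz : L.obs i j μ ∈ ghcZ (F j) (F i) 2, ∀ v : Module.Dual k (HH (F j) (F i) 2),
      v (cls _ hz) = μ (w i j v)

/-- Extending scalars of operators amounts to pulling back linear forms, which makes naturality of
obstructions formal. -/
theorem obs_of_lifts {f : R ⟶ R'} {L : PreModel F R} {L' : PreModel F R'} (h : Lifts f L L')
    (i j : Fin p) (μ : R' →ₗ[k] k) :
    L'.obs i j μ = L.obs i j (μ ∘ₗ (PointedAlg.hom f).toLinearMap) := by
  refine GHC.ext2 (fun x a => ?_) (fun x a => ?_) fun x a => ?_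
  · refine freeComp_freeMap (f := L.defAct _ _ _) (g := L'.defAct _ _ _) f (fun n => ?_) i j μ
    simp [defAct, h.act]
  · refine freeComp_freeMap (f := L.defMix _ _) (g := L'.defMix _ _) f (fun n => ?_) i j μ
    simp [defMix, h.act, h.map]
  · refine freeComp_freeMap (f := L.defMap _ _) (g := L'.defMap _ _) f (fun n => ?_) i j μ
    simp [defMap, h.map]

/-- Obstructions are natural. -/
theorem Obs.push {u : R ⟶ S} {u' : R' ⟶ S'} {f : R ⟶ R'} {g : S ⟶ S'} (hfg : f ≫ u' = u ≫ g)
    {M : PreModel F S} {w : ∀ i j, Module.Dual k (HH (F j) (F i) 2) →ₗ[k] R} (h : Obs u M w) :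
    Obs u' (M.push g) fun i j => (PointedAlg.hom f).toLinearMap ∘ₗ w i j := by
  obtain ⟨h0, L, hL, h⟩ := h
  refine ⟨fun i j v => ?_, L.push f, ?_, fun i j μ => ?_⟩
  · change PointedAlg.hom (f ≫ u') (w i j v) = 0
    rw [hfg, PointedAlg.hom_comp, h0, map_zero]
  · exact (lifts_push f L).of_comp (hfg ▸ hL.comp (lifts_push g M))
  · obtain ⟨hz, h⟩ := h i j (μ ∘ₗ (PointedAlg.hom f).toLinearMap)
    have := obs_of_lifts (lifts_push f L) i j μ
    refine ⟨this ▸ hz, fun v => ?_⟩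
    refine Eq.trans ?_ (h v)
    congr 2

theorem eq_of_forall_form {x y : R} (h : ∀ μ : R →ₗ[k] k, μ x = μ y) : x = y := by
  rw [← sub_eq_zero, ← Module.forall_dual_apply_eq_zero_iff k]
  intro μ
  rw [map_sub, h, sub_self]

/-- The defects of L' are conjugate to those of L by g, and since g reduces to the identity, it is
invisible on K-valued maps from either side. -/
theorem Gauge.obs_eq {u : R ⟶ S} (hu : IsSmall u) {L L' : PreModel F R} {M M' : PreModel F S}
    (h : Lifts u L M) (hM : M.IsExact) (h' : Lifts u L' M') (hM' : M'.IsExact) (g : Gauge L L')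
    (i j : Fin p) (μ : R →ₗ[k] k) : L'.obs i j μ = L.obs i j μ := by
  have hred : ∀ c, ReducesTo (g.app c) fun i => (LinearMap.id : (F i).obj c →ₗ[k] _) := g.red
  refine GHC.ext2 (fun x a => ?_) (fun x a => ?_) fun x a => ?_
  · have key : ∀ c a b, freeComp i j μ (L'.defAct c a b) = freeComp i j μ (L.defAct c a b) :=
      fun c a b => by
        have h1 := freeComp_comp_right hu (hred c) (L'.defAct_lin c a b)
          (freeMap_defAct h' hM' c a b) i j μ
        have h2 := freeComp_comp_left hu (g.lin c) (hred c) (freeMap_defAct h hM c a b) i j μ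
        rw [LinearMap.comp_id] at h1
        rw [LinearMap.id_comp] at h2
        rw [← h1, ← h2]
        congr 1
        refine LinearMap.ext fun n => ?_
        simp [defAct, g.act]
    exact key _ _ _
  · have key : ∀ (c d : C) (φ : c ⟶ d) a, freeComp i j μ (L'.defMix φ a) =
        freeComp i j μ (L.defMix φ a) := fun c d φ a => by
        have h1 := freeComp_comp_right hu (hred c) (L'.defMix_lin φ a)
          (freeMap_defMix h' hM' φ a) i j μ
        have h2 := freeComp_comp_left hu (g.lin d) (hred d) (freeMap_defMix h hM φ a) i j μ
        rw [LinearMap.comp_id] at h1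
        rw [LinearMap.id_comp] at h2
        rw [← h1, ← h2]
        congr 1
        refine LinearMap.ext fun n => ?_
        simp [defMix, g.act, g.map]
    exact key _ _ (x.map' 0 1) (a 0)
  · have key : ∀ (c d e : C) (φ : c ⟶ d) (ψ : d ⟶ e), freeComp i j μ (L'.defMap φ ψ) =
        freeComp i j μ (L.defMap φ ψ) := fun c d e φ ψ => by
        have h1 := freeComp_comp_right hu (hred c) (L'.defMap_lin φ ψ)
          (freeMap_defMap h' hM' φ ψ) i j μ
        have h2 := freeComp_comp_left hu (g.lin e) (hred e) (freeMap_defMap h hM φ ψ) i j μ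
        rw [LinearMap.comp_id] at h1
        rw [LinearMap.id_comp] at h2
        rw [← h1, ← h2]
        congr 1
        refine LinearMap.ext fun n => ?_
        simp [defMap, g.map]
    exact key _ _ _ (x.map' 0 1) (x.map (homOfLE (by decide : (1 : Fin 3) ≤ 2)))

/-- Obstructions are unique, and invariant under gauge transformations. -/
theorem Obs.unique {m : ℕ} (hR : R.rad ^ m = ⊥) {u : R ⟶ S} (hu : IsSmall u) {M M' : PreModel F S}
    (hM : M.IsExact) (hM' : M'.IsExact)
    {w w' : ∀ i j, Module.Dual k (HH (F j) (F i) 2) →ₗ[k] R} (h : Obs u M w)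
    (h' : Obs u M' w') (g : Gauge M M') (i j v) : w i j v = w' i j v := by
  obtain ⟨-, L, hL, h⟩ := h
  obtain ⟨-, L', hL', h'⟩ := h'
  -- Transporting L along a lift of g produces a lift of M' with the same obstruction cochain as L.
  -- It lifts the same model as L', so the two cochains differ by a coboundary.
  obtain ⟨L₂, hL₂, G, -⟩ := Gauge.exists_lifts hR hu.surjective hL g
  refine eq_of_forall_form fun μ => ?_
  obtain ⟨hz, h⟩ := h i j μ
  obtain ⟨hz', h'⟩ := h' i j μ
  rw [← h v, ← h' v]
  congr 1
  rw [cls_eq, obs_sub hu (hL₂.agree hL'), ← G.obs_eq hu hL hM hL₂ hM', sub_sub_cancel]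
  exact ⟨_, rfl⟩

/-- The classes of the components along the dual basis of e_i K e_j, paired with v, are the
coordinates of w i j v. Compatibility with the idempotents is recorded because w is later lifted to
values of a morphism on the generators of T^2. -/
theorem exists_obs [Module.Finite k R] {u : R ⟶ S} (hu : IsSmall u) {M : PreModel F S}
    (hM : M.IsExact) : ∃ w, Obs u M w ∧
      (∀ i j v, R.e i * w i j v = w i j v) ∧ ∀ i j v, w i j v * R.e j = w i j v := by
  obtain ⟨L, hL⟩ := exists_lifts u hu.surjective M
  have hZ := obs_mem hu hL hM
  let w : ∀ i j, Module.Dual k (HH (F j) (F i) 2) →ₗ[k] kerSpace u i j := fun i j =>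
    ∑ α, (LinearMap.applyₗ (cls _ (hZ i j (kerDual u i j α)))).smulRight (kerBasis u i j α)
  refine ⟨fun i j => (kerSpace u i j).subtype ∘ₗ w i j, ⟨fun i j v => (w i j v).2.1, L, hL,
    fun i j μ => ⟨hZ i j μ, fun v => ?_⟩⟩, fun i j v => (w i j v).2.2.1, fun i j v => (w i j v).2.2.2⟩
  have h1 : cls _ (hZ i j μ) =
      ∑ α, μ (kerBasis u i j α : R) • cls _ (hZ i j (kerDual u i j α)) := by
    have : (⟨_, hZ i j μ⟩ : ghcZ (F j) (F i) 2) =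
        ∑ α, μ (kerBasis u i j α : R) • ⟨_, hZ i j (kerDual u i j α)⟩ := by
      refine Subtype.ext ?_
      simpa using obs_eq_sum hL hM i j μ
    refine (congrArg (Submodule.mkQ _) this).trans ?_
    simp only [map_sum, map_smul]
    rfl
  rw [h1]
  simp [w, mul_comm]

theorem Lifts.obs_zero {u : R ⟶ S} {L : PreModel F R} {M : PreModel F S} (h : Lifts u L M)
    (hL : L.IsExact) : Obs u M 0 := by
  refine ⟨fun i j v => map_zero _, L, h, fun i j μ => ⟨?_, fun v => ?_⟩⟩
  · rw [hL.obs_eq_zero]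
    exact Submodule.zero_mem _
  · have : cls (L.obs i j μ) (by rw [hL.obs_eq_zero]; exact Submodule.zero_mem _) = 0 := by
      rw [cls_eq_zero, hL.obs_eq_zero]
      exact Submodule.zero_mem _
    rw [this, map_zero]
    exact (map_zero μ).symm

/-- Every linear form on H^2 kills the class, so the obstruction cochain is a coboundary for every
μ. Feeding primitives along a basis of K to `exists_diff` changes the lift so that its obstruction
cochain becomes zero. -/
theorem Obs.exists_isExact [Module.Finite k R] {u : R ⟶ S} (hu : IsSmall u) {M : PreModel F S}
    (hM : M.IsExact) (h : Obs u M 0) : ∃ L : PreModel F R, Lifts u L M ∧ L.IsExact := by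
  obtain ⟨-, L, hL, h⟩ := h
  have hB : ∀ i j μ, L.obs i j μ ∈ ghcB (F j) (F i) 2 := fun i j μ => by
    obtain ⟨hz, h⟩ := h i j μ
    rw [← cls_eq_zero (hz := hz), ← Module.forall_dual_apply_eq_zero_iff k]
    exact fun v => (h v).trans (map_zero μ)
  choose z hz using fun i j (α : Fin (Module.finrank k (kerSpace u i j))) =>
    (show ∃ z, ghcD (F j) (F i) 1 z = L.obs i j (kerDual u i j α) from hB i j _)
  obtain ⟨L', hA, hd⟩ := exists_diff L (x := fun i j α => (kerBasis u i j α : R))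
    (fun i j α => (kerBasis u i j α).2.2.1) (fun i j α => (kerBasis u i j α).2.2.2)
    (fun i j α => R.mem_rad.2 (by
      rw [← PointedAlg.aug_hom u, (kerBasis u i j α).2.1, map_zero])) z
  have hA := hA S u fun i j α => (kerBasis u i j α).2.1
  have hL' := hA.lifts hL
  refine ⟨L', hL', isExact_of_obs_eq_zero hu hL' hM fun i j μ => ?_⟩
  rw [obs_sub hu hA, hd, obs_eq_sum hL hM i j μ]
  simp only [map_sum, map_smul, hz, sub_self]

theorem diff_of_lifts {f : R ⟶ R'} {L M : PreModel F R} {L' M' : PreModel F R'} (h : Lifts f L L')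
    (h' : Lifts f M M') (i j : Fin p) (μ : R' →ₗ[k] k) :
    diff L' M' i j μ = diff L M i j (μ ∘ₗ (PointedAlg.hom f).toLinearMap) := by
  refine GHC.ext1 (fun x a => ?_) (fun x a => ?_)
  · refine freeComp_freeMap (f := M.act _ (a 0) - L.act _ (a 0))
      (g := M'.act _ (a 0) - L'.act _ (a 0)) f (fun n => ?_) i j μ
    simp [h.act, h'.act]
  · refine congrArg Neg.neg (freeComp_freeMap (f := M.map (x.map' 0 1) - L.map (x.map' 0 1))
      (g := M'.map (x.map' 0 1) - L'.map (x.map' 0 1)) f (fun n => ?_) i j μ)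
    simp [h.map, h'.map]

/-- Both obstruction cochains vanish, so `obs_sub` leaves the differential of the difference equal
to zero. -/
theorem diff_mem {u : R ⟶ S} (hu : IsSmall u) {L L' : PreModel F R} (h : Agree u L L')
    (hL : L.IsExact) (hL' : L'.IsExact) (i j : Fin p) (μ : R →ₗ[k] k) :
    diff L L' i j μ ∈ ghcZ (F j) (F i) 1 := by
  have := obs_sub hu h i j μ
  rw [hL.obs_eq_zero, hL'.obs_eq_zero, zero_sub, eq_comm, neg_eq_zero] at this
  exact this

/-- `w` is the class of the difference of `L` and `L'` in `HH^1 ⊗ ker u`. -/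
def DiffClass (L L' : PreModel F R) (w : ∀ i j, Module.Dual k (HH (F j) (F i) 1) →ₗ[k] R) : Prop :=
  ∀ i j (μ : R →ₗ[k] k), (∀ a, μ (R.incl a) = 0) → ∃ hz : diff L L' i j μ ∈ ghcZ (F j) (F i) 1,
    ∀ v : Module.Dual k (HH (F j) (F i) 1), v (cls _ hz) = μ (w i j v)

end PreModel

end Gauges

/-! ### Liftings in coordinates: the dictionary between liftings and models -/

section Frames

variable {k : Type u} [Field k] {C : Type u} [SmallCategory C] {A : C ⥤ AlgCat.{u} k} {p : ℕ}
  {F : Fin p → ModPresheaf A} {R S R' S' T : PointedAlg k p} {c d e : C}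

/-- The reduction `X(c) → F_i(c)` of a lifting. -/
def rho (X : Lifting F R) (i : Fin p) (c : C) : X.obj.obj c →ₗ[k] (F i).obj c :=
  app (X.iso i).hom c ∘ₗ (X.obj.tmk (simpleMod R i) c).flip 1

theorem rho_ract (X : Lifting F R) (i : Fin p) (c : C) (r : R) (x) :
    rho X i c (X.obj.ract c (op r) x) = R.aug r i • rho X i c x := by
  rw [← map_smul]
  change app (X.iso i).hom c (X.obj.tmk (simpleMod R i) c _ 1) =
    app (X.iso i).hom c (X.obj.tmk (simpleMod R i) c _ 1)
  rw [tmk_smul, map_smul, LinearMap.smul_apply, ← map_smul, simpleMod_apply, smul_eq_mul]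

theorem rho_act (X : Lifting F R) (i : Fin p) (c : C) (a : A.obj c) (x) :
    rho X i c (X.obj.act c a x) = (F i).act c a (rho X i c x) :=
  app_act (X.iso i).hom c a (X.obj.tmk (simpleMod R i) c x 1)

theorem rho_map (X : Lifting F R) (i : Fin p) (φ : c ⟶ d) (x) :
    rho X i d (X.obj.map φ x) = (F i).map φ (rho X i c x) :=
  app_map (X.iso i).hom φ (X.obj.tmk (simpleMod R i) c x 1)

theorem iso_tmk (X : Lifting F R) (i : Fin p) (c : C) (x) (t : k) :
    app (X.iso i).hom c (X.obj.tmk (simpleMod R i) c x t) = t • rho X i c x := by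
  rw [← map_smul]
  change _ = app (X.iso i).hom c (X.obj.tmk (simpleMod R i) c _ 1)
  rw [map_smul, LinearMap.smul_apply, ← map_smul, smul_eq_mul, mul_one]

theorem iso_hom_bijective (X : Lifting F R) (i : Fin p) (c : C) :
    Function.Bijective (app (X.iso i).hom c) := by
  refine Function.bijective_iff_has_inverse.2 ⟨app (X.iso i).inv c, fun x => ?_, fun x => ?_⟩
  · exact congrArg (fun f => app f c x) (X.iso i).hom_inv_id
  · exact congrArg (fun f => app f c x) (X.iso i).inv_hom_id

theorem rho_surjective (X : Lifting F R) (i : Fin p) (c : C) : Function.Surjective (rho X i c) := by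
  intro f
  obtain ⟨y, rfl⟩ := (iso_hom_bijective X i c).2 f
  induction y using tensor_ind with
  | h x t => exact ⟨t • x, by rw [map_smul, iso_tmk]⟩
  | add a b ha hb =>
    obtain ⟨x, hx⟩ := ha
    obtain ⟨y, hy⟩ := hb
    exact ⟨x + y, by rw [map_add, map_add, hx, hy]⟩

/-- `R`-linear maps from the free module to a lifting that are compatible with the reductions are
bijective. -/
theorem frame_bijective {m : ℕ} (hR : R.rad ^ m = ⊥) (X : Lifting F R) (c : C)
    (θ : FreeMod F R c →ₗ[k] X.obj.obj c)
    (hθ : ∀ r n, θ (freeMul F R c r n) = X.obj.ract c (op r) (θ n))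
    (hr : ∀ i n, rho X i c (θ n) = red F R c i n) : Function.Bijective θ := by
  obtain ⟨E, hE⟩ := X.free c
  have hE' : ∀ r n, E.symm (freeMul F R c r n) = X.obj.ract c (op r) (E.symm n) := fun r n => by
    rw [LinearEquiv.symm_apply_eq, hE, E.apply_symm_apply]
  -- The coordinates E given by freeness need not respect the reductions to F_i(c); the endomorphism
  -- g i measures the discrepancy.
  let g i : (F i).obj c →ₗ[k] (F i).obj c := rho X i c ∘ₗ E.symm.toLinearMap ∘ₗ freeIncl F R c i
  have hg : ∀ i n, rho X i c (E.symm n) = g i (red F R c i n) := fun i n => by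
    induction n using free_ind with
    | zero => simp
    | h j f a =>
      rw [hE', rho_ract, red_freeMul, map_smul]
      rcases eq_or_ne j i with rfl | hj
      · rw [red_freeIncl_self]
        rfl
      · rw [red_freeIncl_ne hj, ← freeMul_e_freeIncl, hE', rho_ract, aug_e, if_neg hj.symm]
        simp
    | add a b ha hb => simp only [map_add, ha, hb]
  -- A vector killed by g i has zero class in X ⊗ k_i, because X ⊗ k_i → F_i is injective. The
  -- reduction in the coordinates E factors through X ⊗ k_i, so it vanishes as well.
  have hinj : ∀ i, Function.Injective (g i) := fun i => by
    rw [injective_iff_map_eq_zero]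
    intro f hf
    have h1 : X.obj.tmk (simpleMod R i) c (E.symm (freeIncl F R c i f)) 1 = 0 :=
      (iso_hom_bijective X i c).1 (by rw [map_zero]; exact hf)
    have h2 := congrArg (tlift (X := X.obj) (l := simpleMod R i)
      (LinearMap.mk₂ k (fun x (t : k) => t • red F R c i (E x)) (fun _ _ _ => by simp)
        (fun t x s => by simp [smul_comm t]) (fun x s t => by simp [add_smul])
        (fun t x s => by simp [mul_smul])) fun x r t => by
          simp [hE, red_freeMul, smul_smul, mul_comm]) h1
    rw [map_zero] at h2
    have h3 : (1 : k) • red F R c i (E (E.symm (freeIncl F R c i f))) = 0 := h2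
    rwa [one_smul, E.apply_symm_apply, red_freeIncl_self] at h3
  have hα : ∀ i n, g i (red F R c i (E (θ n))) = red F R c i n := fun i n => by
    rw [← hg, E.symm_apply_apply, hr]
  have hgl : ∀ i n, red F R c i (freeExt (fun i => freeIncl F R c i ∘ₗ g i) n) =
    g i (red F R c i n) := PreModel.reducesTo_freeExt g
  have hαl : IsRLin (E.toLinearMap ∘ₗ θ) := fun r n => by
    change E (θ _) = _
    rw [hθ, hE]
    rfl
  have hγl : IsRLin (freeExt (fun i => freeIncl F R c i ∘ₗ g i)) := isRLin_freeExt _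
  -- Let γ be the linear extension of the g i. Both γEθ and Eθγ reduce to the identity, so both are
  -- bijective, and hence so is Eθ.
  have h1 := bijective_of_red hR (hγl.comp hαl) fun i n => by
    rw [LinearMap.comp_apply, hgl]
    exact hα i n
  have h2 := bijective_of_red hR (hαl.comp hγl) fun i n => by
    apply hinj i
    refine (hα i _).trans (hgl i n)
  have h3 : Function.Bijective (E ∘ θ) := ⟨Function.Injective.of_comp h1.1,
    Function.Surjective.of_comp (g := freeExt (fun i => freeIncl F R c i ∘ₗ g i)) h2.2⟩
  exact (Function.Bijective.of_comp_iff' E.bijective θ).1 h3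

/-- An isomorphism of a model with a lifting. -/
structure Frame (X : Lifting F R) (M : PreModel F R) where
  app : ∀ c, FreeMod F R c →ₗ[k] X.obj.obj c
  lin : ∀ c r n, app c (freeMul F R c r n) = X.obj.ract c (op r) (app c n)
  red : ∀ c i n, rho X i c (app c n) = red F R c i n
  act : ∀ c a n, app c (M.act c a n) = X.obj.act c a (app c n)
  map : ∀ {c d : C} (φ : c ⟶ d) n, app d (M.map φ n) = X.obj.map φ (app c n)

namespace Frame

theorem bijective {m : ℕ} (hR : R.rad ^ m = ⊥) {X : Lifting F R} {M : PreModel F R} (θ : Frame X M)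
    (c : C) : Function.Bijective (θ.app c) :=
  frame_bijective hR X c _ (θ.lin c) (θ.red c)

theorem isExact {m : ℕ} (hR : R.rad ^ m = ⊥) {X : Lifting F R} {M : PreModel F R}
    (θ : Frame X M) : M.IsExact where
  act_one c n := (θ.bijective hR c).1 (by simp [θ.act])
  act_mul c a b n := (θ.bijective hR c).1 (by simp [θ.act])
  map_id c n := (θ.bijective hR c).1 (by rw [θ.map, X.obj.map_id])
  map_comp {c d e} φ ψ n := (θ.bijective hR e).1 (by rw [θ.map, θ.map, θ.map, X.obj.map_comp])
  map_act {c d} φ a n := (θ.bijective hR d).1 (by rw [θ.map, θ.act, θ.act, θ.map, X.obj.map_act])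

/-- Liftings over nilpotent algebras are given by models. -/
theorem exists_of_app {m : ℕ} (hR : R.rad ^ m = ⊥) (X : Lifting F R)
    (θ : ∀ c, FreeMod F R c →ₗ[k] X.obj.obj c)
    (hθ : ∀ c r n, θ c (freeMul F R c r n) = X.obj.ract c (op r) (θ c n))
    (hr : ∀ c i n, rho X i c (θ c n) = Deformation.red F R c i n) :
    ∃ (M : PreModel F R) (f : Frame X M), f.app = θ := by
  let E c := LinearEquiv.ofBijective (θ c) (frame_bijective hR X c _ (hθ c) (hr c))
  have hE : ∀ c x, θ c ((E c).symm x) = x := fun c x => (E c).apply_symm_apply x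
  have hl : ∀ c r x, (E c).symm (X.obj.ract c (op r) x) = freeMul F R c r ((E c).symm x) :=
    fun c r x => by
      rw [LinearEquiv.symm_apply_eq]
      change _ = θ c _
      rw [hθ, hE]
  have hr' : ∀ c i x, Deformation.red F R c i ((E c).symm x) = rho X i c x := fun c i x => by
    rw [← hr, hE]
  refine ⟨{ act := fun c =>
              { toFun := fun a => (E c).symm.toLinearMap ∘ₗ X.obj.act c a ∘ₗ θ c
                map_add' := fun a b => by refine LinearMap.ext fun n => ?_; simp
                map_smul' := fun t a => by refine LinearMap.ext fun n => ?_; simp }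
            act_lin := fun c a r n => ?_
            act_red := fun c a i n => ?_
            map := fun {c d} φ => (E d).symm.toLinearMap ∘ₗ X.obj.map φ ∘ₗ θ c
            map_lin := fun {c d} φ r n => ?_
            map_red := fun {c d} φ i n => ?_ }, ⟨θ, hθ, hr, fun c a n => hE c _,
              fun {c d} φ n => hE d _⟩, rfl⟩
  · change (E c).symm (X.obj.act c a (θ c _)) = freeMul F R c r ((E c).symm _)
    rw [hθ, ← X.obj.ract_act, hl]
    rfl
  · change Deformation.red F R c i ((E c).symm _) = _
    rw [hr', ← hr]
    exact rho_act _ _ _ _ _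
  · change (E d).symm (X.obj.map φ (θ c _)) = freeMul F R d r ((E d).symm _)
    rw [hθ, X.obj.ract_map, hl]
    rfl
  · change Deformation.red F R d i ((E d).symm _) = _
    rw [hr', ← hr]
    exact rho_map _ _ _ _

/-- Linear sections of the reductions X(c) → F_i(c) extend R-linearly from the generators f ⊗ e_i.
By `frame_bijective` the result is a system of coordinates compatible with the reductions. -/
theorem exists_app (X : Lifting F R) (c : C) : ∃ θ : FreeMod F R c →ₗ[k] X.obj.obj c,
    (∀ r n, θ (freeMul F R c r n) = X.obj.ract c (op r) (θ n)) ∧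
    ∀ i n, rho X i c (θ n) = Deformation.red F R c i n := by
  choose s hs using fun i => (rho X i c).exists_rightInverse_of_surjective
    (LinearMap.range_eq_top.2 (rho_surjective X i c))
  refine ⟨freeLift (X.obj.ract c) s, freeLift_freeMul _ _, fun i n => ?_⟩
  induction n using free_ind with
  | zero => simp
  | h j f a =>
    rw [freeLift_freeMul, rho_ract, freeLift_freeIncl, rho_ract, red_freeMul, aug_e]
    congr 1
    rcases eq_or_ne j i with rfl | hj
    · rw [if_pos rfl, one_smul, red_freeIncl_self]
      exact LinearMap.congr_fun (hs j) f
    · rw [if_neg hj.symm, zero_smul, red_freeIncl_ne hj]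
  | add a b ha hb => simp only [map_add, ha, hb]

theorem exists_frame {m : ℕ} (hR : R.rad ^ m = ⊥) (X : Lifting F R) :
    ∃ M : PreModel F R, Nonempty (Frame X M) := by
  choose θ h1 h2 using exists_app X
  obtain ⟨M, f, -⟩ := exists_of_app hR X θ h1 h2
  exact ⟨M, ⟨f⟩⟩

/-- The gauge transformation between two models of a lifting. -/
def gauge {m : ℕ} (hR : R.rad ^ m = ⊥) {X : Lifting F R} {M M' : PreModel F R} (θ : Frame X M)
    (θ' : Frame X M') : M.Gauge M' :=
  let E c := LinearEquiv.ofBijective (θ'.app c) (θ'.bijective hR c)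
  have hE : ∀ c x, θ'.app c ((E c).symm x) = x := fun c x => (E c).apply_symm_apply x
  { app := fun c => (E c).symm.toLinearMap ∘ₗ θ.app c
    lin := fun c r n => (θ'.bijective hR c).1 (by
      change θ'.app c ((E c).symm _) = θ'.app c (freeMul F R c r ((E c).symm _))
      rw [hE, θ'.lin, hE, θ.lin])
    red := fun c i n => by
      rw [← θ'.red]
      refine (congrArg _ (hE c _)).trans (θ.red c i n)
    act := fun c a n => (θ'.bijective hR c).1 (by
      change θ'.app c ((E c).symm _) = θ'.app c (M'.act c a ((E c).symm _))
      rw [hE, θ'.act, hE, θ.act])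
    map := fun {c d} φ n => (θ'.bijective hR d).1 (by
      change θ'.app d ((E d).symm _) = θ'.app d (M'.map φ ((E c).symm _))
      rw [hE, θ'.map, hE, θ.map]) }

/-- Frames can be composed with gauge transformations. -/
def comp {X : Lifting F R} {M M' : PreModel F R} (θ : Frame X M') (g : M.Gauge M') : Frame X M where
  app c := θ.app c ∘ₗ g.app c
  lin c r n := by rw [LinearMap.comp_apply, g.lin, θ.lin]; rfl
  red c i n := by rw [LinearMap.comp_apply, θ.red, g.red]
  act c a n := by rw [LinearMap.comp_apply, g.act, θ.act]; rfl
  map φ n := by rw [LinearMap.comp_apply, g.map, θ.map]; rfl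

/-- Frames can be transported to equivalent liftings. -/
theorem of_equivalent {X Y : Lifting F R} {M : PreModel F R} (θ : Frame X M)
    (h : X.Equivalent Y) : Nonempty (Frame Y M) := by
  obtain ⟨τ, h⟩ := h
  refine ⟨⟨fun c => ModPresheaf.app (hom τ.hom) c ∘ₗ θ.app c, fun c r n => ?_, fun c i n => ?_,
    fun c a n => ?_, fun {c d} φ n => ?_⟩⟩
  · rw [LinearMap.comp_apply, θ.lin, app_ract]; rfl
  · rw [← θ.red]
    change _ = ModPresheaf.app (X.iso i).hom c _
    rw [← h i]
    rfl
  · rw [LinearMap.comp_apply, θ.act, app_act]; rfl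
  · rw [LinearMap.comp_apply, θ.map, app_map]; rfl

theorem equivalent {m : ℕ} (hR : R.rad ^ m = ⊥) {X Y : Lifting F R} {M : PreModel F R}
    (θ : Frame X M) (θ' : Frame Y M) : X.Equivalent Y := by
  let E c := LinearEquiv.ofBijective (θ.app c) (θ.bijective hR c)
  let E' c := LinearEquiv.ofBijective (θ'.app c) (θ'.bijective hR c)
  have hE : ∀ c n, (E c).symm (θ.app c n) = n := fun c n => (E c).symm_apply_apply n
  have hs : ∀ c, Function.Surjective (θ.app c) := fun c => (θ.bijective hR c).2
  let f : X.obj ⟶ Y.obj :=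
    { hom :=
        { app := fun c => θ'.app c ∘ₗ (E c).symm.toLinearMap
          app_act := fun c a x => by
            obtain ⟨n, rfl⟩ := hs c x
            change θ'.app c ((E c).symm _) = Y.obj.act c a (θ'.app c ((E c).symm _))
            rw [← θ.act, hE, hE, θ'.act]
          naturality := fun {c d} φ x => by
            obtain ⟨n, rfl⟩ := hs c x
            change θ'.app d ((E d).symm _) = Y.obj.map φ (θ'.app c ((E c).symm _))
            rw [← θ.map, hE, hE, θ'.map] }
      app_ract := fun c r x => by
        obtain ⟨n, rfl⟩ := hs c x
        obtain ⟨r, rfl⟩ := op_surjective r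
        change θ'.app c ((E c).symm _) = Y.obj.ract c _ (θ'.app c ((E c).symm _))
        rw [← θ.lin, hE, hE, θ'.lin] }
  refine ⟨RObj.isoOfInv f (fun c => θ.app c ∘ₗ (E' c).symm.toLinearMap) (fun c x => ?_)
    (fun c y => ?_), fun i => tensor_hom_ext fun c x t => ?_⟩
  · exact (congrArg (θ.app c) ((E' c).symm_apply_apply _)).trans ((E c).apply_symm_apply x)
  · exact (congrArg (θ'.app c) ((E c).symm_apply_apply _)).trans ((E' c).apply_symm_apply y)
  · obtain ⟨n, rfl⟩ := hs c x
    rw [iso_tmk, θ.red]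
    refine (iso_tmk Y i c (θ'.app c ((E c).symm (θ.app c n))) t).trans ?_
    rw [hE, θ'.red]

/-- Base change of frames. -/
def baseChange {X : Lifting F R} {M : PreModel F R} (θ : Frame X M) (u : R ⟶ S) :
    Frame (X.baseChange u) (M.push u) :=
  let f c : FreeMod F S c →ₗ[k] (X.obj.baseChange u).obj c :=
    freeLift ((X.obj.baseChange u).ract c)
      fun i => (X.obj.bmk u c).flip 1 ∘ₗ θ.app c ∘ₗ freeIncl F R c i
  have hlin : ∀ c r n, f c (freeMul F S c r n) = (X.obj.baseChange u).ract c (op r) (f c n) :=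
    fun c => freeLift_freeMul _ _
  have hf : ∀ c n, f c (freeMap F u c n) = X.obj.bmk u c (θ.app c n) 1 := fun c n => by
    induction n using free_ind with
    | zero => simp
    | h i x a =>
      rw [freeMap_freeMul, hlin, freeMap_freeIncl, freeLift_freeIncl, θ.lin, bmk_smul,
        ← freeMul_e_freeIncl F i x, θ.lin]
      simp [bmk_smul, PointedAlg.hom_e]
    | add a b ha hb => simp only [map_add, ha, hb, LinearMap.add_apply]
  { app := f
    lin := hlin
    red := fun c i n => by
      induction n using free_ind with
      | zero => simp
      | h j x a =>
        rw [hlin, rho_ract, red_freeMul, ← freeMap_freeIncl u, hf, red_freeMap, ← θ.red]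
        congr 1
        change ModPresheaf.app (X.iso i).hom c (X.obj.tmk _ c _ (S.aug 1 i * 1)) = _
        simp
        rfl
      | add a b ha hb => simp only [map_add, ha, hb]
    act := fun c a n => by
      induction n using free_ind with
      | zero => simp
      | h j x r =>
        rw [(M.push u).act_lin, hlin, hlin, ← freeMap_freeIncl u, ← (M.lifts_push u).act, hf, hf,
          θ.act, ← (X.obj.baseChange u).ract_act]
        rfl
      | add a b ha hb => simp only [map_add, ha, hb]
    map := fun {c d} φ n => by
      induction n using free_ind with
      | zero => simp
      | h j x r =>
        rw [(M.push u).map_lin, hlin, hlin, ← freeMap_freeIncl u, ← (M.lifts_push u).map, hf, hf,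
          θ.map, (X.obj.baseChange u).ract_map]
        rfl
      | add a b ha hb => simp only [map_add, ha, hb] }

end Frame

/-- The `R`-object defined by an exact model. -/
def PreModel.toRObj (M : PreModel F R) (hM : M.IsExact) : RObj A R where
  obj := fun c => FreeMod F R c
  act := fun c => AlgHom.ofLinearMap (M.act c) (LinearMap.ext (hM.act_one c))
    fun a b => LinearMap.ext (hM.act_mul c a b)
  map := M.map
  map_id := hM.map_id
  map_comp := hM.map_comp
  map_act := hM.map_act
  ract := fun c => freeAct F R c
  ract_act := fun c r a n => (M.act_lin c a r.unop n).symm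
  ract_map := fun φ r n => M.map_lin φ r.unop n

/-- The class of `n ⊗ t` in the tensor product of an exact model with `k_i`. -/
def PreModel.tmk (M : PreModel F R) (hM : M.IsExact) (i : Fin p) (c : C) :
    FreeMod F R c →ₗ[k] k →ₗ[k] ((M.toRObj hM).tensor (simpleMod R i)).obj c :=
  (M.toRObj hM).tmk (simpleMod R i) c

theorem PreModel.tmk_freeMul (M : PreModel F R) (hM : M.IsExact) (i : Fin p) (c : C) (r : R)
    (n : FreeMod F R c) (t : k) :
    M.tmk hM i c (freeMul F R c r n) t = M.tmk hM i c n (R.aug r i * t) :=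
  (M.toRObj hM).tmk_smul (simpleMod R i) c n r t

theorem PreModel.tmk_smul (M : PreModel F R) (hM : M.IsExact) (i : Fin p) (c : C)
    (n : FreeMod F R c) (t : k) : M.tmk hM i c n t = t • M.tmk hM i c n 1 := by
  rw [← map_smul, smul_eq_mul, mul_one]

theorem PreModel.tmk_red (M : PreModel F R) (hM : M.IsExact) (i : Fin p) (c : C)
    (n : FreeMod F R c) : M.tmk hM i c (freeIncl F R c i (red F R c i n)) 1 =
      M.tmk hM i c n 1 := by
  induction n using free_ind with
  | zero => rw [map_zero, map_zero]
  | h j f a =>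
    rw [red_freeMul, tmk_freeMul, mul_one, M.tmk_smul hM i c (freeIncl F R c j f) (R.aug a i),
      map_smul, map_smul, LinearMap.smul_apply]
    congr 1
    rcases eq_or_ne j i with rfl | hj
    · rw [red_freeIncl_self]
    · rw [red_freeIncl_ne hj, map_zero, ← freeMul_e_freeIncl F j f, tmk_freeMul, aug_e,
        if_neg hj.symm, zero_mul, map_zero, map_zero, LinearMap.zero_apply]
  | add a b ha hb => simp only [map_add, LinearMap.add_apply, ha, hb]

/-- The reduction of an exact model. -/
def PreModel.reduction (M : PreModel F R) (hM : M.IsExact) (i : Fin p) (c : C) :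
    ((M.toRObj hM).tensor (simpleMod R i)).obj c →ₗ[k] (F i).obj c :=
  tlift (X := M.toRObj hM) (c := c)
    ((LinearMap.lsmul k ((F i).obj c)).flip ∘ₗ red F R c i :
      FreeMod F R c →ₗ[k] k →ₗ[k] (F i).obj c) fun (x : FreeMod F R c) r t => by
    change t • red F R c i (freeMul F R c r x) = (R.aug r i * t) • red F R c i x
    rw [red_freeMul, smul_smul, mul_comm]

theorem PreModel.reduction_tmk (M : PreModel F R) (hM : M.IsExact) (i : Fin p) (c : C)
    (n : FreeMod F R c) (t : k) :
    M.reduction hM i c (M.tmk hM i c n t) = t • red F R c i n := rfl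

theorem PreModel.tmk_ind {M : PreModel F R} {hM : M.IsExact} {i : Fin p} {c : C}
    {motive : ((M.toRObj hM).tensor (simpleMod R i)).obj c → Prop} (x)
    (h : ∀ n t, motive (M.tmk hM i c n t))
    (add : ∀ a b, motive a → motive b → motive (a + b)) : motive x :=
  tensor_ind x h add

/-- The lifting defined by an exact model. -/
def PreModel.toLifting (M : PreModel F R) (hM : M.IsExact) : Lifting F R where
  obj := M.toRObj hM
  free c := ⟨LinearEquiv.refl k _, fun _ _ => rfl⟩
  iso i := ModPresheaf.isoOfInv
    { app := M.reduction hM i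
      app_act := fun c a x => by
        induction x using PreModel.tmk_ind with
        | h n t =>
          change M.reduction hM i c (M.tmk hM i c (M.act c a n) t) = _
          rw [M.reduction_tmk, M.act_red, M.reduction_tmk, map_smul]
        | add a b ha hb => simp only [map_add, ha, hb]
      naturality := fun {c d} φ x => by
        induction x using PreModel.tmk_ind with
        | h n t =>
          change M.reduction hM i d (M.tmk hM i d (M.map φ n) t) = _
          rw [M.reduction_tmk, M.map_red, M.reduction_tmk, map_smul]
        | add a b ha hb => simp only [map_add, ha, hb] }
    (fun c => (M.tmk hM i c).flip 1 ∘ₗ freeIncl F R c i)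
    (fun c x => by
      induction x using PreModel.tmk_ind with
      | h n t =>
        change M.tmk hM i c (freeIncl F R c i (t • red F R c i n)) 1 = M.tmk hM i c n t
        rw [← map_smul, M.tmk_red hM, map_smul, LinearMap.smul_apply, ← M.tmk_smul]
      | add a b ha hb => simp only [map_add, ha, hb])
    (fun c f => by
      change (1 : k) • red F R c i (freeIncl F R c i f) = f
      rw [one_smul, red_freeIncl_self])

/-- The canonical frame. -/
def PreModel.frame (M : PreModel F R) (hM : M.IsExact) : Frame (M.toLifting hM) M where
  app _ := LinearMap.id
  lin _ _ _ := rfl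
  red c i n := one_smul k (red F R c i n)
  act _ _ _ := rfl
  map _ _ := rfl

/-! ### Obstructions and first order classes -/

/-- The trivial model has coefficients in k^p, where μ vanishes. For such μ the difference from the
trivial model therefore has components L(a) and -L(φ), as in the definition of first order classes.
-/
theorem freeComp_triv_act {μ : R →ₗ[k] k} (hμ : ∀ a, μ (R.incl a) = 0) (i j : Fin p) (c : C)
    (a : A.obj c) : freeComp i j μ ((PreModel.triv F R).act c a) = 0 := by
  refine LinearMap.ext fun x => ?_
  change freeEval F R c i μ ((PreModel.triv F R).act c a (freeIncl F R c j x)) = 0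
  rw [PreModel.triv_act, ← freeMul_e_freeIncl]
  rcases eq_or_ne j i with rfl | hj
  · rw [freeEval_freeMul_freeIncl_self, PointedAlg.e_mul_e, PointedAlg.e, hμ, zero_smul]
  · rw [freeEval_freeMul_freeIncl_ne hj]

theorem freeComp_triv_map {μ : R →ₗ[k] k} (hμ : ∀ a, μ (R.incl a) = 0) (i j : Fin p) (φ : c ⟶ d) :
    freeComp i j μ ((PreModel.triv F R).map φ) = 0 := by
  refine LinearMap.ext fun x => ?_
  change freeEval F R d i μ ((PreModel.triv F R).map φ (freeIncl F R c j x)) = 0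
  rw [PreModel.triv_map, ← freeMul_e_freeIncl]
  rcases eq_or_ne j i with rfl | hj
  · rw [freeEval_freeMul_freeIncl_self, PointedAlg.e_mul_e, PointedAlg.e, hμ, zero_smul]
  · rw [freeEval_freeMul_freeIncl_ne hj]

theorem PreModel.obs_map (L : PreModel F R) (i j : Fin p) (μ : R →ₗ[k] k)
    (x : ComposableArrows C 2) (a) : ghcComp 2 0 rfl (L.obs i j μ) x a =
      freeComp i j μ (L.map (x.map' 1 2) ∘ₗ L.map (x.map' 0 1) - L.map (x.map' 0 2)) := by
  rw [ComposableArrows.map'_comp x 0 1 2]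
  rfl

/-- The map from the free modules over `S` determined by a choice of lifted actions. -/
theorem exists_frame_of_liftedAction {m : ℕ} (hS : S.rad ^ m = ⊥) {u : R ⟶ S}
    (hu : Function.Surjective (PointedAlg.hom u)) {X : Lifting F S} (L : LiftedAction u X) :
    ∃ (M : PreModel F S) (_ : Frame X M) (L' : PreModel F R), L'.Lifts u M ∧
      (∀ c a, L'.act c a = L.act c a) ∧ ∀ {c d : C} (φ : c ⟶ d), L'.map φ = L.map φ := by
  have hq : ∀ i c n, rho X i c (L.q c n) = red F R c i n := L.q_reduction
  -- The surjection `L.q c` from the free module over R factors through the free module over S. In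
  -- the coordinates f the given operators are literally a lift of a model.
  let f c : FreeMod F S c →ₗ[k] X.obj.obj c :=
    freeLift (X.obj.ract c) fun i => L.q c ∘ₗ freeIncl F R c i
  have hlin : ∀ c r n, f c (freeMul F S c r n) = X.obj.ract c (op r) (f c n) :=
    fun c => freeLift_freeMul _ _
  have hf : ∀ c n, f c (freeMap F u c n) = L.q c n := fun c n => by
    induction n using free_ind with
    | zero => simp
    | h i x a =>
      rw [freeMap_freeMul, hlin, freeMap_freeIncl, freeLift_freeIncl, L.q_mul,
        ← R.hom_e u, LinearMap.comp_apply, ← L.q_mul, freeMul_e_freeIncl]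
    | add a b ha hb => simp only [map_add, ha, hb]
  obtain ⟨M, θ, hθ⟩ := Frame.exists_of_app hS X f hlin fun c i n => by
    obtain ⟨n, rfl⟩ := freeMap_surjective u hu n
    rw [hf, hq, red_freeMap]
  refine ⟨M, θ, ⟨L.act, fun c a r n => L.act_mul c a r n, fun c a i n => ?_, L.map,
    fun φ r n => L.map_mul φ r n, fun φ i n => ?_⟩, ⟨fun c a n => ?_, fun {c d} φ n => ?_⟩,
    fun c a => rfl, fun φ => rfl⟩
  · rw [← hq, L.q_act, rho_act, hq]
  · rw [← hq, L.q_map, rho_map, hq]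
  · refine (θ.bijective hS c).1 ?_
    rw [θ.act, hθ, hf, hf, L.q_act]
  · refine (θ.bijective hS d).1 ?_
    rw [θ.map, hθ, hf, hf, L.q_map]

/-- The lifted actions given by a lift of a model. -/
def Frame.liftedAction {m : ℕ} (hS : S.rad ^ m = ⊥) {u : R ⟶ S}
    (hu : Function.Surjective (PointedAlg.hom u)) {X : Lifting F S} {M : PreModel F S}
    (θ : Frame X M) {L : PreModel F R} (h : L.Lifts u M) : LiftedAction u X where
  q c := θ.app c ∘ₗ freeMap F u c
  q_mul c r n := by rw [LinearMap.comp_apply, freeMap_freeMul, θ.lin]; rfl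
  q_surjective c := (θ.bijective hS c).2.comp (freeMap_surjective u hu)
  q_reduction i c n := (θ.red c i _).trans (red_freeMap u i n)
  act := L.act
  act_mul := L.act_lin
  q_act c a n := by rw [LinearMap.comp_apply, h.act, θ.act]; rfl
  map := L.map
  map_mul := L.map_lin
  q_map φ n := by rw [LinearMap.comp_apply, h.map, θ.map]; rfl

theorem Frame.isObstruction {m : ℕ} (hS : S.rad ^ m = ⊥) {u : R ⟶ S}
    (hu : Function.Surjective (PointedAlg.hom u)) {X : Lifting F S} {M : PreModel F S}
    (θ : Frame X M) {w : ∀ i j, Module.Dual k (HH (F j) (F i) 2) →ₗ[k] R} (h : M.Obs u w) :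
    IsObstruction u X w := by
  obtain ⟨h0, L, hL, h⟩ := h
  refine ⟨h0, θ.liftedAction hS hu hL, fun i j μ => ?_⟩
  obtain ⟨hz, h⟩ := h i j μ
  exact ⟨⟨_, hz⟩, fun x a => rfl, fun x a => rfl, fun x a => L.obs_map i j μ x a, h⟩

/-- Together with `Frame.isObstruction` this translates between obstructions of liftings, with all
their choices, and obstructions of models. -/
theorem exists_obs_of_isObstruction {m : ℕ} (hS : S.rad ^ m = ⊥) {u : R ⟶ S}
    (hu : Function.Surjective (PointedAlg.hom u)) {X : Lifting F S}
    {w : ∀ i j, Module.Dual k (HH (F j) (F i) 2) →ₗ[k] R} (h : IsObstruction u X w) :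
    ∃ M : PreModel F S, Nonempty (Frame X M) ∧ M.Obs u w := by
  obtain ⟨h0, L, h⟩ := h
  obtain ⟨M, θ, L', hL, ha, hm⟩ := exists_frame_of_liftedAction hS hu L
  refine ⟨M, ⟨θ⟩, h0, L', hL, fun i j μ => ?_⟩
  obtain ⟨z, h1, h2, h3, h4⟩ := h i j μ
  have : L'.obs i j μ = z.1 := by
    refine GHC.ext2 (fun x a => ?_) (fun x a => ?_) fun x a => ?_
    · rw [h1, ← ha, ← ha, ← ha]
      rfl
    · rw [h2, ← ha, ← ha, ← hm]
      rfl
    · rw [h3, ← hm, ← hm, ← hm]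
      exact L'.obs_map i j μ x a
  exact ⟨this ▸ z.2, fun v => by rw [← h4 v]; congr 2⟩

theorem Frame.isFirstOrderClass {m : ℕ} (hR : R.rad ^ m = ⊥) {X : Lifting F R} {M : PreModel F R}
    (θ : Frame X M) {w : ∀ i j, Module.Dual k (HH (F j) (F i) 1) →ₗ[k] R}
    (h0 : ∀ i j v, w i j v ∈ R.rad) (h : (PreModel.triv F R).DiffClass M w) :
    IsFirstOrderClass X w := by
  refine ⟨h0, θ.liftedAction (L := M) hR (fun x => ⟨x, rfl⟩) ⟨fun c a n => ?_, fun φ n => ?_⟩,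
    fun i j μ hμ => ?_⟩
  · rw [freeMap_id, freeMap_id]
  · rw [freeMap_id, freeMap_id]
  obtain ⟨hz, h⟩ := h i j μ hμ
  refine ⟨⟨_, hz⟩, fun x a => ?_, fun x a => ?_, h⟩
  · refine (freeComp_sub i j μ (M.act _ (a 0)) _).trans ?_
    rw [freeComp_triv_act hμ, sub_zero]
    rfl
  · refine (congrArg Neg.neg (freeComp_sub i j μ (M.map (x.map' 0 1)) _)).trans ?_
    rw [freeComp_triv_map hμ, sub_zero]
    rfl

theorem exists_diffClass_of_isFirstOrderClass {m : ℕ} (hR : R.rad ^ m = ⊥) {X : Lifting F R}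
    {w : ∀ i j, Module.Dual k (HH (F j) (F i) 1) →ₗ[k] R} (h : IsFirstOrderClass X w) :
    ∃ M : PreModel F R, Nonempty (Frame X M) ∧ (PreModel.triv F R).DiffClass M w := by
  obtain ⟨h0, L, h⟩ := h
  obtain ⟨M, θ, L', hL, ha, hm⟩ := exists_frame_of_liftedAction hR (fun x => ⟨x, rfl⟩) L
  have ha' : ∀ c a, M.act c a = L.act c a := fun c a => LinearMap.ext fun n => by
    have := hL.act c a n
    rw [freeMap_id, freeMap_id, ha] at this
    exact this.symm
  have hm' : ∀ {c d : C} (φ : c ⟶ d), M.map φ = L.map φ := fun φ => LinearMap.ext fun n => by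
    have := hL.map φ n
    rw [freeMap_id, freeMap_id, hm] at this
    exact this.symm
  refine ⟨M, ⟨θ⟩, fun i j μ hμ => ?_⟩
  obtain ⟨z, h1, h2, h3⟩ := h i j μ hμ
  have : (PreModel.triv F R).diff M i j μ = z.1 := by
    refine GHC.ext1 (fun x a => ?_) fun x a => ?_
    · rw [h1, ← ha']
      refine (freeComp_sub i j μ (M.act _ (a 0)) _).trans ?_
      rw [freeComp_triv_act hμ, sub_zero]
    · rw [h2, ← hm']
      refine (congrArg Neg.neg (freeComp_sub i j μ (M.map (x.map' 0 1)) _)).trans ?_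
      rw [freeComp_triv_map hμ, sub_zero]
  exact ⟨this ▸ z.2, fun v => by rw [← h3 v]; congr 2⟩

end Frames

section Algebras

open PointedAlg

variable {k : Type u} [Field k] {p : ℕ} {R S T : PointedAlg k p}

/-! ### Finiteness -/

/-- The radical is generated, as a left ideal, by a finite-dimensional subspace. -/
def RadFG (R : PointedAlg k p) : Prop :=
  ∃ P : Submodule k R, P.FG ∧ P ≤ R.rad.restrictScalars k ∧ R.rad.restrictScalars k ≤ ⊤ * P

theorem radFG_of_isNoetherianRing [IsNoetherianRing R] : RadFG R := by
  obtain ⟨s, hs⟩ := IsNoetherian.noetherian R.rad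
  refine ⟨Submodule.span k s, ⟨s, rfl⟩, ?_, fun x hx => ?_⟩
  · rw [Submodule.span_le, ← hs]
    exact Submodule.subset_span
  · have hx' : x ∈ R.rad := hx
    clear hx
    rw [← hs] at hx'
    induction hx' using Submodule.span_induction with
    | mem x hx => exact one_mul x ▸ Submodule.mul_mem_mul Submodule.mem_top (Submodule.subset_span hx)
    | zero => exact Submodule.zero_mem _
    | add a b _ _ ha hb => exact Submodule.add_mem _ ha hb
    | smul t a _ ha =>
      clear * - ha
      rw [smul_eq_mul]
      induction ha using Submodule.mul_induction_on' with
      | mem_mul_mem m _ n hn => exact mul_assoc t m n ▸ Submodule.mul_mem_mul Submodule.mem_top hn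
      | add x _ y _ hx hy => rw [mul_add]; exact Submodule.add_mem _ hx hy

theorem RadFG.map (h : RadFG R) (f : R ⟶ S) (hf : Function.Surjective (hom f)) : RadFG S := by
  obtain ⟨P, h1, h2, h3⟩ := h
  refine ⟨P.map (hom f).toLinearMap, h1.map _, ?_, fun s hs => ?_⟩
  · rintro _ ⟨r, hr, rfl⟩
    exact (S.mem_rad).2 ((aug_hom f r).trans (R.mem_rad.1 (h2 hr)))
  · obtain ⟨r, rfl⟩ := hf s
    have hr : r ∈ R.rad := R.mem_rad.2 ((aug_hom f r).symm.trans (S.mem_rad.1 hs))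
    have := Submodule.mem_map_of_mem (f := (hom f).toLinearMap) (h3 hr)
    rw [Submodule.map_mul] at this
    exact (Submodule.mul_le.2 fun a _ b hb => Submodule.mul_mem_mul Submodule.mem_top hb) this

/-- One factor at a time: I^(m+n) I is contained in I^(m+n) R P, and the power of I is two-sided. -/
theorem pow_add_le_mul {P : Submodule k R} (hP : R.rad.restrictScalars k ≤ ⊤ * P) (m n : ℕ) :
    (R.rad ^ (m + n)).restrictScalars k ≤ (R.rad ^ m).restrictScalars k * P ^ n := by
  induction n with
  | zero => rw [pow_zero, mul_one]; rfl
  | succ n ih =>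
    intro x hx
    have hx' : x ∈ R.rad ^ (m + n + 1) := hx
    clear hx
    rw [Submodule.pow_succ] at hx'
    induction hx' using Submodule.mul_induction_on' with
    | mem_mul_mem r hr s hs =>
      have hs' := hP hs
      clear hs
      induction hs' using Submodule.mul_induction_on' with
      | mem_mul_mem a _ q hq =>
        rw [pow_succ, ← mul_assoc, ← mul_assoc]
        exact Submodule.mul_mem_mul (ih (Ideal.mul_mem_right a _ hr)) hq
      | add x _ y _ hx hy => rw [mul_add]; exact Submodule.add_mem _ hx hy
    | add x _ y _ hx hy => exact Submodule.add_mem _ hx hy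

theorem pow_rad_le_pow {P : Submodule k R} (hP : P ≤ R.rad.restrictScalars k) (n : ℕ) :
    P ^ n ≤ (R.rad ^ n).restrictScalars k := by
  induction n with
  | zero =>
    intro x _
    change x ∈ R.rad ^ 0
    simp [Submodule.pow_zero]
  | succ n ih =>
    rw [pow_succ, Submodule.mul_le]
    intro a ha b hb
    change a * b ∈ R.rad ^ (n + 1)
    rw [Submodule.pow_succ]
    exact Ideal.mul_mem_mul (ih ha) (hP hb)

/-- The subspace `k^p`. -/
theorem exists_sub_mem_rad (r : R) : r - R.incl (R.aug r) ∈ R.rad := by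
  rw [mem_rad, map_sub, R.aug_incl, sub_self]

/-- Iterate R = k^p + RP: from R = Q + RP^n follows R = k^p + QP + RP^(n+1). Hence all R / I^n are
finite-dimensional. -/
theorem RadFG.exists_fg (h : RadFG R) (n : ℕ) :
    ∃ Q : Submodule k R, Q.FG ∧ Q ⊔ (R.rad ^ n).restrictScalars k = ⊤ := by
  obtain ⟨P, h1, h2, h3⟩ := h
  suffices H : ∃ Q : Submodule k R, Q.FG ∧ Q ⊔ ⊤ * P ^ n = ⊤ by
    obtain ⟨Q, hQ, hQ'⟩ := H
    refine ⟨Q, hQ, top_le_iff.1 (hQ'.ge.trans (sup_le_sup_left ?_ Q))⟩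
    rw [Submodule.mul_le]
    exact fun a _ b hb => (R.rad ^ n).mul_mem_left a (pow_rad_le_pow h2 n hb)
  have hU : (R.incl.toLinearMap.range).FG := by
    rw [LinearMap.range_eq_map]
    exact (Module.Finite.fg_top).map _
  have hT : R.incl.toLinearMap.range ⊔ ⊤ * P = ⊤ := top_le_iff.1 fun r _ => by
    rw [← add_sub_cancel (R.incl (R.aug r)) r]
    exact Submodule.add_mem_sup ⟨_, rfl⟩ (h3 (exists_sub_mem_rad r))
  induction n with
  | zero => exact ⟨⊥, Submodule.fg_bot, by simp⟩
  | succ n ih =>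
    obtain ⟨Q, hQ, hQ'⟩ := ih
    refine ⟨R.incl.toLinearMap.range ⊔ Q * P, hU.sup (hQ.mul h1), ?_⟩
    rw [sup_assoc, pow_succ, ← mul_assoc, ← Submodule.sup_mul, hQ', hT]

theorem RadFG.finite (h : RadFG R) {n : ℕ} (hn : R.rad ^ n = ⊥) : Module.Finite k R := by
  obtain ⟨Q, hQ, hQ'⟩ := h.exists_fg n
  rw [hn] at hQ'
  refine ⟨?_⟩
  rw [← hQ']
  simpa using hQ

theorem RadFG.finite_of_surjective (h : RadFG R) (f : R ⟶ S) (hf : Function.Surjective (hom f))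
    {n : ℕ} (hn : S.rad ^ n = ⊥) : Module.Finite k S := (h.map f hf).finite hn

theorem isArt_of_finite [Module.Finite k R] {n : ℕ} (hn : R.rad ^ n = ⊥) : R.IsArt :=
  ⟨isArtinian_of_tower k inferInstance, R.isComplete_of_pow_eq_bot hn⟩

/-- An Artinian ring is Noetherian, so the radical is finitely generated as a left ideal, and it is
nilpotent. Objects of a_p are thus finite-dimensional, which the expansions in a basis of K require.
-/
theorem finite_of_isArt (h : R.IsArt) : Module.Finite k R := by
  have := h.1
  obtain ⟨n, hn⟩ := h.exists_pow_eq_bot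
  exact radFG_of_isNoetherianRing.finite hn

theorem RadFG.finite_level (h : RadFG R) (n : ℕ) : Module.Finite k (R.level n) :=
  h.finite_of_surjective (R.toLevel n) (proj_surjective _ _) (R.level_rad_pow n)

theorem RadFG.isPro (h : RadFG R) (h' : R.IsComplete) : R.IsPro :=
  ⟨fun n => have := h.finite_level n; (isArt_of_finite (R.level_rad_pow n)).1, h'⟩

/-! ### Quotients of complete algebras -/

/-- J is closed, which gives separatedness. A Cauchy sequence lifts to R by lifting its successive
differences inside the powers of the radical and summing them. -/
theorem isComplete_quot (h : R.IsComplete) (J : Ideal R) [J.IsTwoSided] (hJ : J ≤ R.rad)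
    (hc : ∀ x, (∀ n, x ∈ J ⊔ R.rad ^ n) → x ∈ J) : (R.quot J hJ).IsComplete := by
  have hk : ∀ x, hom (proj J hJ) x = 0 ↔ x ∈ J := fun x => Ideal.Quotient.eq_zero_iff_mem
  have hs := proj_surjective J hJ
  constructor
  · intro x hx
    obtain ⟨x, rfl⟩ := hs x
    rw [hk]
    refine hc x fun n => ?_
    obtain ⟨y, hy, hxy⟩ := exists_of_mem_pow_rad (proj J hJ) hs n (hx n)
    rw [← sub_add_cancel x y]
    refine Submodule.add_mem_sup ?_ hy
    rw [← hk, map_sub, hxy, sub_self]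
  · intro x hx
    choose r hr hr' using fun n => exists_of_mem_pow_rad (proj J hJ) hs n (hx n)
    obtain ⟨z0, hz0⟩ := hs (x 0)
    have hz : ∀ n, hom (proj J hJ) (z0 + ∑ l ∈ Finset.range n, r l) = x n := fun n => by
      induction n with
      | zero => simpa using hz0
      | succ n ih => rw [Finset.sum_range_succ, ← add_assoc, map_add, ih, hr', add_sub_cancel]
    obtain ⟨y, hy⟩ := h.2 (fun n => z0 + ∑ l ∈ Finset.range n, r l) fun n => by
      rw [Finset.sum_range_succ, ← add_assoc, add_sub_cancel_left]
      exact hr n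
    refine ⟨hom (proj J hJ) y, fun n => ?_⟩
    rw [← hz, ← map_sub]
    exact hom_pow_rad _ n (hy n)

theorem isPro_cofiber (h : RadFG S) (h' : S.IsComplete) (f : R ⟶ S) : (cofiber f).IsPro := by
  refine (h.map (toCofiber f) (proj_surjective _ _)).isPro (isComplete_quot h' _ _ fun x hx => ?_)
  rw [Submodule.mem_iInf]
  intro n
  exact (sup_le (iInf_le (fun n : ℕ => imageIdeal f ⊔ S.rad ^ n) n) le_sup_right) (hx n)

/-! ### Small extensions -/

theorem hom_smallExtMap (f : R ⟶ S) (r : R) : hom (smallExtMap f) (hom (toSmallExt f) r) = hom f r :=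
  rfl

theorem toSmallExt_comp (f : R ⟶ S) : toSmallExt f ≫ smallExtMap f = f := rfl

theorem toSmallExt_surjective (f : R ⟶ S) : Function.Surjective (hom (toSmallExt f)) :=
  proj_surjective _ _

theorem toSmallExt_eq_zero (f : R ⟶ S) {r : R} : hom (toSmallExt f) r = 0 ↔ r ∈ smallIdeal f :=
  Ideal.Quotient.eq_zero_iff_mem

theorem mem_ker (f : R ⟶ S) {r : R} : r ∈ PointedAlg.ker f ↔ hom f r = 0 := Iff.rfl

theorem isSmall_smallExtMap {f : R ⟶ S} (hf : Function.Surjective (hom f)) :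
    IsSmall (smallExtMap f) where
  surjective s := by
    obtain ⟨r, rfl⟩ := hf s
    exact ⟨hom (toSmallExt f) r, rfl⟩
  rad_mul r hr x hx := by
    obtain ⟨r, rfl⟩ := toSmallExt_surjective f r
    obtain ⟨x, rfl⟩ := toSmallExt_surjective f x
    rw [← map_mul, toSmallExt_eq_zero]
    refine Ideal.mem_sup_left (Ideal.mul_mem_mul ?_ hx)
    rwa [mem_rad, aug_hom] at hr
  mul_rad r hr x hx := by
    obtain ⟨r, rfl⟩ := toSmallExt_surjective f r
    obtain ⟨x, rfl⟩ := toSmallExt_surjective f x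
    rw [← map_mul, toSmallExt_eq_zero]
    refine Ideal.mem_sup_right (Ideal.mul_mem_mul hx ?_)
    rwa [mem_rad, aug_hom] at hr

/-- The kernel of f contains I^n, so b contains I · I^n. -/
theorem rad_pow_smallExt (f : R ⟶ S) {n : ℕ} (hS : S.rad ^ n = ⊥) :
    (smallExt f).rad ^ (n + 1) = ⊥ := by
  rw [eq_bot_iff]
  intro x hx
  obtain ⟨r, hr, rfl⟩ := exists_of_mem_pow_rad (toSmallExt f) (toSmallExt_surjective f) _ hx
  refine (toSmallExt_eq_zero f).2 (Ideal.mem_sup_left ?_)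
  rw [Ideal.IsTwoSided.pow_succ] at hr
  refine Ideal.mul_mono_right (fun y hy => ?_) hr
  have := hom_pow_rad f n hy
  rw [hS] at this
  exact this

end Algebras

/-! ### The topology of the completion -/

section Completion

open PointedAlg

variable {k : Type u} [Field k] {p : ℕ} {R S T : PointedAlg k p}

/-- The projection of the completion to `R / I(R)^{n+1}`. -/
def complProj (R : PointedAlg k p) (n : ℕ) : R.completion →ₐ[k] R.level n :=
  (Pi.evalAlgHom k (fun n => R.level n) n).comp R.complAlg.val

theorem complProj_trans (n : ℕ) (x : R.completion) :
    hom (R.levelTrans n) (complProj R (n + 1) x) = complProj R n x := x.2 n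

theorem complProj_toCompletion (n : ℕ) (r : R) :
    complProj R n (hom R.toCompletion r) = hom (R.toLevel n) r := rfl

theorem completion_ext {x y : R.completion} (h : ∀ n, complProj R n x = complProj R n y) : x = y :=
  Subtype.ext (funext h)

/-- Elements of the completion from compatible families. -/
def complMk (x : ∀ n, R.level n) (hx : ∀ n, hom (R.levelTrans n) (x (n + 1)) = x n) :
    R.completion := (⟨x, hx⟩ : R.complAlg)

theorem complProj_complMk (x : ∀ n, R.level n) (hx) (n : ℕ) :
    complProj R n (complMk x hx) = x n := rfl

theorem toLevel_eq_zero {n : ℕ} {r : R} : hom (R.toLevel n) r = 0 ↔ r ∈ R.rad ^ (n + 1) :=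
  Ideal.Quotient.eq_zero_iff_mem

theorem levelTrans_toLevel (n : ℕ) (r : R) :
    hom (R.levelTrans n) (hom (R.toLevel (n + 1)) r) = hom (R.toLevel n) r := rfl

/-- The projection of the completion to `R / I(R)^{n+1}` as a morphism of pointed algebras. -/
def complProjHom (R : PointedAlg k p) (n : ℕ) : R.completion ⟶ R.level n where
  toAlgHom := complProj R n
  map_incl _ := rfl
  aug_map x := by
    change (R.level n).aug (complProj R n x) = (R.level 0).aug (complProj R 0 x)
    induction n with
    | zero => rfl
    | succ n ih =>
      rw [← ih, ← complProj_trans n x]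
      exact (aug_hom (R.levelTrans n) _).symm

theorem complProj_pow_rad {n : ℕ} {x : R.completion} (hx : x ∈ R.completion.rad ^ (n + 1)) :
    complProj R n x = 0 := by
  have := hom_pow_rad (complProjHom R n) (n + 1) hx
  rw [R.level_rad_pow] at this
  exact this

theorem mem_rad_completion {x : R.completion} : x ∈ R.completion.rad ↔ complProj R 0 x = 0 := by
  refine ⟨fun hx => complProj_pow_rad (by rwa [zero_add, Submodule.pow_one]), fun hx => ?_⟩
  rw [mem_rad]
  change (R.level 0).aug (complProj R 0 x) = 0
  rw [hx, map_zero]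

/-- The sum of a convergent series in the completion. -/
def complSum (c : ℕ → R) (hc : ∀ m, c m ∈ R.rad ^ m) : R.completion :=
  complMk (fun n => hom (R.toLevel n) (∑ l ∈ Finset.range (n + 1), c l)) fun n => by
    rw [levelTrans_toLevel, Finset.sum_range_succ, map_add, (toLevel_eq_zero).2 (hc _), add_zero]

theorem exists_of_mem_mul {I P : Submodule k R} {ι : Type*} [Fintype ι] {t : ι → R}
    (ht : Submodule.span k (Set.range t) = P) {x : R} (hx : x ∈ I * P) :
    ∃ c : ι → R, (∀ j, c j ∈ I) ∧ x = ∑ j, c j * t j := by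
  induction hx using Submodule.mul_induction_on' with
  | mem_mul_mem a ha b hb =>
    rw [← ht, Submodule.mem_span_range_iff_exists_fun] at hb
    obtain ⟨c, rfl⟩ := hb
    refine ⟨fun j => c j • a, fun j => I.smul_mem _ ha, ?_⟩
    rw [Finset.mul_sum]
    exact Finset.sum_congr rfl fun j _ => by rw [mul_smul_comm, smul_mul_assoc]
  | add x _ y _ hx hy =>
    obtain ⟨c, hc, rfl⟩ := hx
    obtain ⟨d, hd, rfl⟩ := hy
    refine ⟨c + d, fun j => I.add_mem (hc j) (hd j), ?_⟩
    simp [add_mul, Finset.sum_add_distrib]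

/-- Elements of the kernel of the projection to `R / I(R)^{n+1}` are combinations of elements of
`P^{n+1}`. -/
theorem mem_of_complProj_eq_zero {P : Submodule k R} (h1 : P.FG)
    (h3 : R.rad.restrictScalars k ≤ ⊤ * P) {n : ℕ} {x : R.completion} (hx : complProj R n x = 0) :
    x ∈ (⊤ : Submodule k R.completion) * (P ^ (n + 1)).map (hom R.toCompletion).toLinearMap := by
  obtain ⟨q, t, ht⟩ := Submodule.fg_iff_exists_fin_generating_family.1 (h1.pow (n + 1))
  choose z hz using fun m => proj_surjective _ (R.pow_succ_rad_le m) (complProj R m x)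
  have hz : ∀ m, hom (R.toLevel m) (z m) = complProj R m x := hz
  have hzn : z n ∈ R.rad ^ (n + 1) := by rw [← toLevel_eq_zero, hz, hx]
  -- Representatives of x from level n on, with the first one replaced by zero; this is allowed
  -- because x vanishes at level n. The telescoping sum then has no constant term.
  let z' : ℕ → R := fun m => z (n + m) - if m = 0 then z n else 0
  have hz' : ∀ m, hom (R.toLevel (n + m)) (z' m) = complProj R (n + m) x := fun m => by
    rcases eq_or_ne m 0 with rfl | hm
    · simp [z', hx]
    · simp [z', hm, hz]
  have hd : ∀ m, z' (m + 1) - z' m ∈ R.rad ^ (m + (n + 1)) := fun m => by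
    rw [show m + (n + 1) = n + m + 1 by omega, ← toLevel_eq_zero, map_sub, hz' m,
      ← complProj_trans, sub_eq_zero]
    exact congrArg (hom (R.levelTrans (n + m))) (hz' (m + 1))
  -- The m-th difference lies in I^(m+n+1). Written with coefficients in I^m in front of finitely
  -- many fixed generators of P^(n+1), the differences sum to one convergent series per generator.
  choose c hc hc' using fun m => exists_of_mem_mul ht (pow_add_le_mul h3 m (n + 1) (hd m))
  have hx : x = ∑ j, complSum (fun m => c m j) (fun m => hc m j) * hom R.toCompletion (t j) := by
    refine completion_ext fun N => ?_
    rw [map_sum]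
    have : ∀ j, complProj R N (complSum (fun m => c m j) (fun m => hc m j) *
        hom R.toCompletion (t j)) =
        hom (R.toLevel N) (∑ l ∈ Finset.range (N + 1), c l j * t j) := fun j => by
      rw [map_mul, ← Finset.sum_mul, map_mul]
      rfl
    simp only [this]
    rw [← map_sum, Finset.sum_comm]
    simp only [← hc']
    rw [Finset.sum_range_sub, show z' 0 = 0 by simp [z'], sub_zero]
    have key : ∀ a b : ℕ, ∀ r : R, hom (R.toLevel (a + b)) r = complProj R (a + b) x →
        hom (R.toLevel a) r = complProj R a x := by
      intro a b r
      induction b with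
      | zero => exact id
      | succ b ih =>
        intro h
        refine ih ?_
        rw [← complProj_trans, ← levelTrans_toLevel]
        exact congrArg _ h
    refine (key N (n + 1) _ ?_).symm
    have := hz' (N + 1)
    rwa [show n + (N + 1) = N + (n + 1) by omega] at this
  rw [hx]
  refine Submodule.sum_mem _ fun j _ => Submodule.mul_mem_mul Submodule.mem_top ?_
  refine Submodule.mem_map_of_mem (f := (hom R.toCompletion).toLinearMap) ?_
  rw [← ht]
  exact Submodule.subset_span ⟨j, rfl⟩

theorem radFG_completion (h : RadFG R) : RadFG R.completion := by
  obtain ⟨P, h1, h2, h3⟩ := h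
  refine ⟨P.map (hom R.toCompletion).toLinearMap, h1.map _, ?_, fun x hx => ?_⟩
  · rintro _ ⟨r, hr, rfl⟩
    exact (R.completion.mem_rad).2 ((aug_hom R.toCompletion r).trans (R.mem_rad.1 (h2 hr)))
  · have := mem_of_complProj_eq_zero h1 h3 (mem_rad_completion.1 hx)
    rwa [zero_add, pow_one] at this

/-- The I-adic topology of the completion is its topology as a limit. Finite generation is
essential: an element that vanishes at level n must be a finite combination of products of n + 1
radical elements. -/
theorem complProj_eq_zero (h : RadFG R) {n : ℕ} {x : R.completion} :
    complProj R n x = 0 ↔ x ∈ R.completion.rad ^ (n + 1) := by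
  refine ⟨fun hx => ?_, complProj_pow_rad⟩
  obtain ⟨P, h1, h2, h3⟩ := h
  have := mem_of_complProj_eq_zero h1 h3 hx
  have hle : (⊤ : Submodule k R.completion) * (P ^ (n + 1)).map (hom R.toCompletion).toLinearMap ≤
      (R.completion.rad ^ (n + 1)).restrictScalars k := by
    rw [Submodule.mul_le]
    rintro a _ _ ⟨b, hb, rfl⟩
    exact Ideal.mul_mem_left _ a (hom_pow_rad R.toCompletion _ (pow_rad_le_pow h2 _ hb))
  exact hle this

theorem isComplete_completion (h : RadFG R) : R.completion.IsComplete := by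
  refine ⟨fun x hx => completion_ext fun n => ?_, fun x hx => ?_⟩
  · rw [map_zero]
    exact complProj_pow_rad (hx (n + 1))
  · have hy : ∀ n, hom (R.levelTrans n) (complProj R (n + 1) (x (n + 1 + 1))) =
        complProj R n (x (n + 1)) := fun n => by
      rw [complProj_trans, ← sub_eq_zero, ← map_sub]
      exact complProj_pow_rad (hx (n + 1))
    refine ⟨complMk (fun n => complProj R n (x (n + 1))) hy, fun n => ?_⟩
    cases n with
    | zero => simp [Submodule.pow_zero]
    | succ n =>
      rw [← complProj_eq_zero h, map_sub, complProj_complMk, sub_self]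

end Completion

section FreeAlgebras

open PointedAlg

variable {k : Type u} [Field k] {p : ℕ} {R S T : PointedAlg k p} {V : Fin p → Fin p → Type u}
  [∀ i j, AddCommGroup (V i j)] [∀ i j, Module k (V i j)]

/-! ### The universal property of free matrix rings -/

variable (V) in
/-- The generators of the free matrix ring. -/
def matGen (i j : Fin p) : V i j →ₗ[k] freeMatrix (k := k) V :=
  (RingQuot.mkAlgHom k (FreeRel V)).toLinearMap ∘ₗ TensorAlgebra.ι k ∘ₗ vec V i j

theorem e_mul_matGen (i j : Fin p) (v : V i j) :
    (freeMatrix (k := k) V).e i * matGen V i j v = matGen V i j v := by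
  have := RingQuot.mkAlgHom_rel k (FreeRel.left (k := k) i j v)
  rw [map_mul] at this
  exact this

theorem matGen_mul_e (i j : Fin p) (v : V i j) :
    matGen V i j v * (freeMatrix (k := k) V).e j = matGen V i j v := by
  have := RingQuot.mkAlgHom_rel k (FreeRel.right (k := k) i j v)
  rw [map_mul] at this
  exact this

theorem aug_matGen (i j : Fin p) (v : V i j) :
    (freeMatrix (k := k) V).aug (matGen V i j v) = 0 := by
  refine (RingQuot.liftAlgHom_mkAlgHom_apply k _ _ _).trans ?_
  rw [LinearMap.comp_apply, TensorAlgebra.lift_ι_apply]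
  rfl

/-- A vector is the sum of its components. -/
theorem freeGen_eq (x : FreeGen (k := k) V) :
    x = (x.1, 0) + ∑ i, ∑ j, vec V i j (x.2 i j) := by
  refine Prod.ext ?_ ?_
  · simp [vec, Prod.fst_sum]
  · simp only [Prod.snd_add, Prod.snd_sum, zero_add]
    funext i j
    simp only [vec, LinearMap.comp_apply, LinearMap.inr_apply, LinearMap.coe_single,
      Finset.sum_apply]
    rw [Finset.sum_eq_single i, Finset.sum_eq_single j]
    · simp
    · intro l _ hl
      simp [hl.symm]
    · simp
    · intro l _ hl
      simp [hl.symm]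
    · simp

theorem matrix_ind {motive : freeMatrix (k := k) V → Prop} (x : freeMatrix (k := k) V)
    (incl : ∀ a, motive ((freeMatrix V).incl a)) (gen : ∀ i j v, motive (matGen V i j v))
    (mul : ∀ a b, motive a → motive b → motive (a * b))
    (add : ∀ a b, motive a → motive b → motive (a + b)) : motive x := by
  obtain ⟨x, rfl⟩ := RingQuot.mkAlgHom_surjective k (FreeRel V) x
  induction x using TensorAlgebra.induction with
  | algebraMap r =>
    have := incl (algebraMap k _ r)
    rw [AlgHom.commutes] at this
    rwa [AlgHom.commutes]
  | ι x =>
    have h0 : motive (0 : freeMatrix V) := by simpa using incl 0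
    rw [freeGen_eq x, map_add, map_add, map_sum, map_sum]
    refine add _ _ (incl x.1) (Finset.sum_induction _ motive add h0 fun i _ => ?_)
    rw [map_sum, map_sum]
    exact Finset.sum_induction _ motive add h0 fun j _ => gen i j _
  | mul a b ha hb => rw [map_mul]; exact mul _ _ ha hb
  | add a b ha hb => rw [map_add]; exact add _ _ ha hb

theorem incl_single (i : Fin p) (t : k) : R.incl (Pi.single i t) = t • R.e i := by
  rw [PointedAlg.e, ← map_smul, ← Pi.single_smul, smul_eq_mul, mul_one]

theorem incl_eq_sum (a : Fin p → k) : R.incl a = ∑ i, a i • R.e i := by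
  conv_lhs => rw [← Finset.univ_sum_single a]
  rw [map_sum]
  exact Finset.sum_congr rfl fun i _ => incl_single i _

theorem e_mul_e_ne {i j : Fin p} (h : i ≠ j) : R.e i * R.e j = 0 := by
  rw [PointedAlg.e, PointedAlg.e, ← map_mul]
  have : (Pi.single i 1 * Pi.single j 1 : Fin p → k) = 0 := by
    funext l
    by_cases hl : l = i
    · subst hl; simp [h]
    · simp [hl]
  rw [this, map_zero]

theorem mul_incl_of_mul_e {x : R} {j : Fin p} (h : x * R.e j = x) (a : Fin p → k) :
    x * R.incl a = a j • x := by
  rw [incl_eq_sum, Finset.mul_sum, Finset.sum_eq_single j]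
  · rw [mul_smul_comm, h]
  · intro l _ hl
    rw [mul_smul_comm, ← h, mul_assoc, e_mul_e_ne hl.symm, mul_zero, smul_zero]
  · simp

/-- The ring equals k^p + TP, with P the span of the generators: a product of terms has its last
generator on the right up to a factor in k^p, which P absorbs. For elements of the radical the
augmentation shows that the k^p part is zero. -/
theorem radFG_freeMatrix [∀ i j, Module.Finite k (V i j)] : RadFG (freeMatrix (k := k) V) := by
  let P : Submodule k (freeMatrix (k := k) V) := ⨆ i, ⨆ j, (matGen V i j).range
  have hgen : ∀ i j v, matGen V i j v ∈ P := fun i j v =>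
    Submodule.mem_iSup_of_mem i (Submodule.mem_iSup_of_mem j ⟨v, rfl⟩)
  have hind : ∀ {Q : Submodule k (freeMatrix (k := k) V)}, (∀ i j v, matGen V i j v ∈ Q) → P ≤ Q :=
    fun h => iSup_le fun i => iSup_le fun j => by rintro _ ⟨v, rfl⟩; exact h i j v
  have hP : ∀ x ∈ P, ∀ a, x * (freeMatrix V).incl a ∈ P := fun x hx a => by
    refine hind (Q := P.comap (LinearMap.mulRight k ((freeMatrix V).incl a))) (fun i j v => ?_) hx
    change matGen V i j v * _ ∈ P
    rw [mul_incl_of_mul_e (matGen_mul_e i j v)]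
    exact P.smul_mem _ (hgen i j v)
  have key : ∀ x : freeMatrix (k := k) V, x ∈ (freeMatrix V).incl.toLinearMap.range ⊔ ⊤ * P := by
    intro x
    induction x using matrix_ind with
    | incl a => exact Submodule.mem_sup_left ⟨a, rfl⟩
    | gen i j v =>
      have := Submodule.mul_mem_mul (Submodule.mem_top : (1 : freeMatrix (k := k) V) ∈ ⊤) (hgen i j v)
      rw [one_mul] at this
      exact Submodule.mem_sup_right this
    | mul a b ha hb =>
      obtain ⟨_, ⟨s, rfl⟩, q, hq, rfl⟩ := Submodule.mem_sup.1 ha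
      obtain ⟨_, ⟨t, rfl⟩, q', hq', rfl⟩ := Submodule.mem_sup.1 hb
      have h1 : ∀ y : freeMatrix (k := k) V, y * q' ∈ ⊤ * P := fun y => by
        clear hb
        induction hq' using Submodule.mul_induction_on' with
        | mem_mul_mem m _ n hn =>
          exact mul_assoc y m n ▸ Submodule.mul_mem_mul Submodule.mem_top hn
        | add x _ y' _ hx hy => rw [mul_add]; exact Submodule.add_mem _ hx hy
      have h2 : q * (freeMatrix V).incl t ∈ ⊤ * P := by
        clear ha
        induction hq using Submodule.mul_induction_on' with
        | mem_mul_mem m _ n hn =>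
          exact (mul_assoc m n _).symm ▸ Submodule.mul_mem_mul Submodule.mem_top (hP n hn t)
        | add x _ y' _ hx hy => rw [add_mul]; exact Submodule.add_mem _ hx hy
      rw [mul_add, add_mul]
      refine Submodule.add_mem _ (Submodule.add_mem _ ?_ (Submodule.mem_sup_right h2))
        (Submodule.mem_sup_right (h1 _))
      exact Submodule.mem_sup_left ⟨s * t, map_mul (freeMatrix V).incl s t⟩
    | add a b ha hb => exact Submodule.add_mem _ ha hb
  have hrad : ∀ y ∈ (⊤ : Submodule k (freeMatrix (k := k) V)) * P, (freeMatrix V).aug y = 0 := by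
    have : (⊤ : Submodule k (freeMatrix (k := k) V)) * P ≤
        ((freeMatrix V).rad).restrictScalars k := by
      rw [Submodule.mul_le]
      intro a _ b hb
      refine (freeMatrix V).rad.mul_mem_left a ?_
      exact hind (Q := ((freeMatrix V).rad).restrictScalars k)
        (fun i j v => (mem_rad _).2 (aug_matGen i j v)) hb
    exact fun y hy => (mem_rad _).1 (this hy)
  refine ⟨P, ?_, hind fun i j v => (mem_rad _).2 (aug_matGen i j v), fun x hx => ?_⟩
  · refine Submodule.fg_iSup _ fun i => Submodule.fg_iSup _ fun j => ?_
    rw [LinearMap.range_eq_map]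
    exact (Module.Finite.fg_top).map _
  · obtain ⟨_, ⟨s, rfl⟩, q, hq, rfl⟩ := Submodule.mem_sup.1 (key x)
    have h1 : (freeMatrix V).aug ((freeMatrix V).incl s + q) = 0 := (mem_rad _).1 hx
    rw [map_add, hrad q hq, add_zero, (freeMatrix V).aug_incl] at h1
    change (freeMatrix V).incl s + q ∈ _
    rw [h1, map_zero, zero_add]
    exact hq

/-- The morphism from a free matrix ring with given values on the generators. -/
theorem exists_matrix_hom (φ : ∀ i j, V i j →ₗ[k] R) (h0 : ∀ i j v, φ i j v ∈ R.rad)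
    (h1 : ∀ i j v, R.e i * φ i j v = φ i j v) (h2 : ∀ i j v, φ i j v * R.e j = φ i j v) :
    ∃ f : freeMatrix V ⟶ R, ∀ i j v, hom f (matGen V i j v) = φ i j v := by
  let ψ : FreeGen (k := k) V →ₗ[k] R := R.incl.toLinearMap ∘ₗ LinearMap.fst k _ _ +
    ∑ i, ∑ j, φ i j ∘ₗ LinearMap.proj j ∘ₗ LinearMap.proj i ∘ₗ LinearMap.snd k _ _
  have hψ1 : ∀ a, ψ (a, 0) = R.incl a := fun a => by simp [ψ]
  have hψ2 : ∀ i j v, ψ (vec V i j v) = φ i j v := fun i j v => by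
    simp only [ψ, vec, LinearMap.add_apply, LinearMap.sum_apply, LinearMap.comp_apply,
      LinearMap.proj_apply, LinearMap.fst_apply, LinearMap.snd_apply, LinearMap.inr_apply,
      LinearMap.coe_single, map_zero, zero_add]
    rw [Finset.sum_eq_single i, Finset.sum_eq_single j]
    · simp
    · intro l _ hl
      simp [hl]
    · simp
    · intro l _ hl
      simp [hl]
    · simp
  let f : freeMatrix (k := k) V →ₐ[k] R := RingQuot.liftAlgHom k ⟨TensorAlgebra.lift k ψ, by
    rintro _ _ (_ | ⟨a, b⟩ | ⟨i, j, v⟩ | ⟨i, j, v⟩)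
    · rw [TensorAlgebra.lift_ι_apply, hψ1, map_one, map_one]
    · rw [map_mul, TensorAlgebra.lift_ι_apply, TensorAlgebra.lift_ι_apply,
        TensorAlgebra.lift_ι_apply, hψ1, hψ1, hψ1, map_mul]
    · rw [map_mul, TensorAlgebra.lift_ι_apply, TensorAlgebra.lift_ι_apply, hψ1, hψ2]
      exact h1 i j v
    · rw [map_mul, TensorAlgebra.lift_ι_apply, TensorAlgebra.lift_ι_apply, hψ1, hψ2]
      exact h2 i j v⟩
  have hf : ∀ x, f (RingQuot.mkAlgHom k (FreeRel V) (TensorAlgebra.ι k x)) = ψ x := fun x =>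
    (RingQuot.liftAlgHom_mkAlgHom_apply k _ _ _).trans (TensorAlgebra.lift_ι_apply ψ x)
  have hfi : ∀ a, f ((freeMatrix V).incl a) = R.incl a := fun a => (hf (a, 0)).trans (hψ1 a)
  have hfg : ∀ i j v, f (matGen V i j v) = φ i j v := fun i j v => (hf _).trans (hψ2 i j v)
  refine ⟨⟨f, hfi, fun x => ?_⟩, hfg⟩
  induction x using matrix_ind with
  | incl a => rw [hfi, R.aug_incl, (freeMatrix V).aug_incl]
  | gen i j v => rw [hfg, aug_matGen]; exact (R.mem_rad).1 (h0 i j v)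
  | mul a b ha hb => rw [map_mul, map_mul, map_mul, ha, hb]
  | add a b ha hb => rw [map_add, map_add, map_add, ha, hb]

theorem matrix_hom_ext {f g : freeMatrix V ⟶ R}
    (h : ∀ i j v, hom f (matGen V i j v) = hom g (matGen V i j v)) : f = g := by
  refine PointedAlg.hom_ext fun x => ?_
  induction x using matrix_ind with
  | incl a => rw [hom_incl, hom_incl]
  | gen i j v => exact h i j v
  | mul a b ha hb => rw [map_mul, map_mul, ha, hb]
  | add a b ha hb => rw [map_add, map_add, ha, hb]

/-! ### The universal property of the completion -/

theorem completion_sub_mem (h : RadFG R) (x : R.completion) (n : ℕ) :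
    ∃ r : R, x - hom R.toCompletion r ∈ R.completion.rad ^ (n + 1) := by
  obtain ⟨r, hr⟩ := proj_surjective _ (R.pow_succ_rad_le n) (complProj R n x)
  refine ⟨r, ?_⟩
  rw [← complProj_eq_zero h, map_sub, sub_eq_zero]
  exact hr.symm

/-- R is dense in its completion, and morphisms respect powers of the radicals, so they are
continuous. -/
theorem completion_hom_ext (h : RadFG R) (hS : S.IsComplete) {f g : R.completion ⟶ S}
    (hfg : R.toCompletion ≫ f = R.toCompletion ≫ g) : f = g := by
  refine PointedAlg.hom_ext fun x => ?_
  rw [← sub_eq_zero]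
  refine hS.1 _ fun n => ?_
  obtain ⟨r, hr⟩ := completion_sub_mem h x n
  have h1 := hom_pow_rad f _ hr
  have h2 := hom_pow_rad g _ hr
  have h3 : hom f (hom R.toCompletion r) = hom g (hom R.toCompletion r) :=
    congrArg (fun φ => hom φ r) hfg
  have h4 := Submodule.sub_mem _ h1 h2
  rw [map_sub, map_sub, h3, sub_sub_sub_cancel_right] at h4
  exact Ideal.pow_le_pow_right n.le_succ h4

/-- Extension by continuity: if z_n in R approximates x, then f(z_n) is a Cauchy sequence in S. -/
theorem exists_completion_hom (h : RadFG R) (hS : S.IsComplete) (f : R ⟶ S) :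
    ∃ g : R.completion ⟶ S, R.toCompletion ≫ g = f := by
  choose z hz using completion_sub_mem h
  have hzd : ∀ x n m, z x n - z x m ∈ R.rad ^ (min n m + 1) := fun x n m => by
    have h1 : x - hom R.toCompletion (z x n) ∈ R.completion.rad ^ (min n m + 1) :=
      Ideal.pow_le_pow_right (by omega) (hz x n)
    have h2 : x - hom R.toCompletion (z x m) ∈ R.completion.rad ^ (min n m + 1) :=
      Ideal.pow_le_pow_right (by omega) (hz x m)
    have := Submodule.sub_mem _ h2 h1
    rw [sub_sub_sub_cancel_left, ← map_sub, ← complProj_eq_zero h, complProj_toCompletion,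
      toLevel_eq_zero] at this
    exact this
  choose y hy using fun x => hS.2 (fun n => hom f (z x n)) fun n => by
    rw [← map_sub]
    refine hom_pow_rad f n (Ideal.pow_le_pow_right ?_ (hzd x (n + 1) n))
    omega
  -- Limits do not depend on the approximations: s is the value at x as soon as x and s are
  -- approximated simultaneously by r and f(r). The algebra axioms are then checked on
  -- approximations.
  have key : ∀ x s, (∀ n, ∃ r : R, x - hom R.toCompletion r ∈ R.completion.rad ^ n ∧
      s - hom f r ∈ S.rad ^ n) → y x = s := fun x s hs => by
    rw [← sub_eq_zero]
    refine hS.1 _ fun n => ?_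
    obtain ⟨r, h1, h2⟩ := hs (n + 1)
    have h3 := Submodule.sub_mem _ h1 (hz x n)
    rw [sub_sub_sub_cancel_left, ← map_sub, ← complProj_eq_zero h, complProj_toCompletion,
      toLevel_eq_zero] at h3
    have h4 := hom_pow_rad f _ h3
    rw [map_sub] at h4
    have h5 : y x - s = (y x - hom f (z x n)) - (s - hom f r) + (hom f (z x n) - hom f r) := by
      abel
    rw [h5]
    exact Submodule.add_mem _ (Submodule.sub_mem _ (hy x n)
      (Ideal.pow_le_pow_right n.le_succ h2)) (Ideal.pow_le_pow_right n.le_succ h4)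
  have hz' : ∀ x n, x - hom R.toCompletion (z x n) ∈ R.completion.rad ^ n := fun x n =>
    Ideal.pow_le_pow_right n.le_succ (hz x n)
  have hι : ∀ r, y (hom R.toCompletion r) = hom f r := fun r => key _ _ fun n =>
    ⟨r, by rw [sub_self]; exact Submodule.zero_mem _, by rw [sub_self]; exact Submodule.zero_mem _⟩
  let g : R.completion →ₐ[k] S :=
    AlgHom.ofLinearMap
      { toFun := y
        map_add' := fun a b => key _ _ fun n => ⟨z a n + z b n, by
          rw [map_add, add_sub_add_comm]; exact Submodule.add_mem _ (hz' a n) (hz' b n), by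
          rw [map_add, add_sub_add_comm]; exact Submodule.add_mem _ (hy a n) (hy b n)⟩
        map_smul' := fun t a => key _ _ fun n => ⟨t • z a n, by
          rw [map_smul, ← smul_sub, Algebra.smul_def]; exact Ideal.mul_mem_left _ _ (hz' a n), by
          rw [map_smul, RingHom.id_apply, ← smul_sub, Algebra.smul_def]
          exact Ideal.mul_mem_left _ _ (hy a n)⟩ }
      ((congrArg y (map_one (hom R.toCompletion)).symm).trans ((hι 1).trans (map_one _)))
      fun a b => key _ _ fun n => ⟨z a n * z b n, by
        have : a * b - hom R.toCompletion (z a n * z b n) =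
          (a - hom R.toCompletion (z a n)) * b +
            hom R.toCompletion (z a n) * (b - hom R.toCompletion (z b n)) := by
          rw [map_mul, sub_mul, mul_sub]; abel
        rw [this]
        exact Submodule.add_mem _ (Ideal.mul_mem_right _ _ (hz' a n))
          (Ideal.mul_mem_left _ _ (hz' b n)), by
        have : y a * y b - hom f (z a n * z b n) =
          (y a - hom f (z a n)) * y b + hom f (z a n) * (y b - hom f (z b n)) := by
          rw [map_mul, sub_mul, mul_sub]; abel
        change y a * y b - _ ∈ _
        rw [this]
        exact Submodule.add_mem _ (Ideal.mul_mem_right _ _ (hy a n))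
          (Ideal.mul_mem_left _ _ (hy b n))⟩
  have hg : ∀ r, g (hom R.toCompletion r) = hom f r := hι
  refine ⟨⟨g, fun a => ?_, fun x => ?_⟩, PointedAlg.hom_ext hg⟩
  · rw [← hom_incl R.toCompletion, hg, hom_incl]
  · have h1 := hz' x 1
    have h2 : S.aug (y x - hom f (z x 1)) = 0 := by
      rw [← S.mem_rad, ← Submodule.pow_one S.rad]; exact hy x 1
    rw [Submodule.pow_one, mem_rad, map_sub, aug_hom, sub_eq_zero] at h1
    rw [map_sub, aug_hom, sub_eq_zero] at h2
    exact h2.trans h1.symm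

/-! ### Free formal matrix rings -/

theorem e_mul_freeFormalGen (i j : Fin p) (v : V i j) :
    (freeFormal (k := k) V).e i * freeFormalGen V i j v = freeFormalGen V i j v := by
  refine (map_mul (hom (freeMatrix (k := k) V).toCompletion) _ _).symm.trans
    (congrArg _ (e_mul_matGen i j v))

theorem freeFormalGen_mul_e (i j : Fin p) (v : V i j) :
    freeFormalGen V i j v * (freeFormal (k := k) V).e j = freeFormalGen V i j v := by
  refine (map_mul (hom (freeMatrix (k := k) V).toCompletion) _ _).symm.trans
    (congrArg _ (matGen_mul_e i j v))

theorem freeFormalGen_mem_rad (i j : Fin p) (v : V i j) :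
    freeFormalGen V i j v ∈ (freeFormal (k := k) V).rad :=
  (mem_rad _).2 ((aug_hom (freeMatrix (k := k) V).toCompletion _).trans (aug_matGen i j v))

section

variable [∀ i j, Module.Finite k (V i j)]

variable (V) in
theorem radFG_freeFormal : RadFG (freeFormal (k := k) V) := radFG_completion radFG_freeMatrix

variable (V) in
theorem isComplete_freeFormal : (freeFormal (k := k) V).IsComplete :=
  isComplete_completion radFG_freeMatrix

theorem freeFormal_hom_ext (hR : R.IsComplete) {f g : freeFormal V ⟶ R}
    (h : ∀ i j v, hom f (freeFormalGen V i j v) = hom g (freeFormalGen V i j v)) : f = g :=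
  completion_hom_ext radFG_freeMatrix hR (matrix_hom_ext h)

theorem exists_freeFormal_hom (hR : R.IsComplete) (φ : ∀ i j, V i j →ₗ[k] R)
    (h0 : ∀ i j v, φ i j v ∈ R.rad) (h1 : ∀ i j v, R.e i * φ i j v = φ i j v)
    (h2 : ∀ i j v, φ i j v * R.e j = φ i j v) :
    ∃ f : freeFormal V ⟶ R, ∀ i j v, hom f (freeFormalGen V i j v) = φ i j v := by
  obtain ⟨f, hf⟩ := exists_matrix_hom φ h0 h1 h2
  obtain ⟨g, hg⟩ := exists_completion_hom radFG_freeMatrix hR f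
  refine ⟨g, fun i j v => ?_⟩
  rw [← hf]
  exact congrArg (fun φ => hom φ (matGen V i j v)) hg

end

end FreeAlgebras

/-! ### Factoring and lifting morphisms of pointed algebras -/

section Factorization

open PointedAlg

variable {k : Type u} [Field k] {p : ℕ} {R S T : PointedAlg k p}

theorem hom_ext_of_surjective {f : R ⟶ S} (hf : Function.Surjective (hom f)) {g h : S ⟶ T}
    (H : f ≫ g = f ≫ h) : g = h := by
  refine PointedAlg.hom_ext fun s => ?_
  obtain ⟨r, rfl⟩ := hf s
  exact congrArg (fun φ => hom φ r) H

theorem exists_factor {f : R ⟶ S} (hf : Function.Surjective (hom f)) (g : R ⟶ T)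
    (h : ∀ r, hom f r = 0 → hom g r = 0) : ∃ t : S ⟶ T, f ≫ t = g := by
  obtain ⟨s, hs⟩ := hf.hasRightInverse
  have key : ∀ x r, hom f r = x → hom g (s x) = hom g r := fun x r hr => by
    rw [← sub_eq_zero, ← map_sub]
    exact h _ (by rw [map_sub, hs, hr, sub_self])
  let t : S →ₐ[k] T := AlgHom.ofLinearMap
    { toFun := fun x => hom g (s x)
      map_add' := fun x y => by rw [key _ (s x + s y) (by rw [map_add, hs, hs]), map_add]
      map_smul' := fun t x => by rw [key _ (t • s x) (by rw [map_smul, hs]), map_smul]; rfl }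
    (by
      change hom g (s 1) = 1
      rw [key 1 1 (map_one _), map_one])
    (fun x y => by
      change hom g (s _) = hom g (s x) * hom g (s y)
      rw [key _ (s x * s y) (by rw [map_mul, hs, hs]), map_mul])
  have ht : ∀ r, t (hom f r) = hom g r := fun r => key _ r rfl
  refine ⟨⟨t, fun a => ?_, fun x => ?_⟩, PointedAlg.hom_ext ht⟩
  · rw [← hom_incl f, ht, hom_incl]
  · obtain ⟨r, rfl⟩ := hf x
    rw [ht, aug_hom, aug_hom]

theorem exists_factor_level {n : ℕ} (hS : S.rad ^ (n + 1) = ⊥) (f : R ⟶ S) :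
    ∃ g : R.level n ⟶ S, R.toLevel n ≫ g = f :=
  exists_factor (proj_surjective _ _) f fun r hr => by
    have := hom_pow_rad f (n + 1) (toLevel_eq_zero.1 hr)
    rwa [hS] at this

theorem toLevel_surjective (R : PointedAlg k p) (n : ℕ) : Function.Surjective (hom (R.toLevel n)) :=
  proj_surjective _ _

theorem toCofiber_surjective (f : R ⟶ S) : Function.Surjective (hom (toCofiber f)) :=
  proj_surjective _ _

/-- The augmentation, as a morphism. -/
def augHom (R : PointedAlg k p) : R ⟶ base k p where
  toAlgHom := R.aug
  map_incl := R.aug_incl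
  aug_map _ := rfl

/-- This makes the first order theory a special case of the theory of small surjections, with K = I.
-/
theorem isSmall_augHom (h : R.rad ^ 2 = ⊥) : IsSmall (augHom R) where
  surjective a := ⟨R.incl a, R.aug_incl a⟩
  rad_mul r hr x hx := by
    have h1 : r * x ∈ R.rad ^ 2 := by
      rw [Submodule.pow_succ, Submodule.pow_one]
      exact Ideal.mul_mem_mul hr ((R.mem_rad).2 hx)
    rw [h] at h1
    exact (Submodule.mem_bot _).1 h1
  mul_rad r hr x hx := by
    have h1 : x * r ∈ R.rad ^ 2 := by
      rw [Submodule.pow_succ, Submodule.pow_one]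
      exact Ideal.mul_mem_mul ((R.mem_rad).2 hx) hr
    rw [h] at h1
    exact (Submodule.mem_bot _).1 h1

theorem rad_pow_of_le {m n : ℕ} (h : R.rad ^ m = ⊥) (hmn : m ≤ n) : R.rad ^ n = ⊥ :=
  eq_bot_iff.2 (h ▸ Ideal.pow_le_pow_right hmn)

/-- The ideal generated by the image of `I(R)`, and its closure, are killed by morphisms to nilpotent
algebras that kill the image of `I(R)`. -/
theorem exists_factor_cofiber {n : ℕ} (hT : T.rad ^ n = ⊥) (o : R ⟶ S) (f : S ⟶ T)
    (h : ∀ r ∈ R.rad, hom f (hom o r) = 0) : ∃ g : cofiber o ⟶ T, toCofiber o ≫ g = f := by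
  refine exists_factor (toCofiber_surjective o) f fun r hr => ?_
  have hr : r ∈ ⨅ n : ℕ, imageIdeal o ⊔ S.rad ^ n := Ideal.Quotient.eq_zero_iff_mem.1 hr
  rw [Submodule.mem_iInf] at hr
  -- At precision n the closure adds only elements of I^n, which f kills because T is nilpotent of
  -- order n.
  obtain ⟨x, hx, y, hy, rfl⟩ := Submodule.mem_sup.1 (hr n)
  have h1 : TwoSidedIdeal.span (hom o '' R.rad) ≤ TwoSidedIdeal.ker (hom f) := by
    rw [TwoSidedIdeal.span_le]
    rintro _ ⟨r, hr, rfl⟩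
    change _ ∈ TwoSidedIdeal.ker (hom f)
    rw [TwoSidedIdeal.mem_ker]
    exact h r hr
  have h2 : hom f x = 0 := (TwoSidedIdeal.mem_ker _).1 (h1 (TwoSidedIdeal.mem_asIdeal.1 hx))
  have h3 := hom_pow_rad f n hy
  rw [hT] at h3
  rw [map_add, h2, (Submodule.mem_bot _).1 h3, add_zero]

/-- A morphism that kills the generators factors through `k^p`. -/
theorem hom_eq_zero_of_gen {V : Fin p → Fin p → Type u} [∀ i j, AddCommGroup (V i j)]
    [∀ i j, Module k (V i j)] [∀ i j, Module.Finite k (V i j)] (hT : T.IsComplete)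
    (f : freeFormal V ⟶ T) (h : ∀ i j v, hom f (freeFormalGen V i j v) = 0) :
    ∀ r ∈ (freeFormal (k := k) V).rad, hom f r = 0 := by
  have : f = augHom _ ≫ T.ofBase := freeFormal_hom_ext hT fun i j v => by
    rw [h, PointedAlg.hom_comp]
    have : hom (augHom (freeFormal (k := k) V)) (freeFormalGen V i j v) = 0 :=
      (mem_rad _).1 (freeFormalGen_mem_rad i j v)
    rw [this, map_zero]
  intro r hr
  rw [this, PointedAlg.hom_comp]
  have : hom (augHom (freeFormal (k := k) V)) r = 0 := (mem_rad _).1 hr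
  rw [this, map_zero]

/-- Lifting morphisms from free formal matrix rings along surjections. -/
theorem exists_lift_freeFormal {V : Fin p → Fin p → Type u} [∀ i j, AddCommGroup (V i j)]
    [∀ i j, Module k (V i j)] [∀ i j, Module.Finite k (V i j)] (hR : R.IsComplete)
    (hS : S.IsComplete) (u : R ⟶ S) (hu : Function.Surjective (hom u)) (f : freeFormal V ⟶ S) :
    ∃ g : freeFormal V ⟶ R, g ≫ u = f := by
  obtain ⟨s, hs⟩ := (hom u).toLinearMap.exists_rightInverse_of_surjective (LinearMap.range_eq_top.2 hu)
  have hs : ∀ x, hom u (s x) = x := fun x => LinearMap.congr_fun hs x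
  -- Multiplying by e_i and e_j makes a linear lift of the values homogeneous. The image in S is
  -- unchanged because the values of f on the generators already are.
  have hφ : ∀ i j v, hom u (R.e i * s (hom f (freeFormalGen V i j v)) * R.e j) =
      hom f (freeFormalGen V i j v) := fun i j v => by
    rw [map_mul, map_mul, hom_e, hom_e, hs, ← hom_e f, ← hom_e f, ← map_mul, ← map_mul,
      e_mul_freeFormalGen, freeFormalGen_mul_e]
  obtain ⟨g, hg⟩ := exists_freeFormal_hom hR
    (fun i j => LinearMap.mulRight k (R.e j) ∘ₗ LinearMap.mulLeft k (R.e i) ∘ₗ s ∘ₗ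
      (hom f).toLinearMap ∘ₗ freeFormalGen V i j)
    (fun i j v => (R.mem_rad).2 (by
      rw [← aug_hom u]
      refine (congrArg S.aug (hφ i j v)).trans ?_
      rw [aug_hom]
      exact (mem_rad _).1 (freeFormalGen_mem_rad i j v)))
    (fun i j v => by
      change R.e i * (R.e i * _ * R.e j) = R.e i * _ * R.e j
      rw [← mul_assoc, ← mul_assoc, e_mul_e])
    (fun i j v => by
      change R.e i * _ * R.e j * R.e j = R.e i * _ * R.e j
      rw [mul_assoc, e_mul_e])
  exact ⟨g, freeFormal_hom_ext hS fun i j v => by rw [PointedAlg.hom_comp, hg]; exact hφ i j v⟩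

end Factorization

/-! ### The natural transformation defined by a pro-element -/

section Yoneda

open PointedAlg

variable {k : Type u} [Field k] {p : ℕ} {D : ArtAlg k p ⥤ Type w}

theorem exists_map_proElt (H : ProAlg k p) (ξ : ProElt D H) {R : ArtAlg k p} {n m : ℕ} (h : n ≤ m)
    (g : H.obj.level n ⟶ R.obj) : ∃ g' : H.obj.level m ⟶ R.obj,
      H.obj.toLevel m ≫ g' = H.obj.toLevel n ≫ g ∧
      D.map (X := H.level m) (ObjectProperty.homMk g') (ξ.1 m) =
        D.map (X := H.level n) (ObjectProperty.homMk g) (ξ.1 n) := by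
  induction m, h using Nat.le_induction with
  | base => exact ⟨g, rfl, rfl⟩
  | succ m _ ih =>
    obtain ⟨g', h1, h2⟩ := ih
    have h3 : (ObjectProperty.homMk (H.obj.levelTrans m ≫ g') : H.level (m + 1) ⟶ R) =
        H.levelTrans m ≫ (ObjectProperty.homMk g' : H.level m ⟶ R) := rfl
    have h4 : H.obj.toLevel (m + 1) ≫ H.obj.levelTrans m = H.obj.toLevel m := rfl
    refine ⟨H.obj.levelTrans m ≫ g', by rw [← Category.assoc, h4, h1], ?_⟩
    refine (congrArg (fun φ => D.map φ (ξ.1 (m + 1))) h3).trans ?_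
    rw [D.map_comp_apply, ξ.2 m, h2]

/-- The definition chooses a nilpotency exponent. Two factorizations of f through different levels
agree after passing to a common higher level, so the choice is irrelevant. -/
theorem yonedaMap_eq (H : ProAlg k p) (ξ : ProElt D H) {R : ArtAlg k p} (f : H.obj ⟶ R.obj) {n : ℕ}
    (g : H.obj.level n ⟶ R.obj) (h : H.obj.toLevel n ≫ g = f) :
    _root_.yonedaMap H ξ R f = D.map (X := H.level n) (ObjectProperty.homMk g) (ξ.1 n) := by
  have key : ∀ (m : ℕ) (g₂ : H.obj.level m ⟶ R.obj), H.obj.toLevel m ≫ g₂ = f →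
      D.map (X := H.level m) (ObjectProperty.homMk g₂) (ξ.1 m) =
        D.map (X := H.level n) (ObjectProperty.homMk g) (ξ.1 n) := fun m g₂ h₂ => by
    obtain ⟨g1, h4, h5⟩ := exists_map_proElt H ξ (le_max_left n m) g
    obtain ⟨g2, h6, h7⟩ := exists_map_proElt H ξ (le_max_right n m) g₂
    have : g1 = g2 := hom_ext_of_surjective (toLevel_surjective _ _) (by rw [h4, h6, h, h₂])
    rw [← h5, this, h7]
  exact key _ _ rfl

/-- The lifting property of the map `Mor(H, -) → D` for a morphism. -/
def SmoothAt (H : ProAlg k p) (ξ : ProElt D H) {R S : ArtAlg k p} (u : R ⟶ S) : Prop :=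
  ∀ (v : H.obj ⟶ S.obj) (x : D.obj R), D.map u x = _root_.yonedaMap H ξ S v →
    ∃ w : H.obj ⟶ R.obj, w ≫ u.hom = v ∧ _root_.yonedaMap H ξ R w = x

theorem SmoothAt.comp {H : ProAlg k p} {ξ : ProElt D H} {R S T : ArtAlg k p} {u : R ⟶ S}
    {u' : S ⟶ T} (h : SmoothAt H ξ u) (h' : SmoothAt H ξ u') : SmoothAt H ξ (u ≫ u') := by
  intro v x hx
  rw [D.map_comp_apply] at hx
  obtain ⟨w, hw, hw'⟩ := h' v _ hx
  obtain ⟨w', hw1, hw2⟩ := h w x hw'.symm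
  refine ⟨w', ?_, hw2⟩
  rw [← hw, ← hw1]
  rfl

/-- Every surjection is a composition of small ones. -/
theorem smoothAt_of_small {H : ProAlg k p} {ξ : ProElt D H}
    (h : ∀ (R S : ArtAlg k p) (u : R ⟶ S), IsSmall u.hom → SmoothAt H ξ u) {R : ArtAlg k p} {n : ℕ}
    (hn : R.obj.rad ^ n = ⊥) (m : ℕ) (S : ArtAlg k p) (u : R ⟶ S)
    (hu : Function.Surjective (hom u.hom)) (hk : PointedAlg.ker u.hom ≤ R.obj.rad ^ (n - m)) :
    SmoothAt H ξ u := by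
  induction m generalizing S with
  | zero =>
    -- Here the kernel lies in I^n = 0, so u is injective and small for trivial reasons.
    rw [Nat.sub_zero, hn] at hk
    have h0 : ∀ x, hom u.hom x = 0 → x = 0 := fun x hx => (Submodule.mem_bot _).1 (hk hx)
    exact h R S u ⟨hu, fun r _ x hx => by rw [h0 x hx, mul_zero],
      fun r _ x hx => by rw [h0 x hx, zero_mul]⟩
  | succ m ih =>
    obtain ⟨l, hl⟩ := S.property.exists_pow_eq_bot
    have := finite_of_isArt R.property
    have : Module.Finite k (smallExt u.hom) :=
      Module.Finite.of_surjective (hom (toSmallExt u.hom)).toLinearMap (toSmallExt_surjective u.hom)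
    let E : ArtAlg k p := ⟨smallExt u.hom, isArt_of_finite (rad_pow_smallExt u.hom hl)⟩
    let u1 : R ⟶ E := ObjectProperty.homMk (toSmallExt u.hom)
    let u2 : E ⟶ S := ObjectProperty.homMk (smallExtMap u.hom)
    -- Factor u through R / b. The kernel b = I ker u + ker u I lies one power deeper than ker u, so
    -- induction applies to R → R / b, while R / b → S is small.
    have h1 : SmoothAt H ξ u1 := ih E u1 (toSmallExt_surjective u.hom) fun x hx => by
      have hx : x ∈ smallIdeal u.hom := (toSmallExt_eq_zero u.hom).1 hx
      -- The subtraction in the exponent is truncated: for n ≤ m the bound is the whole ring.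
      rcases le_or_gt n m with hm | hm
      · rw [Nat.sub_eq_zero_of_le hm, Submodule.pow_zero, Ideal.one_eq_top]
        trivial
      · have : n - m = n - (m + 1) + 1 := by omega
        rw [this]
        refine (sup_le (Ideal.mul_le.2 fun a ha b hb => ?_) (Ideal.mul_le.2 fun a ha b hb => ?_) :
          smallIdeal u.hom ≤ _) hx
        · rw [Ideal.IsTwoSided.pow_succ]
          exact Ideal.mul_mem_mul ha (hk hb)
        · rw [Submodule.pow_succ]
          exact Ideal.mul_mem_mul (hk ha) hb
    exact h1.comp (h E S u2 (isSmall_smallExtMap hu))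

end Yoneda

/-! ### Models of deformations -/

section HasModel

variable {k : Type u} [Field k] {C : Type u} [SmallCategory C] {A : C ⥤ AlgCat.{u} k} {p : ℕ}
  {F : Fin p → ModPresheaf A} {R S T : PointedAlg k p} {c d e : C} {m : ℕ}

/-- The deformation `x` is given by the model `M`. -/
def HasModel (x : Quotient (Lifting.setoid F R)) (M : PreModel F R) : Prop :=
  ∃ X, x = Quotient.mk _ X ∧ Nonempty (Frame X M)

theorem exists_hasModel (hR : R.rad ^ m = ⊥) (x : Quotient (Lifting.setoid F R)) :
    ∃ M, HasModel x M ∧ M.IsExact := by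
  induction x using Quotient.inductionOn with
  | h X =>
    obtain ⟨M, ⟨θ⟩⟩ := Frame.exists_frame hR X
    exact ⟨M, ⟨X, rfl, ⟨θ⟩⟩, θ.isExact hR⟩

theorem PreModel.IsExact.exists_hasModel {M : PreModel F R} (hM : M.IsExact) : ∃ x, HasModel x M :=
  ⟨_, M.toLifting hM, rfl, ⟨M.frame hM⟩⟩

namespace HasModel

theorem isExact (hR : R.rad ^ m = ⊥) {x : Quotient (Lifting.setoid F R)} {M : PreModel F R}
    (h : HasModel x M) : M.IsExact := by
  obtain ⟨X, -, ⟨θ⟩⟩ := h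
  exact θ.isExact hR

/-- With `gauge` and `of_gauge` this says that deformations over a nilpotent algebra are exact
models up to gauge transformations. -/
theorem unique (hR : R.rad ^ m = ⊥) {x y : Quotient (Lifting.setoid F R)} {M : PreModel F R}
    (h : HasModel x M) (h' : HasModel y M) : x = y := by
  obtain ⟨X, rfl, ⟨θ⟩⟩ := h
  obtain ⟨Y, rfl, ⟨θ'⟩⟩ := h'
  exact Quotient.sound (θ.equivalent hR θ')

theorem gauge (hR : R.rad ^ m = ⊥) {x : Quotient (Lifting.setoid F R)} {M M' : PreModel F R}
    (h : HasModel x M) (h' : HasModel x M') : Nonempty (M.Gauge M') := by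
  obtain ⟨X, rfl, ⟨θ⟩⟩ := h
  obtain ⟨Y, hY, ⟨θ'⟩⟩ := h'
  obtain ⟨θ₂⟩ := θ.of_equivalent (Quotient.exact hY)
  exact ⟨θ₂.gauge hR θ'⟩

theorem of_gauge {x : Quotient (Lifting.setoid F R)} {M M' : PreModel F R}
    (h : HasModel x M') (g : M.Gauge M') : HasModel x M := by
  obtain ⟨X, rfl, ⟨θ⟩⟩ := h
  exact ⟨X, rfl, ⟨θ.comp g⟩⟩

theorem map {R S : ArtAlg k p} {x : (defFunctor F).obj R} {M : PreModel F R.obj}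
    (h : HasModel x M) (u : R ⟶ S) : HasModel ((defFunctor F).map u x) (M.push u.hom) := by
  obtain ⟨X, rfl, ⟨θ⟩⟩ := h
  exact ⟨X.baseChange u.hom, rfl, ⟨θ.baseChange u.hom⟩⟩

end HasModel

theorem eq_zero_of_red_base {n : FreeMod F (PointedAlg.base k p) c}
    (h : ∀ i, red F (PointedAlg.base k p) c i n = 0) : n = 0 := by
  refine (Submodule.mem_bot k).1 (Submodule.span_le.2 ?_ (mem_of_red_eq_zero n h))
  rintro _ ⟨r, hr, n, rfl⟩
  have hr : r = 0 := hr
  rw [hr, freeMul_zero]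
  exact Submodule.zero_mem _

theorem freeMap_augHom_eq {n n' : FreeMod F R c} (h : ∀ i, red F R c i n = red F R c i n') :
    freeMap F (augHom R) c n = freeMap F (augHom R) c n' := by
  rw [← sub_eq_zero]
  refine eq_zero_of_red_base fun i => ?_
  rw [map_sub, red_freeMap, red_freeMap, h, sub_self]

theorem agree_augHom (L L' : PreModel F R) : PreModel.Agree (augHom R) L L' :=
  ⟨fun c a n => by
    rw [map_sub, freeMap_augHom_eq (n' := L.act c a n) fun i => by rw [L.act_red, L'.act_red],
      sub_self], fun φ n => by
    rw [map_sub, freeMap_augHom_eq (n' := L.map φ n) fun i => by rw [L.map_red, L'.map_red],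
      sub_self]⟩

/-- The radical of k^p is zero, so operators are determined by their reductions. -/
theorem eq_triv (M : PreModel F (PointedAlg.base k p)) : M = PreModel.triv F _ := by
  refine PreModel.ext (fun c a n => ?_) fun φ n => ?_ <;> rw [← sub_eq_zero] <;>
    refine eq_zero_of_red_base fun i => ?_ <;> rw [map_sub]
  · rw [M.act_red, (PreModel.triv F _).act_red, sub_self]
  · rw [M.map_red, (PreModel.triv F _).map_red, sub_self]

theorem unique_def_base (x y : Quotient (Lifting.setoid F (PointedAlg.base k p))) : x = y := by
  obtain ⟨M, hM, -⟩ := exists_hasModel PointedAlg.base_rad x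
  obtain ⟨M', hM', -⟩ := exists_hasModel PointedAlg.base_rad y
  rw [eq_triv M] at hM
  rw [eq_triv M'] at hM'
  exact hM.unique PointedAlg.base_rad hM'

/-- The difference of two extensions of scalars of a model. -/
theorem diff_push_push (f g : R ⟶ S) (M : PreModel F R) (i j : Fin p) (μ : S →ₗ[k] k) :
    (M.push f).diff (M.push g) i j μ = (PreModel.triv F R).diff M i j
      (μ ∘ₗ (PointedAlg.hom g).toLinearMap - μ ∘ₗ (PointedAlg.hom f).toLinearMap) := by
  have hμ : ∀ a, (μ ∘ₗ (PointedAlg.hom g).toLinearMap - μ ∘ₗ (PointedAlg.hom f).toLinearMap)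
      (R.incl a) = 0 := fun a => by
    simp [PointedAlg.hom_incl]
  have hsub : ∀ {c d : C} (μ ν : R →ₗ[k] k) (T : FreeMod F R c →ₗ[k] FreeMod F R d),
      freeComp i j (μ - ν) T = freeComp i j μ T - freeComp i j ν T := fun μ ν T =>
    map_sub (freeCompL i j T) μ ν
  refine GHC.ext1 (fun x a => ?_) fun x a => ?_
  · refine (freeComp_sub i j μ ((M.push g).act _ (a 0)) _).trans (Eq.trans ?_
      (freeComp_sub i j _ (M.act _ (a 0)) _).symm)
    rw [freeComp_triv_act hμ, sub_zero, hsub,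
      freeComp_freeMap g (fun n => (M.lifts_push g).act _ (a 0) n),
      freeComp_freeMap f (fun n => (M.lifts_push f).act _ (a 0) n)]
  · refine congrArg Neg.neg ?_
    refine (freeComp_sub i j μ ((M.push g).map (x.map' 0 1)) _).trans (Eq.trans ?_
      (freeComp_sub i j _ (M.map (x.map' 0 1)) _).symm)
    rw [freeComp_triv_map hμ, sub_zero, hsub,
      freeComp_freeMap g (fun n => (M.lifts_push g).map (x.map' 0 1) n),
      freeComp_freeMap f (fun n => (M.lifts_push f).map (x.map' 0 1) n)]

theorem lifts_triv (u : R ⟶ S) : PreModel.Lifts u (PreModel.triv F R) (PreModel.triv F S) := by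
  refine ⟨fun c a n => ?_, fun {c d} φ n => ?_⟩
  · refine LinearMap.congr_fun (f := freeMap F u c ∘ₗ (PreModel.triv F R).act c a)
      (g := (PreModel.triv F S).act c a ∘ₗ freeMap F u c) (free_ext fun i f r => ?_) n
    simp only [LinearMap.comp_apply]
    rw [(PreModel.triv F R).act_lin, freeMap_freeMul, freeMap_freeMul,
      (PreModel.triv F S).act_lin, PreModel.triv_act, freeMap_freeIncl, freeMap_freeIncl,
      PreModel.triv_act]
  · refine LinearMap.congr_fun (f := freeMap F u d ∘ₗ (PreModel.triv F R).map φ)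
      (g := (PreModel.triv F S).map φ ∘ₗ freeMap F u c) (free_ext fun i f r => ?_) n
    simp only [LinearMap.comp_apply]
    rw [(PreModel.triv F R).map_lin, freeMap_freeMul, freeMap_freeMul,
      (PreModel.triv F S).map_lin, PreModel.triv_map, freeMap_freeIncl, freeMap_freeIncl,
      PreModel.triv_map]

theorem freeComp_sub_add_sub (i j : Fin p) (μ : R →ₗ[k] k)
    (f g h : FreeMod F R c →ₗ[k] FreeMod F R d) :
    freeComp i j μ (h - f) = freeComp i j μ (g - f) + freeComp i j μ (h - g) := by
  rw [← freeComp_add]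
  congr 1
  abel

theorem diff_add (L M N : PreModel F R) (i j : Fin p) (μ : R →ₗ[k] k) :
    L.diff N i j μ = L.diff M i j μ + M.diff N i j μ := by
  refine GHC.ext1 (fun x a => ?_) fun x a => ?_
  · exact freeComp_sub_add_sub i j μ (L.act _ (a 0)) (M.act _ (a 0)) (N.act _ (a 0))
  · exact (congrArg Neg.neg (freeComp_sub_add_sub i j μ (L.map (x.map' 0 1)) (M.map (x.map' 0 1))
      (N.map (x.map' 0 1)))).trans (neg_add _ _)

theorem cls_congr {G H : ModPresheaf A} {n : ℕ} {z z' : GHC G H n} (h : z = z')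
    (hz : z ∈ ghcZ G H n) : cls z hz = cls z' (h ▸ hz) := by
  subst h; rfl

/-- A gauge transformation is trivial over k^p, so along the small surjection R → k^p it changes the
model by a coboundary. -/
theorem PreModel.DiffClass.of_gauge (hR : R.rad ^ 2 = ⊥) {L M M' : PreModel F R}
    {w : ∀ i j, Module.Dual k (HH (F j) (F i) 1) →ₗ[k] R} (h : L.DiffClass M w) (g : M.Gauge M')
    (hM : M.IsExact) (hM' : M'.IsExact) : L.DiffClass M' w := by
  intro i j μ hμ
  obtain ⟨hz, h⟩ := h i j μ hμ
  have h1 : M.diff M' i j μ ∈ ghcB (F j) (F i) 1 := by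
    rw [g.diff_eq (isSmall_augHom hR) fun c n => freeMap_augHom_eq fun i => g.red c i n]
    exact ⟨_, rfl⟩
  have h2 : M.diff M' i j μ ∈ ghcZ (F j) (F i) 1 :=
    diff_mem (isSmall_augHom hR) (agree_augHom M M') hM hM' i j μ
  have h3 : L.diff M' i j μ ∈ ghcZ (F j) (F i) 1 := by
    rw [diff_add L M M']
    exact Submodule.add_mem _ hz h2
  refine ⟨h3, fun v => ?_⟩
  rw [← h v]
  refine congrArg v (cls_eq.2 ?_)
  rw [diff_add L M M', add_sub_cancel_left]
  exact h1

end HasModel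

/-! ### Morphisms into the source of a small surjection -/

section SmallMaps

open PointedAlg

variable {k : Type u} [Field k] {p : ℕ} {Q R S : PointedAlg k p}

/-- f and g differ by a K-valued map d, and f(a)f(b) - g(a)g(b) = d(a)f(b) + g(a)d(b) lies in KI +
IK = 0. -/
theorem IsSmall.hom_mul_eq {u : R ⟶ S} (hu : IsSmall u) {f g : Q ⟶ R} (h : f ≫ u = g ≫ u) {a b : Q}
    (ha : a ∈ Q.rad) (hb : b ∈ Q.rad) : hom f (a * b) = hom g (a * b) := by
  have hrad : ∀ (f : Q ⟶ R) {a}, a ∈ Q.rad → hom f a ∈ R.rad := fun f a ha => by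
    rw [mem_rad, aug_hom]
    exact (mem_rad _).1 ha
  have hk : ∀ x, hom u (hom f x - hom g x) = 0 := fun x => by
    rw [map_sub, sub_eq_zero]
    exact congrArg (fun φ => hom φ x) h
  rw [map_mul, map_mul]
  have h1 := hu.mul_rad _ (hrad f hb) _ (hk a)
  have h2 := hu.rad_mul _ (hrad g ha) _ (hk b)
  rw [sub_mul, sub_eq_zero] at h1
  rw [mul_sub, sub_eq_zero] at h2
  rw [h1, h2]

theorem IsSmall.hom_eq_of_mem_rad_sq {u : R ⟶ S} (hu : IsSmall u) {f g : Q ⟶ R} (h : f ≫ u = g ≫ u)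
    {x : Q} (hx : x ∈ Q.rad ^ 2) : hom f x = hom g x := by
  rw [Submodule.pow_succ, Submodule.pow_one] at hx
  induction hx using Submodule.mul_induction_on' with
  | mem_mul_mem a ha b hb => exact hu.hom_mul_eq h ha hb
  | add a _ b _ ha hb => rw [map_add, map_add, ha, hb]

/-- A morphism whose composition with a small surjection factors through `f` factors through
`toSmallExt f`. -/
theorem IsSmall.exists_factor_smallExt {T : PointedAlg k p} {u : R ⟶ S} (hu : IsSmall u) {f : T ⟶ Q}
    {w : T ⟶ R} {v : Q ⟶ S} (h : w ≫ u = f ≫ v) :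
    ∃ w' : smallExt f ⟶ R, toSmallExt f ≫ w' = w ∧ w' ≫ u = smallExtMap f ≫ v := by
  have hrad : ∀ {a}, a ∈ T.rad → hom w a ∈ R.rad := fun ha => by
    rw [mem_rad, aug_hom]
    exact (mem_rad _).1 ha
  have hk : ∀ {b}, b ∈ PointedAlg.ker f → hom u (hom w b) = 0 := fun {b} hb => by
    have : hom (w ≫ u) b = hom v (hom f b) := congrArg (fun φ => hom φ b) h
    rw [PointedAlg.hom_comp] at this
    rw [this, (mem_ker f).1 hb, map_zero]
  -- The morphism w sends ker f into K, hence b into IK + KI = 0.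
  have h1 : smallIdeal f ≤ PointedAlg.ker w := by
    refine sup_le (Ideal.mul_le.2 fun a ha b hb => ?_) (Ideal.mul_le.2 fun a ha b hb => ?_)
    · exact (map_mul _ _ _).trans (hu.rad_mul _ (hrad ha) _ (hk hb))
    · exact (map_mul _ _ _).trans (hu.mul_rad _ (hrad hb) _ (hk ha))
  obtain ⟨w', hw'⟩ := exists_factor (toSmallExt_surjective f) w fun r hr =>
    h1 ((toSmallExt_eq_zero f).1 hr)
  refine ⟨w', hw', hom_ext_of_surjective (toSmallExt_surjective f) ?_⟩
  rw [← Category.assoc, hw', h]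
  rfl

/-- The images of the generators under a morphism can be changed by elements of the kernel. -/
theorem exists_freeFormal_hom_add {V : Fin p → Fin p → Type u} [∀ i j, AddCommGroup (V i j)]
    [∀ i j, Module k (V i j)] [∀ i j, Module.Finite k (V i j)] (hR : R.IsComplete) {u : R ⟶ S}
    (w : freeFormal V ⟶ R) (δ : ∀ i j, V i j →ₗ[k] R) (h0 : ∀ i j v, hom u (δ i j v) = 0)
    (h1 : ∀ i j v, R.e i * δ i j v = δ i j v) (h2 : ∀ i j v, δ i j v * R.e j = δ i j v) :
    ∃ w' : freeFormal V ⟶ R, ∀ i j v,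
      hom w' (freeFormalGen V i j v) = hom w (freeFormalGen V i j v) + δ i j v := by
  refine exists_freeFormal_hom hR (fun i j => (hom w).toLinearMap ∘ₗ freeFormalGen V i j + δ i j)
    (fun i j v => ?_) (fun i j v => ?_) (fun i j v => ?_)
  · refine Ideal.add_mem _ ((mem_rad _).2 ?_) ((mem_rad _).2 ?_)
    · refine (aug_hom w _).trans ?_
      exact (mem_rad _).1 (freeFormalGen_mem_rad i j v)
    · rw [← aug_hom u, h0, map_zero]
  · refine (mul_add _ _ _).trans (congrArg₂ _ ?_ (h1 i j v))
    rw [← hom_e w]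
    exact (map_mul (hom w) _ _).symm.trans (congrArg (hom w) (e_mul_freeFormalGen i j v))
  · refine (add_mul _ _ _).trans (congrArg₂ _ ?_ (h2 i j v))
    rw [← hom_e w]
    exact (map_mul (hom w) _ _).symm.trans (congrArg (hom w) (freeFormalGen_mul_e i j v))

end SmallMaps

/-! ### Difference classes in H^1 ⊗ K -/

section DifferenceClasses

variable {k : Type u} [Field k] {C : Type u} [SmallCategory C] {A : C ⥤ AlgCat.{u} k} {p : ℕ}
  {F : Fin p → ModPresheaf A} {R S : PointedAlg k p}

/-- The analogue of `exists_obs` in degree 1. Since the values lie in e_i K e_j, they can be added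
to the images of the generators of T^1. -/
theorem exists_diff_class [Module.Finite k R] {u : R ⟶ S} {L L' : PreModel F R}
    (h : PreModel.Agree u L L') (hZ : ∀ i j μ, L.diff L' i j μ ∈ ghcZ (F j) (F i) 1) :
    ∃ w : ∀ i j, Module.Dual k (HH (F j) (F i) 1) →ₗ[k] R, (∀ i j v, PointedAlg.hom u (w i j v) = 0) ∧
      (∀ i j v, R.e i * w i j v = w i j v) ∧ (∀ i j v, w i j v * R.e j = w i j v) ∧
      ∀ i j μ (v : Module.Dual k (HH (F j) (F i) 1)), v (cls _ (hZ i j μ)) = μ (w i j v) := by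
  let w : ∀ i j, Module.Dual k (HH (F j) (F i) 1) →ₗ[k] kerSpace u i j := fun i j =>
    ∑ α, (LinearMap.applyₗ (cls _ (hZ i j (kerDual u i j α)))).smulRight (kerBasis u i j α)
  refine ⟨fun i j => (kerSpace u i j).subtype ∘ₗ w i j, fun i j v => (w i j v).2.1,
    fun i j v => (w i j v).2.2.1, fun i j v => (w i j v).2.2.2, fun i j μ v => ?_⟩
  have h1 : cls _ (hZ i j μ) =
      ∑ α, μ (kerBasis u i j α : R) • cls _ (hZ i j (kerDual u i j α)) := by
    have : (⟨_, hZ i j μ⟩ : ghcZ (F j) (F i) 1) =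
        ∑ α, μ (kerBasis u i j α : R) • ⟨_, hZ i j (kerDual u i j α)⟩ := by
      refine Subtype.ext ?_
      simpa using PreModel.diff_eq_sum h i j μ
    refine (congrArg (Submodule.mkQ _) this).trans ?_
    simp only [map_sum, map_smul]
    rfl
  rw [h1]
  simp [w, mul_comm]

theorem cls_add {G H : ModPresheaf A} {n : ℕ} {z z' : GHC G H n} (hz : z ∈ ghcZ G H n)
    (hz' : z' ∈ ghcZ G H n) : cls (z + z') (Submodule.add_mem _ hz hz') = cls z hz + cls z' hz' :=
  rfl

end DifferenceClasses

/-! ### Generalized Massey products give a hull -/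

section Hull

open PointedAlg

variable {k : Type u} [Field k] {C : Type u} [SmallCategory C] {A : C ⥤ AlgCat.{u} k} {p : ℕ}
  {F : Fin p → ModPresheaf A} {R S : PointedAlg k p}
  {o : formalT F 2 ⟶ formalT F 1} {hH : (cofiber o).IsPro}
  {ξ : ProElt (defFunctor F) ⟨cofiber o, hH⟩}

theorem formalT_hom_ext {n : ℕ} [∀ i j, Module.Finite k (HH (F j) (F i) n)] (hR : R.IsComplete)
    {f g : formalT F n ⟶ R} (h : ∀ i j v, hom f (formalGen F n i j v) = hom g (formalGen F n i j v)) :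
    f = g :=
  freeFormal_hom_ext hR h

/-- The difference of two extensions of scalars of the universal deformation is determined by the
images of the generators. -/
theorem exists_cls_diff_push (h : IsMassey o hH ξ) {n : ℕ} (hn : 1 ≤ n)
    {M : PreModel F ((cofiber o).level n)} (hM : HasModel (ξ.1 n) M) (f g : (cofiber o).level n ⟶ R)
    (μ : R →ₗ[k] k) (hfg : ∀ x ∈ ((cofiber o).level n).rad ^ 2, hom f x = hom g x) (i j : Fin p) :
    ∃ hz : (M.push f).diff (M.push g) i j μ ∈ ghcZ (F j) (F i) 1,
      ∀ v : Module.Dual k (HH (F j) (F i) 1), v (cls _ hz) =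
        μ (hom g (hom (toCofiber o ≫ (cofiber o).toLevel n) (formalGen F 1 i j v))) -
        μ (hom f (hom (toCofiber o ≫ (cofiber o).toLevel n) (formalGen F 1 i j v))) := by
  -- The first order class of ξ lives over H / I^2, so the comparison is transported there along l.
  obtain ⟨l, hl, hl'⟩ : ∃ l : (cofiber o).level n ⟶ (cofiber o).level 1,
      (cofiber o).toLevel n ≫ l = (cofiber o).toLevel 1 ∧
        (defFunctor F).map (X := ProAlg.level ⟨cofiber o, hH⟩ n)
          (Y := ProAlg.level ⟨cofiber o, hH⟩ 1) (ObjectProperty.homMk l) (ξ.1 n) = ξ.1 1 := by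
    obtain ⟨l, hl, hl'⟩ := exists_map_proElt ⟨cofiber o, hH⟩ ξ
      (R := ProAlg.level ⟨cofiber o, hH⟩ 1) hn (𝟙 ((cofiber o).level 1))
    exact ⟨l, hl, hl'.trans (congrArg (fun φ => φ (ξ.1 1)) ((defFunctor F).map_id _))⟩
  have hlr : ∀ r, hom l (hom ((cofiber o).toLevel n) r) = hom ((cofiber o).toLevel 1) r := fun r =>
    congrArg (fun φ => hom φ r) hl
  have hM1 : HasModel (ξ.1 1) (M.push l) := by
    have := hM.map (R := ProAlg.level ⟨cofiber o, hH⟩ n) (S := ProAlg.level ⟨cofiber o, hH⟩ 1)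
      (ObjectProperty.homMk l)
    rwa [hl'] at this
  have hrad := (cofiber o).level_rad_pow 1
  obtain ⟨X, hX, hcl⟩ := h.firstOrder
  obtain ⟨M1, hθ, hd⟩ := exists_diffClass_of_isFirstOrderClass hrad hcl
  have hM2 : HasModel (ξ.1 1) M1 := ⟨X, hX, hθ⟩
  obtain ⟨G⟩ := hM2.gauge hrad hM1
  have hd := hd.of_gauge hrad G (hM2.isExact hrad) (hM1.isExact hrad)
  have hls : Function.Surjective (hom l) := fun x => by
    obtain ⟨r, rfl⟩ := toLevel_surjective _ _ x
    exact ⟨_, hlr r⟩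
  obtain ⟨s, hs⟩ := (hom l).toLinearMap.exists_rightInverse_of_surjective (LinearMap.range_eq_top.2 hls)
  have hs : ∀ x, hom l (s x) = x := fun x => LinearMap.congr_fun hs x
  -- As f and g agree on I^2, the form ν descends to H / I^2, where ν ∘ s is the induced form. It
  -- vanishes on k^p because f and g agree there, so the first order class can be evaluated on it.
  let ν : (cofiber o).level n →ₗ[k] k := μ ∘ₗ (hom g).toLinearMap - μ ∘ₗ (hom f).toLinearMap
  have hν : ∀ x, hom l x = 0 → ν x = 0 := fun x hx => by
    obtain ⟨r, rfl⟩ := toLevel_surjective _ _ x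
    rw [hlr, toLevel_eq_zero] at hx
    have := hfg _ (hom_pow_rad ((cofiber o).toLevel n) 2 hx)
    change μ (hom g _) - μ (hom f _) = 0
    rw [this, sub_self]
  have hν' : (ν ∘ₗ s) ∘ₗ (hom l).toLinearMap = ν := LinearMap.ext fun x => by
    change ν (s (hom l x)) = ν x
    rw [← sub_eq_zero, ← map_sub]
    exact hν _ (by rw [map_sub, hs, sub_self])
  have heq : (M.push f).diff (M.push g) i j μ =
      (PreModel.triv F _).diff (M.push l) i j (ν ∘ₗ s) := by
    rw [diff_push_push, PreModel.diff_of_lifts (lifts_triv l) (PreModel.lifts_push l M), hν']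
  obtain ⟨hz, hv⟩ := hd i j (ν ∘ₗ s) fun a => by
    rw [← hom_incl l]
    refine (LinearMap.congr_fun hν' _).trans ?_
    change μ (hom g _) - μ (hom f _) = 0
    rw [hom_incl, hom_incl, sub_self]
  refine ⟨heq ▸ hz, fun v => ?_⟩
  rw [cls_congr heq]
  refine (hv v).trans ?_
  change (ν ∘ₗ s) (hom ((cofiber o).toLevel 1) (hom (toCofiber o) _)) = _
  rw [← hlr]
  exact LinearMap.congr_fun hν' _

/-- Both halves of the definition of Massey products are used. The obstruction condition shows that
every lift T^1 → R of v descends to H_o, since x exists; the first order condition shows that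
changing such a lift on generators moves the induced deformation by the corresponding class in H^1 ⊗
K, which suffices to reach x. -/
theorem smoothAt_of_isMassey
    (hfin : ∀ i j, Module.Finite k (HH (F j) (F i) 1) ∧ Module.Finite k (HH (F j) (F i) 2))
    (h : IsMassey o hH ξ) (R S : ArtAlg k p) (u : R ⟶ S) (hu : IsSmall u.hom) :
    SmoothAt ⟨cofiber o, hH⟩ ξ u := by
  intro v x hx
  have := fun i j => (hfin i j).1
  have := fun i j => (hfin i j).2
  have := finite_of_isArt R.property
  obtain ⟨n, hn, hR, hS⟩ : ∃ n, 1 ≤ n ∧ R.obj.rad ^ (n + 1) = ⊥ ∧ S.obj.rad ^ (n + 1) = ⊥ := by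
    obtain ⟨a, ha⟩ := R.property.exists_pow_eq_bot
    obtain ⟨b, hb⟩ := S.property.exists_pow_eq_bot
    exact ⟨a + b + 1, by omega, rad_pow_of_le ha (by omega), rad_pow_of_le hb (by omega)⟩
  have hRc := R.property.2
  obtain ⟨v', hv'⟩ := exists_factor_level hS v
  obtain ⟨X, hX, hob⟩ := h.obstruction n hn
  have hsurj : Function.Surjective (hom (toCofiber o ≫ (cofiber o).toLevel n)) :=
    (toLevel_surjective _ n).comp (toCofiber_surjective o)
  have hsm := isSmall_smallExtMap hsurj
  obtain ⟨M, hθ, hobs⟩ :=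
    exists_obs_of_isObstruction ((cofiber o).level_rad_pow n) hsm.surjective hob
  have hM : HasModel (ξ.1 n) M := ⟨X, hX, hθ⟩
  have hME := hM.isExact ((cofiber o).level_rad_pow n)
  have hpush : ∀ {R : ArtAlg k p} (g : (cofiber o).level n ⟶ R.obj),
      HasModel (_root_.yonedaMap ⟨cofiber o, hH⟩ ξ R ((cofiber o).toLevel n ≫ g)) (M.push g) :=
    fun {R} g => by
      rw [yonedaMap_eq ⟨cofiber o, hH⟩ ξ _ g rfl]
      exact hM.map (R := ProAlg.level ⟨cofiber o, hH⟩ n) (ObjectProperty.homMk g)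
  obtain ⟨N₀, hN₀, hNE₀⟩ := exists_hasModel hR x
  have hv₁ := hpush v'
  rw [hv', ← hx] at hv₁
  obtain ⟨g⟩ := (hN₀.map u).gauge hS hv₁
  -- Replaces the model of x by one that lifts the push-forward of M along v on the nose and not
  -- just up to gauge.
  obtain ⟨N, hNl, g', -⟩ := g.exists_lifts hR hu.surjective (PreModel.lifts_push u.hom N₀)
  have hNE := g'.isExact hR hNE₀
  have hN : HasModel x N := hN₀.of_gauge (g'.symm hR)
  -- Such a w induces T^1 / b → R above v'. By naturality the images of the o(λ) are the obstruction
  -- for lifting the push-forward of M along u. It is zero because N is an exact lift, so w kills o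
  -- and factors through the cofiber.
  have hfac : ∀ w : formalT F 1 ⟶ R.obj, w ≫ u.hom = toCofiber o ≫ v →
      ∃ w' : (cofiber o).level n ⟶ R.obj,
        (toCofiber o ≫ (cofiber o).toLevel n) ≫ w' = w ∧ w' ≫ u.hom = v' := fun w hw => by
    have hw' : w ≫ u.hom = (toCofiber o ≫ (cofiber o).toLevel n) ≫ v' := by
      rw [hw, Category.assoc, hv']
    obtain ⟨w1, h1, h2⟩ := hu.exists_factor_smallExt hw'
    have hzero := fun i j v => (hobs.push h2).unique hR hu (hME.push v') (hME.push v')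
      (hNl.obs_zero hNE) (PreModel.Gauge.refl _) i j v
    have hgen := hom_eq_zero_of_gen hRc (o ≫ w) fun i j v => by
      rw [← h1]
      exact hzero i j v
    obtain ⟨w2, hw2⟩ := exists_factor_cofiber hR o w hgen
    obtain ⟨w3, hw3⟩ := exists_factor_level hR w2
    refine ⟨w3, by rw [Category.assoc, hw3, hw2], hom_ext_of_surjective hsurj ?_⟩
    rw [← hw', ← Category.assoc, Category.assoc (toCofiber o), hw3, hw2]
  obtain ⟨w, hw⟩ := exists_lift_freeFormal hRc S.property.2 u.hom hu.surjective (toCofiber o ≫ v)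
  obtain ⟨w', hw', hwu⟩ := hfac w hw
  have hl : ∀ w' : (cofiber o).level n ⟶ R.obj, w' ≫ u.hom = v' →
      PreModel.Lifts u.hom (M.push w') (M.push v') := fun w' hwu => by
    rw [← hwu, ← PreModel.push_comp]
    exact PreModel.lifts_push _ _
  have hA := (hl w' hwu).agree hNl
  -- The push-forward of M along w' and N are exact lifts of the same model; δ is the class of their
  -- difference.
  obtain ⟨δ, h0, h1, h2, h3⟩ := exists_diff_class hA (PreModel.diff_mem hu hA (hME.push w') hNE)
  obtain ⟨w₁, hw₁⟩ : ∃ w₁ : formalT F 1 ⟶ R.obj, ∀ i j v, hom w₁ (formalGen F 1 i j v) =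
      hom w (formalGen F 1 i j v) + δ i j v := exists_freeFormal_hom_add hRc w δ h0 h1 h2
  obtain ⟨w₁', hw₁', hwu₁⟩ := hfac w₁ (formalT_hom_ext S.property.2 fun i j v => by
    refine Eq.trans ?_ (congrArg (fun φ => hom φ (formalGen F 1 i j v)) hw)
    refine (congrArg (hom u.hom) (hw₁ i j v)).trans ?_
    rw [map_add, h0, add_zero]
    rfl)
  -- Passing from w₁' to w' contributes -δ on the generators, and passing from w' to N contributes
  -- δ, so the total class is zero.
  obtain ⟨G⟩ := PreModel.exists_gauge hu ((hl w₁' hwu₁).agree hNl) fun i j μ => by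
    obtain ⟨hz, hv⟩ := exists_cls_diff_push h hn hM w₁' w' μ
      (fun x hx => hu.hom_eq_of_mem_rad_sq (hwu₁.trans hwu.symm) hx) i j
    rw [diff_add _ (M.push w')]
    rw [← cls_eq_zero (hz := Submodule.add_mem _ hz (PreModel.diff_mem hu hA (hME.push w') hNE i j μ)),
      ← Module.forall_dual_apply_eq_zero_iff k]
    intro v
    refine (congrArg v (cls_add hz (PreModel.diff_mem hu hA (hME.push w') hNE i j μ))).trans ?_
    rw [map_add, hv, h3]
    have e1 : hom w' (hom (toCofiber o ≫ (cofiber o).toLevel n) (formalGen F 1 i j v)) =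
        hom w (formalGen F 1 i j v) := congrArg (fun φ => hom φ (formalGen F 1 i j v)) hw'
    have e2 : hom w₁' (hom (toCofiber o ≫ (cofiber o).toLevel n) (formalGen F 1 i j v)) =
        hom w (formalGen F 1 i j v) + δ i j v :=
      (congrArg (fun φ => hom φ (formalGen F 1 i j v)) hw₁').trans (hw₁ i j v)
    rw [e1, e2, map_add]
    ring
  refine ⟨(cofiber o).toLevel n ≫ w₁', ?_, ?_⟩
  · rw [Category.assoc, hwu₁, hv']
  · exact (hpush w₁').unique hR (hN.of_gauge G)

/-- Generalized Massey products determine a hull. -/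
theorem isHull_of_isMassey
    (hfin : ∀ i j, Module.Finite k (HH (F j) (F i) 1) ∧ Module.Finite k (HH (F j) (F i) 2))
    (h : IsMassey o hH ξ) : IsHull (defFunctor F) ⟨cofiber o, hH⟩ ξ where
  smooth R S u hu v x hx := by
    obtain ⟨n, hn⟩ := R.property.exists_pow_eq_bot
    -- With n + 1 steps the required power of the radical is I^0, so the condition on the kernel is
    -- empty.
    refine smoothAt_of_small (smoothAt_of_isMassey hfin h) hn (n + 1) S u hu ?_ v x hx
    rw [Nat.sub_self, Submodule.pow_zero, Ideal.one_eq_top]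
    exact le_top
  bijective R hR := by
    have := fun i j => (hfin i j).1
    constructor
    · intro f g hfg
      obtain ⟨X, hX, hcl⟩ := h.firstOrder
      have hrad := (cofiber o).level_rad_pow 1
      obtain ⟨M, hθ, -⟩ := exists_diffClass_of_isFirstOrderClass hrad hcl
      have hM : HasModel (ξ.1 1) M := ⟨X, hX, hθ⟩
      obtain ⟨f', rfl⟩ := exists_factor_level hR f
      obtain ⟨g', rfl⟩ := exists_factor_level hR g
      rw [yonedaMap_eq ⟨cofiber o, hH⟩ ξ _ f' rfl, yonedaMap_eq ⟨cofiber o, hH⟩ ξ _ g' rfl] at hfg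
      have h1 := hM.map (R := ProAlg.level ⟨cofiber o, hH⟩ 1) (S := R) (ObjectProperty.homMk f')
      have h2 := hM.map (R := ProAlg.level ⟨cofiber o, hH⟩ 1) (S := R) (ObjectProperty.homMk g')
      rw [hfg] at h1
      obtain ⟨G⟩ := h1.gauge hR h2
      refine hom_ext_of_surjective (toCofiber_surjective o)
        (formalT_hom_ext R.property.2 fun i j v => PreModel.eq_of_forall_form fun μ => ?_)
      -- At level 1 the square of the radical is zero, so the agreement on it is automatic. The two
      -- push-forwards are gauge equivalent, so the class vanishes and all linear forms agree on the
      -- images of the generators.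
      obtain ⟨hz, hv⟩ := exists_cls_diff_push h le_rfl hM f' g' μ (fun x hx => by
        have : x ∈ ((cofiber o).level 1).rad ^ (1 + 1) := hx
        rw [hrad] at this
        rw [(Submodule.mem_bot _).1 this, map_zero, map_zero]) i j
      have h3 : cls _ hz = 0 := by
        rw [cls_eq_zero]
        have := G.diff_eq (isSmall_augHom hR)
          (fun c n => freeMap_augHom_eq fun i => G.red c i n) i j μ
        exact ⟨_, this.symm⟩
      have h4 := hv v
      rw [h3, map_zero] at h4
      exact (sub_eq_zero.1 h4.symm).symm
    · intro x
      -- Surjectivity is smoothness along R → k^p; the compatibility holds because there is only one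
      -- deformation over k^p.
      obtain ⟨w, -, hw⟩ := smoothAt_of_isMassey hfin h R ⟨base k p, isArt_base⟩
        (ObjectProperty.homMk (augHom R.obj)) (isSmall_augHom hR) (augHom (cofiber o)) x
        (unique_def_base _ _)
      exact ⟨w, hw⟩

end Hull

/-! ### Levels of cofibers, and convergence of linear maps -/

section Levels

open PointedAlg

variable {k : Type u} [Field k] {p : ℕ} {Q R S T : PointedAlg k p}

theorem isSmall_levelTrans (R : PointedAlg k p) (n : ℕ) : IsSmall (R.levelTrans n) := by
  have key : ∀ x, hom (R.levelTrans n) x = 0 → x ∈ (R.level (n + 1)).rad ^ (n + 1) := fun x hx => by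
    obtain ⟨r, rfl⟩ := toLevel_surjective _ _ x
    rw [levelTrans_toLevel, toLevel_eq_zero] at hx
    exact hom_pow_rad _ _ hx
  have h0 := R.level_rad_pow (n + 1)
  refine ⟨fun s => ?_, fun r hr x hx => ?_, fun r hr x hx => ?_⟩
  · obtain ⟨r, rfl⟩ := toLevel_surjective _ _ s
    exact ⟨hom (R.toLevel (n + 1)) r, rfl⟩
  · have h1 : r * x ∈ (R.level (n + 1)).rad ^ (n + 1 + 1) := by
      rw [Ideal.IsTwoSided.pow_succ]
      exact Ideal.mul_mem_mul hr (key x hx)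
    rw [h0] at h1
    exact (Submodule.mem_bot _).1 h1
  · have h1 : x * r ∈ (R.level (n + 1)).rad ^ (n + 1 + 1) := by
      rw [Submodule.pow_succ]
      exact Ideal.mul_mem_mul (key x hx) hr
    rw [h0] at h1
    exact (Submodule.mem_bot _).1 h1

/-- The projection to `H / I(H)^{n+1}` for a cofiber `H`. -/
abbrev cofiberLevel (o : Q ⟶ T) (n : ℕ) : T ⟶ (cofiber o).level n :=
  toCofiber o ≫ (cofiber o).toLevel n

theorem cofiberLevel_surjective (o : Q ⟶ T) (n : ℕ) :
    Function.Surjective (hom (cofiberLevel o n)) :=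
  (toLevel_surjective _ n).comp (toCofiber_surjective o)

theorem cofiberLevel_trans (o : Q ⟶ T) (n : ℕ) :
    cofiberLevel o (n + 1) ≫ (cofiber o).levelTrans n = cofiberLevel o n := rfl

theorem cofiberLevel_eq_zero (o : Q ⟶ T) {n : ℕ} {x : T} (hx : x ∈ T.rad ^ (n + 1)) :
    hom (cofiberLevel o n) x = 0 := by
  have := hom_pow_rad (cofiberLevel o n) _ hx
  rw [level_rad_pow] at this
  exact (Submodule.mem_bot _).1 this

/-- f maps I(R)^m onto I(S)^m, so a linear section of this restriction lifts φ. Multiplying by e_i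
and e_j makes the lift homogeneous without changing its image. -/
theorem exists_lift_mem_pow_rad {V : Type*} [AddCommGroup V] [Module k V] {f : R ⟶ S}
    (hf : Function.Surjective (hom f)) {m : ℕ} {i j : Fin p} {φ : V →ₗ[k] S}
    (h : ∀ v, φ v ∈ S.rad ^ m) (h1 : ∀ v, S.e i * φ v = φ v) (h2 : ∀ v, φ v * S.e j = φ v) :
    ∃ ψ : V →ₗ[k] R, (∀ v, ψ v ∈ R.rad ^ m) ∧ (∀ v, hom f (ψ v) = φ v) ∧
      (∀ v, R.e i * ψ v = ψ v) ∧ ∀ v, ψ v * R.e j = ψ v := by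
  let P := (R.rad ^ m).restrictScalars k
  let P' := (S.rad ^ m).restrictScalars k
  let q : P →ₗ[k] P' := (hom f).toLinearMap.restrict fun x hx => hom_pow_rad f m hx
  have hq : Function.Surjective q := fun x => by
    obtain ⟨r, hr, h⟩ := exists_of_mem_pow_rad f hf m x.2
    exact ⟨⟨r, hr⟩, Subtype.ext h⟩
  obtain ⟨s, hs⟩ := q.exists_rightInverse_of_surjective (LinearMap.range_eq_top.2 hq)
  have hs : ∀ x, hom f (s x) = x := fun x => congrArg Subtype.val (LinearMap.congr_fun hs x)
  let ψ : V →ₗ[k] R := P.subtype ∘ₗ s ∘ₗ φ.codRestrict P' h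
  have hψ : ∀ v, hom f (ψ v) = φ v := fun v => hs _
  refine ⟨LinearMap.mulRight k (R.e j) ∘ₗ LinearMap.mulLeft k (R.e i) ∘ₗ ψ, fun v => ?_, fun v => ?_,
    fun v => ?_, fun v => ?_⟩
  · exact Ideal.mul_mem_right _ _ (Ideal.mul_mem_left _ _ (s _).2)
  · change hom f (R.e i * ψ v * R.e j) = φ v
    rw [map_mul, map_mul, hom_e, hom_e, hψ, h1, h2]
  · change R.e i * (R.e i * ψ v * R.e j) = R.e i * ψ v * R.e j
    rw [← mul_assoc, ← mul_assoc, e_mul_e]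
  · change R.e i * ψ v * R.e j * R.e j = R.e i * ψ v * R.e j
    rw [mul_assoc, e_mul_e]

/-- Completeness only controls the limit modulo I^n at index n; comparison with the later index n +
c recovers the precision I^(n+c). -/
theorem exists_linear_limit {V : Type*} [AddCommGroup V] [Module k V] (hR : R.IsComplete) {c : ℕ}
    {φ : ℕ → V →ₗ[k] R} (h : ∀ n v, φ (n + 1) v - φ n v ∈ R.rad ^ (n + c)) :
    ∃ ψ : V →ₗ[k] R, ∀ n v, ψ v - φ n v ∈ R.rad ^ (n + c) := by
  have h' : ∀ n d v, φ (n + d) v - φ n v ∈ R.rad ^ (n + c) := fun n d v => by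
    induction d with
    | zero => simp
    | succ d ih =>
      have := Ideal.add_mem _ (Ideal.pow_le_pow_right (by omega : n + c ≤ n + d + c) (h (n + d) v)) ih
      rwa [sub_add_sub_cancel] at this
  choose y hy using fun v => hR.2 (fun n => φ n v) fun n =>
    Ideal.pow_le_pow_right (Nat.le_add_right n c) (h n v)
  have hy' : ∀ n v, y v - φ n v ∈ R.rad ^ (n + c) := fun n v => by
    have := Ideal.add_mem _ (hy v (n + c)) (h' n c v)
    rwa [sub_add_sub_cancel] at this
  have h0 : ∀ x, (∀ n, x ∈ R.rad ^ (n + c)) → x = 0 := fun x hx =>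
    hR.1 x fun n => Ideal.pow_le_pow_right (Nat.le_add_right n c) (hx n)
  refine ⟨{ toFun := y, map_add' := fun a b => ?_, map_smul' := fun t a => ?_ }, hy'⟩
  · rw [← sub_eq_zero]
    refine h0 _ fun n => ?_
    have := Ideal.sub_mem _ (Ideal.sub_mem _ (hy' n (a + b)) (hy' n a)) (hy' n b)
    rw [map_add] at this
    convert this using 1
    abel
  · rw [← sub_eq_zero]
    refine h0 _ fun n => ?_
    have := Ideal.sub_mem _ (hy' n (t • a)) (Submodule.smul_of_tower_mem (R.rad ^ (n + c)) t (hy' n a))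
    rw [map_smul, smul_sub, sub_sub_sub_cancel_right] at this
    exact this

/-- The kernel of `T / b_{n+1} → T / b_n` lies in `I^{n+2}`. -/
theorem mem_pow_rad_smallExt (o : Q ⟶ T) {n : ℕ} {y : T}
    (hy : hom (toSmallExt (cofiberLevel o n)) y = 0) :
    hom (toSmallExt (cofiberLevel o (n + 1))) y ∈ (smallExt (cofiberLevel o (n + 1))).rad ^ (n + 2) := by
  -- An element killed at level n is the sum of an element of I^(n+1) and one killed at level n + 1.
  -- After multiplication by I the second summand dies in the quotient by the small ideal of level n
  -- + 1, and the first lies in I^(n+2).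
  have key : ∀ b ∈ PointedAlg.ker (cofiberLevel o n), ∃ c ∈ T.rad ^ (n + 1),
      b - c ∈ PointedAlg.ker (cofiberLevel o (n + 1)) := fun b hb => by
    have hb : hom ((cofiber o).toLevel n) (hom (toCofiber o) b) = 0 := hb
    rw [toLevel_eq_zero] at hb
    obtain ⟨c, hc, hc'⟩ := exists_of_mem_pow_rad (toCofiber o) (toCofiber_surjective o) _ hb
    refine ⟨c, hc, ?_⟩
    change hom ((cofiber o).toLevel (n + 1)) (hom (toCofiber o) (b - c)) = 0
    rw [map_sub, hc', sub_self, map_zero]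
  have hk : smallIdeal (cofiberLevel o n) ≤ Ideal.comap (hom (toSmallExt (cofiberLevel o (n + 1))))
      ((smallExt (cofiberLevel o (n + 1))).rad ^ (n + 2)) := by
    refine sup_le (Ideal.mul_le.2 fun a ha b hb => ?_) (Ideal.mul_le.2 fun b hb a ha => ?_)
    · obtain ⟨c, hc, hbc⟩ := key b hb
      have h1 : hom (toSmallExt (cofiberLevel o (n + 1))) (a * (b - c)) = 0 :=
        (toSmallExt_eq_zero _).2 (Submodule.mem_sup_left (Ideal.mul_mem_mul ha hbc))
      rw [mul_sub, map_sub, sub_eq_zero] at h1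
      rw [Ideal.mem_comap, h1]
      refine hom_pow_rad _ _ ?_
      rw [Ideal.IsTwoSided.pow_succ]
      exact Ideal.mul_mem_mul ha hc
    · obtain ⟨c, hc, hbc⟩ := key b hb
      have h1 : hom (toSmallExt (cofiberLevel o (n + 1))) ((b - c) * a) = 0 :=
        (toSmallExt_eq_zero _).2 (Submodule.mem_sup_right (Ideal.mul_mem_mul hbc ha))
      rw [sub_mul, map_sub, sub_eq_zero] at h1
      rw [Ideal.mem_comap, h1]
      refine hom_pow_rad _ _ ?_
      rw [Submodule.pow_succ]
      exact Ideal.mul_mem_mul hc ha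
  exact hk ((toSmallExt_eq_zero _).1 hy)

end Levels

/-! ### Changing the obstruction morphism in high degree -/

section Stages

open PointedAlg

variable {k : Type u} [Field k] {C : Type u} [SmallCategory C] {A : C ⥤ AlgCat.{u} k} {p : ℕ}
  {F : Fin p → ModPresheaf A} {R S : PointedAlg k p} {o : formalT F 2 ⟶ formalT F 1}

theorem PreModel.push_id (M : PreModel F R) : M.push (𝟙 R) = M :=
  PreModel.Lifts.push_eq ⟨fun c a n => by rw [freeMap_id, freeMap_id],
    fun φ n => by rw [freeMap_id, freeMap_id]⟩

theorem PreModel.DiffClass.push {M : PreModel F R} (u : R ⟶ S)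
    {w : ∀ i j, Module.Dual k (HH (F j) (F i) 1) →ₗ[k] R} (h : (PreModel.triv F R).DiffClass M w) :
    (PreModel.triv F S).DiffClass (M.push u) fun i j => (hom u).toLinearMap ∘ₗ w i j := by
  intro i j μ hμ
  obtain ⟨hz, h⟩ := h i j (μ ∘ₗ (hom u).toLinearMap) fun a =>
    (congrArg μ (hom_incl u a)).trans (hμ a)
  have := PreModel.diff_of_lifts (lifts_triv u) (M.lifts_push u) i j μ
  refine ⟨this ▸ hz, fun v => ?_⟩
  rw [cls_congr this]
  exact h v

theorem e_mul_hom_formalGen {n : ℕ} (f : formalT F n ⟶ R) (i j : Fin p) (v) :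
    R.e i * hom f (formalGen F n i j v) = hom f (formalGen F n i j v) := by
  rw [← hom_e f, ← map_mul]
  exact congrArg (hom f)
    (e_mul_freeFormalGen (V := fun i j => Module.Dual k (HH (F j) (F i) n)) i j v)

theorem hom_formalGen_mul_e {n : ℕ} (f : formalT F n ⟶ R) (i j : Fin p) (v) :
    hom f (formalGen F n i j v) * R.e j = hom f (formalGen F n i j v) := by
  rw [← hom_e f, ← map_mul]
  exact congrArg (hom f)
    (freeFormalGen_mul_e (V := fun i j => Module.Dual k (HH (F j) (F i) n)) i j v)

theorem formalGen_mem_rad (n : ℕ) (i j : Fin p) (v) : formalGen F n i j v ∈ (formalT F n).rad :=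
  freeFormalGen_mem_rad (V := fun i j => Module.Dual k (HH (F j) (F i) n)) i j v

theorem hom_formalGen_mem_rad {n : ℕ} (f : formalT F n ⟶ R) (i j : Fin p) (v) :
    hom f (formalGen F n i j v) ∈ R.rad := by
  rw [mem_rad, aug_hom]
  exact (mem_rad _).1 (formalGen_mem_rad n i j v)

/-- The small extension for o maps to the one for o' compatibly with the projections from T^1, so
obstructions given by elements t of T^1 stay given by the same t. -/
theorem PreModel.Obs.push_level {o o' : formalT F 2 ⟶ formalT F 1} {n : ℕ}
    {β : (cofiber o).level n ⟶ (cofiber o').level n} (hβ : cofiberLevel o n ≫ β = cofiberLevel o' n)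
    {M : PreModel F ((cofiber o).level n)} {t : ∀ i j, Module.Dual k (HH (F j) (F i) 2) →ₗ[k] formalT F 1}
    (h : M.Obs (smallExtMap (cofiberLevel o n))
      fun i j => (hom (toSmallExt (cofiberLevel o n))).toLinearMap ∘ₗ t i j) :
    (M.push β).Obs (smallExtMap (cofiberLevel o' n))
      fun i j => (hom (toSmallExt (cofiberLevel o' n))).toLinearMap ∘ₗ t i j := by
  obtain ⟨w, hw, hw'⟩ := (isSmall_smallExtMap (cofiberLevel_surjective o' n)).exists_factor_smallExt
    (f := cofiberLevel o n) (w := toSmallExt (cofiberLevel o' n)) (v := β) (by rw [hβ]; rfl)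
  have := h.push hw'
  rw [← hw]
  exact this

theorem exists_formalT_hom {n : ℕ} [∀ i j, Module.Finite k (HH (F j) (F i) n)] (hR : R.IsComplete)
    (φ : ∀ i j, Module.Dual k (HH (F j) (F i) n) →ₗ[k] R)
    (h0 : ∀ i j v, φ i j v ∈ R.rad) (h1 : ∀ i j v, R.e i * φ i j v = φ i j v)
    (h2 : ∀ i j v, φ i j v * R.e j = φ i j v) :
    ∃ f : formalT F n ⟶ R, ∀ i j v, hom f (formalGen F n i j v) = φ i j v :=
  exists_freeFormal_hom hR φ h0 h1 h2

theorem toCofiber_hom_formalGen (o : formalT F 2 ⟶ formalT F 1) (i j : Fin p) (v) :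
    hom (toCofiber o) (hom o (formalGen F 2 i j v)) = 0 :=
  Ideal.Quotient.eq_zero_iff_mem.2 ((Submodule.mem_iInf _).2 fun _ => Submodule.mem_sup_left
    (TwoSidedIdeal.mem_asIdeal.2 (TwoSidedIdeal.subset_span ⟨_, formalGen_mem_rad 2 i j v, rfl⟩)))

theorem finite_smallExt_cofiberLevel [∀ i j, Module.Finite k (HH (F j) (F i) 1)] (n : ℕ) : Module.Finite k (smallExt (cofiberLevel o n)) :=
  (radFG_freeFormal (fun i j => Module.Dual k (HH (F j) (F i) 1))).finite_of_surjective
    (toSmallExt (cofiberLevel o n)) (toSmallExt_surjective _) (rad_pow_smallExt _ (level_rad_pow _ n))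

variable [∀ i j, Module.Finite k (HH (F j) (F i) 2)]

theorem exists_factor_cofiberLevel {n : ℕ} (hR : R.rad ^ (n + 1) = ⊥) (f : formalT F 1 ⟶ R)
    (h : ∀ i j v, hom f (hom o (formalGen F 2 i j v)) = 0) :
    ∃ g : (cofiber o).level n ⟶ R, cofiberLevel o n ≫ g = f := by
  obtain ⟨g, hg⟩ := exists_factor_cofiber hR o f
    (hom_eq_zero_of_gen (R.isComplete_of_pow_eq_bot hR) (o ≫ f) h)
  obtain ⟨g', hg'⟩ := exists_factor_level hR g
  exact ⟨g', by rw [Category.assoc, hg', hg]⟩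

/-- Modulo I^(m+1) the morphism kills the generators, so it factors through k^p. -/
theorem map_rad_of_gen {m : ℕ} (h : ∀ i j v, hom o (formalGen F 2 i j v) ∈ (formalT F 1).rad ^ (m + 1)) :
    ∀ x ∈ (formalT F 2).rad, hom o x ∈ (formalT F 1).rad ^ (m + 1) := fun x hx =>
  toLevel_eq_zero.1 (hom_eq_zero_of_gen (((formalT F 1).level m).isComplete_of_pow_eq_bot
    (level_rad_pow _ m)) (o ≫ (formalT F 1).toLevel m) (fun i j v => toLevel_eq_zero.2 (h i j v)) x hx)

/-- A change of `o` in high degree induces a morphism of the quotients. -/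
theorem exists_level_hom {o o' : formalT F 2 ⟶ formalT F 1} {m n : ℕ} (hmn : m ≤ n)
    (h : ∀ i j v, hom o' (formalGen F 2 i j v) - hom o (formalGen F 2 i j v) ∈
      (formalT F 1).rad ^ (m + 1)) :
    ∃ β : (cofiber o).level n ⟶ (cofiber o').level m, cofiberLevel o n ≫ β = cofiberLevel o' m := by
  refine exists_factor_cofiberLevel (rad_pow_of_le (level_rad_pow _ m) (by omega)) _ fun i j v => ?_
  have h1 := cofiberLevel_eq_zero o' (h i j v)
  rw [map_sub, sub_eq_zero] at h1
  rw [← h1]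
  change hom ((cofiber o').toLevel m) (hom (toCofiber o') _) = 0
  rw [toCofiber_hom_formalGen, map_zero]

variable [∀ i j, Module.Finite k (HH (F j) (F i) 1)]

/-- Changing `o` such that it gives the obstruction of a model. -/
theorem exists_obs_correction {n : ℕ} (hn : 1 ≤ n)
    (ho : ∀ i j v, hom o (formalGen F 2 i j v) ∈ (formalT F 1).rad ^ 2)
    {M : PreModel F ((cofiber o).level n)}
    {w : ∀ i j, Module.Dual k (HH (F j) (F i) 2) →ₗ[k] smallExt (cofiberLevel o n)}
    (hw : M.Obs (smallExtMap (cofiberLevel o n)) w)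
    (h1 : ∀ i j v, (smallExt (cofiberLevel o n)).e i * w i j v = w i j v)
    (h2 : ∀ i j v, w i j v * (smallExt (cofiberLevel o n)).e j = w i j v)
    (h : ∀ i j v, w i j v - hom (toSmallExt (cofiberLevel o n)) (hom o (formalGen F 2 i j v)) ∈
      (smallExt (cofiberLevel o n)).rad ^ (n + 1)) :
    ∃ o' : formalT F 2 ⟶ formalT F 1,
      (∀ i j v, hom o' (formalGen F 2 i j v) ∈ (formalT F 1).rad ^ 2) ∧
      (∀ i j v, hom o' (formalGen F 2 i j v) - hom o (formalGen F 2 i j v) ∈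
        (formalT F 1).rad ^ (n + 1)) ∧
      ∃ β : (cofiber o).level n ⟶ (cofiber o').level n, cofiberLevel o n ≫ β = cofiberLevel o' n ∧
        (M.push β).Obs (smallExtMap (cofiberLevel o' n)) fun i j =>
          (hom (toSmallExt (cofiberLevel o' n))).toLinearMap ∘ₗ (hom o').toLinearMap ∘ₗ
            formalGen F 2 i j := by
  let q := toSmallExt (cofiberLevel o n)
  -- t lifts the discrepancy between w and o, so o + t gives the obstruction w. As t has values in
  -- I^(n+1), the cofiber of o + t receives a map β from that of o at level n, and the model moves
  -- along it.
  choose t ht0 ht ht1 ht2 using fun i j => exists_lift_mem_pow_rad (toSmallExt_surjective _)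
    (i := i) (j := j)
    (φ := w i j - (hom q).toLinearMap ∘ₗ (hom o).toLinearMap ∘ₗ formalGen F 2 i j) (h i j)
    (fun v => by
      refine (mul_sub _ _ _).trans (congrArg₂ _ (h1 i j v) ?_)
      exact e_mul_hom_formalGen (o ≫ q) i j v)
    (fun v => by
      refine (sub_mul _ _ _).trans (congrArg₂ _ (h2 i j v) ?_)
      exact hom_formalGen_mul_e (o ≫ q) i j v)
  have hmem : ∀ i j v, hom o (formalGen F 2 i j v) + t i j v ∈ (formalT F 1).rad ^ 2 := fun i j v =>
    Ideal.add_mem _ (ho i j v) (Ideal.pow_le_pow_right (by omega) (ht0 i j v))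
  obtain ⟨o', ho'⟩ := exists_formalT_hom (n := 2) (R := formalT F 1) (isComplete_freeFormal _)
    (fun i j => (hom o).toLinearMap ∘ₗ formalGen F 2 i j + t i j)
    (fun i j v => Ideal.pow_le_self two_ne_zero (hmem i j v))
    (fun i j v => (mul_add _ _ _).trans (congrArg₂ _ (e_mul_hom_formalGen o i j v) (ht1 i j v)))
    (fun i j v => (add_mul _ _ _).trans (congrArg₂ _ (hom_formalGen_mul_e o i j v) (ht2 i j v)))
  have hd : ∀ i j v, hom o' (formalGen F 2 i j v) - hom o (formalGen F 2 i j v) ∈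
      (formalT F 1).rad ^ (n + 1) := fun i j v => by
    rw [ho']
    exact (congrArg (· ∈ (formalT F 1).rad ^ (n + 1)) (add_sub_cancel_left _ _)).mpr (ht0 i j v)
  obtain ⟨β, hβ⟩ := exists_level_hom le_rfl hd
  refine ⟨o', fun i j v => by rw [ho']; exact hmem i j v, hd, β, hβ, PreModel.Obs.push_level hβ ?_⟩
  convert hw using 3 with i j
  refine LinearMap.ext fun v => ?_
  refine (congrArg (hom q) (ho' i j v)).trans ?_
  refine (map_add (hom q) _ _).trans ?_
  rw [ht]
  exact add_sub_cancel _ _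

end Stages

/-! ### Existence of generalized Massey products by successive approximation -/

section Existence

open PointedAlg

variable {k : Type u} [Field k] {C : Type u} [SmallCategory C] {A : C ⥤ AlgCat.{u} k} {p : ℕ}
  {F : Fin p → ModPresheaf A} {R S : PointedAlg k p}

/-- Every first order class is the class of a deformation. -/
theorem exists_isExact_diffClass [∀ i j, Module.Finite k (HH (F j) (F i) 1)] (hR : R.rad ^ 2 = ⊥)
    (w : ∀ i j, Module.Dual k (HH (F j) (F i) 1) →ₗ[k] R) (h0 : ∀ i j v, w i j v ∈ R.rad)
    (h1 : ∀ i j v, R.e i * w i j v = w i j v) (h2 : ∀ i j v, w i j v * R.e j = w i j v) :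
    ∃ M : PreModel F R, M.IsExact ∧ (PreModel.triv F R).DiffClass M w := by
  let b := fun i j => Module.finBasis k (HH (F j) (F i) 1)
  have hrep : ∀ i j α, ∃ z : ghcZ (F j) (F i) 1, Submodule.Quotient.mk z = b i j α := fun i j α =>
    Submodule.Quotient.mk_surjective _ _
  choose z hz using hrep
  -- The trivial model is deformed by cocycles representing a basis of H^1, with the values of w on
  -- the dual basis as coefficients. The obstruction along R → k^p is minus the differential of this
  -- cocycle, hence zero.
  obtain ⟨M, -, hM⟩ := PreModel.exists_diff (PreModel.triv F R)
    (x := fun i j α => w i j ((b i j).coord α)) (fun i j α => h1 i j _) (fun i j α => h2 i j _)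
    (fun i j α => h0 i j _) (fun i j α => (z i j α).1)
  have hZ : ∀ i j μ, (PreModel.triv F R).diff M i j μ ∈ ghcZ (F j) (F i) 1 := fun i j μ => by
    rw [hM]
    exact Submodule.sum_mem _ fun α _ => Submodule.smul_mem _ _ (z i j α).2
  refine ⟨M, ?_, fun i j μ _ => ⟨hZ i j μ, fun v => ?_⟩⟩
  · refine PreModel.isExact_of_obs_eq_zero (isSmall_augHom hR) (M.lifts_push (augHom R))
      (by rw [eq_triv (M.push (augHom R))]; exact PreModel.triv_isExact) fun i j μ => ?_
    rw [PreModel.obs_sub (isSmall_augHom hR) (agree_augHom (PreModel.triv F R) M),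
      PreModel.triv_isExact.obs_eq_zero, zero_sub, neg_eq_zero]
    exact hZ i j μ
  · have e1 : cls _ (hZ i j μ) = ∑ α, μ (w i j ((b i j).coord α)) • b i j α := by
      have : (⟨_, hZ i j μ⟩ : ghcZ (F j) (F i) 1) =
          ∑ α, μ (w i j ((b i j).coord α)) • z i j α := by
        refine Subtype.ext ?_
        simpa using hM i j μ
      refine (congrArg (Submodule.mkQ _) this).trans ?_
      simp only [map_sum, map_smul]
      exact Finset.sum_congr rfl fun α _ => congrArg _ (hz i j α)
    have e2 : w i j v = ∑ α, v (b i j α) • w i j ((b i j).coord α) := by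
      conv_lhs => rw [← (b i j).sum_dual_apply_smul_coord v]
      rw [map_sum]
      exact Finset.sum_congr rfl fun α _ => map_smul _ _ _
    rw [e1, e2, map_sum, map_sum]
    refine Finset.sum_congr rfl fun α _ => ?_
    rw [map_smul, map_smul, smul_eq_mul, smul_eq_mul, mul_comm]

variable (F) in
/-- A deformation over the quotient of `T^1` by `I^{n+2}` and the values of an approximation of the
obstruction morphism. -/
structure Stage (n : ℕ) where
  o : formalT F 2 ⟶ formalT F 1
  rad_sq : ∀ i j v, hom o (formalGen F 2 i j v) ∈ (formalT F 1).rad ^ 2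
  model : PreModel F ((cofiber o).level (n + 1))
  exact : model.IsExact
  obs : model.Obs (smallExtMap (cofiberLevel o (n + 1))) fun i j =>
    (hom (toSmallExt (cofiberLevel o (n + 1)))).toLinearMap ∘ₗ (hom o).toLinearMap ∘ₗ formalGen F 2 i j

/-- A model whose obstruction is given by `o` lifts to the next level of the cofiber of `o`. -/
theorem exists_lifts_levelTrans [∀ i j, Module.Finite k (HH (F j) (F i) 1)]
    {o : formalT F 2 ⟶ formalT F 1} {n : ℕ}
    {M : PreModel F ((cofiber o).level n)} (hM : M.IsExact)
    (hobs : M.Obs (smallExtMap (cofiberLevel o n)) fun i j =>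
      (hom (toSmallExt (cofiberLevel o n))).toLinearMap ∘ₗ (hom o).toLinearMap ∘ₗ formalGen F 2 i j) :
    ∃ M' : PreModel F ((cofiber o).level (n + 1)),
      PreModel.Lifts ((cofiber o).levelTrans n) M' M ∧ M'.IsExact := by
  have hl := isSmall_levelTrans (cofiber o) n
  obtain ⟨f, hf, hf'⟩ := hl.exists_factor_smallExt (f := cofiberLevel o n)
    (w := cofiberLevel o (n + 1)) (v := 𝟙 _) (by rw [Category.comp_id, cofiberLevel_trans])
  have := (radFG_freeFormal (fun i j => Module.Dual k (HH (F j) (F i) 1))).finite_of_surjective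
    (cofiberLevel o (n + 1)) (cofiberLevel_surjective o _) (level_rad_pow _ (n + 1))
  -- The small extension of level n maps to level n + 1 of the cofiber, where the o(λ) become zero;
  -- by naturality so does the obstruction.
  have hzero : M.Obs ((cofiber o).levelTrans n) 0 := by
    have h1 := hobs.push hf'
    rw [PreModel.push_id] at h1
    convert h1 using 3 with i j
    refine (LinearMap.ext fun v => ?_).symm
    have h2 : hom (cofiberLevel o (n + 1)) (hom o (formalGen F 2 i j v)) = 0 :=
      (congrArg (hom ((cofiber o).toLevel (n + 1))) (toCofiber_hom_formalGen o i j v)).trans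
        (map_zero _)
    rw [← hf] at h2
    exact h2
  exact hzero.exists_isExact hl hM

/-- The obstruction for a further lifting is given by `o` up to terms of high degree. -/
theorem obs_sub_mem_rad_pow {o : formalT F 2 ⟶ formalT F 1} {n : ℕ}
    {M : PreModel F ((cofiber o).level n)} (hM : M.IsExact)
    (hobs : M.Obs (smallExtMap (cofiberLevel o n)) fun i j =>
      (hom (toSmallExt (cofiberLevel o n))).toLinearMap ∘ₗ (hom o).toLinearMap ∘ₗ formalGen F 2 i j)
    {M' : PreModel F ((cofiber o).level (n + 1))}
    (hM' : PreModel.Lifts ((cofiber o).levelTrans n) M' M)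
    {w : ∀ i j, Module.Dual k (HH (F j) (F i) 2) →ₗ[k] smallExt (cofiberLevel o (n + 1))}
    (hw : M'.Obs (smallExtMap (cofiberLevel o (n + 1))) w) (i j v) :
    w i j v - hom (toSmallExt (cofiberLevel o (n + 1))) (hom o (formalGen F 2 i j v)) ∈
      (smallExt (cofiberLevel o (n + 1))).rad ^ (n + 2) := by
  have hsm := isSmall_smallExtMap (cofiberLevel_surjective o n)
  obtain ⟨g, hg, hg'⟩ := hsm.exists_factor_smallExt (f := cofiberLevel o (n + 1))
    (w := toSmallExt (cofiberLevel o n)) (v := (cofiber o).levelTrans n)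
    (by rw [cofiberLevel_trans, toSmallExt_comp])
  have hw' := hw.push hg'
  rw [hM'.push_eq] at hw'
  -- The image of w in the small extension of level n is the obstruction of M, which is given by o.
  -- So w and o differ by an element of the kernel, which lies in I^(n+2).
  have hu := hw'.unique (rad_pow_smallExt _ (level_rad_pow _ n)) hsm hM hM hobs
    (PreModel.Gauge.refl M) i j v
  obtain ⟨y, hy⟩ := toSmallExt_surjective (cofiberLevel o (n + 1)) (w i j v)
  rw [← hy, ← map_sub]
  refine mem_pow_rad_smallExt o ?_
  rw [map_sub, sub_eq_zero]
  refine Eq.trans ?_ hu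
  rw [LinearMap.comp_apply, AlgHom.toLinearMap_apply, ← hy, ← hg, PointedAlg.hom_comp]

variable [∀ i j, Module.Finite k (HH (F j) (F i) 2)]

/-- o has values in I^2, so T^1 → T^1 / I^2 factors through H / I^2. -/
theorem mem_rad_sq_of_cofiberLevel {o : formalT F 2 ⟶ formalT F 1}
    (ho : ∀ i j v, hom o (formalGen F 2 i j v) ∈ (formalT F 1).rad ^ 2) {y : formalT F 1}
    (hy : hom (cofiberLevel o 1) y = 0) : y ∈ (formalT F 1).rad ^ 2 := by
  obtain ⟨g, hg⟩ := exists_factor_cofiberLevel (level_rad_pow _ 1) ((formalT F 1).toLevel 1)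
    fun i j v => toLevel_eq_zero.2 (ho i j v)
  have : hom ((formalT F 1).toLevel 1) y = hom g (hom (cofiberLevel o 1) y) :=
    (congrArg (fun φ => hom φ y) hg).symm
  rw [hy, map_zero] at this
  exact toLevel_eq_zero.1 this

variable [∀ i j, Module.Finite k (HH (F j) (F i) 1)]

/-- Start with o = 0 and the tautological deformation over T^1 / I^2. Its obstruction has values in
I^2 because everything killed at level 1 does; correcting o = 0 by it gives the first approximation.
-/
theorem Stage.exists_zero : ∃ s : Stage F 0, (PreModel.triv F _).DiffClass s.model fun i j =>
    (hom (cofiberLevel s.o 1)).toLinearMap ∘ₗ formalGen F 1 i j := by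
  obtain ⟨o, ho⟩ := exists_formalT_hom (F := F) (n := 2) (R := formalT F 1) (isComplete_freeFormal _)
    (fun i j => 0) (fun i j v => Submodule.zero_mem _) (fun i j v => mul_zero _)
    (fun i j v => zero_mul _)
  have ho : ∀ i j v, hom o (formalGen F 2 i j v) = 0 := ho
  have ho' : ∀ i j v, hom o (formalGen F 2 i j v) ∈ (formalT F 1).rad ^ 2 := fun i j v => by
    rw [ho]
    exact Submodule.zero_mem _
  obtain ⟨M, hM, hd⟩ := exists_isExact_diffClass (F := F) ((cofiber o).level_rad_pow 1)
    (fun i j => (hom (cofiberLevel o 1)).toLinearMap ∘ₗ formalGen F 1 i j)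
    (fun i j v => hom_formalGen_mem_rad (cofiberLevel o 1) i j v)
    (fun i j v => e_mul_hom_formalGen (cofiberLevel o 1) i j v)
    (fun i j v => hom_formalGen_mul_e (cofiberLevel o 1) i j v)
  have := finite_smallExt_cofiberLevel (o := o) 1
  obtain ⟨w, hw, h1, h2⟩ :=
    PreModel.exists_obs (isSmall_smallExtMap (cofiberLevel_surjective o 1)) hM
  obtain ⟨o', h3, -, β, hβ, hobs⟩ := exists_obs_correction le_rfl ho' hw h1 h2 fun i j v => by
    rw [ho, map_zero]
    refine (congrArg (· ∈ (smallExt (cofiberLevel o 1)).rad ^ (1 + 1)) (sub_zero _)).mpr ?_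
    obtain ⟨y, hy⟩ := toSmallExt_surjective (cofiberLevel o 1) (w i j v)
    rw [← hy]
    refine hom_pow_rad _ _ (mem_rad_sq_of_cofiberLevel ho' ?_)
    rw [← hom_smallExtMap, hy, hw.1]
  refine ⟨⟨o', h3, M.push β, hM.push β, hobs⟩, ?_⟩
  have := hd.push β
  change (PreModel.triv F _).DiffClass (M.push β) fun i j =>
    (hom (cofiberLevel o' 1)).toLinearMap ∘ₗ formalGen F 1 i j
  rw [← hβ]
  exact this

/-- The model lifts one level in the cofiber of the old o, and the new obstruction agrees with o up
to I^(n+3). Correcting o by that difference is too small a change to affect the lower level, so the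
old model is recovered along γ. -/
theorem Stage.exists_succ {n : ℕ} (s : Stage F n) : ∃ s' : Stage F (n + 1),
    (∀ i j v, hom s'.o (formalGen F 2 i j v) - hom s.o (formalGen F 2 i j v) ∈
      (formalT F 1).rad ^ (n + 1 + 1 + 1)) ∧
    ∃ γ : (cofiber s'.o).level (n + 1 + 1) ⟶ (cofiber s.o).level (n + 1),
      cofiberLevel s'.o (n + 1 + 1) ≫ γ = cofiberLevel s.o (n + 1) ∧ s'.model.push γ = s.model := by
  obtain ⟨M', hM'l, hM'⟩ := exists_lifts_levelTrans s.exact s.obs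
  have := finite_smallExt_cofiberLevel (o := s.o) (n + 1 + 1)
  obtain ⟨w, hw, h1, h2⟩ :=
    PreModel.exists_obs (isSmall_smallExtMap (cofiberLevel_surjective s.o (n + 1 + 1))) hM'
  obtain ⟨o', h3, h4, β, hβ, hobs'⟩ := exists_obs_correction (Nat.le_add_left 1 (n + 1)) s.rad_sq hw
    h1 h2 (obs_sub_mem_rad_pow s.exact s.obs hM'l hw)
  obtain ⟨γ, hγ⟩ := exists_level_hom (o := o') (o' := s.o) (Nat.le_succ (n + 1)) fun i j v => by
    rw [← neg_sub]
    exact neg_mem (Ideal.pow_le_pow_right (Nat.le_succ (n + 1 + 1)) (h4 i j v))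
  have hγ' : β ≫ γ = (cofiber s.o).levelTrans (n + 1) :=
    hom_ext_of_surjective (cofiberLevel_surjective s.o (n + 1 + 1)) (by
      rw [← Category.assoc, hβ, hγ, cofiberLevel_trans])
  exact ⟨⟨o', h3, M'.push β, hM'.push β, hobs'⟩, h4, γ, hγ, by
    rw [PreModel.push_comp, hγ', hM'l.push_eq]⟩

/-- There are an obstruction morphism and a compatible family of models whose obstructions it
describes. -/
theorem exists_models : ∃ o : formalT F 2 ⟶ formalT F 1,
    (∀ i j v, hom o (formalGen F 2 i j v) ∈ (formalT F 1).rad ^ 2) ∧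
    ∃ M : ∀ n, PreModel F ((cofiber o).level (n + 1)), (∀ n, (M n).IsExact) ∧
      (∀ n, (M (n + 1)).push ((cofiber o).levelTrans (n + 1)) = M n) ∧
      ((PreModel.triv F _).DiffClass (M 0) fun i j =>
        (hom (cofiberLevel o 1)).toLinearMap ∘ₗ formalGen F 1 i j) ∧
      ∀ n, (M n).Obs (smallExtMap (cofiberLevel o (n + 1))) fun i j =>
        (hom (toSmallExt (cofiberLevel o (n + 1)))).toLinearMap ∘ₗ (hom o).toLinearMap ∘ₗ
          formalGen F 2 i j := by
  obtain ⟨s0, hs0⟩ := Stage.exists_zero (F := F)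
  choose next hd hγ using fun n (s : Stage F n) => s.exists_succ
  let s : ∀ n, Stage F n := fun n => Nat.rec s0 next n
  have hT : (formalT F 1).IsComplete := isComplete_freeFormal _
  -- Passing from stage n to stage n + 1 changes o in I^(n+3), whence the offset 3.
  choose φ hφ using fun i j => exists_linear_limit hT (c := 3)
    (φ := fun n => (hom (s n).o).toLinearMap ∘ₗ formalGen F 2 i j) fun n v => hd n (s n) i j v
  have hsep : ∀ x : formalT F 1, (∀ n, x ∈ (formalT F 1).rad ^ (n + 3)) → x = 0 := fun x hx =>
    hT.1 x fun n => Ideal.pow_le_pow_right (Nat.le_add_right n 3) (hx n)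
  obtain ⟨o, ho⟩ := exists_formalT_hom (n := 2) hT φ
    (fun i j v => by
      have h1 := Ideal.add_mem _ (Ideal.pow_le_self (by omega) (hφ i j 0 v))
        (hom_formalGen_mem_rad (s 0).o i j v)
      rwa [LinearMap.comp_apply, AlgHom.toLinearMap_apply, sub_add_cancel] at h1)
    (fun i j v => by
      rw [← sub_eq_zero]
      refine hsep _ fun n => ?_
      have h1 := Ideal.sub_mem _ (Ideal.mul_mem_left _ ((formalT F 1).e i) (hφ i j n v)) (hφ i j n v)
      have h2 := e_mul_hom_formalGen (s n).o i j v
      rw [mul_sub, LinearMap.comp_apply, AlgHom.toLinearMap_apply, h2, sub_sub_sub_cancel_right] at h1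
      exact h1)
    (fun i j v => by
      rw [← sub_eq_zero]
      refine hsep _ fun n => ?_
      have h1 := Ideal.sub_mem _ (Ideal.mul_mem_right ((formalT F 1).e j) _ (hφ i j n v)) (hφ i j n v)
      have h2 := hom_formalGen_mul_e (s n).o i j v
      rw [sub_mul, LinearMap.comp_apply, AlgHom.toLinearMap_apply, h2, sub_sub_sub_cancel_right] at h1
      exact h1)
  have hdiff : ∀ n i j v, hom o (formalGen F 2 i j v) - hom (s n).o (formalGen F 2 i j v) ∈
      (formalT F 1).rad ^ (n + 3) := fun n i j v => by
    rw [ho]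
    exact hφ i j n v
  choose β hβ using fun n => exists_level_hom (o := (s n).o) (o' := o) (le_refl (n + 1)) fun i j v =>
    Ideal.pow_le_pow_right (by omega : n + 1 + 1 ≤ n + 3) (hdiff n i j v)
  refine ⟨o, fun i j v => ?_, fun n => (s n).model.push (β n), fun n => (s n).exact.push _,
    fun n => ?_, ?_, fun n => ?_⟩
  · have h1 := Ideal.add_mem _ (Ideal.pow_le_pow_right (by omega : 2 ≤ 0 + 3) (hdiff 0 i j v))
      ((s 0).rad_sq i j v)
    rwa [sub_add_cancel] at h1
  · obtain ⟨γ, h1, h2⟩ := hγ n (s n)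
    have h3 : β (n + 1) ≫ (cofiber o).levelTrans (n + 1) = γ ≫ β n :=
      hom_ext_of_surjective (cofiberLevel_surjective (s (n + 1)).o (n + 2)) (by
        rw [← Category.assoc, hβ (n + 1), ← Category.assoc]
        refine Eq.trans ?_ (congrArg (fun φ => φ ≫ β n) h1).symm
        exact (hβ n).symm)
    rw [PreModel.push_comp, h3, ← PreModel.push_comp]
    exact congrArg (fun M => M.push (β n)) h2
  · have := hs0.push (β 0)
    rw [← hβ 0]
    exact this
  · have h1 := (s n).obs.push_level (hβ n)
    convert h1 using 3 with i j
    refine LinearMap.ext fun v => ?_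
    refine sub_eq_zero.1 ((map_sub (hom (toSmallExt (cofiberLevel o (n + 1)))) _ _).symm.trans ?_)
    have h2 := hom_pow_rad (toSmallExt (cofiberLevel o (n + 1))) _ (hdiff n i j v)
    rw [rad_pow_smallExt _ (level_rad_pow _ (n + 1))] at h2
    exact (Submodule.mem_bot _).1 h2

theorem exists_isMassey (hpro : ∀ o : formalT F 2 ⟶ formalT F 1, (cofiber o).IsPro) :
    ∃ (o : formalT F 2 ⟶ formalT F 1) (ξ : ProElt (defFunctor F) ⟨cofiber o, hpro o⟩),
      IsMassey o (hpro o) ξ := by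
  obtain ⟨o, ho, M, hM, hMM, hd, hobs⟩ := exists_models (F := F)
  let H : ProAlg k p := ⟨cofiber o, hpro o⟩
  choose y hy using fun n => (hM n).exists_hasModel
  have hyy : ∀ n, (defFunctor F).map (H.levelTrans (n + 1)) (y (n + 1)) = y n := fun n => by
    have h1 := (hy (n + 1)).map (R := H.level (n + 2)) (S := H.level (n + 1)) (H.levelTrans (n + 1))
    have h2 : (M (n + 1)).push (H.levelTrans (n + 1)).hom = M n := hMM n
    rw [h2] at h1
    exact h1.unique (level_rad_pow _ (n + 1)) (hy n)
  -- The n-th model lives at level n + 1, so the family is shifted by one and completed at level 0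
  -- by an image.
  let ξ : ProElt (defFunctor F) H :=
    ⟨fun n => (defFunctor F).map (H.levelTrans n) (y n), fun n => congrArg _ (hyy n)⟩
  have hξ : ∀ n, ξ.1 (n + 1) = y n := hyy
  refine ⟨o, ξ, map_rad_of_gen ho, ?_, fun n hn => ?_⟩
  · obtain ⟨X, hX, ⟨θ⟩⟩ := hy 0
    exact ⟨X, (hξ 0).trans hX, θ.isFirstOrderClass (level_rad_pow _ 1)
      (fun i j v => hom_formalGen_mem_rad (cofiberLevel o 1) i j v) hd⟩
  · obtain ⟨m, rfl⟩ : ∃ m, n = m + 1 := ⟨n - 1, by omega⟩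
    obtain ⟨X, hX, ⟨θ⟩⟩ := hy m
    exact ⟨X, (hξ m).trans hX, θ.isObstruction (level_rad_pow _ (m + 1))
      (isSmall_smallExtMap (cofiberLevel_surjective o (m + 1))).surjective (hobs m)⟩

end Existence

end Deformation

end

/-! ### The main theorem -/

theorem mainTheorem1 {k : Type u} [Field k] [IsAlgClosed k] {C : Type u} [SmallCategory C]
    (A : C ⥤ AlgCat.{u} k) {p : ℕ} (hp : 1 ≤ p) (F : Fin p → ModPresheaf A)
    (hfin : ∀ i j, Module.Finite k (HH (F j) (F i) 1) ∧ Module.Finite k (HH (F j) (F i) 2)) :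
    Nonempty (Unique ((defFunctor F).obj ⟨PointedAlg.base k p, PointedAlg.isArt_base⟩)) ∧
    (∃ (H : ProAlg k p) (ξ : ProElt (defFunctor F) H), IsHull (defFunctor F) H ξ) ∧
    (formalT F 1).IsPro ∧ (formalT F 2).IsPro ∧
    ∃ hpro : ∀ o : formalT F 2 ⟶ formalT F 1, (PointedAlg.cofiber o).IsPro,
      (∃ (o : formalT F 2 ⟶ formalT F 1)
        (ξ : ProElt (defFunctor F) ⟨PointedAlg.cofiber o, hpro o⟩), IsMassey o (hpro o) ξ) ∧
      ∀ (o : formalT F 2 ⟶ formalT F 1)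
        (ξ : ProElt (defFunctor F) ⟨PointedAlg.cofiber o, hpro o⟩), IsMassey o (hpro o) ξ →
        IsHull (defFunctor F) ⟨PointedAlg.cofiber o, hpro o⟩ ξ := by
  have h1 := fun i j => (hfin i j).1
  have h2 := fun i j => (hfin i j).2
  have hf1 : Deformation.RadFG (formalT F 1) := Deformation.radFG_freeFormal _
  have hf2 : Deformation.RadFG (formalT F 2) := Deformation.radFG_freeFormal _
  have hc1 : (formalT F 1).IsComplete := Deformation.isComplete_freeFormal _
  have hc2 : (formalT F 2).IsComplete := Deformation.isComplete_freeFormal _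
  have hpro : ∀ o : formalT F 2 ⟶ formalT F 1, (PointedAlg.cofiber o).IsPro :=
    Deformation.isPro_cofiber hf1 hc1
  obtain ⟨o, ξ, h⟩ := Deformation.exists_isMassey hpro
  -- The trivial model provides the one deformation over k^p.
  obtain ⟨x, -⟩ := (Deformation.PreModel.triv_isExact (F := F)
    (R := PointedAlg.base k p)).exists_hasModel
  exact ⟨⟨⟨⟨x⟩, fun y => Deformation.unique_def_base y x⟩⟩,
    ⟨_, ξ, Deformation.isHull_of_isMassey hfin h⟩, hf1.isPro hc1, hf2.isPro hc2, hpro, ⟨o, ξ, h⟩,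
    fun o ξ h => Deformation.isHull_of_isMassey hfin h⟩
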